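/- **Setting.** Let $k$ be a nonarchimedean local field of characteristic $p>0$ with maximal compact subring $\mathcal O$, residue field of cardinality $q$, and $\mathbb F_q=\{x\in k: x^q=x\}$. Let $\Omega$ be the $k$-vector space of locally constant $\mathbb F_q$-linear functionals $\delta:k\to\mathbb F_q$, with $\operatorname{Res}\delta=\delta(1)$ and $(x\delta)(y)=\delta(xy)$; for a uniformizer $\pi$ let $d\pi\in\Omega$ be determined by $\operatorname{Res}(x\,d\pi)=a_{-1}$ for $x=\sum_i a_i\pi^i$ $(a_i\in\mathbb F_q)$. Fix $0\ne\omega\in\Omega$, a subfield $\mathbb F\subset\mathbb F_q$ and a nonconstant homomorphism $\lambda:\mathbb F\to\mathbb C^\times$. Let $\mathfrak D^{-1}=\{\xi\in k:\operatorname{Res}(\xi x\omega)=0\ \forall x\in\mathcal O\}$. Let $\mu$ be the Haar measure on $k$ with $\mu(\mathcal O)\mu(\mathfrak D^{-1})=1$, and $\mu^\times$ the Haar measure on $k^\times$ with $\mu^\times(\mathcal O^\times)=1$. Put $\|x\|=\mu(x\mathcal O)/\mu(\mathcal O)$, $\operatorname{ord}x=-\log\|x\|/\log q$, and $\operatorname{ord}\omega=\operatorname{ord}(\omega/d\pi)$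 for any uniformizer $\pi$. Let $\lambda_0:\mathbb F\to\mathbb C$ be $1$ at $0$, $-1$ at $1$, and $0$ elsewhere, and put $\mathbf e(x)=\lambda(\operatorname{Tr}_{\mathbb F_q/\mathbb F}\operatorname{Res}(x\omega))$, $\mathbf e_0(x)=\lambda_0(\operatorname{Tr}_{\mathbb F_q/\mathbb F}\operatorname{Res}(x\omega))$. Let $\mathcal S(k\times k)$ be the space of compactly supported locally constant functions $k\times k\to\mathbb C$ and $\mathcal S'(k\times k)$ its linear dual. For $\varphi\in\mathcal S(k\times k)$ put $$\mathcal G[\varphi](\xi,\eta)=\iint\varphi(x,y)\,\mathbf e(x\xi-y\eta)\,d\mu(x)d\mu(y),\qquad \mathcal G_0[\varphi](\xi,\eta)=\iint\varphi(x,y)\,\mathbf e_0(-x\xi+y\eta)\,d\mu(x)d\mu(y),$$ and extend $\mathcal G,\mathcal G_0$ to $\mathcal S'(k\times k)$ by $\langle\mathcal G[\Gamma],\varphi\rangle=\langle\Gamma,\mathcal G[\varphi]\rangle$, and likewise for $\mathcal G_0$. A *primitive rigged virtual lattice* is a $\Phi\in\mathcal S'(k\times k)$ of the form $\langle\Phi,\varphi\rangle=\mu(\mathcal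 O)^{-1}\sum_{x\in\ell+L}\int_{w+r\mathcal O}\varphi(x,y)\,d\mu(y)$ with $L\subset k$ a cocompact discrete subgroup, $\ell,w\in k$ and $r\in k^\times$. The space $\mathcal{RVL}(k)$ of *rigged virtual lattices* is their $\mathbb C$-span; $\Phi$ is *rational* if it is a $\mathbb Z[1/p]$-linear combination of primitive ones. Put $$\Phi_*(x,y)=\lim_{\|a\|\to0}\langle\Phi,\mathbf 1_{x+a\mathcal O}\otimes\mathbf 1_{y+a\mathcal O}\rangle/\|a\|,\qquad \Theta(a,\Phi)=\sum_{x\in k}\Phi_*(x,a^{-1}x)\quad(a\in k^\times).$$ $\Phi$ is *proper* if $a\mapsto\Theta(a,\Phi)$ has compact support in $k^\times$. For rational $\Phi$ the *Catalan symbol* is $$\binom a\Phi=\prod_{x\in k^\times}x^{\Phi_*(x,a^{-1}x)}\cdot\prod_{\xi\in k^\times}\xi^{\mathcal G_0[\Phi]_*(\xi,a\xi)\|a\|},$$ an element of the multiplicative group of the perfect closure of $k$, to which $\operatorname{ord}$ is extended by $\operatorname{ord}(x^{1/p^n})=p^{-n}\operatorname{ord}x$. **Theorem.** (i) For all $a\in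 k^\times$ and $\Phi\in\mathcal{RVL}(k)$: $\mathcal G[\Phi]\in\mathcal{RVL}(k)$; the limits defining $\Phi_*$ and $\mathcal G[\Phi]_*$ exist; the sums defining $\Theta(\cdot,\Phi)$ and the sums below have only finitely many nonzero terms; the integrals below converge absolutely; and $$\begin{aligned}&\Theta(a,\Phi)\operatorname{ord}\omega+\sum_{x\in k^\times}\Phi_*(x,a^{-1}x)\operatorname{ord}x+\sum_{\xi\in k^\times}\|a\|\,\mathcal G[\Phi]_*(\xi,a\xi)\operatorname{ord}\xi\\ &=\int\frac{\Theta(at,\Phi)-c_a(t)}{\|1-t\|}\,d\mu^\times(t)-\Phi_*(0,0)\operatorname{ord}a+\int\bigl(\Phi_*(0,t)-\Phi_*(0,0)\mathbf 1_{\mathcal O}(t)\bigr)d\mu^\times(t)\\ &\quad+\|a\|\Bigl(\mathcal G[\Phi]_*(0,0)\operatorname{ord}a+\int\bigl(\mathcal G[\Phi]_*(0,t)-\mathcal G[\Phi]_*(0,0)\mathbf 1_{\mathcal O}(t)\bigr)d\mu^\times(t)\Bigr),\end{aligned}$$ where $c_a(t)=\|at\|\,\mathcal G[\Phi]_*(0,0)$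 if $\|t\|>1$, $c_a(t)=\Theta(a,\Phi)$ if $\|t\|=1$, and $c_a(t)=\Phi_*(0,0)$ if $\|t\|<1$. (ii) For all $a\in k^\times$ and all proper rational $\Phi\in\mathcal{RVL}(k)$: $\mathcal G_0[\Phi]$ is a rational rigged virtual lattice; the limits defining $\Phi_*$ and $\mathcal G_0[\Phi]_*$ exist and lie in $\mathbb Z[1/p]$; the sums defining $\Theta(\cdot,\Phi)$ have only finitely many nonzero terms and the products defining $\binom a\Phi$ have only finitely many factors with nonzero exponent; the integrals below converge absolutely; and $$\begin{aligned}\Theta(a,\Phi)\operatorname{ord}\omega+\operatorname{ord}\binom a\Phi=&\int\frac{\Theta(at,\Phi)-\mathbf 1_{\mathcal O^\times}(t)\Theta(a,\Phi)}{\|1-t\|}\,d\mu^\times(t)\\&+\int\Phi_*(0,t)\,d\mu^\times(t)+\|a\|\int\mathcal G_0[\Phi]_*(0,t)\,d\mu^\times(t).\end{aligned}$$ -/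

import Mathlib

open ValuativeRel MeasureTheory Topology Filter
open scoped Pointwise

/-! ### Topology of a nonarchimedean local field -/

section LocalField

variable {k : Type*} [Field k] [ValuativeRel k] [TopologicalSpace k] [IsNonarchimedeanLocalField k]

theorem lf_nhds_zero {U : Set k} (hU : U ∈ 𝓝 (0 : k)) :
    ∃ c : k, c ≠ 0 ∧ ∀ x, valuation k x ≤ valuation k c → x ∈ U := by
  obtain ⟨γ, hγ, h⟩ := (IsValuativeTopology.hasBasis_nhds_zero' k).mem_iff.mp hU
  obtain ⟨b, rfl⟩ := ValuativeRel.valuation_surjective γ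
  obtain ⟨r, hr0, hr⟩ := Valuation.IsNontrivial.exists_lt_one (v := valuation k)
  refine ⟨b * r, mul_ne_zero (by simpa using hγ) (by simpa using hr0), fun x hx ↦ h ?_⟩
  refine lt_of_le_of_lt hx ?_
  rw [map_mul]
  exact mul_lt_of_lt_one_right (zero_lt_iff.mpr hγ) hr

theorem lf_ball_mem_nhds {c : k} (hc : c ≠ 0) :
    {x : k | valuation k x ≤ valuation k c} ∈ 𝓝 (0 : k) :=
  mem_of_superset ((IsValuativeTopology.hasBasis_nhds_zero' k).mem_of_mem
    (i := valuation k c) (by simpa using hc)) (fun x (h : valuation k x < valuation k c) ↦ (le_of_lt h : valuation k x ≤ valuation k c))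

theorem lf_val_add {k : Type*} [Field k] [ValuativeRel k] {x y c : k} (hx : valuation k x ≤ valuation k c)
    (hy : valuation k y ≤ valuation k c) : valuation k (x + y) ≤ valuation k c :=
  (Valuation.map_add _ x y).trans (max_le hx hy)

theorem lf_isOpen_ball {c : k} (hc : c ≠ 0) (a : k) :
    IsOpen {x : k | valuation k (x - a) ≤ valuation k c} := by
  rw [isOpen_iff_mem_nhds]
  intro x hx
  have h : (fun y : k ↦ y - x) ⁻¹' {x : k | valuation k x ≤ valuation k c} ∈ 𝓝 x := by
    refine (continuous_id.sub continuous_const).continuousAt.preimage_mem_nhds ?_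
    simpa using lf_ball_mem_nhds hc
  filter_upwards [h] with y hy
  have := lf_val_add (c := c) hy hx
  simpa using this

theorem lf_isClosed_ball {c : k} (hc : c ≠ 0) (a : k) :
    IsClosed {x : k | valuation k (x - a) ≤ valuation k c} := by
  rw [← isOpen_compl_iff, isOpen_iff_mem_nhds]
  intro x hx
  filter_upwards [(lf_isOpen_ball hc x).mem_nhds (by simp)] with y hy hy2
  apply hx
  have := lf_val_add (c := c) (x := -(y - x)) (y := y - a) (by rw [Valuation.map_neg]; exact hy) hy2
  simpa using this

theorem lf_isCompact_ball (c : k) (a : k) :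
    IsCompact {x : k | valuation k (x - a) ≤ valuation k c} := by
  have h := IsNonarchimedeanLocalField.isCompact_closedBall k (valuation k c)
  convert h.image (continuous_add_const a) using 1
  ext x
  constructor
  · intro hx
    exact ⟨x - a, hx, by simp⟩
  · rintro ⟨y, hy, rfl⟩
    simpa using hy

instance lf_t2Space : T2Space k := by
  rw [t2Space_iff_disjoint_nhds]
  intro x y hxy
  have hc : y - x ≠ 0 := sub_ne_zero.mpr hxy.symm
  obtain ⟨r, hr0, hr⟩ := Valuation.IsNontrivial.exists_lt_one (v := valuation k)
  have hr0' : r ≠ 0 := by simpa using hr0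
  have hcr : (y - x) * r ≠ 0 := mul_ne_zero hc hr0'
  rw [Filter.disjoint_iff]
  refine ⟨_, (lf_isOpen_ball hcr x).mem_nhds (by simp), _,
    (lf_isOpen_ball hcr y).mem_nhds (by simp), ?_⟩
  rw [Set.disjoint_left]
  intro z hz hz'
  have := lf_val_add (c := (y - x) * r) (x := z - x) (y := -(z - y)) hz
    (by rw [Valuation.map_neg]; exact hz')
  have h2 : z - x + -(z - y) = y - x := by ring
  rw [h2, map_mul] at this
  exact absurd this (not_le.mpr (mul_lt_of_lt_one_right
    (zero_lt_iff.mpr (by simpa using hc)) hr))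

theorem lf_bounded {K : Set k} (hK : IsCompact K) :
    ∃ c : k, c ≠ 0 ∧ ∀ x ∈ K, valuation k x ≤ valuation k c := by
  obtain ⟨t, ht⟩ := hK.elim_finite_subcover
    (fun c : kˣ ↦ {x : k | valuation k (x - 0) ≤ valuation k (c : k)})
    (fun c ↦ lf_isOpen_ball c.ne_zero 0) (fun x _ ↦ by
      by_cases hx : x = 0
      · exact Set.mem_iUnion.mpr ⟨1, by simp [hx]⟩
      · exact Set.mem_iUnion.mpr ⟨Units.mk0 x hx, by simp⟩)
  have : ∃ c : kˣ, ∀ i ∈ t, valuation k (i : k) ≤ valuation k (c : k) := by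
    clear ht
    classical
    induction t using Finset.induction_on with
    | empty => exact ⟨1, by simp⟩
    | insert a s _ ih =>
      obtain ⟨c, hc⟩ := ih
      rcases le_total (valuation k (a : k)) (valuation k (c : k)) with h | h
      · exact ⟨c, by simpa using ⟨h, hc⟩⟩
      · exact ⟨a, by simpa using fun i hi ↦ (hc i hi).trans h⟩
  obtain ⟨c, hc⟩ := this
  refine ⟨c, c.ne_zero, fun x hx ↦ ?_⟩
  obtain ⟨i, hi, hx⟩ := Set.mem_iUnion₂.mp (ht hx)
  exact (by simpa using hx : valuation k x ≤ valuation k (i : k)).trans (hc i hi)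

theorem lf_isOpen_integers : IsOpen (𝒪[k] : Set k) := by
  convert lf_isOpen_ball (k := k) one_ne_zero 0 using 1
  ext x
  simp [Valuation.mem_integer_iff]

theorem lf_isClosed_integers : IsClosed (𝒪[k] : Set k) := by
  convert lf_isClosed_ball (k := k) one_ne_zero 0 using 1
  ext x
  simp [Valuation.mem_integer_iff]

theorem lf_isCompact_integers : IsCompact (𝒪[k] : Set k) := by
  convert lf_isCompact_ball (k := k) 1 0 using 1
  ext x
  simp [Valuation.mem_integer_iff]

instance lf_borelSpace_units [MeasurableSpace k] [BorelSpace k] : BorelSpace kˣ := by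
  constructor
  have h := (Units.isEmbedding_val₀ (G₀ := k)).eq_induced
  rw [h, borel_comap, ← BorelSpace.measurable_eq (α := k)]
  rfl

/-- The group `𝒪ˣ` as a subset of `kˣ`. -/
def integerUnits (k : Type*) [Field k] [ValuativeRel k] : Set kˣ :=
  {t | valuation k (t : k) = 1}

theorem lf_isOpen_integerUnits : IsOpen (integerUnits k) := by
  have : integerUnits k = (fun t : kˣ ↦ (t : k)) ⁻¹' (𝒪[k] : Set k) ∩
      (fun t : kˣ ↦ ((t⁻¹ : kˣ) : k)) ⁻¹' (𝒪[k] : Set k) := by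
    ext t
    simp only [integerUnits, Set.mem_ofPred_eq, Set.mem_inter_iff, Set.mem_preimage, SetLike.mem_coe,
      Valuation.mem_integer_iff, Units.val_inv_eq_inv_val, map_inv₀]
    rw [inv_le_one₀ (zero_lt_iff.mpr (by simp)), le_antisymm_iff]
  rw [this]
  exact (lf_isOpen_integers.preimage Units.continuous_val).inter
    (lf_isOpen_integers.preimage (Units.continuous_val.comp continuous_inv))

theorem lf_isCompact_integerUnits : IsCompact (integerUnits k) := by
  rw [(Units.isEmbedding_val₀ (G₀ := k)).isCompact_iff]
  obtain ⟨r, hr0, hr⟩ := Valuation.IsNontrivial.exists_lt_one (v := valuation k)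
  have : (Units.val '' integerUnits k) = (𝒪[k] : Set k) ∩ {x : k | valuation k x < 1}ᶜ := by
    ext x
    simp only [integerUnits, Set.mem_image, Set.mem_ofPred_eq, Set.mem_inter_iff, SetLike.mem_coe,
      Valuation.mem_integer_iff, Set.mem_compl_iff, not_lt]
    constructor
    · rintro ⟨t, ht, rfl⟩
      simp [ht]
    · rintro ⟨h1, h2⟩
      have h := le_antisymm h1 h2
      have hx : x ≠ 0 := by rintro rfl; simp at h
      exact ⟨Units.mk0 x hx, h, rfl⟩
  rw [this]
  refine lf_isCompact_integers.inter_right (isClosed_compl_iff.mpr ?_)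
  rw [isOpen_iff_mem_nhds]
  intro x hx
  by_cases hx0 : x = 0
  · subst hx0
    filter_upwards [lf_ball_mem_nhds (c := r) (by simpa using hr0)] with y hy
    exact lt_of_le_of_lt hy hr
  · filter_upwards [(lf_isOpen_ball hx0 x).mem_nhds (by simp)] with y hy
    have := lf_val_add (c := x) (x := y - x) (y := x) hy le_rfl
    rw [sub_add_cancel] at this
    exact lt_of_le_of_lt this hx

end LocalField

/-! ### Bruhat-Schwartz spaces -/

/-- The space `𝒮(X)` of compactly supported locally constant complex-valued functions on `X`. -/
def BruhatSchwartz (X : Type*) [TopologicalSpace X] : Submodule ℂ (X → ℂ) where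
  carrier := {f | IsLocallyConstant f ∧ HasCompactSupport f}
  add_mem' := fun hf hg ↦ ⟨hf.1.add hg.1, hf.2.add hg.2⟩
  zero_mem' := ⟨IsLocallyConstant.const 0, HasCompactSupport.zero⟩
  smul_mem' := fun c f hf ↦ ⟨hf.1.comp (fun z ↦ c * z), hf.2.comp_left (g := fun z ↦ c * z) (mul_zero c)⟩

section BruhatSchwartz

variable {k : Type*} [Field k] [ValuativeRel k] [TopologicalSpace k] [IsNonarchimedeanLocalField k]

theorem bs_mem_of_bounded {f : k → ℂ} {c d : k} (hc : c ≠ 0)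
    (h1 : ∀ x u, valuation k u ≤ valuation k c → f (x + u) = f x)
    (h2 : ∀ x, f x ≠ 0 → valuation k x ≤ valuation k d) : f ∈ BruhatSchwartz k := by
  refine ⟨(IsLocallyConstant.iff_eventually_eq f).mpr fun x ↦ ?_, ?_⟩
  · filter_upwards [(lf_isOpen_ball hc x).mem_nhds (by simp)] with y hy
    have := h1 x (y - x) hy
    simpa using this
  · refine HasCompactSupport.intro (lf_isCompact_ball d 0) fun x hx ↦ ?_
    by_contra h
    exact hx (by simpa using h2 x h)

theorem bs_mem_of_bounded₂ {f : k × k → ℂ} {c d : k} (hc : c ≠ 0)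
    (h1 : ∀ x y u w, valuation k u ≤ valuation k c → valuation k w ≤ valuation k c →
      f (x + u, y + w) = f (x, y))
    (h2 : ∀ x y, f (x, y) ≠ 0 → valuation k x ≤ valuation k d ∧ valuation k y ≤ valuation k d) :
    f ∈ BruhatSchwartz (k × k) := by
  refine ⟨(IsLocallyConstant.iff_eventually_eq f).mpr fun x ↦ ?_, ?_⟩
  · filter_upwards [prod_mem_nhds ((lf_isOpen_ball hc x.1).mem_nhds (by simp))
      ((lf_isOpen_ball hc x.2).mem_nhds (by simp))] with y hy
    have := h1 x.1 x.2 (y.1 - x.1) (y.2 - x.2) hy.1 hy.2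
    simpa using this
  · refine HasCompactSupport.intro ((lf_isCompact_ball d 0).prod (lf_isCompact_ball d 0))
      fun x hx ↦ ?_
    by_contra h
    have := h2 x.1 x.2 h
    exact hx ⟨by simpa using this.1, by simpa using this.2⟩

theorem bs_bounded₂ {f : k × k → ℂ} (hf : f ∈ BruhatSchwartz (k × k)) :
    ∃ d : k, d ≠ 0 ∧
      ∀ x y, f (x, y) ≠ 0 → valuation k x ≤ valuation k d ∧ valuation k y ≤ valuation k d := by
  obtain ⟨c, hc0, hc⟩ := lf_bounded (hf.2.isCompact.image continuous_fst)
  obtain ⟨d, hd0, hd⟩ := lf_bounded (hf.2.isCompact.image continuous_snd)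
  have key : ∀ x y, f (x, y) ≠ 0 →
      valuation k x ≤ valuation k c ∧ valuation k y ≤ valuation k d := fun x y h ↦
    ⟨hc x ⟨(x, y), subset_tsupport _ h, rfl⟩, hd y ⟨(x, y), subset_tsupport _ h, rfl⟩⟩
  rcases le_total (valuation k c) (valuation k d) with h | h
  · exact ⟨d, hd0, fun x y hxy ↦ ⟨(key x y hxy).1.trans h, (key x y hxy).2⟩⟩
  · exact ⟨c, hc0, fun x y hxy ↦ ⟨(key x y hxy).1, (key x y hxy).2.trans h⟩⟩

theorem bs_invariant₂ {f : k × k → ℂ} (hf : f ∈ BruhatSchwartz (k × k)) :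
    ∃ c : k, c ≠ 0 ∧ ∀ x y u w, valuation k u ≤ valuation k c → valuation k w ≤ valuation k c →
      f (x + u, y + w) = f (x, y) := by
  have hloc : ∀ z : k × k, ∃ c : kˣ, ∀ u w, valuation k u ≤ valuation k (c : k) →
      valuation k w ≤ valuation k (c : k) → f (z.1 + u, z.2 + w) = f z := by
    intro z
    have h := (IsLocallyConstant.iff_eventually_eq f).mp hf.1 z
    have h' : {v : k × k | f (z.1 + v.1, z.2 + v.2) = f z} ∈ 𝓝 ((0 : k), (0 : k)) := by
      have hcont : Continuous fun v : k × k ↦ (z.1 + v.1, z.2 + v.2) := by fun_prop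
      have := hcont.tendsto ((0 : k), (0 : k))
      simp only [add_zero, Prod.mk.eta] at this
      exact this.eventually h
    obtain ⟨U, hU, V, hV, hUV⟩ := mem_nhds_prod_iff.mp h'
    obtain ⟨c, hc0, hc⟩ := lf_nhds_zero (Filter.inter_mem hU hV)
    exact ⟨Units.mk0 c hc0, fun u w hu hw ↦
      hUV (Set.mk_mem_prod (hc u hu).1 (hc w hw).2)⟩
  choose c hc using hloc
  obtain ⟨t, ht⟩ := hf.2.isCompact.elim_finite_subcover
    (fun z : k × k ↦ {x : k | valuation k (x - z.1) ≤ valuation k (c z : k)} ×ˢ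
      {x : k | valuation k (x - z.2) ≤ valuation k (c z : k)})
    (fun z ↦ (lf_isOpen_ball (c z).ne_zero _).prod (lf_isOpen_ball (c z).ne_zero _))
    (fun z _ ↦ Set.mem_iUnion.mpr ⟨z, by simp⟩)
  have : ∃ d : kˣ, ∀ z ∈ t, valuation k (d : k) ≤ valuation k (c z : k) := by
    clear ht
    classical
    induction t using Finset.induction_on with
    | empty => exact ⟨1, by simp⟩
    | insert a s _ ih =>
      obtain ⟨d, hd⟩ := ih
      rcases le_total (valuation k (d : k)) (valuation k (c a : k)) with h | h
      · refine ⟨d, fun z hz ↦ ?_⟩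
        rcases Finset.mem_insert.mp hz with rfl | hz
        exacts [h, hd z hz]
      · refine ⟨c a, fun z hz ↦ ?_⟩
        rcases Finset.mem_insert.mp hz with rfl | hz
        exacts [le_rfl, h.trans (hd z hz)]
  obtain ⟨d, hd⟩ := this
  have key : ∀ z ∈ tsupport f, ∀ u w, valuation k u ≤ valuation k (d : k) →
      valuation k w ≤ valuation k (d : k) → f (z.1 + u, z.2 + w) = f z := by
    intro z hz u w hu hw
    obtain ⟨i, hi, hz'⟩ := Set.mem_iUnion₂.mp (ht hz)
    have e1 := hc i (z.1 - i.1 + u) (z.2 - i.2 + w)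
      (lf_val_add hz'.1 (hu.trans (hd i hi))) (lf_val_add hz'.2 (hw.trans (hd i hi)))
    have e2 := hc i (z.1 - i.1) (z.2 - i.2) hz'.1 hz'.2
    rw [show i.1 + (z.1 - i.1 + u) = z.1 + u by ring,
      show i.2 + (z.2 - i.2 + w) = z.2 + w by ring] at e1
    rw [show i.1 + (z.1 - i.1) = z.1 by ring, show i.2 + (z.2 - i.2) = z.2 by ring] at e2
    exact e1.trans e2.symm
  refine ⟨d, d.ne_zero, fun x y u w hu hw ↦ ?_⟩
  by_cases h1 : (x, y) ∈ tsupport f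
  · exact key _ h1 u w hu hw
  by_cases h2 : (x + u, y + w) ∈ tsupport f
  · have := key _ h2 (-u) (-w) (by rwa [Valuation.map_neg]) (by rwa [Valuation.map_neg])
    simpa using this.symm
  · rw [image_eq_zero_of_notMem_tsupport h1, image_eq_zero_of_notMem_tsupport h2]

theorem bs_integrable {X : Type*} [TopologicalSpace X] [MeasurableSpace X] [BorelSpace X]
    {μ : Measure X} [IsFiniteMeasureOnCompacts μ] {f : X → ℂ} (hf : f ∈ BruhatSchwartz X) :
    Integrable f μ :=
  hf.1.continuous.integrable_of_hasCompactSupport hf.2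

theorem bs_slice {f : k × k → ℂ} (hf : f ∈ BruhatSchwartz (k × k)) (x : k) :
    (fun y ↦ f (x, y)) ∈ BruhatSchwartz k := by
  obtain ⟨c, hc0, hc⟩ := bs_invariant₂ hf
  obtain ⟨d, -, hd⟩ := bs_bounded₂ hf
  refine bs_mem_of_bounded (c := c) (d := d) hc0 (fun y u hu ↦ ?_) (fun y hy ↦ (hd x y hy).2)
  have := hc x y 0 u (by simp) hu
  simpa using this

theorem bs_partial_integral [MeasurableSpace k] (μ : Measure k)
    {f : k × k → ℂ} (hf : f ∈ BruhatSchwartz (k × k)) :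
    (fun x ↦ ∫ y, f (x, y) ∂μ) ∈ BruhatSchwartz k := by
  obtain ⟨c, hc0, hc⟩ := bs_invariant₂ hf
  obtain ⟨d, -, hd⟩ := bs_bounded₂ hf
  refine bs_mem_of_bounded (c := c) (d := d) hc0 (fun x u hu ↦ ?_) (fun x hx ↦ ?_)
  · have : ∀ y, f (x + u, y) = f (x, y) := fun y ↦ by
      simpa using hc x y u 0 hu (by simp)
    simp [this]
  · by_contra h
    apply hx
    have : ∀ y, f (x, y) = 0 := fun y ↦ by
      by_contra h'
      exact h (hd x y h').1
    simp [this]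

end BruhatSchwartz

/-! ### The constant field, Chevalley differentials -/

section Chevalley

variable (k : Type*) [Field k] [ValuativeRel k] [TopologicalSpace k] [IsNonarchimedeanLocalField k]
  (p : ℕ) [Fact p.Prime] [CharP k p]

/-- The cardinality `q` of the residue field. -/
noncomputable def residueCard (k : Type*) [Field k] [ValuativeRel k] : ℕ := Nat.card 𝓀[k]

theorem residueCard_eq_pow : ∃ n : ℕ, 0 < n ∧ residueCard k = p ^ n := by
  have hp : ((p : ℕ) : 𝓀[k]) = 0 := by
    have h : ((p : ℕ) : 𝒪[k]) = 0 := Subtype.ext (by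
      push_cast
      exact CharP.cast_eq_zero k p)
    have := congrArg (IsLocalRing.residue 𝒪[k]) h
    rwa [map_natCast, map_zero] at this
  have : CharP 𝓀[k] p := (CharP.charP_iff_prime_eq_zero Fact.out).mpr hp
  have := Fintype.ofFinite 𝓀[k]
  obtain ⟨n, -, h⟩ := FiniteField.card 𝓀[k] p
  exact ⟨n, n.pos, by rw [residueCard, Nat.card_eq_fintype_card, h]⟩

theorem one_lt_residueCard : 1 < residueCard k := Finite.one_lt_card

/-- The subfield `𝔽_q = {x ∈ k | x ^ q = x}` of `k`. -/
def constField : Subfield k where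
  carrier := {x | x ^ residueCard k = x}
  mul_mem' := fun {x y} hx hy ↦ by
    simp only [Set.mem_ofPred_eq] at *
    rw [mul_pow, hx, hy]
  one_mem' := by simp
  add_mem' := fun {x y} hx hy ↦ by
    simp only [Set.mem_ofPred_eq] at *
    obtain ⟨n, -, hn⟩ := residueCard_eq_pow k p
    rw [hn] at hx hy ⊢
    rw [add_pow_char_pow, hx, hy]
  zero_mem' := by
    simp only [Set.mem_ofPred_eq]
    exact zero_pow (by have := one_lt_residueCard k; omega)
  neg_mem' := fun {x} hx ↦ by
    simp only [Set.mem_ofPred_eq] at *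
    obtain ⟨n, -, hn⟩ := residueCard_eq_pow k p
    have h := sub_pow_char_pow (0 : k) x (p := p) (n := n)
    rw [← hn, hx, zero_pow (by have := one_lt_residueCard k; omega)] at h
    simpa using h
  inv_mem' := fun x hx ↦ by
    simp only [Set.mem_ofPred_eq] at *
    rw [inv_pow, hx]

variable {k} in
theorem mem_constField {x : k} : x ∈ constField k p ↔ x ^ residueCard k = x := Iff.rfl

instance constField_finite : Finite (constField k p) := by
  have hq := one_lt_residueCard k
  have hne : (Polynomial.X ^ residueCard k - Polynomial.X : Polynomial k) ≠ 0 :=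
    FiniteField.X_pow_card_sub_X_ne_zero k hq
  have hfin : {x : k | (Polynomial.X ^ residueCard k - Polynomial.X : Polynomial k).IsRoot x}.Finite :=
    Polynomial.finite_setOfPred_isRoot hne
  refine (hfin.subset fun x hx ↦ ?_).to_subtype
  have : x ^ residueCard k = x := hx
  simp [this]

variable {k} in
theorem constField_val_le_one {c : k} (hc : c ∈ constField k p) : valuation k c ≤ 1 := by
  by_contra! h
  have hq := one_lt_residueCard k
  have h1 := congrArg (valuation k) ((mem_constField p).mp hc)
  rw [map_pow] at h1
  exact absurd h1 (ne_of_gt (lt_self_pow₀ h hq))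

/-- The space `Ω` of Chevalley differentials: locally constant `𝔽_q`-linear functionals
`k → 𝔽_q`. -/
def ChevalleyDiff : Submodule (constField k p) (k →ₗ[constField k p] constField k p) where
  carrier := {δ | IsLocallyConstant δ}
  add_mem' := fun {δ ε} hδ hε ↦ IsLocallyConstant.add (f := δ) (g := ε) hδ hε
  zero_mem' := IsLocallyConstant.const 0
  smul_mem' := fun c δ hδ ↦ IsLocallyConstant.comp (f := δ) hδ (fun z ↦ c * z)

variable {k p}

theorem chevalleyDiff_lc (δ : ChevalleyDiff k p) : IsLocallyConstant δ.1 := δ.2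

/-- `Res δ = δ(1)`. -/
def resDiff (δ : ChevalleyDiff k p) : constField k p := δ.1 1

/-- The action `(x δ)(y) = δ(x y)` of `k` on `Ω`. -/
def mulDiff (x : k) (δ : ChevalleyDiff k p) : ChevalleyDiff k p :=
  ⟨δ.1.comp (LinearMap.mulLeft (constField k p) x),
    (chevalleyDiff_lc δ).comp_continuous (continuous_const_mul x)⟩

@[simp] theorem mulDiff_apply (x y : k) (δ : ChevalleyDiff k p) :
    (mulDiff x δ).1 y = δ.1 (x * y) := rfl

@[simp] theorem res_mulDiff (x : k) (δ : ChevalleyDiff k p) :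
    resDiff (mulDiff x δ) = δ.1 x := by simp [resDiff]

theorem chevalleyDiff_exists_vanish (δ : ChevalleyDiff k p) :
    ∃ c : k, c ≠ 0 ∧ ∀ x, valuation k x ≤ valuation k c → δ.1 x = 0 := by
  have h := (IsLocallyConstant.iff_eventually_eq δ.1).mp (chevalleyDiff_lc δ) 0
  simp only [map_zero] at h
  exact lf_nhds_zero h

theorem chevalleyDiff_exists_ne {δ : ChevalleyDiff k p} (hδ : δ ≠ 0) : ∃ y, δ.1 y ≠ 0 := by
  by_contra! h
  exact hδ (Subtype.ext (LinearMap.ext h))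

theorem chevalleyDiff_exists_ne_zero {ω : ChevalleyDiff k p} (hω : ω ≠ 0) :
    ∃ y₀ : k, y₀ ≠ 0 ∧ ω.1 y₀ ≠ 0 := by
  obtain ⟨y, hy⟩ := chevalleyDiff_exists_ne hω
  exact ⟨y, fun h ↦ hy (by simp [h]), hy⟩

end Chevalley

/-! ### Integral transforms on the Bruhat-Schwartz space of `k × k` -/

section Transform

variable {k : Type*} [Field k] [ValuativeRel k] [TopologicalSpace k] [IsNonarchimedeanLocalField k]
  {p : ℕ} [Fact p.Prime] [CharP k p]

/-- A kernel `K : k → ℂ` of the form `x ↦ h (Res (x ω))`, where `h` sums to zero over `𝔽_q`. -/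
def IsResKernel (ω : ChevalleyDiff k p) (K : k → ℂ) : Prop :=
  ∃ h : constField k p → ℂ, ∑ᶠ c, h c = 0 ∧ ∀ x, K x = h (resDiff (mulDiff x ω))

theorem transform_aux {ω : ChevalleyDiff k p} {K : k → ℂ} (hK : IsResKernel ω K) (ξ η : k)
    {φ : k × k → ℂ} (hφ : φ ∈ BruhatSchwartz (k × k)) :
    (fun z : k × k ↦ φ z * K (z.1 * ξ - z.2 * η)) ∈ BruhatSchwartz (k × k) := by
  obtain ⟨h, -, hh⟩ := hK
  refine ⟨hφ.1.mul ?_, hφ.2.mul_right⟩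
  have : (fun z : k × k ↦ K (z.1 * ξ - z.2 * η)) =
      fun z ↦ h (ω.1 (z.1 * ξ - z.2 * η)) := by
    funext z
    rw [hh, res_mulDiff]
  rw [this]
  exact IsLocallyConstant.comp
    ((chevalleyDiff_lc ω).comp_continuous
      (f := fun z : k × k ↦ z.1 * ξ - z.2 * η) (by fun_prop)) h

/-- Summing a residue kernel over suitable translates gives zero. -/
theorem resKernel_sum {ω : ChevalleyDiff k p} {K : k → ℂ} (hK : IsResKernel ω K)
    {y₀ : k} (hy₀ : ω.1 y₀ ≠ 0) [Fintype (constField k p)] (s : k) :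
    ∑ c : constField k p, K (s + (c : k) * y₀) = 0 := by
  obtain ⟨h, h0, hh⟩ := hK
  rw [finsum_eq_sum_of_fintype] at h0
  rw [← h0]
  have hlin : ∀ c : constField k p, ω.1 ((c : k) * y₀) = c * ω.1 y₀ := fun c ↦ by
    have := ω.1.map_smul c y₀
    simpa [Subfield.smul_def] using this
  have : ∀ c : constField k p, K (s + (c : k) * y₀) = h (ω.1 s + c * ω.1 y₀) := fun c ↦ by
    rw [hh, res_mulDiff, map_add, hlin]
  simp_rw [this]
  exact Equiv.sum_comp ((Equiv.mulRight₀ (ω.1 y₀) hy₀).trans (Equiv.addLeft (ω.1 s))) h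

theorem isResKernel_shift {ω : ChevalleyDiff k p} {K : k → ℂ} (hK : IsResKernel ω K) (s : k) :
    IsResKernel ω fun x ↦ K (x + s) := by
  have := Fintype.ofFinite (constField k p)
  obtain ⟨h, h0, hh⟩ := hK
  refine ⟨fun r ↦ h (r + ω.1 s), ?_, fun x ↦ ?_⟩
  · rw [finsum_eq_sum_of_fintype] at h0 ⊢
    rw [← h0]
    exact Equiv.sum_comp (Equiv.addRight (ω.1 s)) h
  · change K (x + s) = h (resDiff (mulDiff x ω) + ω.1 s)
    rw [hh, res_mulDiff, res_mulDiff, map_add]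

variable [MeasurableSpace k]

/-- The integral transform
`φ ↦ ((ξ, η) ↦ ∫∫ φ(x, y) K(x ξ - y η) dμ(x) dμ(y))` of complex-valued functions. -/
noncomputable def transformFun (μ : Measure k) (K : k → ℂ) (φ : k × k → ℂ) : k × k → ℂ :=
  fun ζ ↦ ∫ x, ∫ y, φ (x, y) * K (x * ζ.1 - y * ζ.2) ∂μ ∂μ

variable [BorelSpace k]

theorem transform_mem (μ : Measure k) [μ.IsAddHaarMeasure] {ω : ChevalleyDiff k p} (hω : ω ≠ 0)
    {K : k → ℂ} (hK : IsResKernel ω K) {φ : k × k → ℂ} (hφ : φ ∈ BruhatSchwartz (k × k)) :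
    transformFun μ K φ ∈ BruhatSchwartz (k × k) := by
  obtain ⟨d, hd0, hd⟩ := bs_bounded₂ hφ
  obtain ⟨c, hc0, hc⟩ := bs_invariant₂ hφ
  obtain ⟨b, hb0, hb⟩ := chevalleyDiff_exists_vanish (δ := ω)
  obtain ⟨y₀, hy0, hy₀⟩ := chevalleyDiff_exists_ne_zero hω
  have := Fintype.ofFinite (constField k p)
  -- invariance
  refine bs_mem_of_bounded₂ (c := b / d) (d := y₀ / c) (div_ne_zero hb0 hd0) ?_ ?_
  · intro ξ η u w hu hw
    obtain ⟨h, -, hh⟩ := hK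
    simp only [transformFun]
    refine integral_congr_ae (.of_forall fun x ↦ integral_congr_ae (.of_forall fun y ↦ ?_))
    by_cases hxy : φ (x, y) = 0
    · simp [hxy]
    obtain ⟨hx, hy⟩ := hd x y hxy
    have h1 : ω.1 (x * u - y * w) = 0 := by
      apply hb
      have bd : ∀ x u : k, valuation k x ≤ valuation k d → valuation k u ≤ valuation k (b / d) →
          valuation k (x * u) ≤ valuation k b := fun x u h1 h2 ↦ by
        calc valuation k (x * u) = valuation k x * valuation k u := map_mul _ _ _
          _ ≤ valuation k d * valuation k (b / d) := mul_le_mul' h1 h2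
          _ = valuation k b := by rw [← map_mul, mul_div_cancel₀ _ hd0]
      have := lf_val_add (x := x * u) (y := -(y * w)) (bd x u hx hu)
        (by rw [Valuation.map_neg]; exact bd y w hy hw)
      simpa [sub_eq_add_neg] using this
    have h2 : K (x * (ξ + u) - y * (η + w)) = K (x * ξ - y * η) := by
      rw [hh, hh, res_mulDiff, res_mulDiff,
        show x * (ξ + u) - y * (η + w) = (x * ξ - y * η) + (x * u - y * w) by ring, map_add, h1,
        add_zero]
    simp only [h2]
  · -- bounded support
    intro ξ η hne
    have hcst : ∀ c' : constField k p, valuation k (c' : k) ≤ 1 := fun c' ↦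
      constField_val_le_one p c'.2
    have small : ∀ ζ : k, ¬ valuation k ζ ≤ valuation k (y₀ / c) → ∀ c' : constField k p,
        valuation k ((c' : k) * (y₀ / ζ)) ≤ valuation k c := by
      intro ζ hζ c'
      push Not at hζ
      have hζ0 : ζ ≠ 0 := by rintro rfl; simp at hζ
      rw [map_mul]
      refine (mul_le_of_le_one_left' (hcst c')).trans ?_
      have h1 : valuation k (y₀ / ζ) * valuation k ζ ≤ valuation k c * valuation k ζ := by
        rw [← map_mul, div_mul_cancel₀ _ hζ0]
        calc valuation k y₀ = valuation k c * valuation k (y₀ / c) := by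
              rw [← map_mul, mul_div_cancel₀ _ hc0]
          _ ≤ _ := mul_le_mul' le_rfl hζ.le
      exact le_of_mul_le_mul_right h1 (zero_lt_iff.mpr (by simpa using hζ0))
    have hint := fun ξ η ↦ transform_aux hK ξ η hφ
    constructor
    · by_contra hξ
      have hξ0 : ξ ≠ 0 := by rintro rfl; simp at hξ
      apply hne
      have hs := small ξ hξ
      have e1 : ∀ c' : constField k p, transformFun μ K φ (ξ, η) =
          ∫ x, ∫ y, φ (x, y) * K (x * ξ - y * η + (c' : k) * y₀) ∂μ ∂μ := by
        intro c'
        simp only [transformFun]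
        rw [← integral_add_right_eq_self _ ((c' : k) * (y₀ / ξ))]
        refine integral_congr_ae (.of_forall fun x ↦ integral_congr_ae (.of_forall fun y ↦ ?_))
        have := hc x y _ 0 (hs c') (by simp)
        rw [add_zero] at this
        simp only [this]
        congr 2
        field_simp
        ring
      have e2 : ∑ c' : constField k p, transformFun μ K φ (ξ, η) = 0 := by
        rw [Finset.sum_congr rfl fun c' _ ↦ e1 c']
        have hmem : ∀ c' : constField k p,
            (fun z : k × k ↦ φ z * K (z.1 * ξ - z.2 * η + (c' : k) * y₀)) ∈
              BruhatSchwartz (k × k) := fun c' ↦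
          transform_aux (isResKernel_shift hK _) ξ η hφ
        rw [← integral_finsetSum _ fun c' _ ↦ bs_integrable (bs_partial_integral μ (hmem c'))]
        have : ∀ x, ∑ c' : constField k p, ∫ y, φ (x, y) * K (x * ξ - y * η + (c' : k) * y₀) ∂μ
            = 0 := fun x ↦ by
          rw [← integral_finsetSum _ fun c' _ ↦ bs_integrable (bs_slice (hmem c') x)]
          simp [← Finset.mul_sum, resKernel_sum hK hy₀]
        simp [this]
      simpa using e2
    · by_contra hη
      have hη0 : η ≠ 0 := by rintro rfl; simp at hη
      apply hne
      have hs := small η hη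
      simp only [transformFun]
      refine integral_eq_zero_of_ae (.of_forall fun x ↦ ?_)
      have e1 : ∀ c' : constField k p, ∫ y, φ (x, y) * K (x * ξ - y * η) ∂μ =
          ∫ y, φ (x, y) * K (x * ξ - y * η + (-c' : constField k p) * y₀) ∂μ := by
        intro c'
        rw [← integral_add_right_eq_self _ ((c' : k) * (y₀ / η))]
        refine integral_congr_ae (.of_forall fun y ↦ ?_)
        have := hc x y 0 _ (by simp) (hs c')
        rw [add_zero] at this
        simp only [this]
        congr 2
        push_cast
        field_simp
        ring
      have hmem : ∀ c' : constField k p,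
            Integrable (fun y ↦ φ (x, y) * K (x * ξ - y * η + (-c' : constField k p) * y₀)) μ := by
        intro c'
        have := (bs_integrable (μ := μ) (bs_slice (hint ξ η) x)).comp_add_right
          ((c' : k) * (y₀ / η))
        refine this.congr (.of_forall fun y ↦ ?_)
        have := hc x y 0 _ (by simp) (hs c')
        rw [add_zero] at this
        simp only [this]
        congr 2
        push_cast
        field_simp
        ring
      have e2 : ∑ c' : constField k p, ∫ y, φ (x, y) * K (x * ξ - y * η) ∂μ = 0 := by
        rw [Finset.sum_congr rfl fun c' _ ↦ e1 c', ← integral_finsetSum _ fun c' _ ↦ hmem c']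
        have : ∀ s : k, ∑ c' : constField k p, K (s + (-c' : constField k p) * y₀) = 0 :=
          fun s ↦ by
            rw [← resKernel_sum hK hy₀ s]
            exact Equiv.sum_comp (Equiv.neg _) fun c' : constField k p ↦ K (s + (c' : k) * y₀)
        simp only [← Finset.mul_sum, this, mul_zero, integral_zero]
      simpa using e2

/-- The integral transform with a residue kernel as an operator on `𝒮(k × k)`. -/
noncomputable def transform (μ : Measure k) [μ.IsAddHaarMeasure] {ω : ChevalleyDiff k p}
    (hω : ω ≠ 0) {K : k → ℂ} (hK : IsResKernel ω K) :
    BruhatSchwartz (k × k) →ₗ[ℂ] BruhatSchwartz (k × k) where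
  toFun φ := ⟨transformFun μ K φ, transform_mem μ hω hK φ.2⟩
  map_add' φ ψ := by
    ext ⟨ξ, η⟩
    have h1 := transform_aux hK ξ η φ.2
    have h2 := transform_aux hK ξ η ψ.2
    simp only [transformFun, Submodule.coe_add, Pi.add_apply, add_mul]
    rw [← integral_add (bs_integrable (bs_partial_integral μ h1))
      (bs_integrable (bs_partial_integral μ h2))]
    refine integral_congr_ae (.of_forall fun x ↦ ?_)
    exact integral_add (bs_integrable (bs_slice h1 x)) (bs_integrable (bs_slice h2 x))
  map_smul' r φ := by
    ext ⟨ξ, η⟩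
    simp [transformFun, mul_assoc, integral_const_mul]

end Transform

/-! ### The derivation `d` and the order of a Chevalley differential -/

section Order

variable {k : Type*} [Field k] [ValuativeRel k] [TopologicalSpace k] [IsNonarchimedeanLocalField k]
  {p : ℕ} [Fact p.Prime] [CharP k p]

theorem lf_unif_val_lt_one {k : Type*} [Field k] [ValuativeRel k] {ϖ : 𝒪[k]} (hϖ : Irreducible ϖ) : valuation k (ϖ : k) < 1 := by
  have h1 : valuation k (ϖ : k) ≤ 1 := ϖ.2
  refine lt_of_le_of_ne h1 fun h ↦ hϖ.not_isUnit ?_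
  have h0 : (ϖ : k) ≠ 0 := fun h0 ↦ by simp [h0] at h
  refine IsUnit.of_mul_eq_one ⟨(ϖ : k)⁻¹, by simp [Valuation.mem_integer_iff, h]⟩ ?_
  ext
  simp [h0]

theorem lf_unif_ne_zero {k : Type*} [Field k] [ValuativeRel k] {ϖ : 𝒪[k]} (hϖ : Irreducible ϖ) : (ϖ : k) ≠ 0 := fun h ↦
  hϖ.ne_zero (Subtype.ext h)

theorem lf_val_le_unif {ϖ : 𝒪[k]} (hϖ : Irreducible ϖ) {x : k} (hx : valuation k x < 1) :
    valuation k x ≤ valuation k (ϖ : k) := by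
  have hmem : (⟨x, hx.le⟩ : 𝒪[k]) ∈ 𝓂[k] := by
    rw [IsLocalRing.mem_maximalIdeal]
    intro hu
    obtain ⟨y, hy⟩ := hu.exists_right_inv
    have h1 : x * (y : k) = 1 := congrArg Subtype.val hy
    have h2 := congrArg (valuation k) h1
    rw [map_mul, map_one] at h2
    have : valuation k x * valuation k (y : k) < 1 :=
      lt_of_le_of_lt (mul_le_of_le_one_right' y.2) hx
    exact absurd h2 this.ne
  rw [hϖ.maximalIdeal_eq, Ideal.mem_span_singleton] at hmem
  obtain ⟨z, hz⟩ := hmem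
  have h1 : x = (ϖ : k) * z := congrArg Subtype.val hz
  rw [h1, map_mul]
  exact mul_le_of_le_one_right' z.2

theorem constField_val_eq_one {c : k} (hc : c ∈ constField k p) (h0 : c ≠ 0) :
    valuation k c = 1 := by
  refine le_antisymm (constField_val_le_one p hc) ?_
  have h1 := constField_val_le_one p (inv_mem hc)
  rw [map_inv₀] at h1
  exact (inv_le_one₀ (zero_lt_iff.mpr (by simpa using h0))).mp h1

/-- Every residue class of `𝒪` is represented by an element of the constant field. -/
theorem lf_exists_digit {ϖ : 𝒪[k]} (hϖ : Irreducible ϖ) {x : k} (hx : valuation k x ≤ 1) :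
    ∃ c : constField k p, ∃ y : k, valuation k y ≤ 1 ∧ x = c + ϖ * y := by
  let := IsTopologicalAddGroup.rightUniformSpace k
  have := isUniformAddGroup_of_addCommGroup (G := k)
  obtain ⟨n, hn0, hn⟩ := residueCard_eq_pow k p
  have hq := one_lt_residueCard k
  have hcast : ((residueCard k : ℕ) : 𝒪[k]) = 0 := by
    ext
    push_cast
    rw [hn]
    push_cast
    rw [CharP.cast_eq_zero k p, zero_pow hn0.ne']
  let f : Polynomial 𝒪[k] := Polynomial.X ^ residueCard k - Polynomial.X
  have hmonic : f.Monic := by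
    refine Polynomial.monic_X_pow_sub ?_
    rw [Polynomial.degree_X]
    exact_mod_cast hq
  have hder : ∀ a, f.derivative.eval a = -1 := fun a ↦ by
    simp [f, Polynomial.derivative_X_pow, hcast]
  let x' : 𝒪[k] := ⟨x, hx⟩
  have hev : f.eval x' ∈ 𝓂[k] := by
    rw [← IsLocalRing.residue_eq_zero_iff]
    have := Fintype.ofFinite 𝓀[k]
    have h := FiniteField.pow_card (IsLocalRing.residue 𝒪[k] x')
    rw [← Nat.card_eq_fintype_card] at h
    simp only [f, Polynomial.eval_sub, Polynomial.eval_pow, Polynomial.eval_X, map_sub, map_pow]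
    rw [residueCard, h, sub_self]
  obtain ⟨a, ha, hax⟩ := HenselianRing.is_henselian (I := 𝓂[k]) f hmonic x' hev
    (by rw [hder]; simp)
  have ha' : (a : k) ^ residueCard k = a := by
    have : a ^ residueCard k - a = 0 := by simpa [f, Polynomial.IsRoot] using ha
    simpa using congrArg Subtype.val (sub_eq_zero.mp this)
  rw [hϖ.maximalIdeal_eq, Ideal.mem_span_singleton] at hax
  obtain ⟨z, hz⟩ := hax
  have hz' : (a : k) - x = ϖ * z := congrArg Subtype.val hz
  refine ⟨⟨a, ha'⟩, -z, by rw [Valuation.map_neg]; exact z.2, ?_⟩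
  linear_combination -hz'

theorem lf_exists_pow_mul {ϖ : 𝒪[k]} (hϖ : Irreducible ϖ) (x : k) :
    ∃ n : ℕ, valuation k ((ϖ : k) ^ n * x) ≤ 1 := by
  by_cases hx : x = 0
  · exact ⟨0, by simp [hx]⟩
  obtain ⟨n, hn⟩ := exists_pow_lt₀ (lf_unif_val_lt_one hϖ)
    (Units.mk0 (valuation k x⁻¹) (by simpa using hx))
  refine ⟨n, ?_⟩
  rw [map_mul, map_pow]
  have h := mul_le_mul_left (a := valuation k x) hn.le
  simpa [← map_mul, hx] using h

theorem lf_small_pow {ϖ : 𝒪[k]} (hϖ : Irreducible ϖ) {c : k} (hc : c ≠ 0) :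
    ∃ n : ℕ, ∀ y : k, valuation k y ≤ 1 → valuation k ((ϖ : k) ^ n * y) ≤ valuation k c := by
  obtain ⟨n, hn⟩ := lf_exists_pow_mul hϖ c⁻¹
  refine ⟨n, fun y hy ↦ ?_⟩
  have e : (ϖ : k) ^ n * y = ((ϖ : k) ^ n * c⁻¹) * y * c := by field_simp
  rw [e, map_mul, map_mul]
  exact mul_le_of_le_one_left' (mul_le_one' hn hy)

open Polynomial in
/-- Principal part of an element of `k`. -/
theorem lf_exists_principal {ϖ : 𝒪[k]} (hϖ : Irreducible ϖ) (x : k) :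
    ∃ P : (constField k p)[X], valuation k (x - (ϖ : k)⁻¹ * aeval (ϖ : k)⁻¹ P) ≤ 1 := by
  obtain ⟨n, hn⟩ := lf_exists_pow_mul hϖ x
  induction n generalizing x with
  | zero => exact ⟨0, by simpa using hn⟩
  | succ n ih =>
    have h0 := lf_unif_ne_zero hϖ
    obtain ⟨c, y, hy, hxy⟩ := lf_exists_digit (p := p) hϖ hn
    obtain ⟨P, hP⟩ := ih (x - (ϖ : k)⁻¹ ^ (n + 1) * c) (by
      have : (ϖ : k) ^ n * (x - (ϖ : k)⁻¹ ^ (n + 1) * c) = y := by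
        have : (ϖ : k) * ((ϖ : k) ^ n * (x - (ϖ : k)⁻¹ ^ (n + 1) * c)) = ϖ * y := by
          have e : (ϖ : k) * (ϖ : k) ^ n * (ϖ : k)⁻¹ ^ (n + 1) = 1 := by
            rw [← pow_succ', ← mul_pow, mul_inv_cancel₀ h0, one_pow]
          linear_combination hxy - (c : k) * e
        exact mul_left_cancel₀ h0 this
      rwa [this])
    refine ⟨P + C c * X ^ n, ?_⟩
    convert hP using 2
    have : algebraMap (constField k p) k c = c := rfl
    simp only [map_add, map_mul, aeval_C, aeval_X, map_pow, this]
    ring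

open Polynomial in
theorem lf_principal_unique {ϖ : 𝒪[k]} (hϖ : Irreducible ϖ) (P : (constField k p)[X])
    (hP : P ≠ 0) : 1 ≤ valuation k (aeval (ϖ : k)⁻¹ P) := by
  have h0 := lf_unif_ne_zero hϖ
  have hinv : 1 < valuation k (ϖ : k)⁻¹ := by
    rw [map_inv₀]
    exact (one_lt_inv₀ (zero_lt_iff.mpr (by simpa using h0))).mpr (lf_unif_val_lt_one hϖ)
  induction hd : P.natDegree using Nat.strong_induction_on generalizing P with
  | _ d ih =>
    have hdec := P.divX_mul_X_add
    have hcoe : algebraMap (constField k p) k (P.coeff 0) = P.coeff 0 := rfl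
    by_cases hQ : P.divX = 0
    · rw [hQ, zero_mul, zero_add] at hdec
      have hc : P.coeff 0 ≠ 0 := fun h ↦ hP (by rw [← hdec, h, C_0])
      rw [← hdec, aeval_C, hcoe]
      refine (constField_val_eq_one (p := p) (P.coeff 0).2 ?_).ge
      simpa using hc
    · have hlt : P.divX.natDegree < d := by
        rw [natDegree_divX_eq_natDegree_tsub_one, hd]
        have : d ≠ 0 := by
          rintro rfl
          apply hQ
          rw [eq_C_of_natDegree_eq_zero hd, divX_C]
        omega
      have h1 := ih _ hlt P.divX hQ rfl
      rw [← hdec, map_add, map_mul, aeval_X, aeval_C, hcoe]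
      have h2 : 1 < valuation k (aeval (ϖ : k)⁻¹ P.divX * (ϖ : k)⁻¹) := by
        rw [map_mul]
        exact lt_of_lt_of_le hinv (le_mul_of_one_le_left' h1)
      rw [Valuation.map_add_eq_of_lt_left]
      · exact h2.le
      · exact lt_of_le_of_lt (constField_val_le_one p (P.coeff 0).2) h2

open Polynomial in
theorem lf_principal_eq {ϖ : 𝒪[k]} (hϖ : Irreducible ϖ) {x : k} {P Q : (constField k p)[X]}
    (hP : valuation k (x - (ϖ : k)⁻¹ * aeval (ϖ : k)⁻¹ P) ≤ 1)
    (hQ : valuation k (x - (ϖ : k)⁻¹ * aeval (ϖ : k)⁻¹ Q) ≤ 1) : P = Q := by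
  by_contra hne
  have h1 := lf_principal_unique hϖ (P - Q) (sub_ne_zero.mpr hne)
  have h2 := (Valuation.map_sub (valuation k) _ _).trans (max_le hQ hP)
  have e : (x - (ϖ : k)⁻¹ * aeval (ϖ : k)⁻¹ Q) - (x - (ϖ : k)⁻¹ * aeval (ϖ : k)⁻¹ P) =
      (ϖ : k)⁻¹ * aeval (ϖ : k)⁻¹ (P - Q) := by
    rw [map_sub]; ring
  rw [e, map_mul] at h2
  have h0 := lf_unif_ne_zero hϖ
  have hinv : 1 < valuation k (ϖ : k)⁻¹ := by
    rw [map_inv₀]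
    exact (one_lt_inv₀ (zero_lt_iff.mpr (by simpa using h0))).mpr (lf_unif_val_lt_one hϖ)
  exact absurd h2 (not_le.mpr (lt_of_lt_of_le hinv (le_mul_of_one_le_right' h1)))

/-- `δ = dπ`: for all `x = ∑ aᵢ πⁱ` with `aᵢ ∈ 𝔽_q`, `aᵢ = 0` for `i ≪ 0`, we have
`Res (x δ) = a₋₁`. -/
def IsDifferentialOf (ϖ : 𝒪[k]) (δ : ChevalleyDiff k p) : Prop :=
  ∀ (a : ℤ → constField k p) (x : k), (∃ N : ℤ, ∀ i < N, a i = 0) →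
    HasSum (fun i ↦ (a i : k) * (ϖ : k) ^ i) x → resDiff (mulDiff x δ) = a (-1)

theorem chevalleyDiff_map_const (δ : ChevalleyDiff k p) (c : constField k p) (x : k) :
    δ.1 ((c : k) * x) = c * δ.1 x := by
  have := δ.1.map_smul c x
  simpa [Subfield.smul_def] using this

theorem chevalleyDiff_hasSum (δ : ChevalleyDiff k p) {ι : Type*} {f : ι → k} {x : k}
    (h : HasSum f x) : HasSum (fun i ↦ δ.1 (f i)) (δ.1 x) :=
  h.map δ.1.toAddMonoidHom (chevalleyDiff_lc δ).continuous

open Polynomial in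
theorem lf_exists_approx {ϖ : 𝒪[k]} (hϖ : Irreducible ϖ) (M : ℕ) (x : k)
    (hx : valuation k x ≤ 1) : ∃ P : (constField k p)[X], ∃ y : k, valuation k y ≤ 1 ∧
      x = aeval (ϖ : k) P + (ϖ : k) ^ M * y := by
  induction M generalizing x with
  | zero => exact ⟨0, x, hx, by simp⟩
  | succ M ih =>
    obtain ⟨c, y, hy, rfl⟩ := lf_exists_digit (p := p) hϖ hx
    obtain ⟨P, z, hz, rfl⟩ := ih y hy
    refine ⟨C c + X * P, z, hz, ?_⟩
    have : algebraMap (constField k p) k c = c := rfl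
    simp only [map_add, map_mul, aeval_C, aeval_X, this]
    ring

open Polynomial in
/-- A Chevalley differential is determined by its values at the powers of a uniformizer. -/
theorem chevalleyDiff_ext {ϖ : 𝒪[k]} (hϖ : Irreducible ϖ) {δ ε : ChevalleyDiff k p}
    (h : ∀ i : ℤ, δ.1 ((ϖ : k) ^ i) = ε.1 ((ϖ : k) ^ i)) : δ = ε := by
  have h0 := lf_unif_ne_zero hϖ
  rw [← sub_eq_zero]
  set η := δ - ε with hη
  have hz : ∀ i : ℤ, η.1 ((ϖ : k) ^ i) = 0 := fun i ↦ by
    simp [hη, h i]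
  have hz' : ∀ (c : constField k p) (i : ℤ), η.1 ((c : k) * (ϖ : k) ^ i) = 0 := fun c i ↦ by
    rw [chevalleyDiff_map_const, hz, mul_zero]
  have hpos : ∀ (P : (constField k p)[X]), η.1 (aeval (ϖ : k) P) = 0 := by
    intro P
    rw [aeval_eq_sum_range, map_sum]
    refine Finset.sum_eq_zero fun i _ ↦ ?_
    have := hz' (P.coeff i) i
    rwa [zpow_natCast] at this
  have hneg : ∀ (P : (constField k p)[X]), η.1 ((ϖ : k)⁻¹ * aeval (ϖ : k)⁻¹ P) = 0 := by
    intro P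
    rw [aeval_eq_sum_range, Finset.mul_sum, map_sum]
    refine Finset.sum_eq_zero fun i _ ↦ ?_
    have := hz' (P.coeff i) (-(i + 1 : ℕ))
    rw [zpow_neg, zpow_natCast] at this
    rw [← this]
    congr 1
    rw [Subfield.smul_def, smul_eq_mul, pow_succ, mul_inv, inv_pow]
    ring
  obtain ⟨c, hc0, hc⟩ := chevalleyDiff_exists_vanish η
  obtain ⟨M, hM⟩ := lf_small_pow hϖ hc0
  refine Subtype.ext (LinearMap.ext fun x ↦ ?_)
  obtain ⟨P, hP⟩ := lf_exists_principal (p := p) hϖ x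
  obtain ⟨Q, y, hy, e⟩ := lf_exists_approx (p := p) hϖ M _ hP
  have : x = (ϖ : k)⁻¹ * aeval (ϖ : k)⁻¹ P + (aeval (ϖ : k) Q + (ϖ : k) ^ M * y) := by
    rw [← e]; ring
  rw [this, map_add, map_add, hpos, hneg, hc _ (hM y hy)]
  simp

theorem isDifferentialOf_iff {ϖ : 𝒪[k]} (hϖ : Irreducible ϖ) {δ : ChevalleyDiff k p} :
    IsDifferentialOf ϖ δ ↔ ∀ i : ℤ, δ.1 ((ϖ : k) ^ i) = if i = -1 then 1 else 0 := by
  have h0 := lf_unif_ne_zero hϖ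
  constructor
  · intro h i
    have := h (Pi.single i 1) ((ϖ : k) ^ i)
      ⟨i, fun j hj ↦ by simp [hj.ne]⟩ (by
        convert hasSum_single i ?_ using 1
        · simp
        · intro j hj
          simp [hj])
    rw [res_mulDiff] at this
    rw [this]
    by_cases hi : i = -1
    · subst hi; simp
    · simp [hi, Ne.symm hi]
  · intro h a x _ hx
    rw [res_mulDiff]
    have h1 := chevalleyDiff_hasSum δ hx
    have h2 : HasSum (fun i ↦ δ.1 ((a i : k) * (ϖ : k) ^ i)) (a (-1)) := by
      convert hasSum_single (-1 : ℤ) ?_ using 1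
      · rw [chevalleyDiff_map_const, h]; simp
      · intro j hj
        rw [chevalleyDiff_map_const, h, if_neg hj, mul_zero]
    exact h1.unique h2

open Polynomial in
theorem existsUnique_differentialOf {ϖ : 𝒪[k]} (hϖ : Irreducible ϖ) :
    ∃! δ : ChevalleyDiff k p, IsDifferentialOf ϖ δ := by
  have h0 := lf_unif_ne_zero hϖ
  choose P hP using lf_exists_principal (p := p) hϖ
  have hadd : ∀ x y, P (x + y) = P x + P y := fun x y ↦
    lf_principal_eq hϖ (hP _) (by
      have := (Valuation.map_add (valuation k) _ _).trans (max_le (hP x) (hP y))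
      rwa [show x + y - (ϖ : k)⁻¹ * aeval (ϖ : k)⁻¹ (P x + P y) =
        x - (ϖ : k)⁻¹ * aeval (ϖ : k)⁻¹ (P x) + (y - (ϖ : k)⁻¹ * aeval (ϖ : k)⁻¹ (P y)) by
        rw [map_add]; ring])
  have hsmul : ∀ (c : constField k p) x, P (c • x) = c • P x := fun c x ↦
    lf_principal_eq hϖ (hP _) (by
      have h1 : valuation k ((c : k) * (x - (ϖ : k)⁻¹ * aeval (ϖ : k)⁻¹ (P x))) ≤ 1 := by
        rw [map_mul]
        exact mul_le_one' (constField_val_le_one p c.2) (hP x)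
      convert h1 using 2
      rw [map_smul, Subfield.smul_def, Subfield.smul_def, smul_eq_mul, smul_eq_mul]; ring)
  have hint : ∀ x, valuation k x ≤ 1 → P x = 0 := fun x hx ↦
    lf_principal_eq hϖ (hP x) (by simpa using hx)
  let L : k →ₗ[constField k p] constField k p :=
    { toFun := fun x ↦ (P x).coeff 0
      map_add' := fun x y ↦ by rw [hadd, coeff_add]
      map_smul' := fun c x ↦ by rw [hsmul, coeff_smul, RingHom.id_apply] }
  have hL : IsLocallyConstant L := by
    rw [IsLocallyConstant.iff_eventually_eq]
    intro x
    filter_upwards [(lf_isOpen_ball one_ne_zero x).mem_nhds (by simp)] with y hy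
    have h1 : L (y - x) = 0 := by
      change (P (y - x)).coeff 0 = 0
      rw [hint _ (by simpa using hy), coeff_zero]
    rw [map_sub] at h1
    exact sub_eq_zero.mp h1
  have hval : ∀ i : ℤ, L ((ϖ : k) ^ i) = if i = -1 then 1 else 0 := by
    intro i
    rcases le_or_gt 0 i with hi | hi
    · rw [if_neg (by omega)]
      change (P _).coeff 0 = 0
      rw [hint, coeff_zero]
      lift i to ℕ using hi
      rw [zpow_natCast, map_pow]
      exact pow_le_one' ϖ.2 _
    · obtain ⟨n, rfl⟩ : ∃ n : ℕ, i = -((n + 1 : ℕ) : ℤ) := ⟨(-i - 1).toNat, by omega⟩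
      change (P _).coeff 0 = _
      rw [lf_principal_eq hϖ (hP _) (Q := X ^ n)]
      · rw [coeff_X_pow]
        congr 1
        simp only [eq_iff_iff]
        omega
      · rw [zpow_neg, zpow_natCast, map_pow, aeval_X, ← inv_pow, pow_succ', sub_self, map_zero]
        exact zero_le_one
  refine ⟨⟨L, hL⟩, (isDifferentialOf_iff hϖ).mpr hval, fun ε hε ↦ ?_⟩
  refine chevalleyDiff_ext hϖ fun i ↦ ?_
  rw [(isDifferentialOf_iff hϖ).mp hε i]
  exact (hval i).symm

/-- The Chevalley differential `dπ` of a uniformizer `π`. -/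
noncomputable def dUnif {ϖ : 𝒪[k]} (hϖ : Irreducible ϖ) : ChevalleyDiff k p :=
  (existsUnique_differentialOf hϖ).choose

theorem dUnif_spec {ϖ : 𝒪[k]} (hϖ : Irreducible ϖ) :
    IsDifferentialOf ϖ (dUnif hϖ : ChevalleyDiff k p) :=
  (existsUnique_differentialOf hϖ).choose_spec.1

theorem dUnif_zpow {ϖ : 𝒪[k]} (hϖ : Irreducible ϖ) (i : ℤ) :
    (dUnif hϖ : ChevalleyDiff k p).1 ((ϖ : k) ^ i) = if i = -1 then 1 else 0 :=
  (isDifferentialOf_iff hϖ).mp (dUnif_spec hϖ) i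

/-- `Ω` is spanned over `k` by `dπ`. -/
theorem exists_eq_mul_dUnif {ϖ : 𝒪[k]} (hϖ : Irreducible ϖ) (δ : ChevalleyDiff k p) :
    ∃ x : k, δ = mulDiff x (dUnif hϖ) := by
  have h0 := lf_unif_ne_zero hϖ
  obtain ⟨c, hc0, hc⟩ := chevalleyDiff_exists_vanish δ
  obtain ⟨M, hM⟩ := lf_small_pow hϖ hc0
  have hvan : ∀ j : ℤ, M ≤ j → δ.1 ((ϖ : k) ^ j) = 0 := fun j hj ↦ by
    apply hc
    obtain ⟨n, rfl⟩ : ∃ n : ℕ, j = M + n := ⟨(j - M).toNat, by omega⟩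
    rw [zpow_add₀ h0, zpow_natCast, zpow_natCast]
    exact hM _ (by rw [map_pow]; exact pow_le_one' ϖ.2 _)
  let b : ℕ → constField k p := fun n ↦ δ.1 ((ϖ : k) ^ ((M : ℤ) - 1 - n))
  have hsum : Summable fun n : ℕ ↦ (b n : k) * (ϖ : k) ^ n := by
    let := IsTopologicalAddGroup.rightUniformSpace k
    have := isUniformAddGroup_of_addCommGroup (G := k)
    have : NonarchimedeanAddGroup k := ⟨fun U hU ↦ by
      obtain ⟨r, hr0, hr⟩ := lf_nhds_zero hU
      let S : AddSubgroup k :=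
        { carrier := {x | valuation k x ≤ valuation k r}
          add_mem' := fun h1 h2 ↦ lf_val_add h1 h2
          zero_mem' := by simp
          neg_mem' := fun {x} (h : valuation k x ≤ valuation k r) ↦
            (by rwa [Valuation.map_neg] : valuation k (-x) ≤ valuation k r) }
      have hS : IsOpen (S : Set k) := by
        have := lf_isOpen_ball hr0 (0 : k)
        simp only [sub_zero] at this
        exact this
      exact ⟨⟨S, hS⟩, hr⟩⟩
    refine NonarchimedeanAddGroup.summable_of_tendsto_cofinite_zero ?_
    rw [Nat.cofinite_eq_atTop]
    intro U hU
    obtain ⟨r, hr0, hr⟩ := lf_nhds_zero hU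
    obtain ⟨N, hN⟩ := lf_small_pow hϖ hr0
    change ∀ᶠ n in atTop, _ ∈ U
    filter_upwards [eventually_ge_atTop N] with n hn
    obtain ⟨m, rfl⟩ := Nat.exists_eq_add_of_le hn
    refine hr _ ?_
    rw [pow_add, mul_left_comm]
    refine hN _ ?_
    rw [map_mul, map_pow]
    exact mul_le_one' (constField_val_le_one p (b _).2) (pow_le_one' ϖ.2 _)
  obtain ⟨y, hy⟩ := hsum
  refine ⟨(ϖ : k) ^ (-(M : ℤ)) * y, chevalleyDiff_ext hϖ fun j ↦ ?_⟩
  have h1 := chevalleyDiff_hasSum (dUnif hϖ : ChevalleyDiff k p)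
    (hy.mul_left ((ϖ : k) ^ (j - M)))
  have hterm : ∀ n : ℕ, (dUnif hϖ : ChevalleyDiff k p).1
      ((ϖ : k) ^ (j - M) * ((b n : k) * (ϖ : k) ^ n)) = if j - M + n = -1 then b n else 0 := by
    intro n
    rw [show (ϖ : k) ^ (j - M) * ((b n : k) * (ϖ : k) ^ n) = (b n : k) * (ϖ : k) ^ (j - M + n) by
      rw [zpow_add₀ h0, zpow_natCast]; ring, chevalleyDiff_map_const, dUnif_zpow]
    split_ifs <;> simp
  simp_rw [hterm] at h1
  have h2 : (mulDiff ((ϖ : k) ^ (-(M : ℤ)) * y) (dUnif hϖ : ChevalleyDiff k p)).1 ((ϖ : k) ^ j) =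
      (dUnif hϖ : ChevalleyDiff k p).1 ((ϖ : k) ^ (j - M) * y) := by
    rw [mulDiff_apply]
    congr 1
    rw [sub_eq_add_neg, zpow_add₀ h0]
    ring
  rw [h2]
  by_cases hj : (M : ℤ) ≤ j
  · rw [hvan j hj]
    have h3 : HasSum (fun n : ℕ ↦ if j - M + n = -1 then b n else 0) 0 := by
      convert hasSum_zero using 2 with n
      exact if_neg (by omega)
    exact (h1.unique h3).symm
  · have h3 : HasSum (fun n : ℕ ↦ if j - M + n = -1 then b n else 0) (b (M - 1 - j).toNat) := by
      convert hasSum_single (M - 1 - j).toNat ?_ using 1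
      · rw [if_pos (by omega)]
      · intro n hn
        exact if_neg (by omega)
    rw [h1.unique h3]
    simp only [b]
    congr 2
    omega

theorem dUnif_mul_eq_zero {ϖ : 𝒪[k]} (hϖ : Irreducible ϖ) {x : k}
    (h : mulDiff x (dUnif hϖ : ChevalleyDiff k p) = 0) : x = 0 := by
  by_contra hx
  have h1 : (mulDiff x (dUnif hϖ : ChevalleyDiff k p)).1 (x⁻¹ * (ϖ : k) ^ (-1 : ℤ)) = 0 := by
    rw [h]; rfl
  rw [mulDiff_apply, mul_inv_cancel_left₀ hx, dUnif_zpow] at h1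
  simp at h1

/-- `Ω` is one-dimensional over `k`. -/
theorem existsUnique_diffDiv (ξ : ChevalleyDiff k p) {η : ChevalleyDiff k p} (hη : η ≠ 0) :
    ∃! x : k, ξ = mulDiff x η := by
  obtain ⟨ϖ, hϖ⟩ := IsDiscreteValuationRing.exists_irreducible 𝒪[k]
  obtain ⟨x, rfl⟩ := exists_eq_mul_dUnif hϖ ξ
  obtain ⟨y, rfl⟩ := exists_eq_mul_dUnif hϖ η
  have hy : y ≠ 0 := by
    rintro rfl
    exact hη (Subtype.ext (LinearMap.ext fun z ↦ by simp))
  refine ⟨x / y, Subtype.ext (LinearMap.ext fun z ↦ ?_), fun z hz ↦ ?_⟩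
  · simp only [mulDiff_apply]
    congr 1
    field_simp
  · have h1 : mulDiff (x - z * y) (dUnif hϖ : ChevalleyDiff k p) = 0 := by
      refine Subtype.ext (LinearMap.ext fun w ↦ ?_)
      have := congrArg (fun δ : ChevalleyDiff k p ↦ δ.1 w) hz
      simp only [mulDiff_apply] at this
      rw [mulDiff_apply, sub_mul, map_sub, this]
      rw [show y * (z * w) = z * y * w by ring, sub_self]
      rfl
    rw [eq_div_iff hy]
    exact (sub_eq_zero.mp (dUnif_mul_eq_zero hϖ h1)).symm

/-- The quotient `ξ / η`, i.e. the `x ∈ k` with `ξ = x η` (for `η ≠ 0`). -/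
noncomputable def diffDiv (ξ η : ChevalleyDiff k p) : k :=
  Classical.epsilon fun x : k ↦ ξ = mulDiff x η

theorem diffDiv_spec (ξ : ChevalleyDiff k p) {η : ChevalleyDiff k p} (hη : η ≠ 0) :
    ξ = mulDiff (diffDiv ξ η) η :=
  Classical.epsilon_spec (existsUnique_diffDiv ξ hη).exists

theorem dUnif_ne_zero {ϖ : 𝒪[k]} (hϖ : Irreducible ϖ) :
    (dUnif hϖ : ChevalleyDiff k p) ≠ 0 := fun h ↦ by
  have := dUnif_zpow (p := p) hϖ (-1)
  rw [h] at this
  simp at this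

theorem dUnif_vanish_iff {ϖ : 𝒪[k]} (hϖ : Irreducible ϖ) (x : k) :
    (∀ y : k, valuation k y ≤ 1 → (dUnif hϖ : ChevalleyDiff k p).1 (x * y) = 0) ↔
      valuation k x ≤ 1 := by
  have h0 := lf_unif_ne_zero hϖ
  constructor
  · intro h
    by_contra! hx
    have hx0 : x ≠ 0 := by rintro rfl; simp at hx
    have hlt : valuation k x⁻¹ < 1 := by
      rw [map_inv₀]
      exact inv_lt_one_of_one_lt₀ hx
    have h1 := h (x⁻¹ * (ϖ : k) ^ (-1 : ℤ)) (by
      rw [map_mul, zpow_neg_one, map_inv₀ (valuation k) (ϖ : k), ← div_eq_mul_inv]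
      exact div_le_one_of_le₀ (lf_val_le_unif hϖ hlt) zero_le)
    rw [mul_inv_cancel_left₀ hx0, dUnif_zpow] at h1
    simp at h1
  · intro hx y hy
    have hxy : valuation k (x * y) ≤ 1 := by
      rw [map_mul]; exact mul_le_one' hx hy
    obtain ⟨c, hc0, hc⟩ := chevalleyDiff_exists_vanish (dUnif hϖ : ChevalleyDiff k p)
    obtain ⟨M, hM⟩ := lf_small_pow hϖ hc0
    obtain ⟨Q, z, hz, e⟩ := lf_exists_approx (p := p) hϖ M _ hxy
    rw [e, map_add, hc _ (hM z hz), add_zero, Polynomial.aeval_eq_sum_range, map_sum]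
    refine Finset.sum_eq_zero fun i _ ↦ ?_
    rw [map_smul, ← zpow_natCast, dUnif_zpow, if_neg (by omega), smul_zero]

variable [MeasurableSpace k] [BorelSpace k]

/-- The absolute value `‖x‖ = μ(x𝒪) / μ(𝒪)`, for any Haar measure `μ` on `k`. -/
noncomputable def absv (x : k) : ℝ :=
  (Measure.addHaar (x • (𝒪[k] : Set k)) / Measure.addHaar (𝒪[k] : Set k)).toReal

/-- The additive valuation `ord x = -log ‖x‖ / log q` (used only for `x ≠ 0`). -/
noncomputable def ordv (x : k) : ℝ := -Real.log (absv x) / Real.log (residueCard k)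

theorem absv_mul_unit {x u : k} (hu : valuation k u = 1) : absv (x * u) = absv x := by
  have h : u • (𝒪[k] : Set k) = 𝒪[k] := by
    have hu0 : u ≠ 0 := by rintro rfl; simp at hu
    ext y
    rw [Set.mem_smul_set_iff_inv_smul_mem₀ hu0]
    simp [Valuation.mem_integer_iff, hu]
  rw [absv, mul_smul, h, absv]

/-- `ord δ = ord (δ / dπ)` where `π` is a uniformizer (the choice does not matter, see
`ordDiff_eq`). -/
noncomputable def ordDiff (δ : ChevalleyDiff k p) : ℝ :=
  ordv (diffDiv δ (dUnif (IsDiscreteValuationRing.exists_irreducible 𝒪[k]).choose_spec))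

theorem ordDiff_eq (δ : ChevalleyDiff k p) {ϖ : 𝒪[k]} (hϖ : Irreducible ϖ) :
    ordDiff δ = ordv (diffDiv δ (dUnif hϖ)) := by
  rw [ordDiff]
  set hϖ' := (IsDiscreteValuationRing.exists_irreducible 𝒪[k]).choose_spec
  set ϖ' := (IsDiscreteValuationRing.exists_irreducible 𝒪[k]).choose
  obtain ⟨u, hu⟩ := exists_eq_mul_dUnif hϖ (dUnif hϖ' : ChevalleyDiff k p)
  have hu0 : u ≠ 0 := by
    rintro rfl
    exact dUnif_ne_zero (p := p) hϖ' (by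
      rw [hu]
      exact Subtype.ext (LinearMap.ext fun z ↦ by simp))
  have key : ∀ x : k, valuation k x ≤ 1 ↔ valuation k (u * x) ≤ 1 := fun x ↦ by
    rw [← dUnif_vanish_iff (p := p) hϖ' x, ← dUnif_vanish_iff (p := p) hϖ (u * x)]
    refine forall_congr' fun y ↦ imp_congr_right fun _ ↦ ?_
    rw [hu, mulDiff_apply, mul_assoc]
  have hval : valuation k u = 1 := by
    refine le_antisymm (by simpa using (key 1).mp (by simp)) ?_
    have := (key u⁻¹).mpr (by simp [hu0])
    rw [map_inv₀] at this
    exact (inv_le_one₀ (zero_lt_iff.mpr (by simpa using hu0))).mp this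
  have e1 := diffDiv_spec δ (dUnif_ne_zero (p := p) hϖ)
  have e2 := diffDiv_spec δ (dUnif_ne_zero (p := p) hϖ')
  generalize diffDiv δ (dUnif hϖ') = x' at e2 ⊢
  have e3 : δ = mulDiff (x' * u) (dUnif hϖ) := by
    refine Subtype.ext (LinearMap.ext fun z ↦ ?_)
    conv_lhs => rw [e2]
    rw [mulDiff_apply, mulDiff_apply, hu, mulDiff_apply]
    congr 1
    ring
  have e4 := (existsUnique_diffDiv δ (dUnif_ne_zero (p := p) hϖ)).unique e1 e3
  rw [e4, ordv, ordv, absv_mul_unit hval]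

end Order

/-! ### Measures -/

section Measures

variable {k : Type*} [Field k] [ValuativeRel k] [TopologicalSpace k] [IsNonarchimedeanLocalField k]
  {p : ℕ} [Fact p.Prime] [CharP k p] [MeasurableSpace k] [BorelSpace k]

/-- The fractional ideal `𝔇⁻¹ = {ξ | Res (ξ x ω) = 0 for all x ∈ 𝒪}`. -/
def inverseDifferent (ω : ChevalleyDiff k p) : Set k :=
  {ξ | ∀ x ∈ (𝒪[k] : Set k), resDiff (mulDiff (ξ * x) ω) = 0}

theorem addHaar_integers_pos : Measure.addHaar (𝒪[k] : Set k) ≠ 0 :=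
  (lf_isOpen_integers.measure_pos _ ⟨0, zero_mem 𝒪[k]⟩).ne'

theorem addHaar_integers_ne_top : Measure.addHaar (𝒪[k] : Set k) ≠ ⊤ :=
  lf_isCompact_integers.measure_ne_top

theorem addHaar_inverseDifferent_pos (ω : ChevalleyDiff k p) :
    Measure.addHaar (inverseDifferent ω) ≠ 0 := by
  obtain ⟨c, hc0, hc⟩ := chevalleyDiff_exists_vanish ω
  have h : {x : k | valuation k (x - 0) ≤ valuation k c} ⊆ inverseDifferent ω := by
    intro ξ (hξ : valuation k (ξ - 0) ≤ valuation k c) x (hx : valuation k x ≤ 1)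
    rw [res_mulDiff]
    apply hc
    rw [sub_zero] at hξ
    rw [map_mul]
    exact (mul_le_of_le_one_right' hx).trans hξ
  exact (((lf_isOpen_ball hc0 0).measure_pos Measure.addHaar ⟨0, by simp⟩).trans_le
    (measure_mono h)).ne'

theorem addHaar_inverseDifferent_ne_top {ω : ChevalleyDiff k p} (hω : ω ≠ 0) :
    Measure.addHaar (inverseDifferent ω) ≠ ⊤ := by
  obtain ⟨y, hy0, hy⟩ := chevalleyDiff_exists_ne_zero hω
  have h : inverseDifferent ω ⊆ {x : k | valuation k (x - 0) ≤ valuation k y} := by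
    intro ξ hξ
    change valuation k (ξ - 0) ≤ valuation k y
    rw [sub_zero]
    by_contra! hlt
    have hξ0 : ξ ≠ 0 := by rintro rfl; simp at hlt
    have := hξ (ξ⁻¹ * y) (by
      change valuation k (ξ⁻¹ * y) ≤ 1
      rw [map_mul, map_inv₀]
      exact inv_mul_le_one_of_le₀ hlt.le zero_le)
    rw [res_mulDiff, mul_inv_cancel_left₀ hξ0] at this
    exact hy this
  exact ((measure_mono h).trans_lt (lf_isCompact_ball y 0).measure_lt_top).ne

/-- The scaling factor turning the reference Haar measure into the one normalized by
`μ(𝒪) μ(𝔇⁻¹) = 1`. -/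
noncomputable def haarScale (ω : ChevalleyDiff k p) : ENNReal :=
  (Measure.addHaar (𝒪[k] : Set k) * Measure.addHaar (inverseDifferent ω)) ^ (-(1 / 2) : ℝ)

/-- The Haar measure `μ` on `k` with `μ(𝒪) μ(𝔇⁻¹) = 1`. -/
noncomputable def selfDualHaar (ω : ChevalleyDiff k p) : Measure k :=
  haarScale ω • Measure.addHaar

theorem haarScale_aux {ω : ChevalleyDiff k p} (hω : ω ≠ 0) :
    Measure.addHaar (𝒪[k] : Set k) * Measure.addHaar (inverseDifferent ω) ≠ 0 ∧
    Measure.addHaar (𝒪[k] : Set k) * Measure.addHaar (inverseDifferent ω) ≠ ⊤ :=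
  ⟨mul_ne_zero addHaar_integers_pos (addHaar_inverseDifferent_pos ω),
    ENNReal.mul_ne_top addHaar_integers_ne_top (addHaar_inverseDifferent_ne_top hω)⟩

theorem selfDualHaar_isAddHaar {ω : ChevalleyDiff k p} (hω : ω ≠ 0) :
    (selfDualHaar ω).IsAddHaarMeasure := by
  obtain ⟨h0, h1⟩ := haarScale_aux hω
  refine Measure.IsAddHaarMeasure.smul _ ?_ ?_
  · simp only [haarScale]
    intro h
    rw [ENNReal.rpow_eq_zero_iff] at h
    rcases h with h | h
    · exact h0 h.1
    · exact h1 h.1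
  · simp only [haarScale]
    exact ENNReal.rpow_ne_top_of_ne_zero h0 h1

theorem selfDualHaar_normalized {ω : ChevalleyDiff k p} (hω : ω ≠ 0) :
    selfDualHaar ω (𝒪[k] : Set k) * selfDualHaar ω (inverseDifferent ω) = 1 := by
  obtain ⟨h0, h1⟩ := haarScale_aux hω
  simp only [selfDualHaar, Measure.smul_apply, smul_eq_mul]
  rw [mul_mul_mul_comm, haarScale, ← ENNReal.rpow_add _ _ h0 h1]
  norm_num
  rw [ENNReal.rpow_neg_one]
  exact ENNReal.inv_mul_cancel h0 h1

/-- The Haar measure `μˣ` on `kˣ` with `μˣ(𝒪ˣ) = 1`. -/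
noncomputable def unitHaar (k : Type*) [Field k] [ValuativeRel k] [TopologicalSpace k]
    [IsNonarchimedeanLocalField k] [MeasurableSpace k] [BorelSpace k] : Measure kˣ :=
  Measure.haarMeasure
    { carrier := integerUnits k
      isCompact' := lf_isCompact_integerUnits
      interior_nonempty' := by
        rw [lf_isOpen_integerUnits.interior_eq]
        exact ⟨1, by simp [integerUnits]⟩ }

instance unitHaar_isHaarMeasure : (unitHaar k).IsHaarMeasure := by
  unfold unitHaar
  infer_instance

theorem unitHaar_integerUnits : unitHaar k (integerUnits k) = 1 :=
  Measure.haarMeasure_self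

theorem absv_units (x : kˣ) : absv (x : k) = distribHaarChar k x := by
  have := distribHaarChar_eq_div (μ := (Measure.addHaar : Measure k)) (s := (𝒪[k] : Set k))
    addHaar_integers_pos addHaar_integers_ne_top x
  have h2 : (x • (𝒪[k] : Set k)) = (x : k) • (𝒪[k] : Set k) := rfl
  rw [h2] at this
  rw [absv, ← this]
  rfl

theorem absv_pos (x : kˣ) : 0 < absv (x : k) := by
  rw [absv_units]
  exact_mod_cast distribHaarChar_pos

theorem absv_pow_units (x : kˣ) (n : ℕ) : absv ((x : k) ^ n) = absv (x : k) ^ n := by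
  rw [← Units.val_pow_eq_pow_val, absv_units, absv_units, map_pow]
  push_cast
  rfl

theorem ordv_pow (x : k) {n : ℕ} (hn : n ≠ 0) : ordv (x ^ n) = n * ordv x := by
  by_cases hx : x = 0
  · subst hx
    have h0 : absv (0 : k) = 0 := by
      have h : (0 : k) • (𝒪[k] : Set k) = {0} := Set.zero_smul_set ⟨0, zero_mem 𝒪[k]⟩
      by_contra hne
      have hpos : Measure.addHaar ({0} : Set k) ≠ 0 := by
        intro h2
        rw [absv, h, h2] at hne
        simp at hne
      have hs : ∀ y : k, Measure.addHaar ({y} : Set k) = Measure.addHaar ({0} : Set k) := fun y ↦ by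
        have := measure_preimage_add (Measure.addHaar : Measure k) (-y) {0}
        rw [← this]
        congr 1
        ext z
        simp [eq_comm]
      have hinf : (𝒪[k] : Set k).Infinite := by
        intro hfin
        obtain ⟨ϖ, hϖ⟩ := IsDiscreteValuationRing.exists_irreducible 𝒪[k]
        have : Finite 𝒪[k] := hfin.to_subtype
        have hdom : IsField 𝒪[k] := Finite.isField_of_domain 𝒪[k]
        exact IsDiscreteValuationRing.not_isField 𝒪[k] hdom
      obtain ⟨t, ht⟩ := ENNReal.exists_nat_mul_gt hpos
        (addHaar_integers_ne_top (k := k))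
      obtain ⟨S, hS, hcard⟩ := hinf.exists_subset_card_eq t
      have h3 := measure_mono (μ := (Measure.addHaar : Measure k)) hS
      rw [← sum_measure_singleton, Finset.sum_congr rfl fun y _ ↦ hs y, Finset.sum_const, hcard,
        nsmul_eq_mul] at h3
      exact absurd h3 (not_le.mpr ht)
    simp [ordv, h0, zero_pow hn]
  · have := absv_pow_units (Units.mk0 x hx) n
    simp only [Units.val_mk0] at this
    rw [ordv, ordv, this, Real.log_pow]
    ring

end Measures

/-! ### The perfect closure -/

section Perfect

variable {k : Type*} [Field k] [ValuativeRel k] [TopologicalSpace k] [IsNonarchimedeanLocalField k]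
  (p : ℕ) [Fact p.Prime] [CharP k p] [MeasurableSpace k] [BorelSpace k]

/-- The extension of `ord` to the perfect closure of `k`: `ord (x ^ (1 / p ^ n)) = ord x / p ^ n`. -/
noncomputable def ordPerf (y : PerfectClosure k p) : ℝ :=
  y.liftOn (fun nx ↦ ordv nx.2 / (p : ℝ) ^ nx.1) (by
    rintro _ _ ⟨n, x⟩
    have hp : (p : ℝ) ≠ 0 := by exact_mod_cast (Fact.out : p.Prime).ne_zero
    simp only [frobenius_def]
    rw [ordv_pow x (Fact.out : p.Prime).ne_zero, pow_succ]
    field_simp)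

theorem ordPerf_mk (n : ℕ) (x : k) :
    ordPerf p (PerfectClosure.mk k p (n, x)) = ordv x / (p : ℝ) ^ n := rfl

open Classical in
/-- `x ^ ν` in the perfect closure of a field `K` of characteristic `p`, for `x ∈ Kˣ` and
`ν = m / p ^ n ∈ ℤ[1/p] ⊆ ℂ`; the value is `1` if `ν ∉ ℤ[1/p]`. -/
noncomputable def perfPow {K : Type*} [Field K] [CharP K p] (x : Kˣ) (ν : ℂ) :
    PerfectClosure K p :=
  if h : ∃ mn : ℤ × ℕ, ν = (mn.1 : ℂ) / (p : ℂ) ^ mn.2 then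
    PerfectClosure.mk K p (h.choose.2, (x : K) ^ h.choose.1)
  else 1

theorem perfPow_eq {K : Type*} [Field K] [CharP K p] (x : Kˣ) (m : ℤ) (n : ℕ) :
    perfPow p x ((m : ℂ) / (p : ℂ) ^ n) = PerfectClosure.mk K p (n, (x : K) ^ m) := by
  have h : ∃ mn : ℤ × ℕ, (m : ℂ) / (p : ℂ) ^ n = (mn.1 : ℂ) / (p : ℂ) ^ mn.2 := ⟨(m, n), rfl⟩
  rw [perfPow, dif_pos h]
  have hs := h.choose_spec
  generalize h.choose = mn at hs
  obtain ⟨m', n'⟩ := mn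
  have hp : (p : ℂ) ≠ 0 := by exact_mod_cast (Fact.out : p.Prime).ne_zero
  rw [div_eq_div_iff (pow_ne_zero _ hp) (pow_ne_zero _ hp)] at hs
  have hs' : m * (p : ℤ) ^ n' = m' * (p : ℤ) ^ n := by exact_mod_cast hs
  rw [PerfectClosure.eq_iff]
  simp only [← coe_iterateFrobenius, iterateFrobenius_def]
  rw [← zpow_natCast, ← zpow_natCast, ← zpow_mul, ← zpow_mul]
  push_cast
  rw [hs']

end Perfect

/-! ### Rigged virtual lattices, theta and Catalan symbols -/

/-- The space `𝒮'(k × k)` of generalized functions. -/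
abbrev GenFun (k : Type*) [TopologicalSpace k] : Type _ :=
  BruhatSchwartz (k × k) →ₗ[ℂ] ℂ

/-- The data fixed throughout: a nonzero Chevalley differential `ω`, a subfield `𝔽 ⊆ 𝔽_q` and a
nonconstant homomorphism `lam` from the additive group of `𝔽` to `ℂˣ`. -/
structure StirlingData (k : Type*) [Field k] [ValuativeRel k] [TopologicalSpace k]
    [IsNonarchimedeanLocalField k] (p : ℕ) [Fact p.Prime] [CharP k p] where
  ω : ChevalleyDiff k p
  ω_ne_zero : ω ≠ 0
  F : Subfield (constField k p)
  lam : AddChar F ℂ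
  lam_ne_one : lam ≠ 1

open Classical in
/-- The function `lam₀` on a field equal to `1` at `0`, to `-1` at `1`, and to `0` elsewhere. -/
noncomputable def lamZero {F : Type*} [Field F] (x : F) : ℂ :=
  if x = 0 then 1 else if x = 1 then -1 else 0

namespace StirlingData

variable {k : Type*} [Field k] [ValuativeRel k] [TopologicalSpace k] [IsNonarchimedeanLocalField k]
  {p : ℕ} [Fact p.Prime] [CharP k p]

/-- The character `𝐞(x) = lam (Tr (Res (x ω)))`. -/
noncomputable def e (D : StirlingData k p) (x : k) : ℂ :=
  D.lam (Algebra.trace D.F (constField k p) (resDiff (mulDiff x D.ω)))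

/-- The function `𝐞₀(x) = lam₀ (Tr (Res (x ω)))`. -/
noncomputable def e₀ (D : StirlingData k p) (x : k) : ℂ :=
  lamZero (Algebra.trace D.F (constField k p) (resDiff (mulDiff x D.ω)))

theorem trace_surjective (D : StirlingData k p) :
    Function.Surjective (Algebra.trace D.F (constField k p)) := by
  have : Finite D.F := Subtype.finite
  exact Algebra.trace_surjective D.F (constField k p)

theorem isResKernel_e (D : StirlingData k p) : IsResKernel D.ω D.e := by
  have := Fintype.ofFinite (constField k p)
  refine ⟨fun c ↦ D.lam (Algebra.trace D.F (constField k p) c), ?_, fun x ↦ rfl⟩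
  rw [finsum_eq_sum_of_fintype]
  refine AddChar.sum_eq_zero_of_ne_one
    (ψ := D.lam.compAddMonoidHom (Algebra.trace D.F (constField k p)).toAddMonoidHom) ?_
  intro h
  refine D.lam_ne_one (DFunLike.ext _ _ fun y ↦ ?_)
  obtain ⟨c, rfl⟩ := D.trace_surjective y
  exact DFunLike.congr_fun h c

theorem isResKernel_e₀ (D : StirlingData k p) : IsResKernel D.ω fun x ↦ D.e₀ (-x) := by
  classical
  have := Fintype.ofFinite (constField k p)
  refine ⟨fun c ↦ lamZero (Algebra.trace D.F (constField k p) (-c)), ?_, fun x ↦ ?_⟩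
  · rw [finsum_eq_sum_of_fintype]
    set T := Algebra.trace D.F (constField k p)
    obtain ⟨c₁, hc₁⟩ := D.trace_surjective 1
    have e0 : ∑ c, lamZero (T (-c)) = ∑ c, lamZero (T c) :=
      Equiv.sum_comp (Equiv.neg _) fun c ↦ lamZero (T c)
    have hsplit : ∀ y : D.F, lamZero y = (if y = 0 then (1 : ℂ) else 0) -
        (if y - 1 = 0 then (1 : ℂ) else 0) := fun y ↦ by
      rw [lamZero]
      by_cases h0 : y = 0
      · simp [h0]
      · by_cases h1 : y = 1
        · simp [h1]
        · simp [h0, h1, sub_eq_zero]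
    rw [e0]
    simp_rw [hsplit]
    rw [Finset.sum_sub_distrib, sub_eq_zero]
    have := Equiv.sum_comp (Equiv.subRight c₁) fun c ↦ if T c = 0 then (1 : ℂ) else 0
    rw [← this]
    refine Finset.sum_congr rfl fun c _ ↦ ?_
    simp only [Equiv.subRight_apply, map_sub]
    rw [hc₁]
  · simp only [e₀, res_mulDiff, map_neg]

variable [MeasurableSpace k] [BorelSpace k]

/-- The Haar measure `μ` on `k`, normalized by `μ(𝒪) μ(𝔇⁻¹) = 1`. -/
noncomputable def μ (D : StirlingData k p) : Measure k := selfDualHaar D.ω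

instance (D : StirlingData k p) : D.μ.IsAddHaarMeasure := selfDualHaar_isAddHaar D.ω_ne_zero

/-- The two-variable Fourier transform on `𝒮(k × k)`,
`𝒢[φ](ξ, η) = ∫∫ φ(x, y) 𝐞(x ξ - y η) dμ(x) dμ(y)`. -/
noncomputable def fourierS (D : StirlingData k p) :
    BruhatSchwartz (k × k) →ₗ[ℂ] BruhatSchwartz (k × k) :=
  transform D.μ D.ω_ne_zero D.isResKernel_e

theorem fourierS_apply (D : StirlingData k p) (φ : BruhatSchwartz (k × k)) (ξ η : k) :
    (D.fourierS φ).1 (ξ, η) = ∫ x, ∫ y, φ.1 (x, y) * D.e (x * ξ - y * η) ∂D.μ ∂D.μ := rfl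

/-- The rational Fourier transform on `𝒮(k × k)`,
`𝒢₀[φ](ξ, η) = ∫∫ φ(x, y) 𝐞₀(-x ξ + y η) dμ(x) dμ(y)`. -/
noncomputable def fourierS₀ (D : StirlingData k p) :
    BruhatSchwartz (k × k) →ₗ[ℂ] BruhatSchwartz (k × k) :=
  transform D.μ D.ω_ne_zero D.isResKernel_e₀

theorem fourierS₀_apply (D : StirlingData k p) (φ : BruhatSchwartz (k × k)) (ξ η : k) :
    (D.fourierS₀ φ).1 (ξ, η) = ∫ x, ∫ y, φ.1 (x, y) * D.e₀ (-(x * ξ) + y * η) ∂D.μ ∂D.μ := by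
  change ∫ x, ∫ y, φ.1 (x, y) * D.e₀ (-(x * ξ - y * η)) ∂D.μ ∂D.μ = _
  have h : ∀ x y : k, -(x * ξ - y * η) = -(x * ξ) + y * η := fun x y ↦ by ring
  simp only [h]

/-- The Fourier transform of generalized functions, `⟨𝒢[Γ], φ⟩ = ⟨Γ, 𝒢[φ]⟩`. -/
noncomputable def 𝒢 (D : StirlingData k p) (Γ : GenFun k) : GenFun k := Γ ∘ₗ D.fourierS

/-- The rational Fourier transform of generalized functions, `⟨𝒢₀[Γ], φ⟩ = ⟨Γ, 𝒢₀[φ]⟩`. -/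
noncomputable def 𝒢₀ (D : StirlingData k p) (Γ : GenFun k) : GenFun k := Γ ∘ₗ D.fourierS₀

/-- A primitive rigged virtual lattice:
`⟨Φ, φ⟩ = μ(𝒪)⁻¹ ∑_{x ∈ ℓ + L} ∫_{w + r𝒪} φ(x, y) dμ(y)`
with `L ⊆ k` a cocompact discrete subgroup, `ℓ, w ∈ k` and `r ∈ kˣ`. -/
def IsPrimitive (D : StirlingData k p) (Φ : GenFun k) : Prop :=
  ∃ (L : AddSubgroup k) (ℓ w : k) (r : kˣ), DiscreteTopology L ∧ CompactSpace (k ⧸ L) ∧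
    ∀ φ : BruhatSchwartz (k × k), Φ φ = ((D.μ.real (𝒪[k] : Set k))⁻¹ : ℝ) *
      ∑ᶠ x : L, ∫ y in w +ᵥ (r : k) • (𝒪[k] : Set k), φ.1 (ℓ + x, y) ∂D.μ

/-- The space of rigged virtual lattices. -/
def RVL (D : StirlingData k p) : Submodule ℂ (GenFun k) :=
  Submodule.span ℂ {Φ | D.IsPrimitive Φ}

end StirlingData

/-- The ring `ℤ[1/p]`, as a subring of `ℂ`. -/
def zInv (p : ℕ) : Subring ℂ := Subring.closure {(p : ℂ)⁻¹}

section LowerStar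

variable {k : Type*} [Field k] [ValuativeRel k] [TopologicalSpace k] [IsNonarchimedeanLocalField k]

theorem mem_box_iff {k : Type*} [Field k] [ValuativeRel k] (x z : k) (a : kˣ) :
    z ∈ x +ᵥ (a : k) • (𝒪[k] : Set k) ↔ valuation k (z - x) ≤ valuation k (a : k) := by
  rw [Set.mem_vadd_set_iff_neg_vadd_mem, Set.mem_smul_set_iff_inv_smul_mem₀ a.ne_zero]
  simp only [vadd_eq_add, smul_eq_mul, SetLike.mem_coe, Valuation.mem_integer_iff, map_mul,
    map_inv₀]
  rw [inv_mul_le_one₀ (zero_lt_iff.mpr (by simp)), neg_add_eq_sub]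

/-- The test function `1_{x + a𝒪} ⊗ 1_{y + a𝒪}`. -/
noncomputable def boxTest (x y : k) (a : kˣ) : BruhatSchwartz (k × k) :=
  ⟨fun z ↦ (x +ᵥ (a : k) • (𝒪[k] : Set k)).indicator (fun _ ↦ 1) z.1 *
      (y +ᵥ (a : k) • (𝒪[k] : Set k)).indicator (fun _ ↦ 1) z.2, by
    classical
    have hinv : ∀ c z u : k, valuation k u ≤ valuation k (a : k) →
        (z + u ∈ c +ᵥ (a : k) • (𝒪[k] : Set k) ↔ z ∈ c +ᵥ (a : k) • (𝒪[k] : Set k)) := by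
      intro c z u hu
      rw [mem_box_iff, mem_box_iff]
      constructor
      · intro h
        have := lf_val_add (y := -u) h (by rwa [Valuation.map_neg])
        rwa [show z + u - c + -u = z - c by ring] at this
      · intro h
        have := lf_val_add h hu
        rwa [show z - c + u = z + u - c by ring] at this
    have hK : ∀ c : k, IsCompact (c +ᵥ (a : k) • (𝒪[k] : Set k)) := fun c ↦ by
      convert lf_isCompact_ball (a : k) c using 1
      ext z
      exact mem_box_iff c z a
    obtain ⟨d, hd0, hd⟩ := lf_bounded ((hK x).union (hK y))
    refine bs_mem_of_bounded₂ (c := a) (d := d) a.ne_zero (fun z w u v hu hv ↦ ?_)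
      (fun z w h ↦ ?_)
    · simp only [Set.indicator_apply, hinv _ _ _ hu, hinv _ _ _ hv]
    · have h1 := Set.mem_of_indicator_ne_zero (left_ne_zero_of_mul h)
      have h2 := Set.mem_of_indicator_ne_zero (right_ne_zero_of_mul h)
      exact ⟨hd z (Or.inl h1), hd w (Or.inr h2)⟩⟩

variable [MeasurableSpace k] [BorelSpace k]

/-- The filter on `kˣ` expressing `‖a‖ → 0`. -/
noncomputable def normToZero (k : Type*) [Field k] [ValuativeRel k] [TopologicalSpace k]
    [IsNonarchimedeanLocalField k] [MeasurableSpace k] [BorelSpace k] : Filter kˣ :=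
  Filter.comap (fun a : kˣ ↦ absv (a : k)) (𝓝 0)

/-- The lower star function
`Φ_*(x, y) = lim_{‖a‖ → 0} ⟨Φ, 1_{x + a𝒪} ⊗ 1_{y + a𝒪}⟩ / ‖a‖`. -/
noncomputable def lowerStar (Φ : GenFun k) (x y : k) : ℂ :=
  limUnder (normToZero k) fun a : kˣ ↦ Φ (boxTest x y a) / (absv (a : k) : ℂ)

/-- All the limits defining `Φ_*` exist. -/
def HasLowerStar (Φ : GenFun k) : Prop :=
  ∀ x y : k, Tendsto (fun a : kˣ ↦ Φ (boxTest x y a) / (absv (a : k) : ℂ)) (normToZero k)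
    (𝓝 (lowerStar Φ x y))

/-- The theta symbol `Θ(a, Φ) = ∑_{x ∈ k} Φ_*(x, a⁻¹ x)`. -/
noncomputable def theta (a : kˣ) (Φ : GenFun k) : ℂ :=
  ∑ᶠ x : k, lowerStar Φ x ((a : k)⁻¹ * x)

/-- `Φ` is proper: `Θ(·, Φ)` is compactly supported in `kˣ`. -/
def IsProper (Φ : GenFun k) : Prop := HasCompactSupport fun a : kˣ ↦ theta a Φ

end LowerStar

namespace StirlingData

variable {k : Type*} [Field k] [ValuativeRel k] [TopologicalSpace k] [IsNonarchimedeanLocalField k]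
  {p : ℕ} [Fact p.Prime] [CharP k p] [MeasurableSpace k] [BorelSpace k]

/-- `Φ` is a rational rigged virtual lattice: a finite `ℤ[1/p]`-linear combination of primitive
rigged virtual lattices. -/
def IsRational (D : StirlingData k p) (Φ : GenFun k) : Prop :=
  Φ ∈ Submodule.span (zInv p) {Φ | D.IsPrimitive Φ}

/-- The Catalan symbol
`∏_{x ∈ kˣ} x ^ Φ_*(x, a⁻¹x) · ∏_{ξ ∈ kˣ} ξ ^ (𝒢₀[Φ]_*(ξ, aξ) ‖a‖)`, an element of the perfect
closure of `k`. -/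
noncomputable def catalan (D : StirlingData k p) (a : kˣ) (Φ : GenFun k) : PerfectClosure k p :=
  (∏ᶠ x : kˣ, perfPow p x (lowerStar Φ x ((a : k)⁻¹ * x))) *
    ∏ᶠ ξ : kˣ, perfPow p ξ (lowerStar (D.𝒢₀ Φ) ξ (a * ξ) * absv (a : k))

open Classical in
/-- The function subtracted from `Θ(at, Φ)` in the Stirling formula: `‖at‖ 𝒢[Φ]_*(0,0)`,
`Θ(a, Φ)` or `Φ_*(0,0)` according to whether `‖t‖ > 1`, `‖t‖ = 1` or `‖t‖ < 1`. -/
noncomputable def thetaCorrection (D : StirlingData k p) (a : kˣ) (Φ : GenFun k) (t : kˣ) : ℂ :=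
  if 1 < absv (t : k) then (absv ((a * t : kˣ) : k) : ℂ) * lowerStar (D.𝒢 Φ) 0 0
  else if absv (t : k) = 1 then theta a Φ
  else lowerStar Φ 0 0

/-- The integrand of the first integral in the Stirling formula. -/
noncomputable def thetaIntegrand (D : StirlingData k p) (a : kˣ) (Φ : GenFun k) (t : kˣ) : ℂ :=
  (theta (a * t) Φ - D.thetaCorrection a Φ t) / (absv (1 - (t : k)) : ℂ)

/-- The function `t ↦ Ψ_*(0, t) - Ψ_*(0, 0) 1_𝒪(t)` on `kˣ`. -/
noncomputable def axisIntegrand (Ψ : GenFun k) (t : kˣ) : ℂ :=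
  lowerStar Ψ 0 t - lowerStar Ψ 0 0 * (𝒪[k] : Set k).indicator (fun _ ↦ 1) (t : k)

/-- The integrand of the first integral in the Stirling formula for proper `Φ`. -/
noncomputable def properIntegrand (a : kˣ) (Φ : GenFun k) (t : kˣ) : ℂ :=
  (theta (a * t) Φ - (integerUnits k).indicator (fun _ ↦ 1) t * theta a Φ) /
    (absv (1 - (t : k)) : ℂ)

end StirlingData

/-! ### The absolute value and the balls of a local field -/

section MeasureIndex

/-! Every term of the formula in (i) is linear in Φ, so it is enough to prove it for a primitive Φ
attached to ℓ + L and w + r𝒪 (`stirling_primLattice`); `hasStirling` extends it to the span. Such a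
Φ has an explicit density, the indicator of ℓ + L times the indicator of w + r𝒪
(`isStar_primLattice`), so Θ(t, Φ) counts the points of ℓ + L in the disc t(w + r𝒪). The field is
self-dual under 𝐞 (`exists_eMul_eq`), which gives Poisson summation (`exists_covol`). Consequently
𝒢[Φ] has density a constant times 𝐞(ℓ s) on the annihilator of L, times 𝐞(-w t) on a ball
(`isStar_𝒢_primLattice`).

For primitive Φ put ‖ar‖ = q^R, let N(i) be the number of points of ℓ + L in the disc of radius
q^(R+i) about aw, and let δ be the expected number of points for i = 0. The sum of ord ξ over the
dual lattice is cut into layers according to ‖ξ‖. Each layer is a character sum over a ball of the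
dual lattice, hence by Poisson summation a point count, and the sum of the q^(-i) N(i) - δ over i ≥
1 appears (`exists_dual_layer`). The integral of Θ yields the same sum. If w + r𝒪 contains 0, the
integrand depends only on ‖t‖ and is summed shell by shell (`integral_countIntegrand_of_mem`). If
not, the integral is taken point by point: a point x is counted exactly for t in a small disc about
x/(aw), on which 1/‖1 - t‖ is the constant ‖aw‖/‖x - aw‖, and summation by parts turns counts in
annuli into counts in discs (`integral_countIntegrand_of_notMem`). The infinite-looking sums cancel
after a common truncation, and the axis integrals supply the elementary terms that are left.

For (ii), Fourier inversion on 𝔽 expresses 𝐞₀(-z) as the average of (1 - λ(c)) 𝐞(cz) over c ∈ 𝔽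
(`e₀_neg_eq`). Thus 𝒢₀[Φ] is an average of dilates of 𝒢[Φ] by elements of absolute value one, with
weights of total mass one; such dilations change neither ord nor Haar measure, so 𝒢₀ may replace 𝒢
in the dual terms. Grouping the dilates by orbits of 𝔽_pˣ gives values in ℤ[1/p]
(`orbit_sum_mem_zInv`). Near the two ends of kˣ the theta symbol equals Φ_*(0,0) and ‖t‖
𝒢[Φ]_*(0,0), so properness makes both numbers vanish (`HasStirling.lowerStar_zero_of_isProper`), and
the correction terms disappear. -/

theorem AddSubgroup.relIndex_mul_measure {G : Type*} [AddGroup G] [MeasurableSpace G]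
    [MeasurableAdd G] (μ : Measure G) [μ.IsAddLeftInvariant] {A B : AddSubgroup G}
    (hA : MeasurableSet (A : Set G)) (hB : MeasurableSet (B : Set G)) (h : A ≤ B)
    (h0 : A.relIndex B ≠ 0) : A.relIndex B * μ A = μ B := by
  have hemb : MeasurableEmbedding (Subtype.val : B → G) := MeasurableEmbedding.subtype_coe hB
  have : (A.addSubgroupOf B).FiniteIndex := ⟨h0⟩
  have : MeasurableAdd B :=
    ⟨fun c ↦ ((measurable_const_add (c : G)).comp measurable_subtype_coe).subtype_mk,
      fun c ↦ ((measurable_add_const (c : G)).comp measurable_subtype_coe).subtype_mk⟩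
  -- The measure restricted to B is still invariant, so the index formula inside the group B
  -- applies.
  have hinv : (μ.comap (Subtype.val : B → G)).IsAddLeftInvariant :=
    Measure.IsAddLeftInvariant.comap μ (f := B.subtype) hemb
  have key := (A.addSubgroupOf B).index_mul_measure (measurable_subtype_coe hA)
    (μ.comap (Subtype.val : B → G))
  rw [hemb.comap_apply, hemb.comap_apply] at key
  have e1 : (Subtype.val '' ((A.addSubgroupOf B : AddSubgroup B) : Set B)) = (A : Set G) := by
    ext x
    simp only [Set.mem_image, SetLike.mem_coe, AddSubgroup.mem_addSubgroupOf]
    exact ⟨by rintro ⟨y, hy, rfl⟩; exact hy, fun hx ↦ ⟨⟨x, h hx⟩, hx, rfl⟩⟩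
  rw [e1] at key
  simpa [AddSubgroup.relIndex] using key

end MeasureIndex

section ResidueCard

variable {k : Type*} [Field k] [ValuativeRel k] [TopologicalSpace k] [IsNonarchimedeanLocalField k]

theorem residueCard_pos : (0 : ℝ) < residueCard k := by
  have := one_lt_residueCard k
  positivity

theorem one_lt_residueCard_real : (1 : ℝ) < residueCard k := by
  exact_mod_cast one_lt_residueCard k

theorem zpow_residueCard_inj {m n : ℤ} :
    (residueCard k : ℝ) ^ m = (residueCard k : ℝ) ^ n ↔ m = n :=
  (zpow_right_strictMono₀ one_lt_residueCard_real).injective.eq_iff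

theorem zpow_residueCard_le {m n : ℤ} :
    (residueCard k : ℝ) ^ m ≤ (residueCard k : ℝ) ^ n ↔ m ≤ n :=
  zpow_le_zpow_iff_right₀ one_lt_residueCard_real

theorem zpow_residueCard_lt {m n : ℤ} :
    (residueCard k : ℝ) ^ m < (residueCard k : ℝ) ^ n ↔ m < n :=
  zpow_lt_zpow_iff_right₀ one_lt_residueCard_real

theorem zpow_residueCard_pos (n : ℤ) : 0 < (residueCard k : ℝ) ^ n :=
  zpow_pos residueCard_pos n

end ResidueCard

section AbsoluteValue

variable {k : Type*} [Field k] [ValuativeRel k] [TopologicalSpace k] [IsNonarchimedeanLocalField k]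
  [MeasurableSpace k] [BorelSpace k]

theorem addHaar_smul_integers (c : kˣ) :
    Measure.addHaar ((c : k) • (𝒪[k] : Set k)) =
      ENNReal.ofReal (absv (c : k)) * Measure.addHaar (𝒪[k] : Set k) := by
  have := distribHaarChar_mul (Measure.addHaar : Measure k) c (𝒪[k] : Set k)
  rw [absv_units, ENNReal.ofReal_coe_nnreal]
  exact this.symm

/-- The maximal ideal is ϖ𝒪 and has index q in 𝒪, so q times its Haar measure is the measure of 𝒪.
-/
theorem absv_unif {ϖ : 𝒪[k]} (hϖ : Irreducible ϖ) :
    absv (ϖ : k) = (residueCard k : ℝ)⁻¹ := by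
  have hB : MeasurableSet (𝒪[k] : Set k) := lf_isOpen_integers.measurableSet
  have hemb : MeasurableEmbedding (Subtype.val : 𝒪[k] → k) := MeasurableEmbedding.subtype_coe hB
  have hidx : (𝓂[k].toAddSubgroup).index = residueCard k :=
    Submodule.cardQuot_apply (S := 𝓂[k])
  have h1q := one_lt_residueCard k
  have : (𝓂[k].toAddSubgroup).FiniteIndex := ⟨by rw [hidx]; omega⟩
  have hinv : ((Measure.addHaar : Measure k).comap (Subtype.val : 𝒪[k] → k)).IsAddLeftInvariant :=
    Measure.IsAddLeftInvariant.comap Measure.addHaar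
      (f := (𝒪[k].subtype : 𝒪[k] →+ k)) hemb
  have himg : (Subtype.val '' ((𝓂[k].toAddSubgroup : AddSubgroup 𝒪[k]) : Set 𝒪[k])) =
      (ϖ : k) • (𝒪[k] : Set k) := by
    ext x
    simp only [Set.mem_image, Set.mem_smul_set, SetLike.mem_coe, smul_eq_mul]
    constructor
    · rintro ⟨y, hy, rfl⟩
      have hy' : y ∈ 𝓂[k] := hy
      rw [hϖ.maximalIdeal_eq, Ideal.mem_span_singleton] at hy'
      obtain ⟨z, rfl⟩ := hy'
      exact ⟨z, z.2, rfl⟩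
    · rintro ⟨z, hz, rfl⟩
      refine ⟨ϖ * ⟨z, hz⟩, ?_, rfl⟩
      change _ ∈ 𝓂[k]
      rw [hϖ.maximalIdeal_eq, Ideal.mem_span_singleton]
      exact dvd_mul_right _ _
  have hmeas : MeasurableSet ((𝓂[k].toAddSubgroup : AddSubgroup 𝒪[k]) : Set 𝒪[k]) := by
    rw [← hemb.measurableSet_image, himg]
    have := (lf_isCompact_integers (k := k)).isClosed
    exact (this.smul_of_ne_zero (lf_unif_ne_zero hϖ)).measurableSet
  have key := (𝓂[k].toAddSubgroup).index_mul_measure hmeas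
    ((Measure.addHaar : Measure k).comap (Subtype.val : 𝒪[k] → k))
  rw [hemb.comap_apply, hemb.comap_apply, himg, hidx] at key
  simp only [Set.image_univ, Subtype.range_coe_subtype, SetLike.setOfPred_mem_eq] at key
  have hpos := addHaar_integers_pos (k := k)
  have htop := addHaar_integers_ne_top (k := k)
  have h2 := addHaar_smul_integers (Units.mk0 (ϖ : k) (lf_unif_ne_zero hϖ))
  rw [Units.val_mk0] at h2
  rw [h2] at key
  have h3 := congrArg ENNReal.toReal key
  have hp : (Measure.addHaar (𝒪[k] : Set k)).toReal ≠ 0 := (ENNReal.toReal_pos hpos htop).ne'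
  have hab := absv_pos (Units.mk0 (ϖ : k) (lf_unif_ne_zero hϖ))
  rw [Units.val_mk0] at hab
  rw [ENNReal.toReal_mul, ENNReal.toReal_mul, ENNReal.toReal_ofReal hab.le,
    ENNReal.toReal_natCast, ← mul_assoc] at h3
  refine eq_inv_of_mul_eq_one_right ?_
  exact mul_right_cancel₀ hp (h3.trans (one_mul _).symm)

theorem absv_one : absv (1 : k) = 1 := by
  have := absv_pow_units (1 : kˣ) 0
  simpa using this

theorem absv_units_mul (x y : kˣ) : absv ((x * y : kˣ) : k) = absv (x : k) * absv (y : k) := by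
  rw [absv_units, absv_units, absv_units, map_mul]
  push_cast
  rfl

theorem absv_units_zpow (x : kˣ) (n : ℤ) : absv ((x ^ n : kˣ) : k) = absv (x : k) ^ n := by
  rw [absv_units, absv_units, map_zpow]
  push_cast
  rfl

/-- The set 0·𝒪 lies in every ϖ^n 𝒪, whose measure relative to 𝒪 is q^(-n). -/
theorem absv_zero : absv (0 : k) = 0 := by
  obtain ⟨ϖ, hϖ⟩ := IsDiscreteValuationRing.exists_irreducible 𝒪[k]
  have hle : ∀ n : ℕ, absv (0 : k) ≤ (residueCard k : ℝ)⁻¹ ^ n := by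
    intro n
    rw [← absv_unif hϖ]
    have := absv_pow_units (Units.mk0 (ϖ : k) (lf_unif_ne_zero hϖ)) n
    rw [Units.val_mk0] at this
    rw [← this]
    refine ENNReal.toReal_mono ?_ ?_
    · refine ENNReal.div_ne_top ?_ addHaar_integers_pos
      exact (lf_isCompact_integers.smul _).measure_ne_top
    · refine ENNReal.div_le_div_right (measure_mono ?_) _
      rintro x ⟨y, -, rfl⟩
      exact ⟨0, zero_mem 𝒪[k], by simp⟩
  refine le_antisymm ?_ ENNReal.toReal_nonneg
  refine ge_of_tendsto' (tendsto_pow_atTop_nhds_zero_of_lt_one ?_ ?_) hle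
  · exact inv_nonneg.mpr residueCard_pos.le
  · exact inv_lt_one_of_one_lt₀ one_lt_residueCard_real

theorem absv_mul (x y : k) : absv (x * y) = absv x * absv y := by
  by_cases hx : x = 0
  · simp [hx, absv_zero]
  by_cases hy : y = 0
  · simp [hy, absv_zero]
  exact absv_units_mul (Units.mk0 x hx) (Units.mk0 y hy)

theorem absv_pos' {x : k} (hx : x ≠ 0) : 0 < absv x := absv_pos (Units.mk0 x hx)

theorem absv_nonneg (x : k) : 0 ≤ absv x := ENNReal.toReal_nonneg

@[simp] theorem absv_eq_zero {x : k} : absv x = 0 ↔ x = 0 :=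
  ⟨fun h ↦ by_contra fun hx ↦ (absv_pos' hx).ne' h, fun h ↦ h ▸ absv_zero⟩

theorem absv_inv (x : k) : absv x⁻¹ = (absv x)⁻¹ := by
  by_cases hx : x = 0
  · simp [hx, absv_zero]
  refine eq_inv_of_mul_eq_one_left ?_
  rw [← absv_mul, inv_mul_cancel₀ hx, absv_one]

theorem absv_div (x y : k) : absv (x / y) = absv x / absv y := by
  rw [div_eq_mul_inv, absv_mul, absv_inv, div_eq_mul_inv]

theorem absv_le_one_of_valuation {x : k} (h : valuation k x ≤ 1) : absv x ≤ 1 := by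
  rw [absv]
  refine ENNReal.toReal_le_of_le_ofReal zero_le_one ?_
  rw [ENNReal.ofReal_one]
  refine ENNReal.div_le_of_le_mul ?_
  rw [one_mul]
  refine measure_mono ?_
  rintro y ⟨z, hz, rfl⟩
  exact mul_mem (S := Subring k) (s := 𝒪[k]) (h : x ∈ 𝒪[k]) hz

/-- If the valuation of x exceeded 1, then x⁻¹ would be divisible by ϖ, forcing ‖x‖ ≥ q. -/
theorem absv_le_one_iff {x : k} : absv x ≤ 1 ↔ valuation k x ≤ 1 := by
  refine ⟨fun h ↦ ?_, absv_le_one_of_valuation⟩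
  by_contra! hlt
  obtain ⟨ϖ, hϖ⟩ := IsDiscreteValuationRing.exists_irreducible 𝒪[k]
  have hx : x ≠ 0 := by rintro rfl; simp at hlt
  have h1 : valuation k x⁻¹ < 1 := by
    rw [map_inv₀]
    exact inv_lt_one_of_one_lt₀ hlt
  have h2 := lf_val_le_unif hϖ h1
  have h3 : valuation k (x⁻¹ / ϖ) ≤ 1 := by
    rw [map_div₀]
    exact div_le_one_of_le₀ h2 zero_le
  have h4 := absv_le_one_of_valuation h3
  rw [absv_div, absv_unif hϖ, absv_inv, div_inv_eq_mul] at h4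
  have h5 : 1 ≤ (absv x)⁻¹ := (one_le_inv₀ (absv_pos' hx)).mpr h
  have h6 := one_lt_residueCard_real (k := k)
  nlinarith

/-- Transfers the ultrametric inequalities from the valuation to the module function defined by Haar
measure. -/
theorem absv_le_iff {x y : k} : absv x ≤ absv y ↔ valuation k x ≤ valuation k y := by
  by_cases hy : y = 0
  · subst hy
    rw [absv_zero, map_zero]
    refine ⟨fun h ↦ ?_, fun h ↦ ?_⟩
    · simp [absv_eq_zero.mp (le_antisymm h (absv_nonneg x))]
    · have hx : x = 0 := by simpa using h
      simp [hx, absv_zero]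
  · have h := absv_le_one_iff (x := x / y)
    rwa [absv_div, div_le_one (absv_pos' hy), map_div₀,
      div_le_one₀ (zero_lt_iff.mpr (by simpa using hy))] at h

theorem absv_neg (x : k) : absv (-x) = absv x :=
  le_antisymm (absv_le_iff.mpr (Valuation.map_neg _ _).le)
    (absv_le_iff.mpr (Valuation.map_neg _ _).ge)

theorem absv_sub_comm (x y : k) : absv (x - y) = absv (y - x) := by
  rw [← absv_neg, neg_sub]

theorem absv_add_le (x y : k) : absv (x + y) ≤ max (absv x) (absv y) := by
  rcases le_total (absv x) (absv y) with h | h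
  · rw [max_eq_right h]
    exact absv_le_iff.mpr (lf_val_add (absv_le_iff.mp h) le_rfl)
  · rw [max_eq_left h]
    exact absv_le_iff.mpr (lf_val_add le_rfl (absv_le_iff.mp h))

theorem absv_sub_le (x y : k) : absv (x - y) ≤ max (absv x) (absv y) := by
  rw [sub_eq_add_neg, ← absv_neg y]
  exact absv_add_le _ _

theorem absv_sub_eq_left {x y : k} (h : absv y < absv x) : absv (x - y) = absv x := by
  refine le_antisymm ((absv_sub_le x y).trans (max_le le_rfl h.le)) ?_
  by_contra! hlt
  have := absv_add_le (x - y) y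
  rw [sub_add_cancel] at this
  exact absurd this (not_le.mpr (max_lt hlt h))

theorem absv_add_eq_left {x y : k} (h : absv y < absv x) : absv (x + y) = absv x := by
  have := absv_sub_eq_left (x := x) (y := -y) (by rwa [absv_neg])
  rwa [sub_neg_eq_add] at this

theorem absv_eq_of_sub_lt {x y : k} (h : absv (x - y) < absv y) : absv x = absv y := by
  have := absv_add_eq_left h
  rwa [add_sub_cancel] at this

theorem exists_absv_eq_zpow (k : Type*) [Field k] [ValuativeRel k] [TopologicalSpace k]
    [IsNonarchimedeanLocalField k] [MeasurableSpace k] [BorelSpace k] (n : ℤ) :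
    ∃ c : kˣ, absv (c : k) = (residueCard k : ℝ) ^ n := by
  obtain ⟨ϖ, hϖ⟩ := IsDiscreteValuationRing.exists_irreducible 𝒪[k]
  refine ⟨Units.mk0 (ϖ : k) (lf_unif_ne_zero hϖ) ^ (-n), ?_⟩
  rw [absv_units_zpow, Units.val_mk0, absv_unif hϖ, inv_zpow', neg_neg]

/-- Bracket ‖x‖ in [q^n, q^(n+1)). An element strictly smaller than one of size q^(n+1) is that
element times a multiple of ϖ, which brings the upper bound down to q^n. -/
theorem absv_eq_zpow {x : k} (hx : x ≠ 0) : ∃ n : ℤ, absv x = (residueCard k : ℝ) ^ n := by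
  obtain ⟨n, h1, h2⟩ := exists_mem_Ico_zpow (absv_pos' hx) (one_lt_residueCard_real (k := k))
  refine ⟨n, le_antisymm ?_ h1⟩
  obtain ⟨ϖ, hϖ⟩ := IsDiscreteValuationRing.exists_irreducible 𝒪[k]
  obtain ⟨c, hc⟩ := exists_absv_eq_zpow k (n + 1)
  rw [← hc] at h2
  have h3 : valuation k (x / c) < 1 := by
    have h4 : ¬ valuation k (c : k) ≤ valuation k x := fun h ↦
      absurd (absv_le_iff.mpr h) (not_le.mpr h2)
    rw [map_div₀, div_lt_one₀ (zero_lt_iff.mpr (by simp))]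
    exact not_le.mp h4
  have h5 := absv_le_iff.mpr (lf_val_le_unif hϖ h3)
  rw [absv_div, absv_unif hϖ, div_le_iff₀ (absv_pos c), hc, zpow_add_one₀ residueCard_pos.ne'] at h5
  have := residueCard_pos (k := k)
  field_simp at h5
  linarith

/-- The integer `n` with `‖x‖ = q ^ n`, for `x ≠ 0`. -/
noncomputable def logAbs (x : k) : ℤ :=
  -- The value 0 at the origin agrees with that of `ordv`, so sums weighted by `logAbs` may include
  -- or omit the origin freely.
  open Classical in if hx : x = 0 then 0 else (absv_eq_zpow hx).choose

theorem absv_eq {x : k} (hx : x ≠ 0) : absv x = (residueCard k : ℝ) ^ logAbs x := by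
  rw [logAbs, dif_neg hx]
  exact (absv_eq_zpow hx).choose_spec

theorem logAbs_eq_iff {x : k} (hx : x ≠ 0) {n : ℤ} :
    logAbs x = n ↔ absv x = (residueCard k : ℝ) ^ n := by
  rw [absv_eq hx, zpow_residueCard_inj]

theorem ordv_eq {x : k} (hx : x ≠ 0) : ordv x = -(logAbs x : ℝ) := by
  have h : Real.log (residueCard k) ≠ 0 := (Real.log_pos one_lt_residueCard_real).ne'
  rw [ordv, absv_eq hx, Real.log_zpow]
  field_simp

theorem logAbs_mul {x y : k} (hx : x ≠ 0) (hy : y ≠ 0) : logAbs (x * y) = logAbs x + logAbs y := by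
  rw [logAbs_eq_iff (mul_ne_zero hx hy), absv_mul, absv_eq hx, absv_eq hy,
    zpow_add₀ residueCard_pos.ne']

theorem logAbs_inv {x : k} (hx : x ≠ 0) : logAbs x⁻¹ = -logAbs x := by
  rw [logAbs_eq_iff (inv_ne_zero hx), absv_inv, absv_eq hx, zpow_neg]

theorem logAbs_div {x y : k} (hx : x ≠ 0) (hy : y ≠ 0) : logAbs (x / y) = logAbs x - logAbs y := by
  rw [div_eq_mul_inv, logAbs_mul hx (inv_ne_zero hy), logAbs_inv hy, sub_eq_add_neg]

/-- The ball `{x | ‖x‖ ≤ q ^ n}`. -/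
noncomputable def ball (k : Type*) [Field k] [ValuativeRel k] [TopologicalSpace k]
    [IsNonarchimedeanLocalField k] [MeasurableSpace k] [BorelSpace k] (n : ℤ) : AddSubgroup k where
  carrier := {x | absv x ≤ (residueCard k : ℝ) ^ n}
  add_mem' := fun {x y} hx hy ↦ (absv_add_le x y).trans (max_le hx hy)
  zero_mem' := by
    simp only [Set.mem_ofPred_eq, absv_zero]
    exact (zpow_residueCard_pos n).le
  neg_mem' := fun {x} hx ↦ (absv_neg x).le.trans hx

theorem mem_ball {n : ℤ} {x : k} : x ∈ ball k n ↔ absv x ≤ (residueCard k : ℝ) ^ n := Iff.rfl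

theorem mem_ball_iff {n : ℤ} {x : k} (hx : x ≠ 0) : x ∈ ball k n ↔ logAbs x ≤ n := by
  rw [mem_ball, absv_eq hx, zpow_residueCard_le]

theorem ball_mono {m n : ℤ} (h : m ≤ n) : ball k m ≤ ball k n :=
  fun _ hx ↦ le_trans hx (zpow_residueCard_le.mpr h)

theorem exists_mem_ball (x : k) : ∃ n : ℤ, ∀ m, n ≤ m → x ∈ ball k m := by
  by_cases hx : x = 0
  · exact ⟨0, fun m _ ↦ hx ▸ zero_mem _⟩
  · exact ⟨logAbs x, fun m hm ↦ (mem_ball_iff hx).mpr hm⟩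

theorem eq_zero_of_forall_mem_ball {x : k} {n : ℤ} (h : ∀ m ≤ n, x ∈ ball k m) : x = 0 := by
  by_contra hx
  have := (mem_ball_iff hx).mp (h (min n (logAbs x - 1)) (min_le_left _ _))
  omega

theorem mem_ball_mul_iff {c : k} (hc : c ≠ 0) {n : ℤ} {x : k} :
    c * x ∈ ball k n ↔ x ∈ ball k (n - logAbs c) := by
  rw [mem_ball, mem_ball, absv_mul, zpow_sub₀ residueCard_pos.ne', absv_eq hc,
    le_div_iff₀ (zpow_residueCard_pos _), mul_comm]

theorem ball_eq_valuation (c : kˣ) {n : ℤ} (hn : logAbs (c : k) = n) :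
    (ball k n : Set k) = {x | valuation k x ≤ valuation k (c : k)} := by
  ext x
  rw [Set.mem_ofPred_eq, ← absv_le_iff, absv_eq c.ne_zero, hn]
  rfl

theorem exists_logAbs_eq (k : Type*) [Field k] [ValuativeRel k] [TopologicalSpace k]
    [IsNonarchimedeanLocalField k] [MeasurableSpace k] [BorelSpace k] (n : ℤ) :
    ∃ c : kˣ, logAbs (c : k) = n := by
  obtain ⟨c, hc⟩ := exists_absv_eq_zpow k n
  exact ⟨c, (logAbs_eq_iff c.ne_zero).mpr hc⟩

theorem isOpen_ball (n : ℤ) : IsOpen (ball k n : Set k) := by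
  obtain ⟨c, hc⟩ := exists_logAbs_eq k n
  rw [ball_eq_valuation c hc]
  simpa using lf_isOpen_ball c.ne_zero 0

theorem isCompact_ball (n : ℤ) : IsCompact (ball k n : Set k) := by
  obtain ⟨c, hc⟩ := exists_logAbs_eq k n
  rw [ball_eq_valuation c hc]
  simpa using lf_isCompact_ball (c : k) 0

theorem isClosed_ball (n : ℤ) : IsClosed (ball k n : Set k) := (isCompact_ball n).isClosed

theorem coe_ball_zero : (ball k 0 : Set k) = 𝒪[k] := by
  ext x
  change absv x ≤ _ ↔ valuation k x ≤ 1
  rw [zpow_zero, absv_le_one_iff]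

theorem exists_ball_subset {U : Set k} (hU : U ∈ 𝓝 (0 : k)) :
    ∃ n : ℤ, ∀ m ≤ n, (ball k m : Set k) ⊆ U := by
  obtain ⟨c, hc0, hc⟩ := lf_nhds_zero hU
  refine ⟨logAbs c, fun m hm x hx ↦ hc x ?_⟩
  rw [← absv_le_iff, absv_eq hc0]
  exact ball_mono hm hx

theorem mem_box_iff_ball (x z : k) (a : kˣ) :
    z ∈ x +ᵥ (a : k) • (𝒪[k] : Set k) ↔ z - x ∈ ball k (logAbs (a : k)) := by
  rw [mem_box_iff, ← absv_le_iff, absv_eq a.ne_zero, mem_ball]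

end AbsoluteValue

/-! ### Finiteness of ball quotients and lattices -/

section Balls

variable {k : Type*} [Field k] [ValuativeRel k] [TopologicalSpace k] [IsNonarchimedeanLocalField k]
  [MeasurableSpace k] [BorelSpace k]

theorem finite_quotient_ball {H : AddSubgroup k} (hH : IsOpen (H : Set k)) (n : ℤ) :
    Finite (ball k n ⧸ H.addSubgroupOf (ball k n)) := by
  have : CompactSpace (ball k n) := isCompact_iff_compactSpace.mp (isCompact_ball n)
  exact AddSubgroup.quotient_finite_of_isOpen _ (hH.preimage continuous_subtype_val)

theorem relIndex_ball_ne_zero {H : AddSubgroup k} (hH : IsOpen (H : Set k)) (n : ℤ) :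
    H.relIndex (ball k n) ≠ 0 := by
  have := finite_quotient_ball hH n
  have := AddSubgroup.finiteIndex_of_finite_quotient (H := H.addSubgroupOf (ball k n))
  exact AddSubgroup.FiniteIndex.index_ne_zero (H := H.addSubgroupOf (ball k n))

theorem addHaar_real_ball (n : ℤ) :
    Measure.addHaar.real (ball k n : Set k) =
      (residueCard k : ℝ) ^ n * Measure.addHaar.real (𝒪[k] : Set k) := by
  obtain ⟨c, hc⟩ := exists_logAbs_eq k n
  have h : (ball k n : Set k) = (c : k) • (𝒪[k] : Set k) := by
    rw [← coe_ball_zero]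
    ext x
    rw [Set.mem_smul_set_iff_inv_smul_mem₀ c.ne_zero, smul_eq_mul, SetLike.mem_coe, SetLike.mem_coe,
      mem_ball_mul_iff (inv_ne_zero c.ne_zero), logAbs_inv c.ne_zero, hc]
    simp
  rw [h, measureReal_def, addHaar_smul_integers, ENNReal.toReal_mul,
    ENNReal.toReal_ofReal (absv_nonneg _), absv_eq c.ne_zero, hc, measureReal_def]

/-- The index is the quotient of the Haar measures of the two balls. -/
theorem relIndex_ball {m n : ℤ} (h : m ≤ n) :
    ((ball k m).relIndex (ball k n) : ℝ) = (residueCard k : ℝ) ^ (n - m) := by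
  have key := AddSubgroup.relIndex_mul_measure (Measure.addHaar : Measure k)
    (isOpen_ball m).measurableSet (isOpen_ball n).measurableSet (ball_mono h)
    (relIndex_ball_ne_zero (isOpen_ball m) n)
  have key' := congrArg ENNReal.toReal key
  rw [ENNReal.toReal_mul, ENNReal.toReal_natCast] at key'
  change _ * Measure.addHaar.real (ball k m : Set k) = Measure.addHaar.real (ball k n : Set k) at key'
  rw [addHaar_real_ball, addHaar_real_ball] at key'
  have h0 : Measure.addHaar.real (𝒪[k] : Set k) ≠ 0 :=
    (ENNReal.toReal_pos addHaar_integers_pos addHaar_integers_ne_top).ne'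
  have hq := (zpow_residueCard_pos (k := k) m).ne'
  rw [zpow_sub₀ residueCard_pos.ne']
  field_simp
  rw [← mul_assoc] at key'
  have := mul_right_cancel₀ h0 key'
  linarith

/-- The ball of radius `q ^ n` centred at `w`. -/
def disc (w : k) (n : ℤ) : Set k := {y | y - w ∈ ball k n}

theorem mem_disc {w y : k} {n : ℤ} : y ∈ disc w n ↔ y - w ∈ ball k n := Iff.rfl

theorem disc_eq_preimage (w : k) (n : ℤ) :
    disc w n = (fun y ↦ y - w) ⁻¹' (ball k n : Set k) := rfl

theorem isOpen_disc (w : k) (n : ℤ) : IsOpen (disc w n) :=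
  (isOpen_ball n).preimage (continuous_id.sub continuous_const)

theorem isCompact_disc (w : k) (n : ℤ) : IsCompact (disc w n) := by
  have := (isCompact_ball (k := k) n).image (continuous_add_const w)
  convert this using 1
  ext y
  simp only [mem_disc, Set.mem_image, SetLike.mem_coe]
  exact ⟨fun h ↦ ⟨y - w, h, by simp⟩, by rintro ⟨z, hz, rfl⟩; simpa using hz⟩

theorem disc_congr {w w' : k} {n : ℤ} (h : w - w' ∈ ball k n) : disc w n = disc w' n := by
  ext y
  rw [mem_disc, mem_disc]
  constructor
  · intro hy
    simpa using add_mem hy h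
  · intro hy
    simpa using sub_mem hy h

theorem box_eq_disc (x : k) (a : kˣ) :
    x +ᵥ (a : k) • (𝒪[k] : Set k) = disc x (logAbs (a : k)) := by
  ext z
  exact mem_box_iff_ball x z a

/-- A cocompact discrete subgroup of `k`. -/
structure IsLattice (L : AddSubgroup k) : Prop where
  discrete : DiscreteTopology L
  cocompact : CompactSpace (k ⧸ L)

theorem discreteTopology_of_inf_ball {L : AddSubgroup k} {u : ℤ} (h : L ⊓ ball k u = ⊥) :
    DiscreteTopology L := by
  refine discreteTopology_of_isOpen_singleton_zero ?_
  have : ({0} : Set L) = Subtype.val ⁻¹' (ball k u : Set k) := by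
    ext ⟨x, hx⟩
    simp only [Set.mem_singleton_iff, Set.mem_preimage, SetLike.mem_coe]
    constructor
    · intro h0
      rw [show x = 0 from congrArg Subtype.val h0]
      exact zero_mem _
    · intro hu
      have : x ∈ L ⊓ ball k u := ⟨hx, hu⟩
      rw [h, AddSubgroup.mem_bot] at this
      exact Subtype.ext this
  rw [this]
  exact (isOpen_ball u).preimage continuous_subtype_val

theorem compactSpace_of_sup_ball {L : AddSubgroup k} {n : ℤ} (h : L ⊔ ball k n = ⊤) :
    CompactSpace (k ⧸ L) := by
  refine ⟨?_⟩
  convert (isCompact_ball (k := k) n).image (QuotientAddGroup.continuous_mk (N := L)) using 1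
  symm
  rw [Set.eq_univ_iff_forall]
  intro x
  obtain ⟨x, rfl⟩ := QuotientAddGroup.mk_surjective x
  have hx : x ∈ L ⊔ ball k n := h ▸ AddSubgroup.mem_top x
  obtain ⟨l, hl, b, hb, rfl⟩ := AddSubgroup.mem_sup.mp hx
  refine ⟨b, hb, ?_⟩
  rw [QuotientAddGroup.eq]
  simpa using hl

/-- The criterion by which lattices are recognized below; the converse implications are
`IsLattice.exists_inf_ball` and `IsLattice.exists_sup_ball`. -/
theorem isLattice_of_ball {L : AddSubgroup k} {u n : ℤ} (h : L ⊓ ball k u = ⊥)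
    (h' : L ⊔ ball k n = ⊤) : IsLattice L :=
  ⟨discreteTopology_of_inf_ball h, compactSpace_of_sup_ball h'⟩

namespace IsLattice

variable {L : AddSubgroup k}

theorem exists_inf_ball (hL : IsLattice L) : ∃ u : ℤ, ∀ m ≤ u, L ⊓ ball k m = ⊥ := by
  have := hL.discrete
  obtain ⟨U, hU, hU0⟩ := isOpen_induced_iff.mp (isOpen_discrete ({0} : Set L))
  have h0 : (0 : k) ∈ U := by
    have : (0 : L) ∈ (Subtype.val ⁻¹' U : Set L) := hU0 ▸ rfl
    exact this
  obtain ⟨u, hu⟩ := exists_ball_subset (hU.mem_nhds h0)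
  refine ⟨u, fun m hm ↦ (AddSubgroup.eq_bot_iff_forall _).mpr fun x hx ↦ ?_⟩
  have : (⟨x, hx.1⟩ : L) ∈ (Subtype.val ⁻¹' U : Set L) := hu m hm hx.2
  rw [hU0] at this
  exact congrArg Subtype.val this

/-- The images of the balls form an increasing open cover of the compact quotient, so one of them is
everything. -/
theorem exists_sup_ball (hL : IsLattice L) : ∃ n : ℤ, ∀ m, n ≤ m → L ⊔ ball k m = ⊤ := by
  have := hL.cocompact
  have hopen : ∀ n : ℤ, IsOpen ((QuotientAddGroup.mk : k → k ⧸ L) '' (ball k n : Set k)) :=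
    fun n ↦ QuotientAddGroup.isOpenMap_coe _ (isOpen_ball n)
  obtain ⟨t, ht⟩ := isCompact_univ.elim_finite_subcover _ hopen (by
    intro x _
    obtain ⟨x, rfl⟩ := QuotientAddGroup.mk_surjective x
    obtain ⟨n, hn⟩ := exists_mem_ball x
    exact Set.mem_iUnion.mpr ⟨n, x, hn n le_rfl, rfl⟩)
  obtain ⟨n, hn⟩ := t.exists_le
  refine ⟨n, fun m hm ↦ eq_top_iff.mpr fun x _ ↦ ?_⟩
  obtain ⟨i, hi, y, hy, hxy⟩ := Set.mem_iUnion₂.mp (ht (Set.mem_univ (QuotientAddGroup.mk x)))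
  rw [QuotientAddGroup.eq] at hxy
  have h1 : y ∈ ball k m := ball_mono ((hn i hi).trans hm) hy
  have := add_mem (AddSubgroup.mem_sup_right h1) (AddSubgroup.mem_sup_left (T := ball k m) hxy)
  simpa using this

/-- Modulo a ball meeting L only in 0, points of L stay distinct, and a larger ball has finitely
many classes. -/
theorem finite_inf_ball (hL : IsLattice L) (n : ℤ) : (L ⊓ ball k n : Set k).Finite := by
  obtain ⟨u, hu⟩ := hL.exists_inf_ball
  have := finite_quotient_ball (isOpen_ball (k := k) u) n
  let f : (L ⊓ ball k n : AddSubgroup k) → ball k n ⧸ (ball k u).addSubgroupOf (ball k n) :=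
    fun x ↦ QuotientAddGroup.mk ⟨x.1, x.2.2⟩
  have hf : Function.Injective f := by
    intro x y hxy
    rw [QuotientAddGroup.eq] at hxy
    have h1 : -(x : k) + y ∈ ball k u := hxy
    have h2 : -(x : k) + y ∈ L := add_mem (neg_mem x.2.1) y.2.1
    have h3 : -(x : k) + y ∈ L ⊓ ball k u := ⟨h2, h1⟩
    rw [hu u le_rfl, AddSubgroup.mem_bot] at h3
    exact Subtype.ext (neg_add_eq_zero.mp h3)
  have := Finite.of_injective f hf
  exact Set.toFinite ((L ⊓ ball k n : AddSubgroup k) : Set k)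

theorem finite_coset_disc (hL : IsLattice L) (l c : k) (n : ℤ) :
    {x | x - l ∈ L ∧ x ∈ disc c n}.Finite := by
  rcases Set.eq_empty_or_nonempty {x | x - l ∈ L ∧ x ∈ disc c n} with h | ⟨x₀, h1, h2⟩
  · rw [h]
    exact Set.finite_empty
  · refine ((hL.finite_inf_ball n).image (fun z ↦ z + x₀)).subset ?_
    rintro x ⟨h3, h4⟩
    refine ⟨x - x₀, ⟨?_, ?_⟩, by simp⟩
    · simpa using sub_mem h3 h1
    · simpa using sub_mem (H := ball k n) h4 h2

theorem finite_coset_ball (hL : IsLattice L) (l : k) (n : ℤ) :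
    {x | x - l ∈ L ∧ x ∈ ball k n}.Finite := by
  simpa [disc] using hL.finite_coset_disc l 0 n

end IsLattice

end Balls

/-! ### The conductor of the additive character -/

namespace StirlingData

variable {k : Type*} [Field k] [ValuativeRel k] [TopologicalSpace k] [IsNonarchimedeanLocalField k]
  {p : ℕ} [Fact p.Prime] [CharP k p]

theorem e_zero (D : StirlingData k p) : D.e 0 = 1 := by
  simp [e]

theorem e_add (D : StirlingData k p) (x y : k) : D.e (x + y) = D.e x * D.e y := by
  simp only [e, res_mulDiff, map_add, AddChar.map_add_eq_mul]

theorem e_ne_zero (D : StirlingData k p) (x : k) : D.e x ≠ 0 := by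
  intro h
  have := D.e_add x (-x)
  rw [h, zero_mul, add_neg_cancel, e_zero] at this
  exact one_ne_zero this

theorem e_neg (D : StirlingData k p) (x : k) : D.e (-x) = (D.e x)⁻¹ := by
  refine eq_inv_of_mul_eq_one_left ?_
  rw [← e_add, neg_add_cancel, e_zero]

theorem e_sub (D : StirlingData k p) (x y : k) : D.e (x - y) = D.e x / D.e y := by
  rw [sub_eq_add_neg, e_add, e_neg, div_eq_mul_inv]

theorem isLocallyConstant_e (D : StirlingData k p) : IsLocallyConstant D.e := by
  have : D.e = fun x ↦ D.lam (Algebra.trace D.F (constField k p) (D.ω.1 x)) := by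
    funext x
    rw [e, res_mulDiff]
  rw [this]
  exact IsLocallyConstant.comp (f := D.ω.1) (chevalleyDiff_lc D.ω)
    (fun c ↦ D.lam (Algebra.trace D.F (constField k p) c))

/-- `𝐞` as an additive character. -/
noncomputable def eChar (D : StirlingData k p) : AddChar k ℂ where
  toFun := D.e
  map_zero_eq_one' := D.e_zero
  map_add_eq_mul' := D.e_add

/-- If ω(x) were nonzero, the traces of c ω(x) for c ∈ 𝔽_q would exhaust 𝔽 and λ would be trivial.
-/
theorem omega_eq_zero_of_e (D : StirlingData k p) {x : k}
    (h : ∀ c : constField k p, D.e (c * x) = 1) : D.ω.1 x = 0 := by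
  by_contra hne
  refine D.lam_ne_one (DFunLike.ext _ _ fun y ↦ ?_)
  obtain ⟨c, rfl⟩ := D.trace_surjective y
  have := h (c / D.ω.1 x)
  rw [e, res_mulDiff, chevalleyDiff_map_const, div_mul_cancel₀ _ hne] at this
  simpa using this

theorem diffDiv_ne_zero {ϖ : 𝒪[k]} (hϖ : Irreducible ϖ) (D : StirlingData k p) :
    diffDiv D.ω (dUnif hϖ) ≠ 0 := by
  intro h
  have := diffDiv_spec D.ω (dUnif_ne_zero (p := p) hϖ)
  rw [h] at this
  refine D.ω_ne_zero ?_
  rw [this]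
  exact Subtype.ext (LinearMap.ext fun z ↦ by simp)

variable [MeasurableSpace k] [BorelSpace k]

/-- The integer `n` such that `𝔇⁻¹` is the ball of radius `q ^ n`. -/
noncomputable def cond (D : StirlingData k p) : ℤ :=
  -logAbs (diffDiv D.ω (dUnif (IsDiscreteValuationRing.exists_irreducible 𝒪[k]).choose_spec))

theorem ordDiff_eq_cond (D : StirlingData k p) : ordDiff D.ω = D.cond := by
  rw [ordDiff, ordv_eq (D.diffDiv_ne_zero _), cond]
  push_cast
  rfl

/-- Write ω as a multiple of dϖ, for which the statement is `dUnif_vanish_iff`, and rescale. -/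
theorem omega_vanish_iff (D : StirlingData k p) {x : k} :
    (∀ y ∈ ball k 0, D.ω.1 (x * y) = 0) ↔ x ∈ ball k D.cond := by
  set hϖ := (IsDiscreteValuationRing.exists_irreducible 𝒪[k]).choose_spec with hdef
  have h0 := D.diffDiv_ne_zero hϖ
  have h1 := dUnif_vanish_iff (p := p) hϖ (diffDiv D.ω (dUnif hϖ) * x)
  have h2 := diffDiv_spec D.ω (dUnif_ne_zero (p := p) hϖ)
  rw [← absv_le_one_iff, ← zpow_zero (residueCard k : ℝ), ← mem_ball, mem_ball_mul_iff h0,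
    zero_sub] at h1
  change _ ↔ x ∈ ball k (-logAbs (diffDiv D.ω (dUnif hϖ)))
  rw [← h1]
  refine forall_congr' fun y ↦ ?_
  rw [← SetLike.mem_coe, coe_ball_zero]
  change (valuation k y ≤ 1 → _) ↔ _
  refine imp_congr_right fun _ ↦ ?_
  rw [congrArg (fun δ : ChevalleyDiff k p ↦ δ.1 (x * y)) h2, mulDiff_apply, mul_assoc]

theorem e_eq_one_of_mem (D : StirlingData k p) {x y : k} {n : ℤ} (hx : x ∈ ball k (D.cond - n))
    (hy : y ∈ ball k n) : D.e (x * y) = 1 := by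
  obtain ⟨c, hc⟩ := exists_logAbs_eq k n
  have h1 : (c : k) * x ∈ ball k D.cond := by
    rwa [mem_ball_mul_iff c.ne_zero, hc]
  have h2 : (c : k)⁻¹ * y ∈ ball k 0 := by
    rw [mem_ball_mul_iff (inv_ne_zero c.ne_zero), logAbs_inv c.ne_zero, hc]
    simpa using hy
  have h3 := (D.omega_vanish_iff.mpr h1) _ h2
  rw [show (c : k) * x * ((c : k)⁻¹ * y) = x * y by field_simp [c.ne_zero]] at h3
  rw [e, res_mulDiff, h3]
  simp

/-- A ball is stable under 𝔽_q, so triviality of 𝐞 on its multiple by x forces ω itself to vanish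
there. This is what makes the annihilator of a ball a ball. -/
theorem forall_e_eq_one_iff (D : StirlingData k p) {x : k} {n : ℤ} :
    (∀ y ∈ ball k n, D.e (x * y) = 1) ↔ x ∈ ball k (D.cond - n) := by
  refine ⟨fun h ↦ ?_, fun hx y hy ↦ D.e_eq_one_of_mem hx hy⟩
  obtain ⟨c, hc⟩ := exists_logAbs_eq k n
  rw [← hc, ← mem_ball_mul_iff c.ne_zero, ← omega_vanish_iff]
  intro y hy
  refine D.omega_eq_zero_of_e fun b ↦ ?_
  rw [show (b : k) * (c * x * y) = x * (c * (b * y)) by ring]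
  refine h _ ?_
  rw [mem_ball_mul_iff c.ne_zero, hc, sub_self]
  have hb : absv (b : k) ≤ 1 := absv_le_one_of_valuation (constField_val_le_one p b.2)
  rw [mem_ball, zpow_zero] at hy ⊢
  rw [absv_mul]
  exact mul_le_one₀ hb (absv_nonneg _) hy

/-- The measure of the ball of radius `q ^ n`. -/
noncomputable def vol (D : StirlingData k p) (n : ℤ) : ℝ := D.μ.real (ball k n : Set k)

theorem vol_pos (D : StirlingData k p) (n : ℤ) : 0 < D.vol n :=
  ENNReal.toReal_pos ((isOpen_ball n).measure_pos _ ⟨0, zero_mem _⟩).ne'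
    (isCompact_ball n).measure_ne_top

theorem μ_real_integers (D : StirlingData k p) : D.μ.real (𝒪[k] : Set k) = D.vol 0 := by
  rw [vol, coe_ball_zero]

theorem vol_eq (D : StirlingData k p) (n : ℤ) :
    D.vol n = (residueCard k : ℝ) ^ n * D.vol 0 := by
  have h : ∀ S : Set k, D.μ.real S = (haarScale D.ω).toReal * Measure.addHaar.real S := fun S ↦ by
    rw [measureReal_def, μ, selfDualHaar, Measure.smul_apply, smul_eq_mul, ENNReal.toReal_mul]
    rfl
  rw [vol, vol, h, h, addHaar_real_ball, coe_ball_zero]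
  ring

theorem coe_ball_cond (D : StirlingData k p) :
    (ball k D.cond : Set k) = inverseDifferent D.ω := by
  ext x
  rw [SetLike.mem_coe, ← omega_vanish_iff, inverseDifferent, Set.mem_ofPred_eq, ← coe_ball_zero]
  simp

theorem vol_normalized (D : StirlingData k p) :
    D.vol 0 ^ 2 * (residueCard k : ℝ) ^ D.cond = 1 := by
  have h := congrArg ENNReal.toReal (selfDualHaar_normalized D.ω_ne_zero)
  rw [ENNReal.toReal_mul, ← coe_ball_cond, ← coe_ball_zero, ENNReal.toReal_one] at h
  have h' : D.vol 0 * D.vol D.cond = 1 := h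
  rw [vol_eq D D.cond] at h'
  rw [← h']
  ring

theorem μ_real_disc (D : StirlingData k p) (w : k) (n : ℤ) : D.μ.real (disc w n) = D.vol n := by
  rw [vol, measureReal_def, measureReal_def, disc_eq_preimage]
  simp_rw [sub_eq_add_neg]
  rw [measure_preimage_add_right]

/-- If 𝐞(x·) is trivial on the ball, the integrand is constant on the disc. Otherwise translation by
some z in the ball preserves the disc and multiplies the integral by 𝐞(xz) ≠ 1, so the integral is
zero. -/
theorem setIntegral_disc_e (D : StirlingData k p) (x w : k) (n : ℤ) :
    ∫ y in disc w n, D.e (x * y) ∂D.μ =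
      open Classical in if x ∈ ball k (D.cond - n) then D.e (x * w) * D.vol n else 0 := by
  have hmeas := (isOpen_disc (k := k) w n).measurableSet
  split_ifs with h
  · have : ∀ y ∈ disc w n, D.e (x * y) = D.e (x * w) := fun y hy ↦ by
      have h1 := D.e_eq_one_of_mem h hy
      rw [mul_sub, e_sub, div_eq_one_iff_eq (D.e_ne_zero _)] at h1
      exact h1
    rw [setIntegral_congr_fun hmeas this, setIntegral_const, μ_real_disc]
    simp [mul_comm]
  · rw [← forall_e_eq_one_iff] at h
    push Not at h
    obtain ⟨z, hz, hne⟩ := h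
    rw [← integral_indicator hmeas]
    have h1 := integral_add_right_eq_self (μ := D.μ)
      ((disc w n).indicator fun y ↦ D.e (x * y)) z
    have h2 : ∀ y, (disc w n).indicator (fun y ↦ D.e (x * y)) (y + z) =
        D.e (x * z) * (disc w n).indicator (fun y ↦ D.e (x * y)) y := fun y ↦ by
      have h3 : y + z ∈ disc w n ↔ y ∈ disc w n := by
        rw [mem_disc, mem_disc, show y + z - w = (y - w) + z by ring]
        exact add_mem_cancel_right (H := ball k n) hz
      by_cases hy : y ∈ disc w n
      · rw [Set.indicator_of_mem hy, Set.indicator_of_mem (h3.mpr hy), mul_add, e_add, mul_comm]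
      · rw [Set.indicator_of_notMem hy, Set.indicator_of_notMem (mt h3.mp hy), mul_zero]
    simp_rw [h2] at h1
    rw [integral_const_mul] at h1
    by_contra hI
    exact hne (mul_eq_right₀ hI |>.mp h1)

end StirlingData

/-! ### Self-duality and Poisson summation -/

section AddChar

/-- A character trivial on a subgroup descends to the quotient. -/
def AddChar.descend {G M : Type*} [AddCommGroup G] [CommMonoid M] (A : AddSubgroup G)
    (χ : AddChar G M) (h : ∀ x ∈ A, χ x = 1) : AddChar (G ⧸ A) M where
  toFun q := Quotient.liftOn' q χ fun x y hxy ↦ by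
    rw [QuotientAddGroup.leftRel_apply] at hxy
    have := h _ hxy
    rw [show y = x + (-x + y) by abel, AddChar.map_add_eq_mul, this, mul_one]
  map_zero_eq_one' := AddChar.map_zero_eq_one χ
  map_add_eq_mul' a b := by
    induction a using QuotientAddGroup.induction_on
    induction b using QuotientAddGroup.induction_on
    exact AddChar.map_add_eq_mul χ _ _

end AddChar

namespace StirlingData

variable {k : Type*} [Field k] [ValuativeRel k] [TopologicalSpace k] [IsNonarchimedeanLocalField k]
  {p : ℕ} [Fact p.Prime] [CharP k p]

/-- The character `x ↦ 𝐞(ξ x)`. -/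
noncomputable def eMul (D : StirlingData k p) (ξ : k) : AddChar k ℂ :=
  D.eChar.compAddMonoidHom (AddMonoidHom.mulLeft ξ)

@[simp] theorem eMul_apply (D : StirlingData k p) (ξ x : k) : D.eMul ξ x = D.e (ξ * x) := rfl

/-- The annihilator of a subgroup under the pairing `(x, y) ↦ 𝐞(x y)`. -/
noncomputable def perp (D : StirlingData k p) (H : AddSubgroup k) : AddSubgroup k where
  carrier := {ξ | ∀ x ∈ H, D.e (ξ * x) = 1}
  add_mem' := fun {a b} ha hb x hx ↦ by rw [add_mul, e_add, ha x hx, hb x hx, one_mul]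
  zero_mem' := fun x _ ↦ by rw [zero_mul, e_zero]
  neg_mem' := fun {a} ha x hx ↦ by rw [neg_mul, e_neg, ha x hx, inv_one]

theorem mem_perp (D : StirlingData k p) {H : AddSubgroup k} {ξ : k} :
    ξ ∈ D.perp H ↔ ∀ x ∈ H, D.e (ξ * x) = 1 := Iff.rfl

theorem perp_sup (D : StirlingData k p) (A B : AddSubgroup k) :
    D.perp (A ⊔ B) = D.perp A ⊓ D.perp B := by
  ext ξ
  simp only [AddSubgroup.mem_inf, mem_perp]
  constructor
  · exact fun h ↦ ⟨fun x hx ↦ h x (AddSubgroup.mem_sup_left hx),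
      fun x hx ↦ h x (AddSubgroup.mem_sup_right hx)⟩
  · rintro ⟨h1, h2⟩ x hx
    obtain ⟨a, ha, b, hb, rfl⟩ := AddSubgroup.mem_sup.mp hx
    rw [mul_add, e_add, h1 a ha, h2 b hb, one_mul]

variable [MeasurableSpace k] [BorelSpace k]

theorem perp_ball (D : StirlingData k p) (n : ℤ) :
    D.perp (ball k n) = ball k (D.cond - n) := by
  ext ξ
  exact D.forall_e_eq_one_iff

/-- A counting argument. The characters 𝐞(ξ·), with ξ taken modulo the annihilator of the larger
ball, are pairwise distinct on the finite quotient of the two balls. They number q^(n-u), which is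
the order of that quotient and so the number of all its characters. -/
theorem exists_eMul_eq_on_ball (D : StirlingData k p) {u n : ℤ} (hun : u ≤ n) (χ : AddChar k ℂ)
    (hχ : ∀ x ∈ ball k u, χ x = 1) :
    ∃ ξ ∈ ball k (D.cond - u), ∀ x ∈ ball k n, χ x = D.e (ξ * x) := by
  let A := (ball k u).addSubgroupOf (ball k n)
  let Q := ball k n ⧸ A
  let A' := (ball k (D.cond - n)).addSubgroupOf (ball k (D.cond - u))
  let Q' := ball k (D.cond - u) ⧸ A'
  have : Finite Q := finite_quotient_ball (isOpen_ball u) n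
  have : Finite Q' := finite_quotient_ball (isOpen_ball _) _
  have := Fintype.ofFinite Q
  have := Fintype.ofFinite Q'
  let f (ξ : ball k (D.cond - u)) : AddChar Q ℂ :=
    AddChar.descend A ((D.eMul ξ).compAddMonoidHom (ball k n).subtype)
      (fun x hx ↦ D.e_eq_one_of_mem ξ.2 hx)
  have hf : ∀ ξ ξ', f ξ = f ξ' → (ξ : k) - ξ' ∈ ball k (D.cond - n) := by
    intro ξ ξ' h
    rw [← D.forall_e_eq_one_iff]
    intro y hy
    have h1 : D.e (ξ * y) = D.e (ξ' * y) :=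
      DFunLike.congr_fun h (QuotientAddGroup.mk (⟨y, hy⟩ : ball k n))
    rw [sub_mul, e_sub, h1, div_self (D.e_ne_zero _)]
  let g : Q' → AddChar Q ℂ := fun c ↦ f c.out
  have hg : Function.Injective g := by
    intro c c' h
    have h1 := hf _ _ h.symm
    rw [← QuotientAddGroup.out_eq' c, ← QuotientAddGroup.out_eq' c', QuotientAddGroup.eq]
    change -((c.out : ball k (D.cond - u)) : k) + (c'.out : ball k (D.cond - u)) ∈ ball k (D.cond - n)
    rwa [neg_add_eq_sub]
  have hcard : Nat.card Q' = Nat.card (AddChar Q ℂ) := by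
    rw [Nat.card_eq_fintype_card (α := AddChar Q ℂ), AddChar.card_eq, ← Nat.card_eq_fintype_card]
    have h1 := relIndex_ball (k := k) hun
    have h2 := relIndex_ball (k := k) (show D.cond - n ≤ D.cond - u by omega)
    rw [show D.cond - u - (D.cond - n) = n - u by ring, ← h1] at h2
    exact_mod_cast h2
  have hbij := hg.bijective_of_nat_card_le hcard.ge
  obtain ⟨c, hc⟩ := hbij.2 (AddChar.descend A (χ.compAddMonoidHom (ball k n).subtype)
    (fun x hx ↦ hχ x hx))
  refine ⟨(c.out : ball k (D.cond - u)), c.out.2, fun x hx ↦ ?_⟩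
  exact (DFunLike.congr_fun hc (QuotientAddGroup.mk (⟨x, hx⟩ : ball k n))).symm

/-- Self-duality: every character of `k` trivial on an open ball is of the form `x ↦ 𝐞(ξ x)`. -/
theorem exists_eMul_eq (D : StirlingData k p) {u : ℤ} (χ : AddChar k ℂ)
    (hχ : ∀ x ∈ ball k u, χ x = 1) : ∃ ξ, D.eMul ξ = χ := by
  -- The ξ that represent χ on larger and larger balls form a decreasing sequence of nonempty
  -- compact sets; a common point represents χ everywhere.
  let S : ℕ → Set k := fun m ↦
    {ξ | ξ ∈ ball k (D.cond - u) ∧ ∀ x ∈ ball k (u + m), χ x = D.e (ξ * x)}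
  have hclosed : ∀ m, IsClosed (S m) := by
    intro m
    refine (isClosed_ball (D.cond - u)).inter ?_
    have : {ξ : k | ∀ x ∈ ball k (u + m), χ x = D.e (ξ * x)} =
        ⋂ x ∈ ball k (u + m), (fun ξ : k ↦ D.e (ξ * x)) ⁻¹' {χ x} := by
      ext ξ
      simp [eq_comm]
    change IsClosed {ξ : k | ∀ x ∈ ball k (u + m), χ x = D.e (ξ * x)}
    rw [this]
    refine isClosed_biInter fun x _ ↦ ?_
    exact isClosed_singleton.preimage (D.isLocallyConstant_e.continuous.comp (by fun_prop))
  obtain ⟨ξ, hξ⟩ := IsCompact.nonempty_iInter_of_sequence_nonempty_isCompact_isClosed S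
    (fun m ξ hξ ↦ ⟨hξ.1, fun x hx ↦ hξ.2 x (ball_mono (by push_cast; omega) hx)⟩)
    (fun m ↦ by
      obtain ⟨ξ, h1, h2⟩ := D.exists_eMul_eq_on_ball (show u ≤ u + m by omega) χ hχ
      exact ⟨ξ, h1, h2⟩)
    ((isCompact_ball (D.cond - u)).of_isClosed_subset (hclosed 0) fun _ h ↦ h.1) hclosed
  refine ⟨ξ, DFunLike.ext _ _ fun x ↦ ?_⟩
  obtain ⟨n, hn⟩ := exists_mem_ball x
  exact ((Set.mem_iInter.mp hξ (n - u).toNat).2 x (hn _ (by omega))).symm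

theorem eMul_injective (D : StirlingData k p) : Function.Injective D.eMul := by
  intro ξ ξ' h
  have h1 : ∀ n : ℤ, ξ - ξ' ∈ ball k n := fun n ↦ by
    have := (D.forall_e_eq_one_iff (x := ξ - ξ') (n := D.cond - n)).mp fun y _ ↦ by
      have : D.e (ξ * y) = D.e (ξ' * y) := DFunLike.congr_fun h y
      rw [sub_mul, e_sub, this, div_self (D.e_ne_zero _)]
    simpa using this
  exact sub_eq_zero.mp (eq_zero_of_forall_mem_ball (n := 0) fun m _ ↦ h1 m)

/-- The annihilator of an open subgroup is the dual of the quotient. -/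
noncomputable def perpEquiv (D : StirlingData k p) {H : AddSubgroup k} {u : ℤ}
    (hH : ball k u ≤ H) : D.perp H ≃ AddChar (k ⧸ H) ℂ :=
  Equiv.ofBijective (fun ξ ↦ AddChar.descend H (D.eMul ξ) ξ.2) <| by
    constructor
    · intro ξ ξ' h
      refine Subtype.ext (D.eMul_injective (DFunLike.ext _ _ fun x ↦ ?_))
      exact DFunLike.congr_fun h (QuotientAddGroup.mk x)
    · intro ψ
      let χ : AddChar k ℂ := ψ.compAddMonoidHom (QuotientAddGroup.mk' H)
      have hχ : ∀ x ∈ H, χ x = 1 := fun x hx ↦ by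
        have : (QuotientAddGroup.mk' H) x = 0 := (QuotientAddGroup.eq_zero_iff x).mpr hx
        change ψ (QuotientAddGroup.mk' H x) = 1
        rw [this, AddChar.map_zero_eq_one]
      obtain ⟨ξ, hξ⟩ := D.exists_eMul_eq χ fun x hx ↦ hχ x (hH hx)
      refine ⟨⟨ξ, fun x hx ↦ ?_⟩, DFunLike.ext _ _ fun x ↦ ?_⟩
      · rw [← eMul_apply, hξ, hχ x hx]
      · induction x using QuotientAddGroup.induction_on
        exact DFunLike.congr_fun hξ _

/-- By `perpEquiv` the sum runs over all characters of the finite group k ⧸ H, so this is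
orthogonality of characters. -/
theorem sum_perp (D : StirlingData k p) {H : AddSubgroup k} {u : ℤ} (hH : ball k u ≤ H)
    [Finite (k ⧸ H)] [Fintype (D.perp H)] (x : k) :
    ∑ ξ : D.perp H, D.e (ξ * x) =
      open Classical in if x ∈ H then (Nat.card (k ⧸ H) : ℂ) else 0 := by
  classical
  have := Fintype.ofFinite (k ⧸ H)
  have h := AddChar.sum_apply_eq_ite (QuotientAddGroup.mk x : k ⧸ H)
  rw [← (D.perpEquiv hH).sum_comp] at h
  simp only [QuotientAddGroup.eq_zero_iff] at h
  rw [Nat.card_eq_fintype_card, ← h]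
  rfl

/-- By `ht` the character 𝐞(t·) descends to the quotient of the two balls, so the choice of
representatives is immaterial and its sum vanishes unless it is trivial. -/
theorem sum_ball_quotient (D : StirlingData k p) {u n : ℤ} (hun : u ≤ n)
    [Fintype (ball k n ⧸ (ball k u).addSubgroupOf (ball k n))] {t : k}
    (ht : t ∈ ball k (D.cond - u)) :
    ∑ b : ball k n ⧸ (ball k u).addSubgroupOf (ball k n), D.e (t * (b.out : ball k n)) =
      open Classical in
      if t ∈ ball k (D.cond - n) then (((residueCard k : ℝ) ^ (n - u) : ℝ) : ℂ) else 0 := by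
  classical
  let A := (ball k u).addSubgroupOf (ball k n)
  let ψ := AddChar.descend A ((D.eMul t).compAddMonoidHom (ball k n).subtype)
      (fun x hx ↦ D.e_eq_one_of_mem ht hx)
  have h := AddChar.sum_eq_ite ψ
  have h1 : ∀ b, ψ b = D.e (t * (b.out : ball k n)) := fun b ↦ by
    conv_lhs => rw [← QuotientAddGroup.out_eq' b]
    rfl
  rw [← Finset.sum_congr rfl fun b _ ↦ h1 b, h, ← relIndex_ball hun]
  have h2 : ψ = 0 ↔ t ∈ ball k (D.cond - n) := by
    rw [← D.forall_e_eq_one_iff]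
    constructor
    · intro h y hy
      exact DFunLike.congr_fun h (QuotientAddGroup.mk (⟨y, hy⟩ : ball k n))
    · intro h
      refine DFunLike.ext _ _ fun x ↦ ?_
      induction x using QuotientAddGroup.induction_on with
      | H x => exact h x x.2
  simp only [h2, AddSubgroup.relIndex, AddSubgroup.index, Nat.card_eq_fintype_card]
  push_cast
  rfl

/-- For large n every class is represented in the ball of index n, and that ball has finitely many
classes modulo the open subgroup. -/
theorem finite_quotient_sup_ball {L : AddSubgroup k} (hL : IsLattice L) (u : ℤ) :
    Finite (k ⧸ (L ⊔ ball k u)) := by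
  obtain ⟨n, hn⟩ := hL.exists_sup_ball
  have hopen : IsOpen ((L ⊔ ball k u : AddSubgroup k) : Set k) :=
    AddSubgroup.isOpen_mono le_sup_right (isOpen_ball u)
  have := finite_quotient_ball hopen n
  refine Finite.of_surjective
    (fun b : ball k n ⧸ (L ⊔ ball k u).addSubgroupOf (ball k n) ↦
      (QuotientAddGroup.mk (b.out : k) : k ⧸ (L ⊔ ball k u))) fun x ↦ ?_
  induction x using QuotientAddGroup.induction_on with
  | H x =>
    have hx : x ∈ L ⊔ ball k n := hn n le_rfl ▸ AddSubgroup.mem_top x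
    obtain ⟨l, hl, b, hb, rfl⟩ := AddSubgroup.mem_sup.mp hx
    let b' : ball k n ⧸ (L ⊔ ball k u).addSubgroupOf (ball k n) :=
      QuotientAddGroup.mk (⟨b, hb⟩ : ball k n)
    refine ⟨b', ?_⟩
    rw [QuotientAddGroup.eq]
    have h1 : -(b'.out : k) + b ∈ L ⊔ ball k u := by
      have := QuotientAddGroup.out_eq' b'
      rw [QuotientAddGroup.eq] at this
      exact this
    have h2 : -(b'.out : k) + (l + b) = (-(b'.out : k) + b) + l := by ring
    rw [h2]
    exact add_mem h1 (AddSubgroup.mem_sup_left hl)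

/-- The disc about s lies in the ball of index cond - u, so the points of the dual lattice in it
already belong to the finite annihilator of L + ball u. -/
theorem finsum_perp_disc (D : StirlingData k p) {L : AddSubgroup k} {u i : ℤ} (hui : u ≤ i)
    [Fintype (D.perp (L ⊔ ball k u))] (l : k) {s : k} (hs : s ∈ ball k (D.cond - u)) :
    ∑ᶠ ξ ∈ {ξ | ξ ∈ D.perp L ∧ ξ ∈ disc s (D.cond - i)}, D.e (l * ξ) =
      ∑ ξ : D.perp (L ⊔ ball k u),
        open Classical in if (s - ξ : k) ∈ ball k (D.cond - i) then D.e (ξ * l) else 0 := by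
  classical
  have hsub : ball k (D.cond - i) ≤ ball k (D.cond - u) := ball_mono (by omega)
  rw [← finsum_eq_sum_of_fintype]
  have h := finsum_set_coe_eq_finsum_mem (D.perp (L ⊔ ball k u) : Set k)
    (f := fun ξ ↦ if s - ξ ∈ ball k (D.cond - i) then D.e (ξ * l) else 0)
  refine Eq.trans ?_ h.symm
  rw [finsum_mem_def, finsum_mem_def]
  refine finsum_congr fun ξ ↦ ?_
  have hperp : ξ ∈ (D.perp (L ⊔ ball k u) : Set k) ↔
      ξ ∈ D.perp L ∧ ξ ∈ ball k (D.cond - u) := by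
    rw [SetLike.mem_coe, perp_sup, perp_ball, AddSubgroup.mem_inf]
  have hsym : ξ ∈ disc s (D.cond - i) ↔ s - ξ ∈ ball k (D.cond - i) := by
    rw [mem_disc, ← neg_sub s ξ, neg_mem_iff]
  simp only [Set.indicator_apply, Set.mem_ofPred_eq, hperp, hsym]
  by_cases h7 : s - ξ ∈ ball k (D.cond - i)
  · have h9 : ξ ∈ ball k (D.cond - u) := by
      have := sub_mem hs (hsub h7)
      rwa [sub_sub_cancel] at this
    simp only [h7, h9, and_true, if_true, mul_comm]
  · simp only [h7, and_false, if_false, ite_self]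

/-- Since L meets the small ball only in 0, a class of the large ball modulo the small one contains
at most one point of l + L, and 𝐞(s·) is constant on the class. -/
theorem sum_ball_quotient_coset (D : StirlingData k p) {L : AddSubgroup k} (hL : IsLattice L)
    {u i : ℤ} (hui : u ≤ i) (hu : L ⊓ ball k u = ⊥)
    [Fintype (ball k i ⧸ (ball k u).addSubgroupOf (ball k i))] (l : k) {s : k}
    (hs : s ∈ ball k (D.cond - u)) :
    (∑ b : ball k i ⧸ (ball k u).addSubgroupOf (ball k i), open Classical in
      if l - (b.out : ball k i) ∈ L ⊔ ball k u then D.e (s * (b.out : ball k i)) else 0) =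
      ∑ᶠ x ∈ {x | x - l ∈ L ∧ x ∈ ball k i}, D.e (s * x) := by
  classical
  let Q := ball k i ⧸ (ball k u).addSubgroupOf (ball k i)
  have hfin := hL.finite_coset_ball l i
  rw [finsum_mem_eq_finite_toFinset_sum _ hfin, ← Finset.sum_filter]
  have hout : ∀ (x : k) (hx : x ∈ ball k i),
      x - ((QuotientAddGroup.mk (⟨x, hx⟩ : ball k i) : Q).out : ball k i) ∈ ball k u := by
    intro x hx
    have := QuotientAddGroup.out_eq' (QuotientAddGroup.mk (⟨x, hx⟩ : ball k i) : Q)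
    rw [QuotientAddGroup.eq] at this
    have h7 : -(((QuotientAddGroup.mk (⟨x, hx⟩ : ball k i) : Q).out : ball k i) : k) + x ∈
      ball k u := this
    rwa [neg_add_eq_sub] at h7
  symm
  refine Finset.sum_bij (fun x hx ↦ (QuotientAddGroup.mk
    (⟨x, (hfin.mem_toFinset.mp hx).2⟩ : ball k i) : Q)) ?_ ?_ ?_ ?_
  · intro x hx
    have hx' := hfin.mem_toFinset.mp hx
    rw [Finset.mem_filter]
    refine ⟨Finset.mem_univ _, ?_⟩
    have h8 := add_mem (neg_mem (AddSubgroup.mem_sup_left (T := ball k u) hx'.1))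
      (AddSubgroup.mem_sup_right (S := L) (hout x hx'.2))
    convert h8 using 1
    ring
  · intro x hx y hy hxy
    have hx' := hfin.mem_toFinset.mp hx
    have hy' := hfin.mem_toFinset.mp hy
    rw [QuotientAddGroup.eq] at hxy
    have h8 : -x + y ∈ ball k u := hxy
    have h9 : -x + y ∈ L := by
      convert sub_mem hy'.1 hx'.1 using 1
      ring
    have h10 : -x + y ∈ L ⊓ ball k u := ⟨h9, h8⟩
    rw [hu, AddSubgroup.mem_bot] at h10
    exact neg_add_eq_zero.mp h10
  · intro b hb
    rw [Finset.mem_filter] at hb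
    obtain ⟨y, hy, v, hv, hyv⟩ := AddSubgroup.mem_sup.mp hb.2
    have hv' : v ∈ ball k i := ball_mono hui hv
    have hmem : ((b.out : ball k i) : k) + v ∈ ball k i := add_mem b.out.2 hv'
    refine ⟨(b.out : ball k i) + v, hfin.mem_toFinset.mpr ⟨?_, hmem⟩, ?_⟩
    · convert neg_mem hy using 1
      linear_combination hyv
    · conv_rhs => rw [← QuotientAddGroup.out_eq' b]
      rw [QuotientAddGroup.eq]
      change -(((b.out : ball k i) : k) + v) + (b.out : ball k i) ∈ ball k u
      convert neg_mem hv using 1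
      ring
  · intro x hx
    have hx' := hfin.mem_toFinset.mp hx
    have h8 := D.e_eq_one_of_mem hs (hout x hx'.2)
    rw [mul_sub, e_sub, div_eq_one_iff_eq (D.e_ne_zero _)] at h8
    exact h8

/-- The condition that ξ lies in the disc about s is detected by averaging 𝐞((s - ξ)b) over the
classes b of one ball modulo another. After the two finite sums are exchanged, orthogonality over
the annihilator of H = L + ball u detects whether l - b lies in H. -/
theorem poisson_aux (D : StirlingData k p) {L : AddSubgroup k} (hL : IsLattice L) {u i : ℤ}
    (hui : u ≤ i) (hu : L ⊓ ball k u = ⊥) (l : k) {s : k} (hs : s ∈ ball k (D.cond - u)) :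
    (D.vol u * Nat.card (k ⧸ (L ⊔ ball k u)) : ℝ) *
        ∑ᶠ x ∈ {x | x - l ∈ L ∧ x ∈ ball k i}, D.e (s * x) =
      D.vol i * ∑ᶠ ξ ∈ {ξ | ξ ∈ D.perp L ∧ ξ ∈ disc s (D.cond - i)}, D.e (l * ξ) := by
  classical
  set H := L ⊔ ball k u with hHdef
  have hH : ball k u ≤ H := le_sup_right
  have : Finite (k ⧸ H) := finite_quotient_sup_ball hL u
  have := Fintype.ofFinite (k ⧸ H)
  have := Finite.of_equiv _ (D.perpEquiv hH).symm
  have := Fintype.ofFinite (D.perp H)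
  let A := (ball k u).addSubgroupOf (ball k i)
  let Q := ball k i ⧸ A
  have : Finite Q := finite_quotient_ball (isOpen_ball u) i
  have := Fintype.ofFinite Q
  have hperp : ∀ ξ, ξ ∈ D.perp H ↔ ξ ∈ D.perp L ∧ ξ ∈ ball k (D.cond - u) := fun ξ ↦ by
    rw [hHdef, perp_sup, perp_ball, AddSubgroup.mem_inf]
  have hq : (((residueCard k : ℝ) ^ (i - u) : ℝ) : ℂ) ≠ 0 :=
    Complex.ofReal_ne_zero.mpr (zpow_residueCard_pos _).ne'
  -- the dual side, as a sum over the annihilator of `H`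
  have h1 : ∑ᶠ ξ ∈ {ξ | ξ ∈ D.perp L ∧ ξ ∈ disc s (D.cond - i)}, D.e (l * ξ) =
      ∑ ξ : D.perp H, if (s - ξ : k) ∈ ball k (D.cond - i) then D.e (ξ * l) else 0 :=
    D.finsum_perp_disc hui l hs
  have h2 : ∀ ξ : D.perp H, (if (s - ξ : k) ∈ ball k (D.cond - i) then D.e (ξ * l) else 0) =
      (((residueCard k : ℝ) ^ (i - u) : ℝ) : ℂ)⁻¹ *
        ∑ b : Q, D.e (s * (b.out : ball k i)) * D.e (ξ * (l - (b.out : ball k i))) := by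
    intro ξ
    have h3 := D.sum_ball_quotient hui (t := s - ξ) (sub_mem hs ((hperp ξ).mp ξ.2).2)
    have h4 : ∀ b : Q, D.e (s * (b.out : ball k i)) * D.e (ξ * (l - (b.out : ball k i))) =
        D.e (ξ * l) * D.e ((s - ξ) * (b.out : ball k i)) := fun b ↦ by
      rw [← e_add, ← e_add]
      congr 1
      ring
    rw [Finset.sum_congr rfl fun b _ ↦ h4 b, ← Finset.mul_sum, h3]
    split_ifs
    · field_simp
    · simp
  have h5 : ∑ ξ : D.perp H, (if (s - ξ : k) ∈ ball k (D.cond - i) then D.e (ξ * l) else 0) =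
      (((residueCard k : ℝ) ^ (i - u) : ℝ) : ℂ)⁻¹ * Nat.card (k ⧸ H) *
        ∑ b : Q, if l - (b.out : ball k i) ∈ H then D.e (s * (b.out : ball k i)) else 0 := by
    rw [Finset.sum_congr rfl fun ξ _ ↦ h2 ξ, ← Finset.mul_sum, Finset.sum_comm, mul_assoc]
    congr 1
    rw [Finset.mul_sum]
    refine Finset.sum_congr rfl fun b _ ↦ ?_
    rw [← Finset.mul_sum, D.sum_perp hH]
    split_ifs <;> ring
  have h6 : (∑ b : Q, if l - (b.out : ball k i) ∈ H then D.e (s * (b.out : ball k i)) else 0) =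
      ∑ᶠ x ∈ {x | x - l ∈ L ∧ x ∈ ball k i}, D.e (s * x) :=
    D.sum_ball_quotient_coset hL hui hu l hs
  rw [h1, h5, h6]
  have hvol : D.vol i = (residueCard k : ℝ) ^ (i - u) * D.vol u := by
    rw [D.vol_eq i, D.vol_eq u, ← mul_assoc, ← zpow_add₀ residueCard_pos.ne']
    congr 2
    ring
  rw [hvol]
  push_cast at hq ⊢
  field_simp

/-- An element orthogonal to both L and the ball is orthogonal to all of k, hence lies in every
ball. -/
theorem exists_perp_inf_ball (D : StirlingData k p) {L : AddSubgroup k} {n : ℤ}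
    (hn : L ⊔ ball k n = ⊤) : D.perp L ⊓ ball k (D.cond - n) = ⊥ := by
  rw [← perp_ball, ← perp_sup, hn, AddSubgroup.eq_bot_iff_forall]
  intro ξ hξ
  refine eq_zero_of_forall_mem_ball (n := 0) fun m _ ↦ ?_
  have h := (D.forall_e_eq_one_iff (x := ξ) (n := D.cond - m)).mp
    fun y _ ↦ hξ y (AddSubgroup.mem_top y)
  simpa using h

theorem finsum_coset_inf_ball_eq_one (D : StirlingData k p) {L : AddSubgroup k} {i : ℤ}
    (hi : L ⊓ ball k i = ⊥) (s : k) :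
    ∑ᶠ x ∈ {x | x - 0 ∈ L ∧ x ∈ ball k i}, D.e (s * x) = 1 := by
  have : {x | x - 0 ∈ L ∧ x ∈ ball k i} = ({0} : Set k) := by
    ext x
    rw [Set.mem_ofPred_eq, sub_zero]
    change x ∈ L ⊓ ball k i ↔ _
    rw [hi]
    rfl
  rw [this, finsum_mem_singleton, mul_zero, e_zero]

/-- Poisson summation with l = 0. The only lattice point on the left is the origin, so the left side
is positive; hence the sum on the right is not empty, and the dual lattice meets the disc about
every s. -/
theorem perp_sup_ball (D : StirlingData k p) {L : AddSubgroup k} (hL : IsLattice L) {i : ℤ}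
    (hi : L ⊓ ball k i = ⊥) : D.perp L ⊔ ball k (D.cond - i) = ⊤ := by
  refine eq_top_iff.mpr fun s _ ↦ ?_
  obtain ⟨n, hn⟩ := exists_mem_ball s
  -- The auxiliary radius is shrunk until s lies in the ball of index cond - u, as `poisson_aux`
  -- demands.
  have hui : min i (D.cond - n) ≤ i := min_le_left _ _
  have hu : L ⊓ ball k (min i (D.cond - n)) = ⊥ :=
    le_bot_iff.mp (hi ▸ inf_le_inf_left L (ball_mono hui))
  have h := D.poisson_aux hL hui hu 0
    (hn (D.cond - min i (D.cond - n)) (by have := min_le_right i (D.cond - n); omega))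
  rw [D.finsum_coset_inf_ball_eq_one hi, mul_one] at h
  have := finite_quotient_sup_ball hL (min i (D.cond - n))
  have hpos : (0 : ℝ) < D.vol (min i (D.cond - n)) *
      Nat.card (k ⧸ (L ⊔ ball k (min i (D.cond - n)))) :=
    mul_pos (D.vol_pos _) (by exact_mod_cast Nat.card_pos)
  rcases Set.eq_empty_or_nonempty {ξ | ξ ∈ D.perp L ∧ ξ ∈ disc s (D.cond - i)} with h0 | ⟨ξ, h1, h2⟩
  · rw [h0, finsum_mem_empty, mul_zero] at h
    exact absurd h (by exact_mod_cast hpos.ne')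
  · have := sub_mem (AddSubgroup.mem_sup_left (T := ball k (D.cond - i)) h1)
      (AddSubgroup.mem_sup_right (S := D.perp L) h2)
    simpa using this

theorem isLattice_perp (D : StirlingData k p) {L : AddSubgroup k} (hL : IsLattice L) :
    IsLattice (D.perp L) := by
  obtain ⟨u, hu⟩ := hL.exists_inf_ball
  obtain ⟨n, hn⟩ := hL.exists_sup_ball
  exact isLattice_of_ball (D.exists_perp_inf_ball (hn n le_rfl)) (D.perp_sup_ball hL (hu u le_rfl))

/-- Poisson summation for a lattice. -/
theorem exists_covol (D : StirlingData k p) {L : AddSubgroup k} (hL : IsLattice L) :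
    ∃ V : ℝ, (∃ (u : ℤ) (m : ℕ), V = D.vol u * (p : ℝ) ^ m) ∧ ∀ (l s : k) (i : ℤ),
      (V : ℂ) * ∑ᶠ x ∈ {x | x - l ∈ L ∧ x ∈ ball k i}, D.e (s * x) =
        D.vol i * ∑ᶠ ξ ∈ {ξ | ξ ∈ D.perp L ∧ ξ ∈ disc s (D.cond - i)}, D.e (l * ξ) := by
  obtain ⟨u, hu⟩ := hL.exists_inf_ball
  have hfin := fun v ↦ finite_quotient_sup_ball hL v
  -- Independence of the auxiliary radius: with l = s = 0 and i = u, both constants equal one and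
  -- the same right-hand side, because only the origin contributes on the left.
  have hind : ∀ v ≤ u, D.vol v * Nat.card (k ⧸ (L ⊔ ball k v)) =
      D.vol u * Nat.card (k ⧸ (L ⊔ ball k u)) := by
    intro v hv
    have h1 := D.poisson_aux hL hv (hu v hv) 0 (zero_mem (ball k (D.cond - v)))
    have h2 := D.poisson_aux hL le_rfl (hu u le_rfl) 0 (zero_mem (ball k (D.cond - u)))
    rw [← h2, D.finsum_coset_inf_ball_eq_one (hu u le_rfl), mul_one, mul_one] at h1
    exact_mod_cast h1
  refine ⟨D.vol u * Nat.card (k ⧸ (L ⊔ ball k u)), ?_, fun l s i ↦ ?_⟩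
  -- The quotient is killed by p, so its order is a power of p; the rationality of the Fourier
  -- coefficients depends on this.
  · have hpg : IsPGroup p (Multiplicative (k ⧸ (L ⊔ ball k u))) := by
      intro g
      refine ⟨1, ?_⟩
      rw [pow_one]
      induction g using Multiplicative.rec with | _ g => ?_
      induction g using QuotientAddGroup.induction_on with | H x => ?_
      have : p • (QuotientAddGroup.mk x : k ⧸ (L ⊔ ball k u)) = 0 := by
        rw [← QuotientAddGroup.mk_nsmul, nsmul_eq_mul, CharP.cast_eq_zero, zero_mul,
          QuotientAddGroup.mk_zero]
      rw [← ofAdd_nsmul, this, ofAdd_zero]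
    have := hfin u
    obtain ⟨m, hm⟩ := IsPGroup.iff_card.mp hpg
    have hm' : Nat.card (k ⧸ (L ⊔ ball k u)) = p ^ m := hm
    exact ⟨u, m, by rw [hm']; push_cast; rfl⟩
  · obtain ⟨n, hn⟩ := exists_mem_ball s
    let v := min (min u i) (D.cond - n)
    have hv1 : v ≤ u := (min_le_left _ _).trans (min_le_left _ _)
    have hv2 : v ≤ i := (min_le_left _ _).trans (min_le_right _ _)
    have hv3 : v ≤ D.cond - n := min_le_right _ _
    rw [← hind v hv1]
    exact D.poisson_aux hL hv2 (hu v hv1) l (hn _ (by omega))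

end StirlingData

/-! ### Generalized functions with a discrete-by-continuous density -/

section Star

theorem finsum_addSubgroup_coset {k : Type*} [Field k] (L : AddSubgroup k) (l : k) (F : k → ℂ) :
    ∑ᶠ x : L, F (l + x) = ∑ᶠ x ∈ {x | x - l ∈ L}, F x := by
  have h1 := finsum_set_coe_eq_finsum_mem (L : Set k) (f := fun x ↦ F (l + x))
  have h2 : {x | x - l ∈ L} = (fun x ↦ l + x) '' (L : Set k) := by
    ext x
    simp only [Set.mem_ofPred_eq, Set.mem_image, SetLike.mem_coe]
    exact ⟨fun h ↦ ⟨x - l, h, by ring⟩, by rintro ⟨y, hy, rfl⟩; simpa using hy⟩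
  rw [h2, finsum_mem_image (add_right_injective l).injOn, ← h1]
  rfl

variable {k : Type*} [Field k] [ValuativeRel k] [TopologicalSpace k] [IsNonarchimedeanLocalField k]
  [MeasurableSpace k] [BorelSpace k]

theorem boxTest_apply (x y : k) (a : kˣ) (z w : k) :
    (boxTest x y a).1 (z, w) = (disc x (logAbs (a : k))).indicator 1 z *
      (disc y (logAbs (a : k))).indicator 1 w := by
  rw [← box_eq_disc, ← box_eq_disc]
  rfl

theorem eventually_normToZero_logAbs_le (n : ℤ) : ∀ᶠ a : kˣ in normToZero k, logAbs (a : k) ≤ n := by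
  rw [normToZero]
  refine Filter.mem_comap.mpr ⟨Set.Iio ((residueCard k : ℝ) ^ (n + 1)),
    Iio_mem_nhds (zpow_residueCard_pos _), fun a (ha : absv (a : k) < _) ↦ ?_⟩
  rw [absv_eq a.ne_zero, zpow_residueCard_lt] at ha
  change logAbs (a : k) ≤ n
  omega

instance normToZero_neBot : (normToZero k).NeBot := by
  rw [normToZero, Filter.comap_neBot_iff]
  intro t ht
  have h1 : Tendsto (fun n : ℕ ↦ (residueCard k : ℝ)⁻¹ ^ n) atTop (𝓝 0) :=
    tendsto_pow_atTop_nhds_zero_of_lt_one (inv_nonneg.mpr residueCard_pos.le)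
      (inv_lt_one_of_one_lt₀ one_lt_residueCard_real)
  obtain ⟨n, hn⟩ := (h1.eventually ht).exists
  obtain ⟨c, hc⟩ := exists_absv_eq_zpow k (-n)
  refine ⟨c, ?_⟩
  rw [hc, zpow_neg, zpow_natCast, ← inv_pow]
  exact hn

theorem HasLowerStar.of_tendsto {Φ : GenFun k} {f : k → k → ℂ}
    (h : ∀ x y, Tendsto (fun a : kˣ ↦ Φ (boxTest x y a) / (absv (a : k) : ℂ)) (normToZero k)
      (𝓝 (f x y))) : HasLowerStar Φ ∧ lowerStar Φ = f := by
  have heq : ∀ x y, lowerStar Φ x y = f x y := fun x y ↦ (h x y).limUnder_eq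
  exact ⟨fun x y ↦ by rw [heq]; exact h x y, funext fun x ↦ funext fun y ↦ heq x y⟩

/-- `Φ` is given by the density `f` with respect to (counting measure) ⊗ (Haar measure), where `f`
is supported on finitely many vertical lines near any given one and is uniformly locally constant
in the second variable. -/
def IsStar (Φ : GenFun k) (f : k → k → ℂ) : Prop :=
  (∀ n, {x | x ∈ ball k n ∧ ∃ y, f x y ≠ 0}.Finite) ∧
  ∃ N : ℤ, ∀ a : kˣ, logAbs (a : k) ≤ N → ∀ x y,
    Φ (boxTest x y a) = (absv (a : k) : ℂ) * ∑ᶠ z ∈ disc x (logAbs (a : k)), f z y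

theorem disc_mono (c : k) {m n : ℤ} (h : m ≤ n) : disc c m ⊆ disc c n := fun _ hx ↦
  mem_disc.mpr (ball_mono h (mem_disc.mp hx))

theorem mem_disc_self (c : k) (n : ℤ) : c ∈ disc c n := by
  rw [mem_disc, sub_self]
  exact zero_mem _

theorem mem_disc_comm {x y : k} {n : ℤ} : x ∈ disc y n ↔ y ∈ disc x n := by
  rw [mem_disc, mem_disc, ← neg_sub y x, neg_mem_iff]

theorem mem_disc_iff_of_mem {x y c : k} {m n : ℤ} (h : m ≤ n) (hxy : x ∈ disc y m) :
    x ∈ disc c n ↔ y ∈ disc c n := by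
  have h1 : x - y ∈ ball k n := ball_mono h (mem_disc.mp hxy)
  rw [mem_disc_comm, disc_congr h1, mem_disc_comm]

theorem disc_zero (n : ℤ) : disc (0 : k) n = ball k n := by
  ext x
  rw [mem_disc, sub_zero, SetLike.mem_coe]

theorem finite_disc_of_finite_ball {P : k → Prop} (h : ∀ n, {x | x ∈ ball k n ∧ P x}.Finite)
    (c : k) (n : ℤ) : {x | x ∈ disc c n ∧ P x}.Finite := by
  obtain ⟨m, hm⟩ := exists_mem_ball c
  refine (h (max m n)).subset fun x hx ↦ ⟨?_, hx.2⟩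
  have h1 : x - c ∈ ball k (max m n) := ball_mono (le_max_right m n) (mem_disc.mp hx.1)
  simpa using add_mem h1 (hm _ (le_max_left m n))

namespace IsStar

variable {Φ Ψ : GenFun k} {f g : k → k → ℂ}

theorem finite_support (h : IsStar Φ f) (c : k) (n : ℤ) (y : k) :
    (disc c n ∩ Function.support fun z ↦ f z y).Finite :=
  (finite_disc_of_finite_ball h.1 c n).subset fun _ hx ↦ ⟨hx.1, y, hx.2⟩

/-- Near x only finitely many vertical lines carry mass at height y. A small box about (x, y)
therefore sees only the line through x, and the quotient is eventually constant. -/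
theorem hasLowerStar_and_eq (h : IsStar Φ f) : HasLowerStar Φ ∧ lowerStar Φ = f := by
  refine HasLowerStar.of_tendsto fun x y ↦ ?_
  obtain ⟨N, hN⟩ := h.2
  have hfin : ((disc x 0 ∩ Function.support fun z ↦ f z y) \ {x}).Finite :=
    (h.finite_support x 0 y).subset Set.sdiff_subset
  have hU : (fun z ↦ x + z) ⁻¹' ((disc x 0 ∩ Function.support fun z ↦ f z y) \ {x})ᶜ ∈
      𝓝 (0 : k) := by
    refine (hfin.isClosed.isOpen_compl.preimage (continuous_const_add x)).mem_nhds ?_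
    simp
  obtain ⟨n, hn⟩ := exists_ball_subset hU
  refine tendsto_nhds_of_eventually_eq ?_
  filter_upwards [eventually_normToZero_logAbs_le (min N (min n 0))] with a ha
  rw [hN a (ha.trans (min_le_left _ _)), mul_div_cancel_left₀ _
    (Complex.ofReal_ne_zero.mpr (absv_pos a).ne')]
  have : ∀ z ∈ disc x (logAbs (a : k)), z ≠ x → f z y = 0 := by
    intro z hz hzx
    by_contra hne
    have h1 := hn (logAbs (a : k)) (ha.trans ((min_le_right _ _).trans (min_le_left _ _)))
      (mem_disc.mp hz)
    simp only [Set.mem_preimage, add_sub_cancel] at h1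
    exact h1 ⟨⟨disc_mono x (ha.trans ((min_le_right _ _).trans (min_le_right _ _))) hz, hne⟩, hzx⟩
  rw [finsum_mem_def, finsum_eq_single _ x fun z hzx ↦ ?_, Set.indicator_of_mem (mem_disc_self x _)]
  by_cases hz : z ∈ disc x (logAbs (a : k))
  · rw [Set.indicator_of_mem hz, this z hz hzx]
  · rw [Set.indicator_of_notMem hz]

theorem hasLowerStar (h : IsStar Φ f) : HasLowerStar Φ := h.hasLowerStar_and_eq.1

theorem lowerStar_eq (h : IsStar Φ f) : lowerStar Φ = f := h.hasLowerStar_and_eq.2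

theorem zero : IsStar (0 : GenFun k) 0 := by
  refine ⟨fun n ↦ by simp, 0, fun a _ x y ↦ ?_⟩
  simp

theorem add (h : IsStar Φ f) (h' : IsStar Ψ g) : IsStar (Φ + Ψ) (f + g) := by
  obtain ⟨N, hN⟩ := h.2
  obtain ⟨M, hM⟩ := h'.2
  refine ⟨fun n ↦ ((h.1 n).union (h'.1 n)).subset ?_, min N M, fun a ha x y ↦ ?_⟩
  · rintro x ⟨hx, y, hy⟩
    by_cases hf : f x y = 0
    · refine Or.inr ⟨hx, y, fun hg ↦ hy ?_⟩
      simp [hf, hg]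
    · exact Or.inl ⟨hx, y, hf⟩
  · rw [LinearMap.add_apply, hN a (ha.trans (min_le_left _ _)), hM a (ha.trans (min_le_right _ _)),
      ← mul_add]
    congr 1
    exact (finsum_mem_add_distrib' (h.finite_support _ _ _) (h'.finite_support _ _ _)).symm

theorem smul (h : IsStar Φ f) (c : ℂ) : IsStar (c • Φ) (c • f) := by
  obtain ⟨N, hN⟩ := h.2
  refine ⟨fun n ↦ (h.1 n).subset ?_, N, fun a ha x y ↦ ?_⟩
  · rintro x ⟨hx, y, hy⟩
    exact ⟨hx, y, fun hf ↦ hy (by simp [hf])⟩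
  · rw [LinearMap.smul_apply, hN a ha, smul_eq_mul, mul_left_comm]
    congr 1
    simp only [Pi.smul_apply, smul_eq_mul]
    rw [mul_finsum_mem]

theorem sum {ι : Type*} (s : Finset ι) {Φ : ι → GenFun k} {f : ι → k → k → ℂ}
    (h : ∀ i ∈ s, IsStar (Φ i) (f i)) : IsStar (∑ i ∈ s, Φ i) (∑ i ∈ s, f i) := by
  classical
  induction s using Finset.induction_on with
  | empty => simpa using zero
  | insert i s hi ih =>
    rw [Finset.sum_insert hi, Finset.sum_insert hi]
    exact (h i (Finset.mem_insert_self i s)).add (ih fun j hj ↦ h j (Finset.mem_insert_of_mem hj))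

end IsStar

/-- A test function is invariant under a small ball and supported in a large one. The set T consists
of representatives of the finite quotient of the two balls. -/
theorem bs_eq_sum_boxTest (φ : BruhatSchwartz (k × k)) :
    ∃ N : ℤ, ∀ a : kˣ, logAbs (a : k) ≤ N → ∃ T : Finset k,
      φ = ∑ s ∈ T, ∑ t ∈ T, φ.1 (s, t) • boxTest s t a := by
  obtain ⟨c, hc0, hc⟩ := bs_invariant₂ φ.2
  obtain ⟨d, hd0, hd⟩ := bs_bounded₂ φ.2
  refine ⟨min (logAbs c) (logAbs d), fun a ha ↦ ?_⟩
  have hac : ∀ u ∈ ball k (logAbs (a : k)), valuation k u ≤ valuation k c := fun u hu ↦ by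
    rw [← absv_le_iff, absv_eq hc0]
    exact ball_mono (ha.trans (min_le_left _ _)) hu
  have hbd : ∀ x y, φ.1 (x, y) ≠ 0 → x ∈ ball k (logAbs d) ∧ y ∈ ball k (logAbs d) := by
    intro x y h
    have h1 := hd x y h
    rw [← absv_le_iff, ← absv_le_iff, absv_eq hd0] at h1
    exact h1
  have had : ball k (logAbs (a : k)) ≤ ball k (logAbs d) := ball_mono (ha.trans (min_le_right _ _))
  classical
  let A := (ball k (logAbs (a : k))).addSubgroupOf (ball k (logAbs d))
  let Q := ball k (logAbs d) ⧸ A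
  have : Finite Q := finite_quotient_ball (isOpen_ball _) _
  have := Fintype.ofFinite Q
  let r : Q → k := fun b ↦ (b.out : ball k (logAbs d))
  have hr : ∀ (x : k) (hx : x ∈ ball k (logAbs d)) (b : Q), x ∈ disc (r b) (logAbs (a : k)) ↔
      b = QuotientAddGroup.mk ⟨x, hx⟩ := by
    intro x hx b
    conv_rhs => rw [← QuotientAddGroup.out_eq' b]
    rw [QuotientAddGroup.eq, mem_disc, ← neg_add_eq_sub]
    rfl
  have hrinj : Function.Injective r := by
    intro b b' h
    rw [← QuotientAddGroup.out_eq' b, ← QuotientAddGroup.out_eq' b', Subtype.ext h]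
  refine ⟨Finset.univ.image r, Subtype.ext (funext fun ⟨x, y⟩ ↦ ?_)⟩
  rw [Finset.sum_image fun _ _ _ _ h ↦ hrinj h]
  simp_rw [Finset.sum_image (f := fun t ↦ φ.1 (_, t) • boxTest _ t a) fun _ _ _ _ h ↦ hrinj h]
  simp only [AddSubmonoidClass.coe_finsetSum, Finset.sum_apply, SetLike.val_smul, Pi.smul_apply,
    boxTest_apply, smul_eq_mul, Set.indicator_apply, Pi.one_apply]
  by_cases hxy : x ∈ ball k (logAbs d) ∧ y ∈ ball k (logAbs d)
  · obtain ⟨hx, hy⟩ := hxy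
    simp only [hr x hx, hr y hy]
    rw [Finset.sum_eq_single (QuotientAddGroup.mk ⟨x, hx⟩) (fun b _ hb ↦ by simp [hb]) (by simp),
      Finset.sum_eq_single (QuotientAddGroup.mk ⟨y, hy⟩) (fun b _ hb ↦ by simp [hb]) (by simp)]
    simp only [if_true, mul_one]
    have hx' := (hr x hx _).mpr rfl
    have hy' := (hr y hy _).mpr rfl
    have := hc (r (QuotientAddGroup.mk ⟨x, hx⟩)) (r (QuotientAddGroup.mk ⟨y, hy⟩)) _ _
      (hac _ hx') (hac _ hy')
    rw [add_sub_cancel, add_sub_cancel] at this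
    rw [this]
  · have h0 : φ.1 (x, y) = 0 := by
      by_contra h
      exact hxy (hbd x y h)
    rw [h0]
    symm
    refine Finset.sum_eq_zero fun b _ ↦ Finset.sum_eq_zero fun b' _ ↦ ?_
    have hmem : ∀ (z : k) (b : Q), z ∈ disc (r b) (logAbs (a : k)) → z ∈ ball k (logAbs d) := by
      intro z b hz
      have := add_mem (had hz) (b.out : ball k (logAbs d)).2
      simpa [r] using this
    by_cases h1 : x ∈ disc (r b) (logAbs (a : k))
    · by_cases h2 : y ∈ disc (r b') (logAbs (a : k))
      · exact absurd ⟨hmem _ _ h1, hmem _ _ h2⟩ hxy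
      · simp [h2]
    · simp [h1]

/-- Small boxes span the test functions, and the density prescribes the values on small boxes.
Identities between generalized functions can thus be checked on densities. -/
theorem IsStar.unique {Φ Ψ : GenFun k} {f : k → k → ℂ} (h : IsStar Φ f) (h' : IsStar Ψ f) :
    Φ = Ψ := by
  obtain ⟨N, hN⟩ := h.2
  obtain ⟨M, hM⟩ := h'.2
  refine LinearMap.ext fun φ ↦ ?_
  obtain ⟨K, hK⟩ := bs_eq_sum_boxTest φ
  obtain ⟨a, ha⟩ := exists_logAbs_eq k (min K (min N M))
  obtain ⟨T, hT⟩ := hK a (ha.le.trans (min_le_left _ _))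
  rw [hT]
  simp only [map_sum, map_smul]
  refine Finset.sum_congr rfl fun s _ ↦ Finset.sum_congr rfl fun t _ ↦ ?_
  rw [hN a (ha.le.trans ((min_le_right _ _).trans (min_le_left _ _))),
    hM a (ha.le.trans ((min_le_right _ _).trans (min_le_right _ _)))]

end Star

/-! ### Primitive rigged virtual lattices -/

namespace StirlingData

variable {k : Type*} [Field k] [ValuativeRel k] [TopologicalSpace k] [IsNonarchimedeanLocalField k]
  {p : ℕ} [Fact p.Prime] [CharP k p] [MeasurableSpace k] [BorelSpace k]

/-- The density of a primitive rigged virtual lattice. -/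
noncomputable def primDensity (L : AddSubgroup k) (l w : k) (R : ℤ) (x y : k) : ℂ :=
  {x | x - l ∈ L}.indicator 1 x * (disc w R).indicator 1 y

theorem bs_finite_lattice (D : StirlingData k p) {L : AddSubgroup k} (hL : IsLattice L) (l w : k)
    (R : ℤ) (φ : BruhatSchwartz (k × k)) :
    (Function.support fun x : L ↦ ∫ y in disc w R, φ.1 (l + x, y) ∂D.μ).Finite := by
  obtain ⟨d, hd0, hd⟩ := bs_bounded₂ φ.2
  have hfin := hL.finite_coset_ball l (logAbs d)
  refine Set.Finite.of_finite_image (hfin.subset ?_)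
    (f := fun x : L ↦ l + (x : k)) (fun x _ y _ h ↦ Subtype.ext (add_left_cancel h))
  rintro _ ⟨x, hx, rfl⟩
  refine ⟨by simp, ?_⟩
  by_contra h
  refine hx ?_
  have : ∀ y, φ.1 (l + x, y) = 0 := fun y ↦ by
    by_contra h'
    have h1 := (hd _ _ h').1
    rw [← absv_le_iff, absv_eq hd0] at h1
    exact h h1
  simp [this]

/-- The primitive rigged virtual lattice attached to `ℓ + L` and `w + r𝒪`. -/
noncomputable def primLattice (D : StirlingData k p) {L : AddSubgroup k} (hL : IsLattice L)
    (l w : k) (r : kˣ) : GenFun k where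
  toFun φ := ((D.μ.real (𝒪[k] : Set k))⁻¹ : ℝ) *
      ∑ᶠ x : L, ∫ y in w +ᵥ (r : k) • (𝒪[k] : Set k), φ.1 (l + x, y) ∂D.μ
  map_add' φ ψ := by
    rw [← mul_add, box_eq_disc, ← finsum_add_distrib (D.bs_finite_lattice hL l w _ φ)
      (D.bs_finite_lattice hL l w _ ψ)]
    congr 1
    refine finsum_congr fun x ↦ ?_
    exact integral_add (bs_integrable (bs_slice φ.2 _)).integrableOn
      (bs_integrable (bs_slice ψ.2 _)).integrableOn
  map_smul' c φ := by
    rw [box_eq_disc, RingHom.id_apply, smul_eq_mul, mul_left_comm]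
    congr 1
    rw [mul_finsum]
    refine finsum_congr fun x ↦ ?_
    exact integral_const_mul _ _

theorem isPrimitive_primLattice (D : StirlingData k p) {L : AddSubgroup k} (hL : IsLattice L)
    (l w : k) (r : kˣ) : D.IsPrimitive (D.primLattice hL l w r) :=
  ⟨L, l, w, r, hL.discrete, hL.cocompact, fun _ ↦ rfl⟩

theorem IsPrimitive.exists_eq {D : StirlingData k p} {Φ : GenFun k} (h : D.IsPrimitive Φ) :
    ∃ (L : AddSubgroup k) (hL : IsLattice L) (l w : k) (r : kˣ), Φ = D.primLattice hL l w r := by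
  obtain ⟨L, l, w, r, h1, h2, h3⟩ := h
  exact ⟨L, ⟨h1, h2⟩, l, w, r, LinearMap.ext h3⟩

theorem primLattice_apply (D : StirlingData k p) {L : AddSubgroup k} (hL : IsLattice L)
    (l w : k) (r : kˣ) (φ : BruhatSchwartz (k × k)) :
    D.primLattice hL l w r φ = (D.vol 0 : ℂ)⁻¹ *
      ∑ᶠ x ∈ {x | x - l ∈ L}, ∫ y in disc w (logAbs (r : k)), φ.1 (x, y) ∂D.μ := by
  have := finsum_addSubgroup_coset L l (fun x ↦ ∫ y in disc w (logAbs (r : k)), φ.1 (x, y) ∂D.μ)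
  rw [← this, ← box_eq_disc, ← Complex.ofReal_inv, ← μ_real_integers]
  rfl

theorem absv_eq_vol_div (D : StirlingData k p) (a : kˣ) :
    absv (a : k) = (D.vol 0)⁻¹ * D.vol (logAbs (a : k)) := by
  have := (D.vol_pos 0).ne'
  rw [absv_eq a.ne_zero, D.vol_eq (logAbs (a : k))]
  field_simp

theorem finite_primDensity {L : AddSubgroup k} (hL : IsLattice L) (l w : k) (R n : ℤ) :
    {x | x ∈ ball k n ∧ ∃ y, primDensity L l w R x y ≠ 0}.Finite := by
  refine (hL.finite_coset_ball l n).subset ?_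
  rintro x ⟨hx, y, hy⟩
  rw [primDensity] at hy
  have h := Set.mem_of_indicator_ne_zero (left_ne_zero_of_mul hy)
  exact ⟨h, hx⟩

/-- A box of side at most ‖r‖ has its vertical side either inside w + r𝒪 or disjoint from it, so
integrating in y gives the volume of the box side times an indicator. -/
theorem isStar_primLattice (D : StirlingData k p) {L : AddSubgroup k} (hL : IsLattice L)
    (l w : k) (r : kˣ) :
    IsStar (D.primLattice hL l w r) (primDensity L l w (logAbs (r : k))) := by
  classical
  refine ⟨finite_primDensity hL l w _, logAbs (r : k), fun a ha s t ↦ ?_⟩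
  have h1 : ∀ x, ∫ y in disc w (logAbs (r : k)), (boxTest s t a).1 (x, y) ∂D.μ =
      D.vol (logAbs (a : k)) * ((disc s (logAbs (a : k))).indicator 1 x *
        (disc w (logAbs (r : k))).indicator 1 t) := by
    intro x
    simp_rw [boxTest_apply]
    rw [integral_const_mul, setIntegral_indicator (isOpen_disc _ _).measurableSet]
    simp only [Pi.one_apply]
    rw [setIntegral_const]
    by_cases ht : t ∈ disc w (logAbs (r : k))
    · have : disc w (logAbs (r : k)) ∩ disc t (logAbs (a : k)) = disc t (logAbs (a : k)) := by
        exact Set.inter_eq_right.mpr fun y hy ↦ (mem_disc_iff_of_mem ha hy).mpr ht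
      rw [this, μ_real_disc, Set.indicator_of_mem ht]
      simp [mul_comm]
    · have : disc w (logAbs (r : k)) ∩ disc t (logAbs (a : k)) = ∅ := by
        exact Set.disjoint_iff_inter_eq_empty.mp (Set.disjoint_left.mpr fun y hy hy' ↦
          ht ((mem_disc_iff_of_mem ha hy').mp hy))
      rw [this, Set.indicator_of_notMem ht]
      simp
  rw [primLattice_apply, absv_eq_vol_div D a]
  simp_rw [h1]
  rw [finsum_mem_def, finsum_mem_def]
  push_cast
  rw [mul_assoc]
  congr 1
  rw [mul_finsum]
  refine finsum_congr fun x ↦ ?_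
  simp only [primDensity, Set.indicator_apply, Pi.one_apply]
  split_ifs <;> simp

end StirlingData

/-! ### Fourier transforms of primitive rigged virtual lattices -/

namespace StirlingData

variable {k : Type*} [Field k] [ValuativeRel k] [TopologicalSpace k] [IsNonarchimedeanLocalField k]
  {p : ℕ} [Fact p.Prime] [CharP k p] [MeasurableSpace k] [BorelSpace k]

/-- The kernel is multiplicative, so the double integral factors into two instances of
`setIntegral_disc_e`. -/
theorem fourierS_boxTest (D : StirlingData k p) (s t : k) (a : kˣ) (ξ η : k) :
    (D.fourierS (boxTest s t a)).1 (ξ, η) = (D.vol (logAbs (a : k)) : ℂ) ^ 2 *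
      ((ball k (D.cond - logAbs (a : k)) : Set k).indicator (fun ξ ↦ D.e (ξ * s)) ξ *
       (ball k (D.cond - logAbs (a : k)) : Set k).indicator (fun η ↦ D.e (-(η * t))) η) := by
  classical
  rw [fourierS_apply]
  set n := logAbs (a : k)
  have h1 : ∀ x y, (boxTest s t a).1 (x, y) * D.e (x * ξ - y * η) =
      (disc s n).indicator (fun x ↦ D.e (ξ * x)) x *
        (disc t n).indicator (fun y ↦ D.e (-η * y)) y := by
    intro x y
    rw [boxTest_apply, show x * ξ - y * η = ξ * x + -η * y by ring, e_add]
    simp only [Set.indicator_apply, Pi.one_apply]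
    split_ifs <;> simp
  simp_rw [h1]
  simp_rw [integral_const_mul]
  rw [integral_mul_const, integral_indicator (isOpen_disc s n).measurableSet,
    integral_indicator (isOpen_disc t n).measurableSet, setIntegral_disc_e, setIntegral_disc_e]
  simp only [Set.indicator_apply, SetLike.mem_coe, neg_mem_iff, neg_mul]
  split_ifs <;> ring

/-- The covolume of a lattice, normalized as in Poisson summation. -/
noncomputable def covol (D : StirlingData k p) {L : AddSubgroup k} (hL : IsLattice L) : ℝ :=
  (D.exists_covol hL).choose

theorem covol_eq (D : StirlingData k p) {L : AddSubgroup k} (hL : IsLattice L) :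
    ∃ (u : ℤ) (m : ℕ), D.covol hL = D.vol u * (p : ℝ) ^ m :=
  (D.exists_covol hL).choose_spec.1

theorem covol_pos (D : StirlingData k p) {L : AddSubgroup k} (hL : IsLattice L) :
    0 < D.covol hL := by
  obtain ⟨u, m, h⟩ := D.covol_eq hL
  rw [h]
  have := (Fact.out : p.Prime).pos
  have := D.vol_pos u
  positivity

theorem poisson (D : StirlingData k p) {L : AddSubgroup k} (hL : IsLattice L) (l s : k) (i : ℤ) :
    (D.covol hL : ℂ) * ∑ᶠ x ∈ {x | x - l ∈ L ∧ x ∈ ball k i}, D.e (s * x) =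
      D.vol i * ∑ᶠ ξ ∈ {ξ | ξ ∈ D.perp L ∧ ξ ∈ disc s (D.cond - i)}, D.e (l * ξ) :=
  (D.exists_covol hL).choose_spec.2 l s i

/-- Self-duality of μ on balls: a ball and its annihilator have reciprocal volumes. This cancels the
constants in the transform of a primitive rigged virtual lattice. -/
theorem vol_mul_vol (D : StirlingData k p) (n : ℤ) : D.vol n * D.vol (D.cond - n) = 1 := by
  rw [D.vol_eq n, D.vol_eq (D.cond - n), ← D.vol_normalized]
  have : (residueCard k : ℝ) ^ D.cond = residueCard k ^ n * residueCard k ^ (D.cond - n) := by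
    rw [← zpow_add₀ residueCard_pos.ne']
    congr 1
    ring
  rw [this]
  ring

/-- The density of the Fourier transform of a primitive rigged virtual lattice. -/
noncomputable def dualDensity (D : StirlingData k p) {L : AddSubgroup k} (hL : IsLattice L)
    (l w : k) (R : ℤ) (s t : k) : ℂ :=
  ((D.vol R / D.covol hL : ℝ) : ℂ) * ((D.perp L : Set k).indicator (fun s ↦ D.e (l * s)) s *
    (ball k (D.cond - R) : Set k).indicator (fun t ↦ D.e (-(w * t))) t)

theorem finite_dualDensity (D : StirlingData k p) {L : AddSubgroup k} (hL : IsLattice L)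
    (l w : k) (R n : ℤ) : {x | x ∈ ball k n ∧ ∃ y, D.dualDensity hL l w R x y ≠ 0}.Finite := by
  refine ((D.isLattice_perp hL).finite_inf_ball n).subset ?_
  rintro x ⟨hx, y, hy⟩
  rw [dualDensity] at hy
  have h := Set.mem_of_indicator_ne_zero (left_ne_zero_of_mul (right_ne_zero_of_mul hy))
  exact ⟨h, hx⟩

/-- The transform of a small box is a character on a large dual box containing w + r𝒪 in its second
side, so the y-integral runs over the whole disc. Poisson summation converts the remaining sum over
l + L into a sum over the dual lattice near s. -/
theorem isStar_𝒢_primLattice (D : StirlingData k p) {L : AddSubgroup k} (hL : IsLattice L)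
    (l w : k) (r : kˣ) :
    IsStar (D.𝒢 (D.primLattice hL l w r)) (D.dualDensity hL l w (logAbs (r : k))) := by
  classical
  obtain ⟨m, hm⟩ := exists_mem_ball w
  set R := logAbs (r : k)
  -- With this bound the dual ball of index cond - n contains both w and the ball of index R, hence
  -- the whole disc w + r𝒪.
  refine ⟨D.finite_dualDensity hL l w R, D.cond - max m R, fun a ha s t ↦ ?_⟩
  set n := logAbs (a : k) with hn
  have hsub : disc w R ⊆ ball k (D.cond - n) := fun y hy ↦ by
    have h1 : y - w ∈ ball k (D.cond - n) :=
      ball_mono (by have := le_max_right m R; omega) (mem_disc.mp hy)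
    have h2 := hm (D.cond - n) (by have := le_max_left m R; omega)
    simpa using add_mem h1 h2
  have h1 : ∀ x, ∫ y in disc w R, (D.fourierS (boxTest s t a)).1 (x, y) ∂D.μ =
      (D.vol n : ℂ) ^ 2 * (D.vol R * (ball k (D.cond - R) : Set k).indicator
        (fun t ↦ D.e (-(w * t))) t) *
        (ball k (D.cond - n) : Set k).indicator (fun ξ ↦ D.e (ξ * s)) x := by
    intro x
    simp_rw [fourierS_boxTest, ← hn]
    rw [integral_const_mul, integral_const_mul]
    have h2 : ∫ y in disc w R, (ball k (D.cond - n) : Set k).indicator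
        (fun η ↦ D.e (-(η * t))) y ∂D.μ = ∫ y in disc w R, D.e (-t * y) ∂D.μ := by
      refine setIntegral_congr_fun (isOpen_disc w R).measurableSet fun y hy ↦ ?_
      simp only [Set.indicator_of_mem (hsub hy)]
      congr 1
      ring
    rw [h2, setIntegral_disc_e]
    simp only [Set.indicator_apply, SetLike.mem_coe, neg_mem_iff]
    split_ifs
    · rw [show -t * w = -(w * t) by ring]
      ring
    · simp
    · simp
    · simp
  change D.primLattice hL l w r (D.fourierS (boxTest s t a)) = _
  rw [primLattice_apply]
  rw [finsum_mem_congr rfl fun x _ ↦ h1 x, ← mul_finsum_mem]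
  have h3 : ∑ᶠ x ∈ {x | x - l ∈ L}, (ball k (D.cond - n) : Set k).indicator
      (fun ξ ↦ D.e (ξ * s)) x =
      ∑ᶠ x ∈ {x | x - l ∈ L ∧ x ∈ ball k (D.cond - n)}, D.e (s * x) := by
    rw [finsum_mem_def, finsum_mem_def]
    refine finsum_congr fun x ↦ ?_
    simp only [Set.indicator_apply, Set.mem_ofPred_eq, SetLike.mem_coe, mul_comm s, ite_and]
  have h4 : ∑ᶠ z ∈ disc s n, D.dualDensity hL l w R z t =
      ((D.vol R / D.covol hL : ℝ) : ℂ) * ((ball k (D.cond - R) : Set k).indicator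
        (fun t ↦ D.e (-(w * t))) t *
        ∑ᶠ ξ ∈ {ξ | ξ ∈ D.perp L ∧ ξ ∈ disc s n}, D.e (l * ξ)) := by
    rw [finsum_mem_def, finsum_mem_def, mul_finsum, mul_finsum]
    refine finsum_congr fun x ↦ ?_
    simp only [dualDensity, Set.indicator_apply, Set.mem_ofPred_eq, SetLike.mem_coe]
    by_cases h5 : x ∈ disc s n <;> by_cases h6 : x ∈ D.perp L <;> simp [h5, h6, mul_comm]
  have h7 := D.poisson hL l s (D.cond - n)
  rw [sub_sub_cancel] at h7
  rw [h3, h4, D.absv_eq_vol_div a, ← hn]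
  have hV : (D.covol hL : ℂ) ≠ 0 := Complex.ofReal_ne_zero.mpr (D.covol_pos hL).ne'
  have hv0 : (D.vol 0 : ℂ) ≠ 0 := Complex.ofReal_ne_zero.mpr (D.vol_pos 0).ne'
  have h8 : (D.vol n : ℂ) * D.vol (D.cond - n) = 1 := by exact_mod_cast D.vol_mul_vol n
  have h9 : ∑ᶠ x ∈ {x | x - l ∈ L ∧ x ∈ ball k (D.cond - n)}, D.e (s * x) =
      (D.covol hL : ℂ)⁻¹ * (D.vol (D.cond - n) *
        ∑ᶠ ξ ∈ {ξ | ξ ∈ D.perp L ∧ ξ ∈ disc s n}, D.e (l * ξ)) := by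
    rw [← h7]
    field_simp
  rw [h9]
  push_cast
  linear_combination ((D.vol 0 : ℂ)⁻¹ * (D.vol n) * (D.vol R) * (D.covol hL : ℂ)⁻¹ *
    (ball k (D.cond - R) : Set k).indicator (fun t ↦ D.e (-(w * t))) t *
    ∑ᶠ ξ ∈ {ξ | ξ ∈ D.perp L ∧ ξ ∈ disc s n}, D.e (l * ξ)) * h8

end StirlingData

/-! ### Densities invariant under a lattice and a ball -/

section Combination

variable {k : Type*} [Field k] [ValuativeRel k] [TopologicalSpace k] [IsNonarchimedeanLocalField k]
  {p : ℕ} [Fact p.Prime] [CharP k p] [MeasurableSpace k] [BorelSpace k]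

/-- Modulo L every point of M can be moved into a fixed ball, which contains finitely many points of
M. -/
theorem IsLattice.finite_image_mk {L M : AddSubgroup k} (hL : IsLattice L) (hM : IsLattice M)
    (hLM : L ≤ M) : ((QuotientAddGroup.mk : k → k ⧸ L) '' (M : Set k)).Finite := by
  obtain ⟨n, hn⟩ := hL.exists_sup_ball
  refine ((hM.finite_inf_ball n).image (QuotientAddGroup.mk : k → k ⧸ L)).subset ?_
  rintro _ ⟨x, hx, rfl⟩
  have h1 : x ∈ L ⊔ ball k n := hn n le_rfl ▸ AddSubgroup.mem_top x
  obtain ⟨l, hl, b, hb, rfl⟩ := AddSubgroup.mem_sup.mp h1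
  refine ⟨b, ⟨?_, hb⟩, ?_⟩
  · have := sub_mem hx (hLM hl)
    rwa [add_sub_cancel_left] at this
  · rw [QuotientAddGroup.eq]
    simpa using hl

theorem finite_image_mk_ball (m n : ℤ) :
    ((QuotientAddGroup.mk : k → k ⧸ ball k m) '' (ball k n : Set k)).Finite := by
  have := finite_quotient_ball (isOpen_ball (k := k) m) n
  refine (Set.finite_range fun b : ball k n ⧸ (ball k m).addSubgroupOf (ball k n) ↦
    (QuotientAddGroup.mk (b.out : k) : k ⧸ ball k m)).subset ?_
  rintro _ ⟨x, hx, rfl⟩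
  let b : ball k n ⧸ (ball k m).addSubgroupOf (ball k n) :=
    QuotientAddGroup.mk (⟨x, hx⟩ : ball k n)
  refine ⟨b, ?_⟩
  rw [QuotientAddGroup.eq]
  have := QuotientAddGroup.out_eq' b
  rw [QuotientAddGroup.eq] at this
  exact this

/-- A density invariant under `L × r𝒪` and supported on finitely many cosets belongs to a linear
combination of primitive rigged virtual lattices with coefficients among the values of the
density. -/
theorem StirlingData.exists_isStar_sum_primLattice (D : StirlingData k p) {L M : AddSubgroup k}
    (hL : IsLattice L) (hM : IsLattice M) (hLM : L ≤ M) (r : kˣ) (n : ℤ) {h : k → k → ℂ}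
    (hx : ∀ x y, ∀ l ∈ L, h (x + l) y = h x y)
    (hy : ∀ x y, ∀ b ∈ ball k (logAbs (r : k)), h x (y + b) = h x y)
    (hsupp : ∀ x y, h x y ≠ 0 → x ∈ M ∧ y ∈ ball k n) :
    ∃ T : Finset (k × k),
      IsStar (∑ z ∈ T, h z.1 z.2 • D.primLattice hL z.1 z.2 r) h := by
  classical
  set R := logAbs (r : k)
  let T₁ := (hL.finite_image_mk hM hLM).toFinset
  let T₂ := (finite_image_mk_ball (k := k) R n).toFinset
  let T := T₁.image Quotient.out ×ˢ T₂.image Quotient.out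
  refine ⟨T, ?_⟩
  have hsum := IsStar.sum T fun z _ ↦ (D.isStar_primLattice hL z.1 z.2 r).smul (h z.1 z.2)
  convert hsum using 1
  funext x y
  rw [Finset.sum_apply, Finset.sum_apply]
  -- The only index that can contribute at (x, y): the chosen representatives of the two classes. If
  -- it is absent from T, the density vanishes at (x, y) by `hsupp`.
  let z₀ : k × k := ((QuotientAddGroup.mk x : k ⧸ L).out, (QuotientAddGroup.mk y : k ⧸ ball k R).out)
  have hx₀ : x - z₀.1 ∈ L := by
    have := QuotientAddGroup.out_eq' (QuotientAddGroup.mk x : k ⧸ L)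
    rwa [QuotientAddGroup.eq, neg_add_eq_sub] at this
  have hy₀ : y - z₀.2 ∈ ball k R := by
    have := QuotientAddGroup.out_eq' (QuotientAddGroup.mk y : k ⧸ ball k R)
    rwa [QuotientAddGroup.eq, neg_add_eq_sub] at this
  have hval : h z₀.1 z₀.2 = h x y := by
    have h1 := hx z₀.1 z₀.2 _ hx₀
    rw [add_sub_cancel] at h1
    have h2 := hy x z₀.2 _ hy₀
    rw [add_sub_cancel] at h2
    rw [← h1, h2]
  have hterm : ∀ z ∈ T, (h z.1 z.2 • StirlingData.primDensity L z.1 z.2 R) x y =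
      if z = z₀ then h x y else 0 := by
    rintro ⟨_, _⟩ hz
    obtain ⟨h1, h2⟩ := Finset.mem_product.mp hz
    obtain ⟨q₁, -, rfl⟩ := Finset.mem_image.mp h1
    obtain ⟨q₂, -, rfl⟩ := Finset.mem_image.mp h2
    have e1 : x - q₁.out ∈ L ↔ q₁ = QuotientAddGroup.mk x := by
      conv_rhs => rw [← QuotientAddGroup.out_eq' q₁]
      rw [QuotientAddGroup.eq, neg_add_eq_sub]
    have e2 : y ∈ disc (q₂.out) R ↔ q₂ = QuotientAddGroup.mk y := by
      conv_rhs => rw [← QuotientAddGroup.out_eq' q₂]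
      rw [QuotientAddGroup.eq, neg_add_eq_sub, mem_disc]
    by_cases hz₀ : (q₁.out, q₂.out) = z₀
    · rw [if_pos hz₀]
      have h3 : q₁.out = z₀.1 := congrArg Prod.fst hz₀
      have h4 : q₂.out = z₀.2 := congrArg Prod.snd hz₀
      have h5 : y ∈ disc z₀.2 R := hy₀
      simp only [h3, h4, Pi.smul_apply, StirlingData.primDensity, smul_eq_mul, hval]
      rw [Set.indicator_of_mem (show x ∈ {x | x - z₀.1 ∈ L} from hx₀), Set.indicator_of_mem h5]
      simp
    · rw [if_neg hz₀]
      have h3 : ¬ (x - q₁.out ∈ L ∧ y ∈ disc q₂.out R) := by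
        rw [e1, e2]
        rintro ⟨rfl, rfl⟩
        exact hz₀ rfl
      simp only [Pi.smul_apply, StirlingData.primDensity, smul_eq_mul, Set.indicator_apply,
        Set.mem_ofPred_eq, Pi.one_apply]
      by_cases h4 : x - q₁.out ∈ L
      · rw [if_neg (show ¬ y ∈ disc q₂.out R from fun h5 ↦ h3 ⟨h4, h5⟩)]
        simp
      · simp [h4]
  rw [Finset.sum_congr rfl hterm, Finset.sum_ite_eq']
  split_ifs with hT
  · rfl
  · by_contra hne
    obtain ⟨h1, h2⟩ := hsupp x y hne
    refine hT (Finset.mem_product.mpr ⟨?_, ?_⟩)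
    · exact Finset.mem_image_of_mem _ ((Set.Finite.mem_toFinset _).mpr ⟨x, h1, rfl⟩)
    · exact Finset.mem_image_of_mem _ ((Set.Finite.mem_toFinset _).mpr ⟨y, h2, rfl⟩)

theorem exists_inf_ball_of_finite {H : AddSubgroup k} {n : ℤ}
    (h : (H ⊓ ball k n : Set k).Finite) : ∃ u, H ⊓ ball k u = ⊥ := by
  have hfin : ((H ⊓ ball k n : Set k) \ {0}).Finite := h.subset Set.sdiff_subset
  obtain ⟨u, hu⟩ := exists_ball_subset (hfin.isClosed.isOpen_compl.mem_nhds (by simp))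
  refine ⟨min u n, (AddSubgroup.eq_bot_iff_forall _).mpr fun x hx ↦ ?_⟩
  by_contra hne
  exact hu _ (min_le_left u n) hx.2 ⟨⟨hx.1, ball_mono (min_le_right u n) hx.2⟩, hne⟩

/-- In characteristic p the enlarged group is a union of the p cosets j l + L with 0 ≤ j < p, so a
ball still contains finitely many of its points. On the annihilator of the enlarged lattice the
character 𝐞(l·) is trivial. -/
theorem IsLattice.sup_zmultiples (p : ℕ) [Fact p.Prime] [CharP k p] {L : AddSubgroup k}
    (hL : IsLattice L) (l : k) : IsLattice (L ⊔ AddSubgroup.zmultiples l) := by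
  obtain ⟨n, hn⟩ := hL.exists_sup_ball
  have hsup : L ⊔ AddSubgroup.zmultiples l ⊔ ball k n = ⊤ :=
    top_le_iff.mp ((hn n le_rfl).ge.trans (sup_le_sup_right le_sup_left _))
  have hfin : ((L ⊔ AddSubgroup.zmultiples l : AddSubgroup k) ⊓ ball k n : Set k).Finite := by
    refine (Set.finite_iUnion fun j : Fin p ↦ hL.finite_coset_ball ((j : ℕ) * l) n).subset ?_
    rintro x ⟨hx, hxn⟩
    obtain ⟨y, hy, z, hz, rfl⟩ := AddSubgroup.mem_sup.mp hx
    obtain ⟨m, rfl⟩ := AddSubgroup.mem_zmultiples_iff.mp hz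
    have hp := (Fact.out : p.Prime).pos
    have hmod : m • l = ((m % p).toNat : ℕ) * l := by
      rw [zsmul_eq_mul]
      congr 1
      have h1 : (((m % p).toNat : ℕ) : ℤ) = m % p :=
        Int.toNat_of_nonneg (Int.emod_nonneg _ (by omega))
      have h2 : (((m % p).toNat : ℕ) : k) = ((m % p : ℤ) : k) := by
        rw [← h1]
        push_cast
        rfl
      rw [h2]
      exact CharP.intCast_eq_intCast_mod k p
    refine Set.mem_iUnion.mpr ⟨⟨(m % p).toNat, ?_⟩, ?_, hxn⟩
    · have := Int.emod_lt_of_pos m (show (0 : ℤ) < p by omega)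
      omega
    · rw [← hmod, add_sub_cancel_right]
      exact hy
  obtain ⟨u, hu⟩ := exists_inf_ball_of_finite hfin
  exact isLattice_of_ball hu hsup

end Combination

/-! ### Stability of rigged virtual lattices under Fourier transforms -/

section Scaling

variable {k : Type*} [Field k] [ValuativeRel k] [TopologicalSpace k] [IsNonarchimedeanLocalField k]
  [MeasurableSpace k] [BorelSpace k]

theorem IsLattice.comap_mulLeft {L : AddSubgroup k} (hL : IsLattice L) {c : k} (hc : c ≠ 0) :
    IsLattice (L.comap (AddMonoidHom.mulLeft c)) := by
  obtain ⟨u, hu⟩ := hL.exists_inf_ball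
  obtain ⟨n, hn⟩ := hL.exists_sup_ball
  refine isLattice_of_ball (u := u - logAbs c) (n := n - logAbs c)
    ((AddSubgroup.eq_bot_iff_forall _).mpr fun x hx ↦ ?_)
    ((AddSubgroup.eq_top_iff' _).mpr fun x ↦ ?_)
  · have h1 : c * x ∈ L ⊓ ball k u := ⟨hx.1, (mem_ball_mul_iff hc).mpr hx.2⟩
    rw [hu u le_rfl, AddSubgroup.mem_bot] at h1
    exact (mul_eq_zero.mp h1).resolve_left hc
  · have h1 : c * x ∈ L ⊔ ball k n := hn n le_rfl ▸ AddSubgroup.mem_top _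
    obtain ⟨y, hy, b, hb, hyb⟩ := AddSubgroup.mem_sup.mp h1
    refine AddSubgroup.mem_sup.mpr ⟨c⁻¹ * y, ?_, c⁻¹ * b, ?_, ?_⟩
    · change c * (c⁻¹ * y) ∈ L
      rwa [mul_inv_cancel_left₀ hc]
    · rw [← mem_ball_mul_iff hc, mul_inv_cancel_left₀ hc]
      exact hb
    · rw [← mul_add, hyb, inv_mul_cancel_left₀ hc]

theorem mem_ball_mul_iff_of_absv_eq_one {c x : k} {n : ℤ} (hc : absv c = 1) :
    c * x ∈ ball k n ↔ x ∈ ball k n := by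
  rw [mem_ball, mem_ball, absv_mul, hc, one_mul]

theorem finsum_disc_mul {c : k} (hc : absv c = 1) (s : k) (n : ℤ) (f : k → ℂ) :
    ∑ᶠ z ∈ disc (c * s) n, f z = ∑ᶠ z ∈ disc s n, f (c * z) := by
  have hc0 : c ≠ 0 := by
    rintro rfl
    rw [absv_zero] at hc
    exact zero_ne_one hc
  symm
  refine finsum_mem_eq_of_bijOn (fun z ↦ c * z) ⟨fun z hz ↦ ?_, fun z _ z' _ h ↦ ?_, fun z hz ↦ ?_⟩
    fun _ _ ↦ rfl
  · rw [mem_disc, ← mul_sub, mem_ball_mul_iff_of_absv_eq_one hc]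
    exact hz
  · exact mul_left_cancel₀ hc0 h
  · refine ⟨c⁻¹ * z, ?_, mul_inv_cancel_left₀ hc0 z⟩
    rw [mem_disc, ← mem_ball_mul_iff_of_absv_eq_one hc, mul_sub, mul_inv_cancel_left₀ hc0]
    exact hz

end Scaling

namespace StirlingData

variable {k : Type*} [Field k] [ValuativeRel k] [TopologicalSpace k] [IsNonarchimedeanLocalField k]
  {p : ℕ} [Fact p.Prime] [CharP k p]

/-- The inclusion of the subfield `𝔽` in `k`. -/
def incl (D : StirlingData k p) : D.F →+* k := (constField k p).subtype.comp D.F.subtype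

theorem incl_ne_zero (D : StirlingData k p) {c : D.F} (hc : c ≠ 0) : D.incl c ≠ 0 :=
  (map_ne_zero D.incl).mpr hc

instance (D : StirlingData k p) : CharP D.F p := RingHom.charP D.incl D.incl.injective p

instance (D : StirlingData k p) : Finite D.F := Subtype.finite

theorem e_incl_mul (D : StirlingData k p) (c : D.F) (z : k) :
    D.e (D.incl c * z) = D.lam (c * Algebra.trace D.F (constField k p) (D.ω.1 z)) := by
  rw [e, res_mulDiff]
  change D.lam (Algebra.trace D.F (constField k p) (D.ω.1 (((c : constField k p) : k) * z))) = _
  rw [chevalleyDiff_map_const, ← smul_eq_mul c, ← map_smul]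
  rfl

/-- Fourier inversion on 𝔽: with T the trace of ω(z), the sums of λ(cT) and of λ(c(1 + T)) over c
detect T = 0 and T = -1, and their difference is the multiple |𝔽| of λ₀(-T). The weight vanishes at
c = 0, so only invertible dilations matter. -/
theorem e₀_neg_eq (D : StirlingData k p) [Fintype D.F] (z : k) :
    D.e₀ (-z) = (Fintype.card D.F : ℂ)⁻¹ * ∑ c : D.F, (1 - D.lam c) * D.e (D.incl c * z) := by
  classical
  set T := Algebra.trace D.F (constField k p) (D.ω.1 z) with hT
  have hprim : D.lam.IsPrimitive := by
    refine AddChar.IsPrimitive.of_ne_one ?_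
    exact D.lam_ne_one
  have h1 : ∑ c : D.F, (1 - D.lam c) * D.e (D.incl c * z) =
      (∑ c : D.F, D.lam (c * T)) - ∑ c : D.F, D.lam (c * (1 + T)) := by
    rw [← Finset.sum_sub_distrib]
    refine Finset.sum_congr rfl fun c _ ↦ ?_
    rw [e_incl_mul, sub_mul, one_mul, ← AddChar.map_add_eq_mul, mul_add, mul_one]
  have hcard : (Fintype.card D.F : ℂ) ≠ 0 := by
    exact_mod_cast Fintype.card_ne_zero
  rw [h1, AddChar.sum_mulShift T hprim, AddChar.sum_mulShift (1 + T) hprim, e₀, res_mulDiff,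
    map_neg, map_neg, ← hT, lamZero]
  have h2 : -T = 1 ↔ 1 + T = 0 := by
    rw [neg_eq_iff_eq_neg, ← add_eq_zero_iff_eq_neg, add_comm]
  simp only [neg_eq_zero, h2]
  split_ifs with h3 h4
  · rw [h3, add_zero] at h4
    exact absurd h4 one_ne_zero
  · push_cast
    field_simp
    simp
  · push_cast
    field_simp
    simp
  · simp

variable [MeasurableSpace k] [BorelSpace k]

theorem absv_incl (D : StirlingData k p) {c : D.F} (hc : c ≠ 0) : absv (D.incl c) = 1 := by
  have h : valuation k (D.incl c) = 1 :=
    constField_val_eq_one (p := p) (c : constField k p).2 (D.incl_ne_zero hc)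
  have := absv_mul_unit (x := (1 : k)) h
  rwa [one_mul, absv_one] at this

/-- For c ∈ 𝔽ˣ one has ‖c‖ = 1, so dilating the transform of a box by c gives the transform of the
box of the same size about the dilated centre; the kernel identity `e₀_neg_eq` then averages over c.
-/
theorem fourierS₀_boxTest (D : StirlingData k p) [Fintype D.F] (s t : k) (a : kˣ) :
    D.fourierS₀ (boxTest s t a) = (Fintype.card D.F : ℂ)⁻¹ •
      ∑ c : D.F, (1 - D.lam c) • D.fourierS (boxTest (D.incl c * s) (D.incl c * t) a) := by
  classical
  refine Subtype.ext (funext fun z ↦ ?_)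
  obtain ⟨ξ, η⟩ := z
  have h0 : ∀ c : D.F, (1 - D.lam c) * (D.fourierS (boxTest s t a)).1
      (D.incl c * ξ, D.incl c * η) = (1 - D.lam c) *
      (D.fourierS (boxTest (D.incl c * s) (D.incl c * t) a)).1 (ξ, η) := by
    intro c
    rcases eq_or_ne c 0 with rfl | hc
    · simp
    · have h1 := D.absv_incl hc
      rw [fourierS_boxTest, fourierS_boxTest]
      simp only [Set.indicator_apply, SetLike.mem_coe, mem_ball_mul_iff_of_absv_eq_one h1]
      rw [show D.incl c * ξ * s = ξ * (D.incl c * s) by ring,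
        show D.incl c * η * t = η * (D.incl c * t) by ring]
  have h2 : (D.fourierS₀ (boxTest s t a)).1 (ξ, η) =
      ∫ x, ∫ y, (boxTest s t a).1 (x, y) * D.e₀ (-(x * ξ - y * η)) ∂D.μ ∂D.μ := rfl
  simp only [Submodule.coe_smul, Submodule.coe_sum, Pi.smul_apply, Finset.sum_apply, smul_eq_mul]
  rw [h2]
  have h3 : ∀ x y : k, (boxTest s t a).1 (x, y) * D.e₀ (-(x * ξ - y * η)) =
      (Fintype.card D.F : ℂ)⁻¹ * ∑ c : D.F, (1 - D.lam c) * ((boxTest s t a).1 (x, y) *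
        D.e (x * (D.incl c * ξ) - y * (D.incl c * η))) := by
    intro x y
    rw [e₀_neg_eq, mul_left_comm, Finset.mul_sum]
    congr 1
    refine Finset.sum_congr rfl fun c _ ↦ ?_
    rw [mul_left_comm, show D.incl c * (x * ξ - y * η) =
      x * (D.incl c * ξ) - y * (D.incl c * η) by ring]
  simp_rw [h3, integral_const_mul]
  congr 1
  have hint : ∀ c : D.F, (fun z : k × k ↦ (boxTest s t a).1 z *
      D.e (z.1 * (D.incl c * ξ) - z.2 * (D.incl c * η))) ∈ BruhatSchwartz (k × k) := fun c ↦
    transform_aux D.isResKernel_e _ _ (boxTest s t a).2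
  have h4 : ∀ x : k, ∫ y, ∑ c : D.F, (1 - D.lam c) * ((boxTest s t a).1 (x, y) *
        D.e (x * (D.incl c * ξ) - y * (D.incl c * η))) ∂D.μ =
      ∑ c : D.F, (1 - D.lam c) * ∫ y, (boxTest s t a).1 (x, y) *
        D.e (x * (D.incl c * ξ) - y * (D.incl c * η)) ∂D.μ := by
    intro x
    rw [integral_finsetSum _ fun c _ ↦ (bs_integrable (bs_slice (hint c) x)).const_mul _]
    simp_rw [integral_const_mul]
  simp_rw [h4]
  rw [integral_finsetSum _ fun c _ ↦ (bs_integrable (bs_partial_integral D.μ (hint c))).const_mul _]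
  refine Finset.sum_congr rfl fun c _ ↦ ?_
  rw [integral_const_mul, ← h0, fourierS_apply]

/-- Averaging over dilated boxes becomes averaging over dilated densities, because multiplication by
c ∈ 𝔽ˣ maps discs to discs of the same radius. -/
theorem isStar_𝒢₀ (D : StirlingData k p) [Fintype D.F] {Φ : GenFun k} {g : k → k → ℂ}
    (h : IsStar (D.𝒢 Φ) g) : IsStar (D.𝒢₀ Φ) fun s t ↦ (Fintype.card D.F : ℂ)⁻¹ *
      ∑ c : D.F, (1 - D.lam c) * g (D.incl c * s) (D.incl c * t) := by
  classical
  obtain ⟨N, hN⟩ := h.2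
  have hfin : ∀ c : D.F, c ≠ 0 → ∀ n, {x | x ∈ ball k n ∧ ∃ y, g (D.incl c * x) y ≠ 0}.Finite := by
    intro c hc n
    refine Set.Finite.subset ((h.1 n).preimage (f := fun x ↦ D.incl c * x)
      (mul_right_injective₀ (D.incl_ne_zero hc)).injOn) ?_
    rintro x ⟨hx, y, hy⟩
    exact ⟨(mem_ball_mul_iff_of_absv_eq_one (D.absv_incl hc)).mpr hx, y, hy⟩
  have hfin' : ∀ c : D.F, ∀ s n t, (disc s n ∩ Function.support fun x ↦
      (1 - D.lam c) * g (D.incl c * x) t).Finite := by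
    intro c s n t
    rcases eq_or_ne c 0 with rfl | hc
    · simp
    · refine (finite_disc_of_finite_ball (hfin c hc) s n).subset ?_
      rintro x ⟨hx, hxt⟩
      exact ⟨hx, t, right_ne_zero_of_mul hxt⟩
  refine ⟨fun n ↦ ?_, N, fun a ha s t ↦ ?_⟩
  · have : (⋃ c : {c : D.F // c ≠ 0}, {x | x ∈ ball k n ∧ ∃ y, g (D.incl c * x) y ≠ 0}).Finite :=
      Set.finite_iUnion fun c ↦ hfin c c.2 n
    refine this.subset ?_
    rintro x ⟨hx, y, hy⟩
    obtain ⟨c, -, hc⟩ := Finset.exists_ne_zero_of_sum_ne_zero (right_ne_zero_of_mul hy)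
    have hc0 : c ≠ 0 := by
      rintro rfl
      simp at hc
    exact Set.mem_iUnion.mpr ⟨⟨c, hc0⟩, hx, _, right_ne_zero_of_mul hc⟩
  · change Φ (D.fourierS₀ (boxTest s t a)) = _
    rw [fourierS₀_boxTest, map_smul, map_sum, ← mul_finsum_mem, smul_eq_mul, mul_left_comm]
    congr 1
    rw [finsum_mem_def]
    have h1 : ∀ z, (disc s (logAbs (a : k))).indicator (fun z ↦ ∑ c : D.F, (1 - D.lam c) *
        g (D.incl c * z) (D.incl c * t)) z = ∑ c : D.F, (disc s (logAbs (a : k))).indicator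
        (fun z ↦ (1 - D.lam c) * g (D.incl c * z) (D.incl c * t)) z := by
      intro z
      rw [Set.indicator_apply]
      split_ifs with hz
      · simp [hz]
      · simp [hz]
    simp_rw [h1]
    rw [finsum_sum_comm _ _ fun c _ ↦ by
      rw [Function.HasFiniteSupport, Set.support_indicator]; exact hfin' c s _ _, Finset.mul_sum]
    refine Finset.sum_congr rfl fun c _ ↦ ?_
    rw [map_smul, smul_eq_mul]
    rcases eq_or_ne c 0 with rfl | hc
    · simp
    have h2 : Φ (D.fourierS (boxTest (D.incl c * s) (D.incl c * t) a)) = _ := hN a ha _ _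
    rw [h2, finsum_disc_mul (D.absv_incl hc), ← finsum_mem_def, ← mul_finsum_mem, mul_left_comm]

/-- The dual density is invariant in the first variable under the annihilator of L + ℤ l, where
𝐞(l·) is trivial, and in the second under a ball where 𝐞(w·) is trivial. Such a density comes from a
finite combination of primitive ones, and densities determine generalized functions. -/
theorem 𝒢_primLattice_mem_RVL (D : StirlingData k p) {L : AddSubgroup k} (hL : IsLattice L)
    (l w : k) (r : kˣ) : D.𝒢 (D.primLattice hL l w r) ∈ D.RVL := by
  classical
  obtain ⟨m, hm⟩ := exists_mem_ball w
  set R := logAbs (r : k) with hR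
  -- This radius keeps the ball inside the support of the dual density and, since w has index at
  -- most m, inside the kernel of 𝐞(w·).
  obtain ⟨r', hr'⟩ := exists_logAbs_eq k (D.cond - max R m)
  have hle : D.perp (L ⊔ AddSubgroup.zmultiples l) ≤ D.perp L := by
    rw [perp_sup]
    exact inf_le_left
  have hx : ∀ x y, ∀ b ∈ D.perp (L ⊔ AddSubgroup.zmultiples l),
      D.dualDensity hL l w R (x + b) y = D.dualDensity hL l w R x y := by
    intro x y b hb
    have h1 : D.e (l * b) = 1 := by
      rw [mul_comm]
      exact hb l (AddSubgroup.mem_sup_right (AddSubgroup.mem_zmultiples l))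
    simp only [dualDensity, Set.indicator_apply, SetLike.mem_coe,
      AddSubgroup.add_mem_cancel_right _ (hle hb), mul_add, e_add, h1, mul_one]
  have hy : ∀ x y, ∀ b ∈ ball k (logAbs (r' : k)),
      D.dualDensity hL l w R x (y + b) = D.dualDensity hL l w R x y := by
    intro x y b hb
    rw [hr'] at hb
    have h1 : b ∈ ball k (D.cond - R) := ball_mono (by have := le_max_left R m; omega) hb
    have h2 : D.e (-(w * b)) = 1 := by
      rw [show -(w * b) = -b * w by ring]
      exact D.e_eq_one_of_mem (n := max R m) (neg_mem hb) (hm _ (le_max_right _ _))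
    simp only [dualDensity, Set.indicator_apply, SetLike.mem_coe,
      AddSubgroup.add_mem_cancel_right _ h1, mul_add, neg_add, e_add, h2, mul_one]
  obtain ⟨T, hT⟩ := D.exists_isStar_sum_primLattice
    (D.isLattice_perp (hL.sup_zmultiples p l)) (D.isLattice_perp hL) hle r' (D.cond - R) hx hy
    fun x y hxy ↦ by
      rw [dualDensity] at hxy
      exact ⟨Set.mem_of_indicator_ne_zero (left_ne_zero_of_mul (right_ne_zero_of_mul hxy)),
        Set.mem_of_indicator_ne_zero (right_ne_zero_of_mul (right_ne_zero_of_mul hxy))⟩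
  rw [(D.isStar_𝒢_primLattice hL l w r).unique hT]
  exact Submodule.sum_mem _ fun z _ ↦ Submodule.smul_mem _ _
    (Submodule.subset_span (D.isPrimitive_primLattice _ _ _ _))

theorem 𝒢_mem_RVL (D : StirlingData k p) {Φ : GenFun k} (hΦ : Φ ∈ D.RVL) : D.𝒢 Φ ∈ D.RVL := by
  induction hΦ using Submodule.span_induction with
  | mem Φ h =>
    obtain ⟨L, hL, l, w, r, rfl⟩ := IsPrimitive.exists_eq h
    exact D.𝒢_primLattice_mem_RVL hL l w r
  | zero => exact D.RVL.zero_mem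
  | add Φ Ψ _ _ h h' => exact D.RVL.add_mem h h'
  | smul c Φ _ h => exact D.RVL.smul_mem c h

end StirlingData

/-! ### Rationality -/

theorem zpow_mem_zInv (p : ℕ) [Fact p.Prime] (n : ℤ) : (p : ℂ) ^ n ∈ zInv p := by
  have h1 : (p : ℂ)⁻¹ ∈ zInv p := Subring.subset_closure rfl
  obtain ⟨m, rfl | rfl⟩ := n.eq_nat_or_neg
  · rw [zpow_natCast]
    exact pow_mem (natCast_mem _ p) m
  · rw [zpow_neg, zpow_natCast, ← inv_pow]
    exact pow_mem h1 m

theorem sum_units_eq {K M : Type*} [Field K] [Fintype K] [Fintype Kˣ] [AddCommMonoid M]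
    (f : K → M) (hf : f 0 = 0) : ∑ u : Kˣ, f u = ∑ x : K, f x :=
  Fintype.sum_of_injective (fun u : Kˣ ↦ (u : K)) Units.val_injective _ _ (fun x hx ↦ by
    by_contra h
    have hx0 : x ≠ 0 := by
      rintro rfl
      exact h hf
    exact hx ⟨Units.mk0 x hx0, rfl⟩) fun _ ↦ rfl

/-- T is a transversal of 𝔽_pˣ in Kˣ. Letting j run over all of 𝔽_p is harmless because f vanishes
at 0. -/
theorem exists_sum_eq_sum_orbits (p : ℕ) [Fact p.Prime] {K : Type*} [Field K] [Fintype K]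
    [CharP K p] : ∃ T : Finset Kˣ, ∀ f : K → ℂ, f 0 = 0 →
      ∑ x : K, f x = ∑ c ∈ T, ∑ j : ZMod p, f (c * ZMod.castHom (dvd_refl p) K j) := by
  classical
  let φ := Units.map (ZMod.castHom (dvd_refl p) K).toMonoidHom
  have hφ : Function.Injective φ := Units.map_injective (ZMod.castHom (dvd_refl p) K).injective
  obtain ⟨S, hS, -⟩ := φ.range.exists_isComplement_left 1
  have : Fintype S := Fintype.ofFinite S
  refine ⟨S.toFinset, fun f hf ↦ ?_⟩
  have hbij : Function.Bijective fun z : S × (ZMod p)ˣ ↦ (z.1 : Kˣ) * φ z.2 :=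
    hS.comp ((Equiv.refl S).prodCongr (MonoidHom.ofInjective hφ).toEquiv).bijective
  rw [← sum_units_eq f hf, ← hbij.sum_comp fun u : Kˣ ↦ f u, Fintype.sum_prod_type,
    ← Finset.sum_coe_sort S.toFinset]
  refine Fintype.sum_equiv (Equiv.subtypeEquivRight fun x ↦ Set.mem_toFinset.symm) _ _ fun c ↦ ?_
  exact sum_units_eq (fun j : ZMod p ↦ f (((c : Kˣ) : K) * ZMod.castHom (dvd_refl p) K j))
    (by rw [map_zero, mul_zero, hf])

namespace StirlingData

variable {k : Type*} [Field k] [ValuativeRel k] [TopologicalSpace k] [IsNonarchimedeanLocalField k]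
  {p : ℕ} [Fact p.Prime] [CharP k p]

theorem incl_castHom (D : StirlingData k p) (j : ZMod p) :
    D.incl (ZMod.castHom (dvd_refl p) D.F j) = (j.val : k) := by
  conv_lhs => rw [← ZMod.natCast_zmod_val j, map_natCast, map_natCast]

/-- Elements of 𝔽_p act as integer multiples, so every additive subgroup of k is stable under them
and under their inverses. -/
theorem incl_castHom_mul_mem (D : StirlingData k p) {H : AddSubgroup k} {j : ZMod p} (hj : j ≠ 0)
    {x : k} : D.incl (ZMod.castHom (dvd_refl p) D.F j) * x ∈ H ↔ x ∈ H := by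
  have key : ∀ (i : ZMod p) {y : k}, y ∈ H →
      D.incl (ZMod.castHom (dvd_refl p) D.F i) * y ∈ H := fun i y hy ↦ by
    rw [incl_castHom, ← nsmul_eq_mul]
    exact H.nsmul_mem hy _
  refine ⟨fun h ↦ ?_, key j⟩
  have := key j⁻¹ h
  rwa [← mul_assoc, ← map_mul, ← map_mul, inv_mul_cancel₀ hj, map_one, map_one, one_mul] at this

theorem card_F_eq_pow (D : StirlingData k p) [Fintype D.F] : ∃ n : ℕ, Fintype.card D.F = p ^ n := by
  obtain ⟨n, -, h⟩ := FiniteField.card D.F p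
  exact ⟨n, h⟩

/-- Both j ↦ 𝐞(jz) and j ↦ λ(cj)𝐞(jz) are characters of 𝔽_p, and the sum of a character over 𝔽_p is
0 or p. -/
theorem orbit_sum_mem_zInv (D : StirlingData k p) (c : D.F) (z : k) :
    ∑ j : ZMod p, (1 - D.lam (c * ZMod.castHom (dvd_refl p) D.F j)) *
      D.e (D.incl (ZMod.castHom (dvd_refl p) D.F j) * z) ∈ zInv p := by
  classical
  let ψ : AddChar (ZMod p) ℂ := D.eChar.compAddMonoidHom
    ((AddMonoidHom.mulRight z).comp (D.incl.comp (ZMod.castHom (dvd_refl p) D.F)).toAddMonoidHom)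
  let χ : AddChar (ZMod p) ℂ := D.lam.compAddMonoidHom
    ((AddMonoidHom.mulLeft c).comp (ZMod.castHom (dvd_refl p) D.F).toAddMonoidHom)
  have h1 : ∑ j : ZMod p, (1 - D.lam (c * ZMod.castHom (dvd_refl p) D.F j)) *
      D.e (D.incl (ZMod.castHom (dvd_refl p) D.F j) * z) = ∑ j, ψ j - ∑ j, (χ * ψ) j := by
    rw [← Finset.sum_sub_distrib]
    refine Finset.sum_congr rfl fun j _ ↦ ?_
    rw [AddChar.mul_apply]
    change (1 - χ j) * ψ j = _
    ring
  rw [h1, AddChar.sum_eq_ite, AddChar.sum_eq_ite]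
  refine sub_mem ?_ ?_
  · split_ifs
    · exact natCast_mem _ _
    · exact zero_mem _
  · split_ifs
    · exact natCast_mem _ _
    · exact zero_mem _

variable [MeasurableSpace k] [BorelSpace k]

/-- Volume and covolume are powers of p times the volume of 𝒪. That volume may be irrational, but it
cancels. -/
theorem vol_div_covol_mem_zInv (D : StirlingData k p) {L : AddSubgroup k} (hL : IsLattice L)
    (R : ℤ) : ((D.vol R / D.covol hL : ℝ) : ℂ) ∈ zInv p := by
  obtain ⟨u, m, hum⟩ := D.covol_eq hL
  obtain ⟨n, -, hn⟩ := residueCard_eq_pow k p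
  have h0 := (D.vol_pos 0).ne'
  have hp : (p : ℝ) ≠ 0 := by exact_mod_cast (Fact.out : p.Prime).ne_zero
  have h1 : D.vol R / D.covol hL = (p : ℝ) ^ (n * (R - u) - m : ℤ) := by
    rw [hum, D.vol_eq R, D.vol_eq u, hn, Nat.cast_pow, zpow_sub₀ hp, zpow_mul, zpow_natCast,
      zpow_natCast, zpow_sub₀ (pow_ne_zero n hp)]
    field_simp
  rw [h1]
  push_cast
  exact zpow_mem_zInv p _

theorem isRational_primLattice (D : StirlingData k p) {L : AddSubgroup k} (hL : IsLattice L)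
    (l w : k) (r : kˣ) : D.IsRational (D.primLattice hL l w r) :=
  Submodule.subset_span (D.isPrimitive_primLattice hL l w r)

/-- The part of the density of `𝒢₀[Φ]` belonging to the orbit of `c` under `𝔽_pˣ`, for a primitive
rigged virtual lattice `Φ`. -/
noncomputable def orbitDensity (D : StirlingData k p) [Fintype D.F] {L : AddSubgroup k}
    (hL : IsLattice L) (l w : k) (R : ℤ) (c : D.F) (s t : k) : ℂ :=
  (Fintype.card D.F : ℂ)⁻¹ * ∑ j : ZMod p, (1 - D.lam (c * ZMod.castHom (dvd_refl p) D.F j)) *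
    D.dualDensity hL l w R (D.incl (c * ZMod.castHom (dvd_refl p) D.F j) * s)
      (D.incl (c * ZMod.castHom (dvd_refl p) D.F j) * t)

/-- The annihilator of L and the ball are stable under 𝔽_pˣ, so the indicators leave the orbit sum
and a pure character sum remains. -/
theorem orbitDensity_eq (D : StirlingData k p) [Fintype D.F] {L : AddSubgroup k}
    (hL : IsLattice L) (l w : k) (R : ℤ) (c : D.F) (s t : k) :
    D.orbitDensity hL l w R c s t = (Fintype.card D.F : ℂ)⁻¹ * (((D.vol R / D.covol hL : ℝ) : ℂ) *
      ((D.perp L : Set k).indicator 1 (D.incl c * s) *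
      ((ball k (D.cond - R) : Set k).indicator 1 (D.incl c * t) *
      ∑ j : ZMod p, (1 - D.lam (c * ZMod.castHom (dvd_refl p) D.F j)) *
        D.e (D.incl (ZMod.castHom (dvd_refl p) D.F j) * (D.incl c * (l * s - w * t)))))) := by
  classical
  rw [orbitDensity]
  congr 1
  rw [Finset.mul_sum, Finset.mul_sum, Finset.mul_sum]
  refine Finset.sum_congr rfl fun j _ ↦ ?_
  -- The indicators may change at j = 0, but there the weight 1 - λ(0) is zero.
  rcases eq_or_ne j 0 with rfl | hj
  · simp
  have h1 : ∀ x, D.incl (c * ZMod.castHom (dvd_refl p) D.F j) * x =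
      D.incl (ZMod.castHom (dvd_refl p) D.F j) * (D.incl c * x) := fun x ↦ by
    rw [map_mul]
    ring
  simp only [h1, dualDensity, Set.indicator_apply, SetLike.mem_coe, D.incl_castHom_mul_mem hj,
    Pi.one_apply]
  have h2 : D.e (D.incl (ZMod.castHom (dvd_refl p) D.F j) * (D.incl c * (l * s - w * t))) =
      D.e (l * (D.incl (ZMod.castHom (dvd_refl p) D.F j) * (D.incl c * s))) *
      D.e (-(w * (D.incl (ZMod.castHom (dvd_refl p) D.F j) * (D.incl c * t)))) := by
    rw [← e_add]
    congr 1
    ring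
  rw [h2]
  split_ifs
  · ring
  · simp
  · simp
  · simp

theorem orbitDensity_mem_zInv (D : StirlingData k p) [Fintype D.F] {L : AddSubgroup k}
    (hL : IsLattice L) (l w : k) (R : ℤ) (c : D.F) (s t : k) :
    D.orbitDensity hL l w R c s t ∈ zInv p := by
  classical
  have hind : ∀ (S : Set k) (x : k), S.indicator (1 : k → ℂ) x ∈ zInv p := fun S x ↦ by
    rw [Set.indicator_apply]
    split_ifs
    · exact one_mem _
    · exact zero_mem _
  have hF : (Fintype.card D.F : ℂ)⁻¹ ∈ zInv p := by
    obtain ⟨n, hn⟩ := D.card_F_eq_pow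
    rw [hn, Nat.cast_pow, ← zpow_natCast, ← zpow_neg]
    exact zpow_mem_zInv p _
  rw [orbitDensity_eq]
  exact mul_mem hF (mul_mem (D.vol_div_covol_mem_zInv hL R) (mul_mem (hind _ _) (mul_mem (hind _ _)
    (D.orbit_sum_mem_zInv c _))))

/-- The argument of `𝒢_primLattice_mem_RVL`, with lattices pulled back along multiplication by c.
The coefficients are values of the density, hence in ℤ[1/p] by `orbitDensity_mem_zInv`. -/
theorem exists_isRational_orbitDensity (D : StirlingData k p) [Fintype D.F] {L : AddSubgroup k}
    (hL : IsLattice L) (l w : k) (R : ℤ) {c : D.F} (hc : c ≠ 0) :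
    ∃ Ψ, D.IsRational Ψ ∧ IsStar Ψ (D.orbitDensity hL l w R c) := by
  classical
  obtain ⟨m, hm⟩ := exists_mem_ball w
  obtain ⟨r', hr'⟩ := exists_logAbs_eq k (D.cond - max R m)
  have hc0 := D.incl_ne_zero hc
  have hle : D.perp (L ⊔ AddSubgroup.zmultiples l) ≤ D.perp L := by
    rw [perp_sup]
    exact inf_le_left
  have hx : ∀ x y, ∀ b ∈ (D.perp (L ⊔ AddSubgroup.zmultiples l)).comap
      (AddMonoidHom.mulLeft (D.incl c)),
      D.orbitDensity hL l w R c (x + b) y = D.orbitDensity hL l w R c x y := by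
    intro x y b hb
    have hb' : D.incl c * b ∈ D.perp (L ⊔ AddSubgroup.zmultiples l) := hb
    have h1 : ∀ j : ZMod p, D.e (D.incl (ZMod.castHom (dvd_refl p) D.F j) *
        (D.incl c * (l * (x + b) - w * y))) =
        D.e (D.incl (ZMod.castHom (dvd_refl p) D.F j) * (D.incl c * (l * x - w * y))) := by
      intro j
      have h2 : D.e (D.incl c * b * (j.val * l)) = 1 := by
        refine hb' _ (AddSubgroup.mem_sup_right ?_)
        rw [← nsmul_eq_mul]
        exact AddSubgroup.nsmul_mem_zmultiples l _
      rw [← incl_castHom] at h2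
      rw [show D.incl (ZMod.castHom (dvd_refl p) D.F j) * (D.incl c * (l * (x + b) - w * y)) =
        D.incl (ZMod.castHom (dvd_refl p) D.F j) * (D.incl c * (l * x - w * y)) +
        D.incl c * b * (D.incl (ZMod.castHom (dvd_refl p) D.F j) * l) by ring, e_add, h2, mul_one]
    simp only [orbitDensity_eq, h1, Set.indicator_apply, SetLike.mem_coe, mul_add (D.incl c) x b,
      AddSubgroup.add_mem_cancel_right _ (hle hb'), Pi.one_apply]
  have hy : ∀ x y, ∀ b ∈ ball k (logAbs (r' : k)),
      D.orbitDensity hL l w R c x (y + b) = D.orbitDensity hL l w R c x y := by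
    intro x y b hb
    rw [hr', ← mem_ball_mul_iff_of_absv_eq_one (D.absv_incl hc)] at hb
    have h0 : D.incl c * b ∈ ball k (D.cond - R) :=
      ball_mono (by have := le_max_left R m; omega) hb
    have h1 : ∀ j : ZMod p, D.e (D.incl (ZMod.castHom (dvd_refl p) D.F j) *
        (D.incl c * (l * x - w * (y + b)))) =
        D.e (D.incl (ZMod.castHom (dvd_refl p) D.F j) * (D.incl c * (l * x - w * y))) := by
      intro j
      have h2 : D.e (-(D.incl c * b) * (j.val * w)) = 1 := by
        refine D.e_eq_one_of_mem (n := max R m) (neg_mem hb) ?_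
        rw [← nsmul_eq_mul]
        exact AddSubgroup.nsmul_mem _ (hm _ (le_max_right _ _)) _
      rw [← incl_castHom] at h2
      rw [show D.incl (ZMod.castHom (dvd_refl p) D.F j) * (D.incl c * (l * x - w * (y + b))) =
        D.incl (ZMod.castHom (dvd_refl p) D.F j) * (D.incl c * (l * x - w * y)) +
        -(D.incl c * b) * (D.incl (ZMod.castHom (dvd_refl p) D.F j) * w) by ring, e_add, h2,
        mul_one]
    simp only [orbitDensity_eq, h1, Set.indicator_apply, SetLike.mem_coe, mul_add (D.incl c) y b,
      AddSubgroup.add_mem_cancel_right _ h0, Pi.one_apply]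
  obtain ⟨T, hT⟩ := D.exists_isStar_sum_primLattice
    ((D.isLattice_perp (hL.sup_zmultiples p l)).comap_mulLeft hc0)
    ((D.isLattice_perp hL).comap_mulLeft hc0) (AddSubgroup.comap_mono hle) r' (D.cond - R) hx hy
    fun x y hxy ↦ by
      rw [orbitDensity_eq] at hxy
      have h1 := right_ne_zero_of_mul (right_ne_zero_of_mul hxy)
      have h2 : D.incl c * x ∈ D.perp L := Set.mem_of_indicator_ne_zero (left_ne_zero_of_mul h1)
      exact ⟨h2,
        (mem_ball_mul_iff_of_absv_eq_one (D.absv_incl hc)).mp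
          (Set.mem_of_indicator_ne_zero (left_ne_zero_of_mul (right_ne_zero_of_mul h1)))⟩
  exact ⟨_, Submodule.sum_mem _ fun z _ ↦ Submodule.smul_mem _
    (⟨_, D.orbitDensity_mem_zInv hL l w R c z.1 z.2⟩ : zInv p) (D.isRational_primLattice _ _ _ _),
    hT⟩

/-- Single dilates of 𝒢[Φ] take values involving p-th roots of unity; rationality appears once the
average is grouped into orbits of 𝔽_pˣ. -/
theorem isRational_𝒢₀_primLattice (D : StirlingData k p) {L : AddSubgroup k} (hL : IsLattice L)
    (l w : k) (r : kˣ) : D.IsRational (D.𝒢₀ (D.primLattice hL l w r)) := by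
  classical
  have := Fintype.ofFinite D.F
  obtain ⟨T, hT⟩ := exists_sum_eq_sum_orbits p (K := D.F)
  choose Ψ hΨ₁ hΨ₂ using fun c : D.Fˣ ↦
    D.exists_isRational_orbitDensity hL l w (logAbs (r : k)) c.ne_zero
  have h1 := IsStar.sum T fun c _ ↦ hΨ₂ c
  have h2 := D.isStar_𝒢₀ (D.isStar_𝒢_primLattice hL l w r)
  have h3 : (fun s t ↦ (Fintype.card D.F : ℂ)⁻¹ * ∑ c : D.F, (1 - D.lam c) *
      D.dualDensity hL l w (logAbs (r : k)) (D.incl c * s) (D.incl c * t)) =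
      ∑ c ∈ T, D.orbitDensity hL l w (logAbs (r : k)) (c : D.F) := by
    funext s t
    rw [hT _ (by simp), Finset.sum_apply, Finset.sum_apply, Finset.mul_sum]
    rfl
  rw [h3] at h2
  rw [h2.unique h1]
  exact Submodule.sum_mem _ fun c _ ↦ hΨ₁ c

theorem isRational_𝒢₀ (D : StirlingData k p) {Φ : GenFun k} (hΦ : D.IsRational Φ) :
    D.IsRational (D.𝒢₀ Φ) := by
  rw [IsRational] at hΦ
  induction hΦ using Submodule.span_induction with
  | mem Φ h =>
    obtain ⟨L, hL, l, w, r, rfl⟩ := IsPrimitive.exists_eq h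
    exact D.isRational_𝒢₀_primLattice hL l w r
  | zero => exact Submodule.zero_mem _
  | add Φ Ψ _ _ h h' => exact Submodule.add_mem _ h h'
  | smul c Φ _ h => exact Submodule.smul_mem _ c h

theorem IsRational.mem_RVL {D : StirlingData k p} {Φ : GenFun k} (hΦ : D.IsRational Φ) :
    Φ ∈ D.RVL := by
  rw [IsRational] at hΦ
  induction hΦ using Submodule.span_induction with
  | mem Φ h => exact Submodule.subset_span h
  | zero => exact Submodule.zero_mem _
  | add Φ Ψ _ _ h h' => exact Submodule.add_mem _ h h'
  | smul c Φ _ h => exact Submodule.smul_mem _ (c : ℂ) h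

theorem exists_isStar_of_mem_RVL (D : StirlingData k p) {Φ : GenFun k} (hΦ : Φ ∈ D.RVL) :
    ∃ f, IsStar Φ f := by
  induction hΦ using Submodule.span_induction with
  | mem Φ h =>
    obtain ⟨L, hL, l, w, r, rfl⟩ := IsPrimitive.exists_eq h
    exact ⟨_, D.isStar_primLattice hL l w r⟩
  | zero => exact ⟨_, IsStar.zero⟩
  | add Φ Ψ _ _ h h' =>
    obtain ⟨f, hf⟩ := h
    obtain ⟨g, hg⟩ := h'
    exact ⟨_, hf.add hg⟩
  | smul c Φ _ h =>
    obtain ⟨f, hf⟩ := h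
    exact ⟨_, hf.smul c⟩

theorem isStar_of_mem_RVL (D : StirlingData k p) {Φ : GenFun k} (hΦ : Φ ∈ D.RVL) :
    IsStar Φ (lowerStar Φ) := by
  obtain ⟨f, hf⟩ := D.exists_isStar_of_mem_RVL hΦ
  rwa [hf.lowerStar_eq]

theorem IsRational.lowerStar_mem_zInv {D : StirlingData k p} {Φ : GenFun k}
    (hΦ : D.IsRational Φ) (x y : k) : lowerStar Φ x y ∈ zInv p := by
  suffices h : ∃ f, IsStar Φ f ∧ ∀ x y, f x y ∈ zInv p by
    obtain ⟨f, hf, h⟩ := h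
    rw [hf.lowerStar_eq]
    exact h x y
  clear x y
  rw [IsRational] at hΦ
  induction hΦ using Submodule.span_induction with
  | mem Φ h =>
    classical
    obtain ⟨L, hL, l, w, r, rfl⟩ := IsPrimitive.exists_eq h
    refine ⟨_, D.isStar_primLattice hL l w r, fun x y ↦ ?_⟩
    rw [primDensity, Set.indicator_apply, Set.indicator_apply]
    refine mul_mem ?_ ?_ <;> split_ifs <;> simp [zero_mem, one_mem]
  | zero => exact ⟨_, IsStar.zero, fun x y ↦ zero_mem _⟩
  | add Φ Ψ _ _ h h' =>
    obtain ⟨f, hf, h1⟩ := h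
    obtain ⟨g, hg, h2⟩ := h'
    exact ⟨_, hf.add hg, fun x y ↦ add_mem (h1 x y) (h2 x y)⟩
  | smul c Φ _ h =>
    obtain ⟨f, hf, h1⟩ := h
    exact ⟨_, hf.smul c, fun x y ↦ mul_mem c.2 (h1 x y)⟩

end StirlingData

/-! ### Integration over the multiplicative group -/

section Multiplicative

variable {k : Type*} [Field k] [ValuativeRel k] [TopologicalSpace k] [IsNonarchimedeanLocalField k]
  [MeasurableSpace k] [BorelSpace k]

/-- The shell `{t | ‖t‖ = q ^ j}` in `kˣ`. -/
def shell (k : Type*) [Field k] [ValuativeRel k] [TopologicalSpace k]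
    [IsNonarchimedeanLocalField k] [MeasurableSpace k] [BorelSpace k] (j : ℤ) : Set kˣ :=
  {t | logAbs (t : k) = j}

theorem mem_shell {t : kˣ} {j : ℤ} : t ∈ shell k j ↔ logAbs (t : k) = j := Iff.rfl

/-- The preimage of a disc in `kˣ`. -/
def unitDisc (c : k) (n : ℤ) : Set kˣ := {t | (t : k) ∈ disc c n}

theorem mem_unitDisc {c : k} {n : ℤ} {t : kˣ} : t ∈ unitDisc c n ↔ (t : k) - c ∈ ball k n := Iff.rfl

theorem measurableSet_unitDisc (c : k) (n : ℤ) : MeasurableSet (unitDisc c n) :=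
  ((isOpen_disc c n).preimage Units.continuous_val).measurableSet

theorem logAbs_eq_of_sub_mem {x y : k} (hy : y ≠ 0) {n : ℤ} (hn : n < logAbs y)
    (h : x - y ∈ ball k n) : x ≠ 0 ∧ logAbs x = logAbs y := by
  have h1 : absv (x - y) < absv y := by
    rw [absv_eq hy]
    exact lt_of_le_of_lt h (zpow_residueCard_lt.mpr hn)
  have h2 := absv_eq_of_sub_lt h1
  have hx : x ≠ 0 := by
    rintro rfl
    rw [absv_zero] at h2
    exact (absv_pos' hy).ne h2
  exact ⟨hx, (logAbs_eq_iff hx).mpr (h2.trans (absv_eq hy))⟩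

theorem unitDisc_subset_shell {c : k} (hc : c ≠ 0) {n : ℤ} (hn : n < logAbs c) :
    unitDisc c n ⊆ shell k (logAbs c) := fun _ ht ↦ (logAbs_eq_of_sub_mem hc hn ht).2

theorem shell_zero : shell k 0 = integerUnits k := by
  ext t
  have h : ∀ x : k, valuation k x = 1 ↔ absv x = 1 := fun x ↦ by
    have := absv_le_iff (x := x) (y := 1)
    have h2 := absv_le_iff (x := 1) (y := x)
    rw [absv_one, map_one] at this h2
    rw [le_antisymm_iff, le_antisymm_iff, this, h2]
  change logAbs (t : k) = 0 ↔ valuation k (t : k) = 1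
  rw [h, logAbs_eq_iff t.ne_zero, zpow_zero]

theorem preimage_mul_shell (c : kˣ) (j : ℤ) :
    (fun t ↦ c * t) ⁻¹' shell k j = shell k (j - logAbs (c : k)) := by
  ext t
  rw [Set.mem_preimage, mem_shell, mem_shell, Units.val_mul, logAbs_mul c.ne_zero t.ne_zero]
  omega

theorem measurableSet_shell (j : ℤ) : MeasurableSet (shell k j) := by
  obtain ⟨c, hc⟩ := exists_logAbs_eq k (-j)
  have := preimage_mul_shell c 0
  rw [hc, zero_sub, neg_neg, shell_zero] at this
  rw [← this]
  exact (lf_isOpen_integerUnits.preimage (continuous_const_mul c)).measurableSet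

theorem unitHaar_shell (j : ℤ) : unitHaar k (shell k j) = 1 := by
  obtain ⟨c, hc⟩ := exists_logAbs_eq k (-j)
  have := preimage_mul_shell c 0
  rw [hc, zero_sub, neg_neg, shell_zero] at this
  rw [← this, measure_preimage_mul, unitHaar_integerUnits]

/-- Multiplication by c/d, which has absolute value one, carries one disc onto the other. -/
theorem unitHaar_unitDisc_congr {c d : k} (hc : c ≠ 0) (hd : d ≠ 0) (h : logAbs c = logAbs d)
    (n : ℤ) : unitHaar k (unitDisc c n) = unitHaar k (unitDisc d n) := by
  have h1 : (fun t ↦ Units.mk0 c hc / Units.mk0 d hd * t) ⁻¹' unitDisc c n = unitDisc d n := by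
    ext t
    have h2 : ((Units.mk0 c hc / Units.mk0 d hd * t : kˣ) : k) - c = c / d * (t - d) := by
      push_cast [Units.val_div_eq_div_val]
      simp only [Units.val_mk0]
      field_simp
    rw [Set.mem_preimage, mem_unitDisc, mem_unitDisc, h2, mem_ball_mul_iff (div_ne_zero hc hd),
      logAbs_div hc hd, h, sub_self, sub_zero]
  rw [← h1, measure_preimage_mul]

theorem unitHaar_unitDisc_lt_top {c : k} (hc : c ≠ 0) {n : ℤ} (hn : n < logAbs c) :
    unitHaar k (unitDisc c n) < ⊤ :=
  (measure_mono (unitDisc_subset_shell hc hn)).trans_lt (by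
    rw [unitHaar_shell]
    exact ENNReal.one_lt_top)

/-- A disc of radius smaller than the norm of its centre stays in one shell, so the shell is a union
of classes modulo the ball of index n. -/
theorem exists_shell_partition {n j : ℤ} (hn : n < j) : ∃ T : Finset k,
    (∀ c ∈ T, c ≠ 0 ∧ logAbs c = j) ∧ (T : Set k).PairwiseDisjoint (fun c ↦ disc c n) ∧
    ⋃ c ∈ T, disc c n = (ball k j : Set k) \ ball k (j - 1) := by
  classical
  have hfin := (finite_image_mk_ball (k := k) n j).subset
    (Set.image_mono (Set.sdiff_subset (t := (ball k (j - 1) : Set k))))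
  have hmem : ∀ x : k, x ∈ (ball k j : Set k) \ ball k (j - 1) ↔ x ≠ 0 ∧ logAbs x = j := by
    intro x
    rcases eq_or_ne x 0 with rfl | hx
    · simp [zero_mem]
    · rw [Set.mem_sdiff, SetLike.mem_coe, SetLike.mem_coe, mem_ball_iff hx, mem_ball_iff hx]
      constructor
      · rintro ⟨h1, h2⟩
        exact ⟨hx, by omega⟩
      · rintro ⟨-, h⟩
        omega
  have hout : ∀ x : k, x - (QuotientAddGroup.mk x : k ⧸ ball k n).out ∈ ball k n := fun x ↦ by
    have := QuotientAddGroup.out_eq' (QuotientAddGroup.mk x : k ⧸ ball k n)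
    rwa [QuotientAddGroup.eq, neg_add_eq_sub] at this
  have hT : ∀ c ∈ hfin.toFinset.image Quotient.out, ∃ x, x ≠ 0 ∧ logAbs x = j ∧
      c = (QuotientAddGroup.mk x : k ⧸ ball k n).out := by
    intro c hc
    obtain ⟨z, hz, rfl⟩ := Finset.mem_image.mp hc
    obtain ⟨x, hx, rfl⟩ := (Set.Finite.mem_toFinset _).mp hz
    exact ⟨x, ((hmem x).mp hx).1, ((hmem x).mp hx).2, rfl⟩
  have hT' : ∀ c ∈ hfin.toFinset.image Quotient.out, c ≠ 0 ∧ logAbs c = j := by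
    intro c hc
    obtain ⟨x, hx0, hx, rfl⟩ := hT c hc
    have := logAbs_eq_of_sub_mem hx0 (n := n) (by rw [hx]; exact hn)
      (by rw [← neg_mem_iff, neg_sub]; exact hout x)
    exact ⟨this.1, this.2.trans hx⟩
  refine ⟨hfin.toFinset.image Quotient.out, hT', fun c hc d hd hcd ↦ ?_, ?_⟩
  · obtain ⟨x, -, -, rfl⟩ := hT c hc
    obtain ⟨y, -, -, rfl⟩ := hT d hd
    rw [Function.onFun, Set.disjoint_left]
    intro z hz hz'
    refine hcd (congrArg Quotient.out ?_)
    have h1 : ∀ w : k, z ∈ disc (QuotientAddGroup.mk w : k ⧸ ball k n).out n →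
        (QuotientAddGroup.mk z : k ⧸ ball k n) = QuotientAddGroup.mk w := fun w hw ↦ by
      rw [eq_comm, QuotientAddGroup.eq, neg_add_eq_sub]
      have := sub_mem hw (hout w)
      rwa [sub_sub_sub_cancel_right] at this
    exact (h1 x hz).symm.trans (h1 y hz')
  · ext x
    rw [Set.mem_iUnion₂, hmem]
    constructor
    · rintro ⟨c, hc, hx⟩
      obtain ⟨h1, h2⟩ := hT' c hc
      have := logAbs_eq_of_sub_mem h1 (n := n) (by rw [h2]; exact hn) (mem_disc.mp hx)
      exact ⟨this.1, this.2.trans h2⟩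
    · intro hx
      have h1 : (QuotientAddGroup.mk x : k ⧸ ball k n) ∈ hfin.toFinset :=
        (Set.Finite.mem_toFinset _).mpr ⟨x, (hmem x).mpr hx, rfl⟩
      exact ⟨(QuotientAddGroup.mk x : k ⧸ ball k n).out,
        Finset.mem_image.mpr ⟨(QuotientAddGroup.mk x : k ⧸ ball k n), h1, rfl⟩, hout x⟩

variable {p : ℕ} [Fact p.Prime] [CharP k p]

/-- Comparison of the additive and the multiplicative Haar measure on a shell. -/
theorem StirlingData.setIntegral_shell (D : StirlingData k p) {n j : ℤ} (hn : n < j) {h : k → ℂ}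
    (hh : ∀ x, ∀ b ∈ ball k n, h (x + b) = h x) :
    ((D.vol j - D.vol (j - 1) : ℝ) : ℂ) * ∫ t in shell k j, h (t : k) ∂unitHaar k =
      ∫ x in (ball k j : Set k) \ ball k (j - 1), h x ∂D.μ := by
  classical
  obtain ⟨T, hT, hdisj, hU⟩ := exists_shell_partition (k := k) hn
  obtain ⟨c₀, hc₀⟩ := exists_logAbs_eq k j
  set v := (unitHaar k).real (unitDisc (c₀ : k) n) with hv
  have hTv : ∀ c ∈ T, (unitHaar k).real (unitDisc c n) = v := fun c hc ↦ by
    rw [hv, measureReal_def, measureReal_def,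
      unitHaar_unitDisc_congr (hT c hc).1 c₀.ne_zero ((hT c hc).2.trans hc₀.symm)]
  have hU' : ⋃ c ∈ T, unitDisc c n = shell k j := by
    ext t
    have h1 : (t : k) ∈ (⋃ c ∈ T, disc c n) ↔ (t : k) ∈ (ball k j : Set k) \ ball k (j - 1) := by
      rw [hU]
    rw [Set.mem_sdiff, SetLike.mem_coe, SetLike.mem_coe, mem_ball_iff t.ne_zero,
      mem_ball_iff t.ne_zero, Set.mem_iUnion₂] at h1
    rw [Set.mem_iUnion₂, mem_shell]
    refine h1.trans ⟨fun h ↦ by omega, fun h ↦ by omega⟩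
  have hdisj' : (T : Set k).Pairwise (Function.onFun Disjoint fun c ↦ unitDisc c n) :=
    fun c hc d hd hcd ↦ (hdisj hc hd hcd).preimage _
  have hconst : ∀ (c : k), ∀ x ∈ disc c n, h x = h c := fun c x hx ↦ by
    have := hh c _ hx
    rwa [add_sub_cancel] at this
  have hadd : ∀ g : k → ℂ, (∀ c, ∀ x ∈ disc c n, g x = g c) →
      ∫ x in (ball k j : Set k) \ ball k (j - 1), g x ∂D.μ = D.vol n * ∑ c ∈ T, g c := by
    intro g hg
    have h1 : ∀ c ∈ T, IntegrableOn g (disc c n) D.μ := fun c _ ↦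
      ((integrableOn_const_iff (C := g c)).mpr (Or.inr (isCompact_disc c n).measure_lt_top)).congr_fun
        (fun x hx ↦ (hg c x hx).symm) (isOpen_disc c n).measurableSet
    rw [← hU, integral_biUnion_finset T (fun c _ ↦ (isOpen_disc c n).measurableSet) hdisj h1,
      Finset.mul_sum]
    refine Finset.sum_congr rfl fun c _ ↦ ?_
    rw [setIntegral_congr_fun (isOpen_disc c n).measurableSet (hg c), setIntegral_const, μ_real_disc,
      Complex.real_smul]
  have hmul : ∀ g : k → ℂ, (∀ c, ∀ x ∈ disc c n, g x = g c) →
      ∫ t in shell k j, g (t : k) ∂unitHaar k = v * ∑ c ∈ T, g c := by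
    intro g hg
    have h1 : ∀ c ∈ T, IntegrableOn (fun t : kˣ ↦ g t) (unitDisc c n) (unitHaar k) := fun c hc ↦
      ((integrableOn_const_iff (C := g c)).mpr (Or.inr (unitHaar_unitDisc_lt_top (hT c hc).1
        ((hT c hc).2.symm ▸ hn)))).congr_fun (fun x hx ↦ (hg c x hx).symm)
        (measurableSet_unitDisc c n)
    rw [← hU', integral_biUnion_finset T (fun c _ ↦ measurableSet_unitDisc c n) hdisj' h1,
      Finset.mul_sum]
    refine Finset.sum_congr rfl fun c hc ↦ ?_
    rw [setIntegral_congr_fun (g := fun _ ↦ g c) (measurableSet_unitDisc c n) fun t ht ↦ hg c t ht,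
      setIntegral_const, hTv c hc, Complex.real_smul]
  -- Both integrals are multiples of the sum of h over the centres. The case h = 1 determines the
  -- ratio of the two multipliers, including the common multiplicative volume v of the discs.
  have e1 := hadd (fun _ ↦ 1) fun _ _ _ ↦ rfl
  have e2 := hmul (fun _ ↦ 1) fun _ _ _ ↦ rfl
  have e3 : D.μ.real ((ball k j : Set k) \ ball k (j - 1)) = D.vol j - D.vol (j - 1) := by
    rw [measureReal_sdiff (ball_mono (by omega)) (isOpen_ball _).measurableSet
      (isCompact_ball _).measure_ne_top]
    rfl
  rw [setIntegral_const, e3, Complex.real_smul, mul_one] at e1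
  rw [setIntegral_const, measureReal_def, unitHaar_shell, ENNReal.toReal_one, one_smul] at e2
  rw [hadd h hconst, hmul h hconst, e1]
  linear_combination (-(D.vol n * ∑ c ∈ T, h c)) * e2

end Multiplicative

/-! ### Finite sums by layers and annuli -/

section Sums

/-- The weight m - φ(x) is the number of i ≥ 0 with φ(x) ≤ m - (i + 1). -/
theorem sum_layer {ι : Type*} (X : Finset ι) (φ : ι → ℤ) (E : ι → ℂ) (m : ℤ) (I : ℕ)
    (h₁ : ∀ x ∈ X, φ x ≤ m) (h₂ : ∀ x ∈ X, m - I ≤ φ x) :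
    ∑ x ∈ X, ((m - φ x : ℤ) : ℂ) * E x =
      ∑ i ∈ Finset.range I, ∑ x ∈ X with φ x ≤ m - (i + 1), E x := by
  simp_rw [Finset.sum_filter]
  rw [Finset.sum_comm]
  refine Finset.sum_congr rfl fun x hx ↦ ?_
  rw [← Finset.sum_filter, Finset.sum_const, nsmul_eq_mul]
  congr 1
  have h3 := h₁ x hx
  have h4 := h₂ x hx
  have h5 : Finset.filter (fun i : ℕ ↦ φ x ≤ m - ((i : ℤ) + 1)) (Finset.range I) =
      Finset.range (m - φ x).toNat := by
    ext i
    simp only [Finset.mem_filter, Finset.mem_range]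
    omega
  rw [h5, Finset.card_range]
  have h6 : ((m - φ x).toNat : ℤ) = m - φ x := Int.toNat_of_nonneg (by omega)
  exact_mod_cast h6.symm

theorem sum_annuli {ι : Type*} (X : Finset ι) (φ : ι → ℤ) (G : ℤ → ℂ) (m : ℤ) (I : ℕ)
    (h₁ : ∀ x ∈ X, m < φ x) (h₂ : ∀ x ∈ X, φ x ≤ m + I) :
    ∑ x ∈ X, G (φ x) = ∑ i ∈ Finset.range I,
      G (m + (i + 1)) * (Finset.card {x ∈ X | φ x = m + (i + 1)} : ℂ) := by
  have h3 : ∀ x ∈ X, G (φ x) = ∑ i ∈ Finset.range I,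
      if φ x = m + (i + 1) then G (m + (i + 1)) else 0 := by
    intro x hx
    have h4 := h₁ x hx
    have h5 := h₂ x hx
    rw [Finset.sum_eq_single (φ x - m - 1).toNat]
    · rw [if_pos (by omega)]
      congr 1
      omega
    · intro i _ hi
      rw [if_neg (by omega)]
    · intro hi
      rw [Finset.mem_range] at hi
      omega
  rw [Finset.sum_congr rfl h3, Finset.sum_comm]
  refine Finset.sum_congr rfl fun i _ ↦ ?_
  rw [← Finset.sum_filter, Finset.sum_const, nsmul_eq_mul, mul_comm]

theorem finsum_units {k : Type*} [Field k] (F : k → ℂ) (hF : F 0 = 0) :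
    ∑ᶠ u : kˣ, F u = ∑ᶠ x, F x := by
  rw [← finsum_mem_range (g := fun u : kˣ ↦ (u : k)) Units.val_injective, finsum_mem_def]
  refine finsum_congr fun x ↦ ?_
  rcases eq_or_ne x 0 with rfl | hx
  · rw [hF]
    exact Set.indicator_apply_eq_zero.mpr fun _ ↦ hF
  · exact Set.indicator_of_mem (Set.mem_range.mpr ⟨Units.mk0 x hx, rfl⟩) F

end Sums

section ResidueCardCast

variable {k : Type*} [Field k] [ValuativeRel k] [TopologicalSpace k] [IsNonarchimedeanLocalField k]

theorem residueCard_sub_one_ne_zero : (residueCard k : ℂ) - 1 ≠ 0 := by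
  rw [sub_ne_zero]
  exact_mod_cast (one_lt_residueCard k).ne'

theorem residueCard_ne_zero : (residueCard k : ℂ) ≠ 0 := by
  exact_mod_cast (zero_lt_one.trans (one_lt_residueCard k)).ne'

end ResidueCardCast

/-! ### Integrals over shells of the multiplicative group -/

section ShellIntegrals

variable {k : Type*} [Field k] [ValuativeRel k] [TopologicalSpace k] [IsNonarchimedeanLocalField k]
  [MeasurableSpace k] [BorelSpace k]

@[simp] theorem logAbs_zero : logAbs (0 : k) = 0 := by
  rw [logAbs, dif_pos rfl]

theorem ordv_eq_neg_logAbs (x : k) : ordv x = -(logAbs x : ℝ) := by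
  rcases eq_or_ne x 0 with rfl | hx
  · simp [ordv]
  · exact ordv_eq hx

theorem integral_eq_sum_shell {h : kˣ → ℂ} (s : Finset ℤ)
    (hs : ∀ t : kˣ, logAbs (t : k) ∉ s → h t = 0)
    (hint : ∀ j ∈ s, IntegrableOn h (shell k j) (unitHaar k)) :
    Integrable h (unitHaar k) ∧
      ∫ t, h t ∂unitHaar k = ∑ j ∈ s, ∫ t in shell k j, h t ∂unitHaar k := by
  have h0 : ∀ t : kˣ, t ∉ ⋃ j ∈ s, shell k j → h t = 0 := fun t ht ↦ hs t fun hts ↦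
    ht (Set.mem_iUnion₂.mpr ⟨_, hts, rfl⟩)
  refine ⟨(integrableOn_iff_integrable_of_support_subset (s := ⋃ j ∈ s, shell k j) fun t ht ↦ ?_).mp
    (integrableOn_finset_iUnion.mpr hint), ?_⟩
  · by_contra hn
    exact ht (h0 t hn)
  · rw [← setIntegral_eq_integral_of_forall_compl_eq_zero h0,
      integral_biUnion_finset s (fun j _ ↦ measurableSet_shell j) (fun i _ j _ hij ↦ ?_) hint]
    exact Set.disjoint_left.mpr fun t ht ht' ↦ hij (ht.symm.trans ht')

theorem setIntegral_shell_const (j : ℤ) (c : ℂ) : ∫ _ in shell k j, c ∂unitHaar k = c := by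
  rw [setIntegral_const, measureReal_def, unitHaar_shell, ENNReal.toReal_one, one_smul]

theorem integrableOn_shell_const (j : ℤ) (c : ℂ) :
    IntegrableOn (fun _ ↦ c) (shell k j) (unitHaar k) :=
  (integrableOn_const_iff (C := c)).mpr (Or.inr (by
    rw [unitHaar_shell]
    exact ENNReal.one_lt_top))

theorem integral_of_eq_logAbs {h : kˣ → ℂ} (s : Finset ℤ) (H : ℤ → ℂ)
    (hs : ∀ j ∉ s, H j = 0) (hH : ∀ t : kˣ, h t = H (logAbs (t : k))) :
    Integrable h (unitHaar k) ∧ ∫ t, h t ∂unitHaar k = ∑ j ∈ s, H j := by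
  have h1 : ∀ j, Set.EqOn h (fun _ ↦ H j) (shell k j) := fun j t ht ↦ by
    rw [hH, mem_shell.mp ht]
  obtain ⟨h2, h3⟩ := integral_eq_sum_shell (h := h) s (fun t ht ↦ by rw [hH, hs _ ht])
    fun j _ ↦ (integrableOn_shell_const j (H j)).congr_fun (h1 j).symm (measurableSet_shell j)
  refine ⟨h2, h3.trans (Finset.sum_congr rfl fun j _ ↦ ?_)⟩
  rw [setIntegral_congr_fun (measurableSet_shell j) (h1 j), setIntegral_shell_const]

theorem sum_Icc_sub {m n A B : ℤ} (hA : A ≤ m) (hA' : A ≤ n) (hB : m ≤ B) (hB' : n ≤ B) :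
    ∑ j ∈ Finset.Icc (A + 1) B, ((if j ≤ m then (1 : ℂ) else 0) - if j ≤ n then 1 else 0) =
      m - n := by
  rw [Finset.sum_sub_distrib, ← Finset.sum_filter, ← Finset.sum_filter, Finset.sum_const,
    Finset.sum_const]
  have h : ∀ m, A ≤ m → m ≤ B →
      ((Finset.card {j ∈ Finset.Icc (A + 1) B | j ≤ m} : ℕ) : ℂ) = m - A := by
    intro m hA hB
    have h1 : Finset.filter (fun j ↦ j ≤ m) (Finset.Icc (A + 1) B) = Finset.Icc (A + 1) m := by
      ext j
      simp only [Finset.mem_filter, Finset.mem_Icc]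
      omega
    have h2 : ((m + 1 - (A + 1)).toNat : ℤ) = m - A := by omega
    rw [h1, Int.card_Icc]
    exact_mod_cast congrArg (Int.cast : ℤ → ℂ) h2
  rw [nsmul_eq_mul, nsmul_eq_mul, h m hA hB, h n hA' hB']
  ring

variable {p : ℕ} [Fact p.Prime] [CharP k p]

namespace StirlingData

theorem ofReal_vol_eq (D : StirlingData k p) (m n : ℤ) :
    (D.vol m : ℂ) = (residueCard k : ℂ) ^ (m - n) * D.vol n := by
  rw [D.vol_eq m, D.vol_eq n, zpow_sub₀ residueCard_ne_zero]
  have : (residueCard k : ℂ) ^ n ≠ 0 := zpow_ne_zero _ residueCard_ne_zero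
  push_cast
  field_simp

theorem ofReal_vol_ne_zero (D : StirlingData k p) (n : ℤ) : (D.vol n : ℂ) ≠ 0 :=
  Complex.ofReal_ne_zero.mpr (D.vol_pos n).ne'

/-- Comparison of the two Haar measures on the shell of c, applied to the indicator of the disc: the
volume of the disc divided by the additive volume of the shell. -/
theorem unitHaar_real_unitDisc (D : StirlingData k p) {c : k} (hc : c ≠ 0) {n : ℤ}
    (hn : n < logAbs c) : ((unitHaar k).real (unitDisc c n) : ℂ) =
      (residueCard k : ℂ) ^ (n - logAbs c) * (residueCard k / (residueCard k - 1)) := by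
  classical
  set j := logAbs c with hj
  have h1 := D.setIntegral_shell hn (h := (disc c n).indicator 1) fun x b hb ↦ by
    simp only [Set.indicator_apply, mem_disc, add_sub_right_comm, Pi.one_apply,
      AddSubgroup.add_mem_cancel_right _ hb]
  have hsub : disc c n ⊆ (ball k j : Set k) \ ball k (j - 1) := fun x hx ↦ by
    obtain ⟨h2, h3⟩ := logAbs_eq_of_sub_mem hc hn (mem_disc.mp hx)
    rw [Set.mem_sdiff, SetLike.mem_coe, SetLike.mem_coe, mem_ball_iff h2, mem_ball_iff h2]
    omega
  have h2 : (fun t : kˣ ↦ (disc c n).indicator (1 : k → ℂ) t) = (unitDisc c n).indicator 1 := rfl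
  rw [h2, setIntegral_indicator (measurableSet_unitDisc c n),
    Set.inter_eq_right.mpr (unitDisc_subset_shell hc hn),
    setIntegral_indicator (isOpen_disc c n).measurableSet, Set.inter_eq_right.mpr hsub] at h1
  simp only [Pi.one_apply, setIntegral_const, μ_real_disc, Complex.real_smul, mul_one] at h1
  push_cast at h1
  rw [D.ofReal_vol_eq j n, D.ofReal_vol_eq (j - 1) n] at h1
  have hv := D.ofReal_vol_ne_zero n
  have hq := residueCard_ne_zero (k := k)
  have hq1 := residueCard_sub_one_ne_zero (k := k)
  have h3 : (residueCard k : ℂ) ^ (j - n) ≠ 0 := zpow_ne_zero _ hq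
  rw [show j - 1 - n = j - n - 1 by ring, zpow_sub_one₀ hq] at h1
  rw [show n - j = -(j - n) by ring, zpow_neg]
  field_simp at h1 ⊢
  linear_combination h1

theorem integrableOn_shell_e (D : StirlingData k p) (w : k) (j : ℤ) :
    IntegrableOn (fun t : kˣ ↦ D.e (-(w * t))) (shell k j) (unitHaar k) := by
  refine IntegrableOn.of_bound (by rw [unitHaar_shell]; exact ENNReal.one_lt_top) ?_ 1 ?_
  · refine Continuous.aestronglyMeasurable ?_
    exact D.isLocallyConstant_e.continuous.comp (continuous_const.mul Units.continuous_val).neg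
  -- The values of 𝐞 are p-th roots of unity because p annihilates k, so the integrand is bounded by
  -- 1.
  · refine ae_of_all _ fun t ↦ (Complex.norm_eq_one_of_pow_eq_one (n := p) ?_
      (Fact.out : p.Prime).ne_zero).le
    have := D.eChar.map_nsmul_eq_pow p (-(w * (t : k)))
    rw [nsmul_eq_mul, CharP.cast_eq_zero, zero_mul, AddChar.map_zero_eq_one] at this
    exact this.symm

/-- The shell is a difference of two balls, and the additive integral of 𝐞 over a ball is its volume
or zero. On the first shell beyond the kernel only the inner ball survives, which accounts for -1/(q
- 1). -/
theorem setIntegral_shell_e (D : StirlingData k p) {w : k} (hw : w ≠ 0) (j : ℤ) :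
    ∫ t in shell k j, D.e (-(w * t)) ∂unitHaar k =
      if j ≤ D.cond - logAbs w then 1 else
        if j = D.cond - logAbs w + 1 then -(1 / ((residueCard k : ℂ) - 1)) else 0 := by
  classical
  have h1 := D.setIntegral_shell (n := min (j - 1) (D.cond - logAbs w)) (j := j) (by omega)
    (h := fun x ↦ D.e (-(w * x))) fun x b hb ↦ by
      have h2 : D.e (-b * w) = 1 := D.e_eq_one_of_mem (n := logAbs w)
        (neg_mem (ball_mono (min_le_right _ _) hb)) ((mem_ball_iff hw).mpr le_rfl)
      rw [show -(w * (x + b)) = -(w * x) + -b * w by ring, e_add, h2, mul_one]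
  have hb : ∀ n, ∫ x in (ball k n : Set k), D.e (-(w * x)) ∂D.μ =
      if n ≤ D.cond - logAbs w then (D.vol n : ℂ) else 0 := by
    intro n
    have := D.setIntegral_disc_e (-w) 0 n
    rw [disc_zero] at this
    simp_rw [neg_mul] at this
    rw [this, mul_zero, neg_zero, e_zero, one_mul]
    refine if_congr ?_ rfl rfl
    rw [neg_mem_iff, mem_ball_iff hw]
    omega
  have hint : IntegrableOn (fun x ↦ D.e (-(w * x))) (ball k j : Set k) D.μ :=
    (D.isLocallyConstant_e.continuous.comp
      (continuous_const.mul continuous_id).neg).continuousOn.integrableOn_compact (isCompact_ball j)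
  rw [setIntegral_sdiff (isOpen_ball _).measurableSet hint (ball_mono (by omega)), hb, hb] at h1
  have hv := D.ofReal_vol_ne_zero (j - 1)
  have hq := residueCard_ne_zero (k := k)
  have hq1 := residueCard_sub_one_ne_zero (k := k)
  push_cast at h1
  rw [D.ofReal_vol_eq j (j - 1), sub_sub_cancel, zpow_one] at h1
  have h3 : (residueCard k : ℂ) * D.vol (j - 1) - D.vol (j - 1) ≠ 0 := by
    rw [← sub_one_mul]
    exact mul_ne_zero hq1 hv
  refine mul_left_cancel₀ h3 (h1.trans ?_)
  split_ifs with h4 h5 h6 h7 h8 <;> first | omega | skip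
  · ring
  · field_simp
    ring
  · ring

end StirlingData

end ShellIntegrals

/-! ### Counting points of cosets -/

section Counting

variable {k : Type*} [Field k] [ValuativeRel k] [TopologicalSpace k] [IsNonarchimedeanLocalField k]
  [MeasurableSpace k] [BorelSpace k]

/-- The points of the coset `l + L` in a disc. -/
noncomputable def cosetFin {L : AddSubgroup k} (hL : IsLattice L) (l c : k) (n : ℤ) : Finset k :=
  (hL.finite_coset_disc l c n).toFinset

theorem mem_cosetFin {L : AddSubgroup k} {hL : IsLattice L} {l c : k} {n : ℤ} {x : k} :
    x ∈ cosetFin hL l c n ↔ x - l ∈ L ∧ x ∈ disc c n :=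
  Set.Finite.mem_toFinset _

theorem cosetFin_congr {L : AddSubgroup k} (hL : IsLattice L) (l : k) {c d : k} {n : ℤ}
    (h : c - d ∈ ball k n) : cosetFin hL l c n = cosetFin hL l d n := by
  ext x
  rw [mem_cosetFin, mem_cosetFin, disc_congr h]

/-- The unit ball contains finitely many points of the coset, so the nonzero ones stay away from the
origin. -/
theorem exists_forall_mem_of_mem_ball {L : AddSubgroup k} (hL : IsLattice L) (l : k) :
    ∃ n : ℤ, ∀ x, x - l ∈ L → x ≠ 0 → n < logAbs x := by
  obtain ⟨n, hn⟩ := exists_ball_subset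
    (((hL.finite_coset_ball l 0).subset (Set.sdiff_subset (t := {0}))).isClosed.isOpen_compl.mem_nhds
      (x := (0 : k)) (by simp))
  refine ⟨min n 0, fun x hx hx0 ↦ ?_⟩
  by_contra! h
  have h1 : x ∈ ball k (min n 0) := (mem_ball_iff hx0).mpr h
  exact hn _ (min_le_left _ _) h1 ⟨⟨hx, ball_mono (min_le_right _ _) h1⟩, hx0⟩

theorem sum_shells_eq {h : kˣ → ℂ} (H : ℤ → ℂ) (I J : ℕ) (hI : ∀ j : ℤ, I < j → H j = 0)
    (hJ : ∀ j : ℤ, j < -J → H j = 0) (hH : ∀ t : kˣ, h t = H (logAbs (t : k))) :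
    Integrable h (unitHaar k) ∧ ∫ t, h t ∂unitHaar k =
      H 0 + ∑ i ∈ Finset.range I, H (i + 1) + ∑ i ∈ Finset.range J, H (-(i + 1)) := by
  classical
  have hs : ∀ j ∉ insert 0 ((Finset.range I).image (fun i : ℕ ↦ (i : ℤ) + 1) ∪
      (Finset.range J).image (fun i : ℕ ↦ -((i : ℤ) + 1))), H j = 0 := by
    intro j hj
    by_contra hne
    have h3 : j ≤ I := by
      by_contra! h4
      exact hne (hI j h4)
    have h4 : -(J : ℤ) ≤ j := by
      by_contra! h4
      exact hne (hJ j h4)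
    refine hj ?_
    rw [Finset.mem_insert, Finset.mem_union, Finset.mem_image, Finset.mem_image]
    rcases lt_trichotomy j 0 with h5 | h5 | h5
    · exact Or.inr (Or.inr ⟨(-j - 1).toNat, Finset.mem_range.mpr (by omega), by omega⟩)
    · exact Or.inl h5
    · exact Or.inr (Or.inl ⟨(j - 1).toNat, Finset.mem_range.mpr (by omega), by omega⟩)
  obtain ⟨h1, h2⟩ := integral_of_eq_logAbs (h := h) _ H hs hH
  refine ⟨h1, h2.trans ?_⟩
  rw [Finset.sum_insert, Finset.sum_union, Finset.sum_image, Finset.sum_image, add_assoc]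
  · intro a _ b _ hab
    simpa using hab
  · intro a _ b _ hab
    simpa using hab
  · rw [Finset.disjoint_left]
    intro x hx hx'
    obtain ⟨a, -, rfl⟩ := Finset.mem_image.mp hx
    obtain ⟨b, -, hb⟩ := Finset.mem_image.mp hx'
    omega
  · intro hmem
    rcases Finset.mem_union.mp hmem with h | h <;> obtain ⟨b, -, hb⟩ := Finset.mem_image.mp h <;>
      omega

theorem absv_one_sub_of_pos {t : kˣ} (h : 0 < logAbs (t : k)) :
    absv (1 - (t : k)) = (residueCard k : ℝ) ^ logAbs (t : k) := by
  rw [absv_sub_comm, ← absv_eq t.ne_zero]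
  refine absv_sub_eq_left ?_
  rw [absv_one, absv_eq t.ne_zero, ← zpow_zero (residueCard k : ℝ)]
  exact zpow_residueCard_lt.mpr h

theorem absv_one_sub_of_neg {t : kˣ} (h : logAbs (t : k) < 0) : absv (1 - (t : k)) = 1 := by
  rw [← absv_one (k := k)]
  refine absv_sub_eq_left ?_
  rw [absv_one, absv_eq t.ne_zero, ← zpow_zero (residueCard k : ℝ)]
  exact zpow_residueCard_lt.mpr h

theorem one_lt_absv_iff {t : kˣ} : 1 < absv (t : k) ↔ 0 < logAbs (t : k) := by
  rw [absv_eq t.ne_zero, ← zpow_zero (residueCard k : ℝ), zpow_residueCard_lt]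

theorem absv_eq_one_iff {t : kˣ} : absv (t : k) = 1 ↔ logAbs (t : k) = 0 := by
  rw [absv_eq t.ne_zero, ← zpow_zero (residueCard k : ℝ), zpow_residueCard_inj]

variable {p : ℕ} [Fact p.Prime] [CharP k p]

namespace StirlingData

/-- The points of the dual lattice in a ball. -/
noncomputable def dualFin (D : StirlingData k p) {L : AddSubgroup k} (hL : IsLattice L) (n : ℤ) :
    Finset k :=
  ((D.isLattice_perp hL).finite_inf_ball n).toFinset

theorem mem_dualFin {D : StirlingData k p} {L : AddSubgroup k} {hL : IsLattice L} {n : ℤ} {x : k} :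
    x ∈ D.dualFin hL n ↔ x ∈ D.perp L ∧ x ∈ ball k n :=
  Set.Finite.mem_toFinset _

/-- The quotient of the volumes of a ball and of a fundamental domain of a lattice. -/
noncomputable def density (D : StirlingData k p) {L : AddSubgroup k} (hL : IsLattice L) (n : ℤ) : ℂ :=
  ((D.vol n / D.covol hL : ℝ) : ℂ)

theorem density_add (D : StirlingData k p) {L : AddSubgroup k} (hL : IsLattice L) (n i : ℤ) :
    D.density hL (n + i) = (residueCard k : ℂ) ^ i * D.density hL n := by
  rw [density, density]
  push_cast
  rw [D.ofReal_vol_eq (n + i) n, add_sub_cancel_left, mul_div_assoc]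

/-- Poisson summation for the coset translated by -c, at s = 0. -/
theorem card_cosetFin (D : StirlingData k p) {L : AddSubgroup k} (hL : IsLattice L) (l c : k)
    (n : ℤ) : ((cosetFin hL l c n).card : ℂ) =
      D.density hL n * ∑ ξ ∈ D.dualFin hL (D.cond - n), D.e ((l - c) * ξ) := by
  have h1 := D.poisson hL (l - c) 0 n
  have h2 : ∑ᶠ x ∈ {x | x - (l - c) ∈ L ∧ x ∈ ball k n}, D.e (0 * x) =
      ((cosetFin hL l c n).card : ℂ) := by
    rw [← nsmul_one, ← Finset.sum_const, ← finsum_mem_coe_finset]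
    symm
    refine finsum_mem_eq_of_bijOn (fun x ↦ x - c) ⟨fun x hx ↦ ?_, fun x _ y _ h ↦ ?_,
      fun x hx ↦ ⟨x + c, ?_, add_sub_cancel_right x c⟩⟩ fun x _ ↦ by rw [zero_mul, e_zero]
    · obtain ⟨h3, h4⟩ := mem_cosetFin.mp hx
      exact ⟨by rwa [sub_sub_sub_cancel_right], h4⟩
    · exact sub_left_injective h
    · refine mem_cosetFin.mpr ⟨?_, ?_⟩
      · rw [show x + c - l = x - (l - c) by ring]
        exact hx.1
      · rw [mem_disc, add_sub_cancel_right]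
        exact hx.2
  have h3 : ∑ᶠ ξ ∈ {ξ | ξ ∈ D.perp L ∧ ξ ∈ disc 0 (D.cond - n)}, D.e ((l - c) * ξ) =
      ∑ ξ ∈ D.dualFin hL (D.cond - n), D.e ((l - c) * ξ) := by
    rw [← finsum_mem_coe_finset]
    refine finsum_mem_congr (Set.ext fun x ↦ ?_) fun _ _ ↦ rfl
    rw [Finset.mem_coe, mem_dualFin, disc_zero]
    rfl
  have hV : (D.covol hL : ℂ) ≠ 0 := Complex.ofReal_ne_zero.mpr (D.covol_pos hL).ne'
  rw [h2, h3] at h1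
  rw [density]
  push_cast
  field_simp
  rw [← h1, mul_comm]

theorem dualFin_eq_singleton (D : StirlingData k p) {L : AddSubgroup k} (hL : IsLattice L) :
    ∃ m : ℤ, ∀ n ≤ m, D.dualFin hL n = {0} := by
  obtain ⟨m, hm⟩ := (D.isLattice_perp hL).exists_inf_ball
  refine ⟨m, fun n hn ↦ Finset.ext fun x ↦ ?_⟩
  rw [mem_dualFin, Finset.mem_singleton, ← AddSubgroup.mem_inf, hm n hn, AddSubgroup.mem_bot]

/-- For a large disc the dual ball contains only ξ = 0, so the count is exactly the expected one,
uniformly in the centre. -/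
theorem exists_card_cosetFin_eq (D : StirlingData k p) {L : AddSubgroup k} (hL : IsLattice L)
    (l : k) : ∃ m : ℤ, ∀ n, m ≤ n → ∀ c, ((cosetFin hL l c n).card : ℂ) = D.density hL n := by
  obtain ⟨m, hm⟩ := D.dualFin_eq_singleton hL
  refine ⟨D.cond - m, fun n hn c ↦ ?_⟩
  rw [card_cosetFin, hm _ (by omega), Finset.sum_singleton, mul_zero, e_zero, mul_one]

/-- The condition t⁻¹x ∈ w + r𝒪 says that x lies in the dilated disc t(w + r𝒪); this makes the theta
symbol a point count. -/
theorem primDensity_section (L : AddSubgroup k) (hL : IsLattice L) (l w : k) (R : ℤ) (t : kˣ)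
    (x : k) : primDensity L l w R x ((t : k)⁻¹ * x) =
      (cosetFin hL l (t * w) (R + logAbs (t : k)) : Set k).indicator 1 x := by
  classical
  have h : (t : k)⁻¹ * x ∈ disc w R ↔ x ∈ disc (t * w) (R + logAbs (t : k)) := by
    rw [mem_disc, mem_disc, show x - t * w = t * ((t : k)⁻¹ * x - w) by
      rw [mul_sub, mul_inv_cancel_left₀ t.ne_zero], mem_ball_mul_iff t.ne_zero, add_sub_cancel_right]
  simp only [primDensity, Set.indicator_apply, h, Set.mem_ofPred_eq, Pi.one_apply, Finset.mem_coe,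
    mem_cosetFin, ite_and]
  split_ifs <;> simp

theorem theta_primLattice (D : StirlingData k p) {L : AddSubgroup k} (hL : IsLattice L) (l w : k)
    (r t : kˣ) : theta t (D.primLattice hL l w r) =
      (cosetFin hL l (t * w) (logAbs (r : k) + logAbs (t : k))).card := by
  rw [theta, (D.isStar_primLattice hL l w r).lowerStar_eq]
  simp_rw [primDensity_section L hL]
  rw [← finsum_mem_def, finsum_mem_coe_finset]
  simp

theorem finite_support_section {L : AddSubgroup k} (hL : IsLattice L)
    (l w : k) (R : ℤ) (t : kˣ) :
    (Function.support fun x ↦ primDensity L l w R x ((t : k)⁻¹ * x)).Finite := by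
  refine (cosetFin hL l (t * w) (R + logAbs (t : k))).finite_toSet.subset fun x hx ↦ ?_
  rw [Function.mem_support, primDensity_section L hL] at hx
  exact Set.mem_of_indicator_ne_zero hx

theorem finsum_primDensity_ord (L : AddSubgroup k) (hL : IsLattice L) (l w : k) (R : ℤ) (t : kˣ) :
    ∑ᶠ x : kˣ, primDensity L l w R x ((t : k)⁻¹ * x) * ordv (x : k) =
      -∑ x ∈ cosetFin hL l (t * w) (R + logAbs (t : k)), (logAbs x : ℂ) := by
  rw [finsum_units (fun x ↦ primDensity L l w R x ((t : k)⁻¹ * x) * ordv x)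
    (by rw [ordv_eq_neg_logAbs]; simp), ← Finset.sum_neg_distrib, ← finsum_mem_coe_finset,
    finsum_mem_def]
  refine finsum_congr fun x ↦ ?_
  rw [primDensity_section L hL, ordv_eq_neg_logAbs]
  by_cases hx : x ∈ (cosetFin hL l (t * w) (R + logAbs (t : k)) : Set k)
  · simp [hx]
  · rw [Set.indicator_of_notMem hx, Set.indicator_of_notMem hx, zero_mul]

theorem absv_mul_density (D : StirlingData k p) {L : AddSubgroup k} (hL : IsLattice L) (R : ℤ)
    (a : kˣ) : (absv (a : k) : ℂ) * D.density hL R = D.density hL (R + logAbs (a : k)) := by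
  rw [density_add, absv_eq a.ne_zero]
  push_cast
  rfl

/-- Along the line (ξ, aξ) the two characters merge into 𝐞((l - aw)ξ), and the factor ‖a‖ rescales
the density of points. -/
theorem dualDensity_section (D : StirlingData k p) {L : AddSubgroup k} (hL : IsLattice L) (l w : k)
    (R : ℤ) (a : kˣ) (ξ : k) : absv (a : k) * D.dualDensity hL l w R ξ (a * ξ) =
      D.density hL (R + logAbs (a : k)) *
        (D.dualFin hL (D.cond - (R + logAbs (a : k))) : Set k).indicator
          (fun ξ ↦ D.e ((l - a * w) * ξ)) ξ := by
  classical
  rw [dualDensity, ← density, ← mul_assoc, absv_mul_density]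
  congr 1
  have h1 : a * ξ ∈ ball k (D.cond - R) ↔ ξ ∈ ball k (D.cond - (R + logAbs (a : k))) := by
    rw [mem_ball_mul_iff a.ne_zero, sub_sub]
  simp only [Set.indicator_apply, SetLike.mem_coe, h1, mem_dualFin, ite_and]
  rw [show (l - a * w) * ξ = l * ξ + -(w * (a * ξ)) by ring, e_add]
  split_ifs <;> simp

theorem finite_support_dual_section (D : StirlingData k p) {L : AddSubgroup k} (hL : IsLattice L)
    (l w : k) (R : ℤ) (a : kˣ) :
    (Function.support fun ξ : kˣ ↦ D.dualDensity hL l w R ξ (a * ξ)).Finite := by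
  refine ((D.dualFin hL (D.cond - (R + logAbs (a : k)))).finite_toSet.preimage
    (f := fun ξ : kˣ ↦ (ξ : k)) Units.val_injective.injOn).subset fun ξ hξ ↦ ?_
  have h1 : (absv (a : k) : ℂ) * D.dualDensity hL l w R ξ (a * ξ) ≠ 0 :=
    mul_ne_zero (Complex.ofReal_ne_zero.mpr (absv_pos a).ne') hξ
  rw [dualDensity_section] at h1
  have h2 : (ξ : k) ∈ (D.dualFin hL (D.cond - (R + logAbs (a : k))) : Set k) :=
    Set.mem_of_indicator_ne_zero (right_ne_zero_of_mul h1)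
  exact h2

theorem finsum_dualDensity_ord (D : StirlingData k p) {L : AddSubgroup k} (hL : IsLattice L)
    (l w : k) (R : ℤ) (a : kˣ) :
    ∑ᶠ ξ : kˣ, absv (a : k) * D.dualDensity hL l w R ξ (a * ξ) * ordv (ξ : k) =
      -(D.density hL (R + logAbs (a : k)) *
        ∑ ξ ∈ D.dualFin hL (D.cond - (R + logAbs (a : k))),
          (logAbs ξ : ℂ) * D.e ((l - a * w) * ξ)) := by
  rw [finsum_units (fun ξ ↦ absv (a : k) * D.dualDensity hL l w R ξ (a * ξ) * ordv ξ)
    (by rw [ordv_eq_neg_logAbs]; simp), Finset.mul_sum, ← Finset.sum_neg_distrib,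
    ← finsum_mem_coe_finset, finsum_mem_def]
  refine finsum_congr fun x ↦ ?_
  rw [dualDensity_section, ordv_eq_neg_logAbs]
  by_cases hx : x ∈ (D.dualFin hL (D.cond - (R + logAbs (a : k))) : Set k)
  · rw [Set.indicator_of_mem hx, Set.indicator_of_mem hx]
    push_cast
    ring
  · rw [Set.indicator_of_notMem hx, Set.indicator_of_notMem hx, mul_zero, zero_mul]

/-- Write -log ξ as (m - log ξ) - m, where m = cond - R is the index of the outer dual ball. The
layers of the first part are character sums over the nonzero points of smaller dual balls, that is,
point counts by `card_cosetFin` minus the term ξ = 0; the constant m gives the last term. Any large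
I is allowed, so that the truncation can be shared with the theta integral. -/
theorem exists_dual_layer (D : StirlingData k p) {L : AddSubgroup k} (hL : IsLattice L) (R : ℤ) :
    ∃ I₀ : ℕ, ∀ I : ℕ, I₀ ≤ I → ∀ l c : k,
      -(D.density hL R * ∑ ξ ∈ D.dualFin hL (D.cond - R), (logAbs ξ : ℂ) * D.e ((l - c) * ξ)) =
        ∑ i ∈ Finset.range I, ((residueCard k : ℂ) ^ (-(i + 1) : ℤ) *
          (cosetFin hL l c (R + (i + 1))).card - D.density hL R) -
        (D.cond - R) * ((cosetFin hL l c R).card - D.density hL R) := by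
  classical
  obtain ⟨m₀, hm₀⟩ := exists_forall_mem_of_mem_ball (D.isLattice_perp hL) 0
  -- Below index m₀ the dual lattice has no nonzero points, so further layers are empty.
  refine ⟨(D.cond - R - m₀).toNat, fun I hI l c ↦ ?_⟩
  set m := D.cond - R with hm
  set X := (D.dualFin hL m).erase 0 with hX
  set E : k → ℂ := fun ξ ↦ D.e ((l - c) * ξ) with hE
  have hE0 : E 0 = 1 := by rw [hE]; simp [e_zero]
  have h0 : ∀ n, (0 : k) ∈ D.dualFin hL n := fun n ↦ mem_dualFin.mpr ⟨zero_mem _, zero_mem _⟩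
  have hM : ∀ n, ∑ ξ ∈ (D.dualFin hL n).erase 0, E ξ = ∑ ξ ∈ D.dualFin hL n, E ξ - 1 := fun n ↦ by
    rw [← Finset.add_sum_erase _ _ (h0 n), hE0, add_sub_cancel_left]
  have hlayer := sum_layer X logAbs E m I (fun x hx ↦ ?_) fun x hx ↦ ?_
  · have h1 : ∀ i : ℕ, ∑ x ∈ X with logAbs x ≤ m - (i + 1), E x =
        ∑ ξ ∈ D.dualFin hL (m - (i + 1)), E ξ - 1 := by
      intro i
      rw [← hM]
      refine Finset.sum_congr (Finset.ext fun x ↦ ?_) fun _ _ ↦ rfl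
      rw [Finset.mem_filter, Finset.mem_erase, Finset.mem_erase, mem_dualFin, mem_dualFin]
      constructor
      · rintro ⟨⟨h2, h3, -⟩, h4⟩
        exact ⟨h2, h3, (mem_ball_iff h2).mpr h4⟩
      · rintro ⟨h2, h3, h4⟩
        exact ⟨⟨h2, h3, ball_mono (by omega) h4⟩, (mem_ball_iff h2).mp h4⟩
    have h2 : ∑ x ∈ X, ((m - logAbs x : ℤ) : ℂ) * E x =
        m * (∑ ξ ∈ D.dualFin hL m, E ξ - 1) - ∑ ξ ∈ D.dualFin hL m, (logAbs ξ : ℂ) * E ξ := by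
      rw [← hM, ← Finset.add_sum_erase _ (fun ξ ↦ (logAbs ξ : ℂ) * E ξ) (h0 m), logAbs_zero,
        Int.cast_zero, zero_mul, zero_add, Finset.mul_sum, ← Finset.sum_sub_distrib]
      refine Finset.sum_congr rfl fun x _ ↦ ?_
      push_cast
      ring
    simp_rw [h1] at hlayer
    rw [h2] at hlayer
    have h3 : ∀ i : ℕ, (residueCard k : ℂ) ^ (-(i + 1) : ℤ) *
        (cosetFin hL l c (R + (i + 1))).card - D.density hL R =
        D.density hL R * (∑ ξ ∈ D.dualFin hL (m - (i + 1)), E ξ - 1) := by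
      intro i
      rw [card_cosetFin, density_add, ← sub_sub, ← hm, zpow_neg, mul_assoc (_ ^ _),
        inv_mul_cancel_left₀ (zpow_ne_zero _ residueCard_ne_zero)]
      ring
    simp_rw [h3]
    rw [← Finset.mul_sum, ← hlayer, card_cosetFin, ← hm]
    have h4 : (D.cond : ℂ) - R = m := by rw [hm]; push_cast; ring
    rw [h4]
    ring
  · obtain ⟨h1, h2⟩ := Finset.mem_erase.mp hx
    exact (mem_ball_iff h1).mp (mem_dualFin.mp h2).2
  · obtain ⟨h1, h2⟩ := Finset.mem_erase.mp hx
    have := hm₀ x (by rw [sub_zero]; exact (mem_dualFin.mp h2).1) h1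
    omega

end StirlingData

end Counting

/-! ### The integral of the theta symbol of a primitive rigged virtual lattice -/

section ThetaIntegral

variable {k : Type*} [Field k] [ValuativeRel k] [TopologicalSpace k] [IsNonarchimedeanLocalField k]
  [MeasurableSpace k] [BorelSpace k]

open Classical in
theorem card_cosetFin_zero {L : AddSubgroup k} (hL : IsLattice L) (l : k) (n : ℤ) :
    ((cosetFin hL l 0 n).card : ℂ) =
      ((cosetFin hL l 0 n).erase 0).card + {x | x - l ∈ L}.indicator 1 (0 : k) := by
  classical
  by_cases h : (0 : k) - l ∈ L
  · have h0 : (0 : k) ∈ cosetFin hL l 0 n := mem_cosetFin.mpr ⟨h, mem_disc_self 0 n⟩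
    have h1 : (0 : k) ∈ {x | x - l ∈ L} := h
    rw [Set.indicator_of_mem h1, ← Finset.card_erase_add_one h0]
    push_cast
    rfl
  · have h0 : (0 : k) ∉ cosetFin hL l 0 n := fun h' ↦ h (mem_cosetFin.mp h').1
    have h1 : (0 : k) ∉ {x | x - l ∈ L} := h
    rw [Set.indicator_of_notMem h1, Finset.erase_eq_of_notMem h0, add_zero]

/-- Summation by parts: it passes from counts in annuli, the increments of b, to counts in discs. -/
theorem sum_abel (q : ℂ) (hq : q ≠ 0) (hq1 : q - 1 ≠ 0) (b : ℕ → ℂ) (I : ℕ) :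
    (∑ i ∈ Finset.range I, q ^ (-(i + 1) : ℤ) * (b (i + 1) - b i)) * (q / (q - 1)) =
      ∑ i ∈ Finset.range I, q ^ (-(i + 1) : ℤ) * b (i + 1) - b 0 / (q - 1) +
        q ^ (-I : ℤ) * b I / (q - 1) := by
  induction I with
  | zero => simp
  | succ I ih =>
    have h1 : q ^ (-I : ℤ) = q ^ (-(I + 1) : ℤ) * q := by
      rw [← zpow_add_one₀ hq]
      congr 1
      ring
    rw [Finset.sum_range_succ, Finset.sum_range_succ, add_mul, ih, h1]
    push_cast
    field_simp
    ring

variable {p : ℕ} [Fact p.Prime] [CharP k p]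

namespace StirlingData

/-- The integrand attached to the function counting points of `l + L` in the discs
`t c + t ρ 𝒪`, where `‖ρ‖ = q ^ R`. -/
noncomputable def countIntegrand (D : StirlingData k p) {L : AddSubgroup k} (hL : IsLattice L)
    (l c : k) (R : ℤ) (t : kˣ) : ℂ :=
  ((cosetFin hL l (t * c) (R + logAbs (t : k))).card -
    (if 0 < logAbs (t : k) then (residueCard k : ℂ) ^ logAbs (t : k) * D.density hL R
      else if logAbs (t : k) = 0 then ((cosetFin hL l c R).card : ℂ)
      else primDensity L l c R 0 0)) / (absv (1 - (t : k)) : ℂ)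

/-- The disc contains 0, so its dilate by t is a ball depending only on ‖t‖ and the integral is a
sum over shells. Shells with ‖t‖ > 1 give the sum over i, the unit shell gives zero, and shells with
‖t‖ < 1 give by layers the sum of R - log x over the nonzero points x. -/
theorem integral_countIntegrand_of_mem (D : StirlingData k p) {L : AddSubgroup k}
    (hL : IsLattice L) (l : k) {c : k} {R : ℤ} (hc : c ∈ ball k R) :
    ∃ I₀ : ℕ, ∀ I : ℕ, I₀ ≤ I →
      Integrable (D.countIntegrand hL l c R) (unitHaar k) ∧
      ∫ t, D.countIntegrand hL l c R t ∂unitHaar k =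
        R * ((cosetFin hL l c R).card - {x | x - l ∈ L}.indicator 1 0) -
        ∑ x ∈ cosetFin hL l c R, (logAbs x : ℂ) +
        ∑ i ∈ Finset.range I, ((residueCard k : ℂ) ^ (-(i + 1) : ℤ) *
          (cosetFin hL l c (R + (i + 1))).card - D.density hL R) := by
  classical
  obtain ⟨m₁, hm₁⟩ := D.exists_card_cosetFin_eq hL l
  obtain ⟨n₀, hn₀⟩ := exists_forall_mem_of_mem_ball hL l
  set ε : ℂ := {x | x - l ∈ L}.indicator 1 0 with hε
  have hcc : ∀ n, R ≤ n → cosetFin hL l c n = cosetFin hL l 0 n := fun n hn ↦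
    cosetFin_congr hL l (by rw [sub_zero]; exact ball_mono hn hc)
  -- Beyond J shells below the unit one, the dilated ball contains no nonzero point of the coset.
  let J := (R - n₀).toNat
  let H : ℤ → ℂ := fun j ↦ if 0 < j then (residueCard k : ℂ) ^ (-j) *
      (cosetFin hL l 0 (R + j)).card - D.density hL R else
    if j = 0 then 0 else (cosetFin hL l 0 (R + j)).card - ε
  have hprim : primDensity L l c R 0 0 = ε := by
    have h1 : (0 : k) ∈ disc c R := by
      rw [mem_disc, zero_sub]
      exact neg_mem hc
    rw [primDensity, Set.indicator_of_mem h1, Pi.one_apply, mul_one]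
  -- From this index on the count equals its expected value, and the shells contribute nothing.
  refine ⟨(m₁ - R).toNat, fun I hI ↦ ?_⟩
  have hH : ∀ t : kˣ, D.countIntegrand hL l c R t = H (logAbs (t : k)) := by
    intro t
    have h1 : cosetFin hL l (t * c) (R + logAbs (t : k)) =
        cosetFin hL l 0 (R + logAbs (t : k)) := by
      refine cosetFin_congr hL l ?_
      rw [sub_zero, mem_ball_mul_iff t.ne_zero, add_sub_cancel_right]
      exact hc
    rw [countIntegrand, h1, hprim]
    simp only [H]
    split_ifs with h2 h3
    · rw [absv_one_sub_of_pos h2, zpow_neg]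
      have h4 : (residueCard k : ℂ) ^ logAbs (t : k) ≠ 0 := zpow_ne_zero _ residueCard_ne_zero
      push_cast
      field_simp
    · rw [h3, add_zero, hcc R le_rfl, sub_self, zero_div]
    · rw [absv_one_sub_of_neg (by omega), Complex.ofReal_one, div_one]
  have hint := sum_shells_eq H I J (fun j hj ↦ ?_) (fun j hj ↦ ?_) hH
  · obtain ⟨h1, h2⟩ := hint
    refine ⟨h1, h2.trans ?_⟩
    have h3 : H 0 = 0 := by simp [H]
    have h4 : ∀ i : ℕ, H (i + 1) = (residueCard k : ℂ) ^ (-(i + 1) : ℤ) *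
        (cosetFin hL l c (R + (i + 1))).card - D.density hL R := fun i ↦ by
      rw [hcc _ (by omega)]
      simp only [H]
      rw [if_pos (by omega)]
    set X := (cosetFin hL l 0 R).erase 0 with hX
    have h5 : ∀ i : ℕ, H (-(i + 1)) = ∑ x ∈ X with logAbs x ≤ R - (i + 1), 1 := fun i ↦ by
      simp only [H]
      rw [if_neg (by omega), if_neg (by omega), card_cosetFin_zero, add_sub_cancel_right,
        Finset.sum_const, nsmul_one]
      refine congrArg (fun s : Finset k ↦ (s.card : ℂ)) (Finset.ext fun x ↦ ?_)
      rw [hX, Finset.mem_filter, Finset.mem_erase, Finset.mem_erase, mem_cosetFin, mem_cosetFin,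
        disc_zero, disc_zero, SetLike.mem_coe, SetLike.mem_coe]
      constructor
      · rintro ⟨h6, h7, h8⟩
        exact ⟨⟨h6, h7, ball_mono (by omega) h8⟩, by have := (mem_ball_iff h6).mp h8; omega⟩
      · rintro ⟨⟨h6, h7, h8⟩, h9⟩
        exact ⟨h6, h7, (mem_ball_iff h6).mpr (by omega)⟩
    have hlayer := sum_layer X logAbs (fun _ ↦ 1) R J (fun x hx ↦ ?_) fun x hx ↦ ?_
    · rw [h3, Finset.sum_congr rfl fun i _ ↦ h4 i, Finset.sum_congr rfl fun i _ ↦ h5 i, ← hlayer,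
        hcc R le_rfl, card_cosetFin_zero, add_sub_cancel_right, zero_add, add_comm]
      congr 1
      have h6 : ∑ x ∈ cosetFin hL l 0 R, (logAbs x : ℂ) = ∑ x ∈ X, (logAbs x : ℂ) := by
        rw [hX, Finset.sum_erase]
        rw [logAbs_zero, Int.cast_zero]
      rw [h6, ← nsmul_one (Finset.card _), ← Finset.sum_const, Finset.mul_sum,
        ← Finset.sum_sub_distrib]
      refine Finset.sum_congr rfl fun x _ ↦ ?_
      push_cast
      ring
    · obtain ⟨h6, h7⟩ := Finset.mem_erase.mp hx
      have := (mem_cosetFin.mp h7).2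
      rw [disc_zero] at this
      exact (mem_ball_iff h6).mp this
    · obtain ⟨h6, h7⟩ := Finset.mem_erase.mp hx
      have := hn₀ x (mem_cosetFin.mp h7).1 h6
      omega
  · simp only [H]
    rw [if_pos (by omega), hm₁ _ (by omega), density_add, zpow_neg,
      inv_mul_cancel_left₀ (zpow_ne_zero _ residueCard_ne_zero), sub_self]
  · simp only [H]
    rw [if_neg (by omega), if_neg (by omega), card_cosetFin_zero, add_sub_cancel_right]
    rw [Nat.cast_eq_zero, Finset.card_eq_zero, Finset.eq_empty_iff_forall_notMem]
    intro x hx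
    obtain ⟨h6, h7⟩ := Finset.mem_erase.mp hx
    obtain ⟨h8, h9⟩ := mem_cosetFin.mp h7
    rw [disc_zero] at h9
    have h10 := (mem_ball_iff h6).mp h9
    have := hn₀ x h8 h6
    omega

end StirlingData

end ThetaIntegral

/-! ### The theta integral for discs avoiding the origin -/

section ThetaIntegralOffCenter

variable {k : Type*} [Field k] [ValuativeRel k] [TopologicalSpace k] [IsNonarchimedeanLocalField k]
  [MeasurableSpace k] [BorelSpace k]

theorem logAbs_neg (x : k) : logAbs (-x) = logAbs x := by
  rcases eq_or_ne x 0 with rfl | hx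
  · rw [neg_zero]
  · rw [logAbs_eq_iff (neg_ne_zero.mpr hx), absv_neg, absv_eq hx]

theorem notMem_ball_iff {x : k} {n : ℤ} : x ∉ ball k n ↔ x ≠ 0 ∧ n < logAbs x := by
  rcases eq_or_ne x 0 with rfl | hx
  · simp [zero_mem]
  · rw [mem_ball_iff hx, not_le]
    exact ⟨fun h ↦ ⟨hx, h⟩, fun h ↦ h.2⟩

theorem logAbs_one : logAbs (1 : k) = 0 := by
  rw [logAbs_eq_iff one_ne_zero, absv_one, zpow_zero]

theorem logAbs_eq_zero_of_mem_unitDisc_one {n : ℤ} (hn : n < 0) {t : kˣ}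
    (ht : t ∈ unitDisc (1 : k) n) : logAbs (t : k) = 0 := by
  rw [← logAbs_one (k := k)]
  exact unitDisc_subset_shell one_ne_zero (by rw [logAbs_one]; exact hn) ht

theorem unitDisc_mono (c : k) {m n : ℤ} (h : m ≤ n) : unitDisc c m ⊆ unitDisc c n :=
  Set.preimage_mono (disc_mono c h)

variable {p : ℕ} [Fact p.Prime] [CharP k p]

namespace StirlingData

theorem integral_indicator_unitDisc (D : StirlingData k p) {c : k} (hc : c ≠ 0) {n : ℤ}
    (hn : n < logAbs c) (z : ℂ) :
    Integrable ((unitDisc c n).indicator fun _ ↦ z) (unitHaar k) ∧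
      ∫ t, (unitDisc c n).indicator (fun _ ↦ z) t ∂unitHaar k =
        (residueCard k : ℂ) ^ (n - logAbs c) * (residueCard k / (residueCard k - 1)) * z := by
  refine ⟨(integrable_indicator_iff (measurableSet_unitDisc c n)).mpr
    ((integrableOn_const_iff (C := z)).mpr (Or.inr (unitHaar_unitDisc_lt_top hc hn))), ?_⟩
  rw [integral_indicator (measurableSet_unitDisc c n), setIntegral_const, Complex.real_smul,
    D.unitHaar_real_unitDisc hc hn]

open Classical in
/-- The function `1 / ‖1 - t‖` on the units `t` outside of a disc around `1`. -/
noncomputable def unitPole (d : ℕ) (t : kˣ) : ℂ :=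
  if logAbs (t : k) = 0 ∧ t ∉ unitDisc (1 : k) (-(d + 1)) then (absv (1 - (t : k)) : ℂ)⁻¹ else 0

theorem unitPole_zero : unitPole (k := k) 0 =
    (shell k 0).indicator (fun _ ↦ 1) - (unitDisc (1 : k) (-1)).indicator (fun _ ↦ 1) := by
  classical
  funext t
  rw [Pi.sub_apply, unitPole, Set.indicator_apply, Set.indicator_apply, mem_shell, Nat.cast_zero,
    zero_add]
  by_cases h2 : t ∈ unitDisc (1 : k) (-1)
  · have h1 := logAbs_eq_zero_of_mem_unitDisc_one (by norm_num) h2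
    rw [if_neg fun h ↦ h.2 h2, if_pos h1, if_pos h2, sub_self]
  · by_cases h1 : logAbs (t : k) = 0
    · rw [if_pos ⟨h1, h2⟩, if_pos h1, if_neg h2, sub_zero]
      have h2' : (t : k) - 1 ∉ ball k (-1) := h2
      obtain ⟨h3, h4⟩ := notMem_ball_iff.mp h2'
      have h5 : (t : k) - 1 ∈ ball k 0 :=
        sub_mem ((mem_ball_iff t.ne_zero).mpr h1.le)
          ((mem_ball_iff one_ne_zero).mpr logAbs_one.le)
      have h6 := (mem_ball_iff h3).mp h5
      rw [absv_sub_comm, absv_eq h3, show logAbs ((t : k) - 1) = 0 by omega]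
      simp
    · rw [if_neg fun h ↦ h1 h.1, if_neg h1, if_neg h2, sub_zero]

/-- The new region is the annulus ‖1 - t‖ = q^(-(d+1)), written as the difference of two discs. -/
theorem unitPole_succ (d : ℕ) : unitPole (k := k) (d + 1) = unitPole d +
    ((unitDisc (1 : k) (-(d + 1))).indicator (fun _ ↦ (residueCard k : ℂ) ^ (d + 1)) -
    (unitDisc (1 : k) (-(d + 2))).indicator (fun _ ↦ (residueCard k : ℂ) ^ (d + 1))) := by
  classical
  funext t
  rw [Pi.add_apply, Pi.sub_apply, unitPole, unitPole, Set.indicator_apply, Set.indicator_apply, show -(((d + 1 : ℕ) : ℤ) + 1) = -(d + 2) by push_cast; ring]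
  by_cases h2 : t ∈ unitDisc (1 : k) (-(d + 2))
  · have h3 : t ∈ unitDisc (1 : k) (-(d + 1)) := unitDisc_mono 1 (by omega) h2
    rw [if_neg fun h ↦ h.2 h2, if_neg fun h ↦ h.2 h3, if_pos h3, if_pos h2, sub_self, add_zero]
  · by_cases h3 : t ∈ unitDisc (1 : k) (-(d + 1))
    · have h1 := logAbs_eq_zero_of_mem_unitDisc_one (by omega) h3
      have h2' : (t : k) - 1 ∉ ball k (-(d + 2)) := h2
      obtain ⟨h4, h5⟩ := notMem_ball_iff.mp h2'
      have h6 := (mem_ball_iff h4).mp (mem_unitDisc.mp h3)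
      rw [if_pos ⟨h1, h2⟩, if_neg fun h ↦ h.2 h3, if_pos h3, if_neg h2, absv_sub_comm, absv_eq h4,
        show logAbs ((t : k) - 1) = -((d + 1 : ℕ) : ℤ) by push_cast; omega, zpow_neg, zpow_natCast]
      simp
    · rw [if_neg h3, if_neg h2, sub_zero, add_zero]
      exact if_congr ⟨fun h ↦ ⟨h.1, h3⟩, fun h ↦ ⟨h.1, h2⟩⟩ rfl rfl

/-- Each annulus about 1 inside the unit shell contributes exactly 1; the region ‖t‖ = ‖1 - t‖ = 1
contributes 1 - 1/(q - 1). -/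
theorem integral_unitPole (D : StirlingData k p) (d : ℕ) :
    Integrable (unitPole (k := k) d) (unitHaar k) ∧
      ∫ t, unitPole d t ∂unitHaar k = d + 1 - 1 / ((residueCard k : ℂ) - 1) := by
  have hq := residueCard_ne_zero (k := k)
  have hq1 := residueCard_sub_one_ne_zero (k := k)
  induction d with
  | zero =>
    have h1 := D.integral_indicator_unitDisc (c := 1) one_ne_zero (n := -1)
      (by rw [logAbs_one]; norm_num) 1
    have h2 : Integrable ((shell k 0).indicator fun _ ↦ (1 : ℂ)) (unitHaar k) :=
      (integrable_indicator_iff (measurableSet_shell 0)).mpr (integrableOn_shell_const 0 1)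
    rw [unitPole_zero]
    refine ⟨h2.sub h1.1, ?_⟩
    rw [integral_sub' h2 h1.1, h1.2, integral_indicator (measurableSet_shell 0),
      setIntegral_shell_const, logAbs_one]
    simp only [sub_zero, Int.reduceNeg, zpow_neg, zpow_one, Nat.cast_zero, zero_add, mul_one]
    field_simp
  | succ d ih =>
    have h1 := D.integral_indicator_unitDisc (c := 1) one_ne_zero (n := -(d + 1))
      (by rw [logAbs_one]; omega) ((residueCard k : ℂ) ^ (d + 1))
    have h2 := D.integral_indicator_unitDisc (c := 1) one_ne_zero (n := -(d + 2))
      (by rw [logAbs_one]; omega) ((residueCard k : ℂ) ^ (d + 1))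
    rw [unitPole_succ]
    refine ⟨ih.1.add (h1.1.sub h2.1), ?_⟩
    rw [integral_add' ih.1 (h1.1.sub h2.1), integral_sub' h1.1 h2.1, h1.2, h2.2, ih.2, logAbs_one,
      sub_zero, sub_zero, show (-((d : ℤ) + 2)) = -(d + 1) - 1 by ring, zpow_sub_one₀ hq,
      show (-((d : ℤ) + 1)) = -((d + 1 : ℕ) : ℤ) by push_cast; ring, zpow_neg, zpow_natCast]
    have h3 : (residueCard k : ℂ) ^ (d + 1) ≠ 0 := pow_ne_zero _ hq
    push_cast
    field_simp
    ring

/-- A point x ≠ 0 lies in the dilate of the disc by t exactly when t lies in the disc of radius q^R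
‖x‖/‖c‖² about x/c. If moreover x is outside the original disc, then ‖x - c‖ = ‖c‖ ‖1 - t‖, so 1/‖1
- t‖ is constant there. For t within q^R/‖c‖ of 1 the dilated disc is the original one, and no
admissible point is counted. -/
theorem sum_indicator_unitDisc {L : AddSubgroup k}
    (hL : IsLattice L) (l : k) {c : k} {R : ℤ} (hc0 : c ≠ 0) (hc : R < logAbs c) {I : ℤ}
    (hI : logAbs c ≤ R + I) {t : kˣ} (ht : logAbs (t : k) ≤ R + I - logAbs c) :
    open Classical in
    ∑ x ∈ cosetFin hL l c (R + I) with x ≠ 0 ∧ x ∉ disc c R,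
      (unitDisc (x / c) (R - logAbs c + (logAbs x - logAbs c))).indicator
        (fun _ ↦ (residueCard k : ℂ) ^ (logAbs c - logAbs (x - c))) t =
      if t ∈ unitDisc (1 : k) (R - logAbs c) then 0 else
        ((cosetFin hL l (t * c) (R + logAbs (t : k))).card : ℂ) / absv (1 - (t : k)) := by
  classical
  set W := logAbs c with hW
  have key : ∀ x, x ≠ 0 → t ∈ unitDisc (x / c) (R - W + (logAbs x - W)) →
      logAbs (t : k) = logAbs x - W ∧ x - t * c ∈ ball k (R + logAbs (t : k)) := by
    intro x hx h
    have h1 : logAbs (x / c) = logAbs x - W := logAbs_div hx hc0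
    have h2 := (logAbs_eq_of_sub_mem (div_ne_zero hx hc0) (by omega) (mem_unitDisc.mp h)).2
    refine ⟨h2.trans h1, ?_⟩
    rw [← neg_mem_iff, show -(x - t * c) = c * (t - x / c) by field_simp; ring,
      mem_ball_mul_iff hc0, ← hW, h2, h1]
    convert mem_unitDisc.mp h using 2
    ring
  split_ifs with h1
  · refine Finset.sum_eq_zero fun x hx ↦ Set.indicator_of_notMem (fun h ↦ ?_) _
    obtain ⟨hx1, hx0, hx2⟩ := Finset.mem_filter.mp hx
    obtain ⟨h3, h4⟩ := key x hx0 h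
    have h5 := logAbs_eq_zero_of_mem_unitDisc_one (by omega) h1
    refine hx2 (mem_disc.mpr ?_)
    rw [h5, add_zero] at h4
    have h6 : c * ((t : k) - 1) ∈ ball k R := (mem_ball_mul_iff hc0).mpr (mem_unitDisc.mp h1)
    have := add_mem h4 h6
    rwa [show x - t * c + c * (t - 1) = x - c by ring] at this
  · have h1' : (t : k) - 1 ∉ ball k (R - W) := h1
    obtain ⟨ht1, ht2⟩ := notMem_ball_iff.mp h1'
    -- The radius of the dilated disc is smaller than the distance from tc to c, so all its points
    -- are equally far from c.
    have hlog : R + logAbs (t : k) < W + logAbs ((t : k) - 1) := by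
      rcases lt_or_ge 0 (logAbs (t : k)) with h | h
      · have := absv_one_sub_of_pos h
        rw [absv_sub_comm, ← logAbs_eq_iff ht1] at this
        omega
      · omega
    have hpt : ∀ x ∈ cosetFin hL l (t * c) (R + logAbs (t : k)),
        x ≠ 0 ∧ logAbs x = W + logAbs (t : k) ∧ x - c ≠ 0 ∧
          logAbs (x - c) = W + logAbs ((t : k) - 1) := by
      intro x hx
      have h2 := mem_disc.mp (mem_cosetFin.mp hx).2
      have h3 : logAbs (t * c) = W + logAbs (t : k) := by
        rw [logAbs_mul t.ne_zero hc0, ← hW, add_comm]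
      have h4 : logAbs (c * ((t : k) - 1)) = W + logAbs ((t : k) - 1) := by
        rw [logAbs_mul hc0 ht1, ← hW]
      obtain ⟨h5, h6⟩ := logAbs_eq_of_sub_mem (mul_ne_zero t.ne_zero hc0) (by omega) h2
      obtain ⟨h7, h8⟩ := logAbs_eq_of_sub_mem (x := x - c) (mul_ne_zero hc0 ht1)
        (n := R + logAbs (t : k)) (by omega)
        (by rwa [show x - c - c * (t - 1) = x - t * c by ring])
      exact ⟨h5, h6.trans h3, h7, h8.trans h4⟩
    have hset : (cosetFin hL l c (R + I)).filter (fun x ↦ (x ≠ 0 ∧ x ∉ disc c R) ∧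
        t ∈ unitDisc (x / c) (R - W + (logAbs x - W))) =
        cosetFin hL l (t * c) (R + logAbs (t : k)) := by
      ext x
      rw [Finset.mem_filter]
      constructor
      · rintro ⟨hx1, ⟨hx0, hx2⟩, hx3⟩
        exact mem_cosetFin.mpr ⟨(mem_cosetFin.mp hx1).1, (key x hx0 hx3).2⟩
      · intro hx
        obtain ⟨h2, h3, h4, h5⟩ := hpt x hx
        obtain ⟨h6, h7⟩ := mem_cosetFin.mp hx
        refine ⟨mem_cosetFin.mpr ⟨h6, mem_disc.mpr (sub_mem ((mem_ball_iff h2).mpr (by omega))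
          ((mem_ball_iff hc0).mpr (by omega)))⟩, ⟨h2, fun h ↦ ?_⟩, ?_⟩
        · have := (mem_ball_iff h4).mp (mem_disc.mp h)
          omega
        · rw [mem_unitDisc]
          have h8 : c * ((t : k) - x / c) ∈ ball k (R + logAbs (t : k)) := by
            rw [show c * ((t : k) - x / c) = -(x - t * c) by field_simp; ring, neg_mem_iff]
            exact h7
          rw [mem_ball_mul_iff hc0] at h8
          convert h8 using 2
          omega
    simp_rw [Set.indicator_apply]
    rw [← Finset.sum_filter, Finset.filter_filter, hset, Finset.sum_congr rfl (g := fun _ ↦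
      (absv (1 - (t : k)) : ℂ)⁻¹) fun x hx ↦ ?_, Finset.sum_const, nsmul_eq_mul, div_eq_mul_inv]
    rw [(hpt x hx).2.2.2, absv_sub_comm, absv_eq ht1, sub_add_cancel_left, zpow_neg]
    push_cast
    rfl

/-- The points are sorted by their distance from c; an annulus holds the difference of two
successive disc counts. The excluded origin would contribute ‖c‖/‖0 - c‖ = 1 if it belonged to the
coset, hence the subtracted indicator. -/
theorem sum_annuli_cosetFin {L : AddSubgroup k} (hL : IsLattice L) (l : k) {c : k} {R : ℤ}
    (hc0 : c ≠ 0) (hc : R < logAbs c) {I : ℕ} (hI : logAbs c ≤ R + I) :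
    open Classical in
    (∑ x ∈ cosetFin hL l c (R + I) with x ≠ 0 ∧ x ∉ disc c R,
      (residueCard k : ℂ) ^ (logAbs c - logAbs (x - c))) =
      (residueCard k : ℂ) ^ (logAbs c - R) * (∑ i ∈ Finset.range I,
        (residueCard k : ℂ) ^ (-(i + 1) : ℤ) * ((cosetFin hL l c (R + (i + 1))).card -
          (cosetFin hL l c (R + i)).card)) - {x | x - l ∈ L}.indicator 1 0 := by
  classical
  set X := (cosetFin hL l c (R + I)).filter (fun x ↦ x ∉ disc c R) with hX
  have h0 : ∑ x ∈ cosetFin hL l c (R + I) with x ≠ 0 ∧ x ∉ disc c R,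
      (residueCard k : ℂ) ^ (logAbs c - logAbs (x - c)) =
      ∑ x ∈ X, (residueCard k : ℂ) ^ (logAbs c - logAbs (x - c)) -
        {x | x - l ∈ L}.indicator 1 0 := by
    have h1 : (cosetFin hL l c (R + I)).filter (fun x ↦ x ≠ 0 ∧ x ∉ disc c R) = X.erase 0 := by
      ext x
      simp only [hX, Finset.mem_filter, Finset.mem_erase]
      tauto
    rw [h1]
    have h2 : (0 : k) ∈ X ↔ (0 : k) - l ∈ L := by
      rw [hX, Finset.mem_filter, mem_cosetFin, mem_disc, mem_disc, zero_sub c, neg_mem_iff,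
        neg_mem_iff, mem_ball_iff hc0, mem_ball_iff hc0]
      exact ⟨fun h ↦ h.1.1, fun h ↦ ⟨⟨h, hI⟩, by omega⟩⟩
    by_cases h3 : (0 : k) - l ∈ L
    · rw [← Finset.add_sum_erase _ _ (h2.mpr h3), zero_sub, logAbs_neg, sub_self, zpow_zero,
        Set.indicator_of_mem (show (0 : k) ∈ {x | x - l ∈ L} from h3), Pi.one_apply,
        add_sub_cancel_left]
    · rw [Set.indicator_of_notMem (show (0 : k) ∉ {x | x - l ∈ L} from h3), sub_zero,
        Finset.erase_eq_of_notMem fun h ↦ h3 (h2.mp h)]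
  have hmem : ∀ x ∈ X, x - c ≠ 0 ∧ R < logAbs (x - c) ∧ logAbs (x - c) ≤ R + I := fun x hx ↦ by
    obtain ⟨h1, h2⟩ := Finset.mem_filter.mp hx
    obtain ⟨h3, h4⟩ := notMem_ball_iff.mp fun h ↦ h2 (mem_disc.mpr h)
    exact ⟨h3, h4, (mem_ball_iff h3).mp (mem_disc.mp (mem_cosetFin.mp h1).2)⟩
  have h1 := sum_annuli X (fun x ↦ logAbs (x - c))
    (fun n ↦ (residueCard k : ℂ) ^ (logAbs c - n)) R I (fun x hx ↦ (hmem x hx).2.1)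
    fun x hx ↦ (hmem x hx).2.2
  rw [h0, h1, Finset.mul_sum]
  congr 1
  refine Finset.sum_congr rfl fun i hi ↦ ?_
  have hi' := Finset.mem_range.mp hi
  have h2 : X.filter (fun x ↦ logAbs (x - c) = R + (i + 1)) =
      cosetFin hL l c (R + (i + 1)) \ cosetFin hL l c (R + i) := by
    ext x
    rw [Finset.mem_filter, Finset.mem_sdiff]
    constructor
    · rintro ⟨h3, h4⟩
      obtain ⟨h5, -, -⟩ := hmem x h3
      have h6 := (mem_cosetFin.mp (Finset.mem_filter.mp h3).1).1
      refine ⟨mem_cosetFin.mpr ⟨h6, (mem_ball_iff h5).mpr h4.le⟩, fun h7 ↦ ?_⟩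
      have := (mem_ball_iff h5).mp (mem_disc.mp (mem_cosetFin.mp h7).2)
      omega
    · rintro ⟨h3, h4⟩
      obtain ⟨h5, h6⟩ := mem_cosetFin.mp h3
      obtain ⟨h7, h8⟩ := notMem_ball_iff.mp fun h ↦ h4 (mem_cosetFin.mpr ⟨h5, mem_disc.mpr h⟩)
      have h9 := (mem_ball_iff h7).mp (mem_disc.mp h6)
      refine ⟨Finset.mem_filter.mpr ⟨mem_cosetFin.mpr ⟨h5, disc_mono c (by omega) h6⟩,
        fun h ↦ ?_⟩, by omega⟩
      have := (mem_ball_iff h7).mp (mem_disc.mp h)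
      omega
  have h3 : cosetFin hL l c (R + i) ⊆ cosetFin hL l c (R + (i + 1)) := fun x hx ↦
    mem_cosetFin.mpr ⟨(mem_cosetFin.mp hx).1, disc_mono c (by omega) (mem_cosetFin.mp hx).2⟩
  rw [h2, Finset.card_sdiff_of_subset h3, Nat.cast_sub (Finset.card_le_card h3), ← mul_assoc,
    ← zpow_add₀ residueCard_ne_zero]
  congr 2
  ring

/-- The integrand splits into the contributions G of single points, the constant -density on the
shells 1 to J, and -N times the pole 1/‖1 - t‖ on the units, N being the count for the original
disc. The point contributions form a weighted sum over annuli, which `sum_abel` converts into the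
sum over discs. -/
theorem integral_countIntegrand_of_notMem (D : StirlingData k p) {L : AddSubgroup k}
    (hL : IsLattice L) (l : k) {c : k} {R : ℤ} (hc0 : c ≠ 0) (hc : R < logAbs c) :
    ∃ I₀ : ℕ, ∀ I : ℕ, I₀ ≤ I →
      Integrable (D.countIntegrand hL l c R) (unitHaar k) ∧
      ∫ t, D.countIntegrand hL l c R t ∂unitHaar k =
        ∑ i ∈ Finset.range I, ((residueCard k : ℂ) ^ (-(i + 1) : ℤ) *
          (cosetFin hL l c (R + (i + 1))).card - D.density hL R) -
        (logAbs c - R) * ((cosetFin hL l c R).card - D.density hL R) +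
        D.density hL R / (residueCard k - 1) -
        {x | x - l ∈ L}.indicator 1 0 *
          ((residueCard k : ℂ) ^ (R - logAbs c) * (residueCard k / (residueCard k - 1))) := by
  classical
  obtain ⟨m₁, hm₁⟩ := D.exists_card_cosetFin_eq hL l
  set W := logAbs c with hW
  -- For t within q^(R-W) = q^(-(d+1)) of 1 the dilated disc equals the original one and the
  -- integrand vanishes; the pole is needed only outside that disc.
  set d := (W - R - 1).toNat with hd
  have hdW : R - W = -(d + 1) := by omega
  -- Large enough that R + J ≥ m₁ for J = R + I - W, so the count has its expected value on the
  -- shells beyond J; also W ≤ R + I, so the origin falls within the disc of index R + I about c.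
  refine ⟨(m₁ - R).toNat + (W - R).toNat, fun I hI ↦ ?_⟩
  set u : ℂ := (residueCard k : ℂ) ^ (R - W) * (residueCard k / (residueCard k - 1)) with hu
  set X := (cosetFin hL l c (R + I)).filter (fun x ↦ x ≠ 0 ∧ x ∉ disc c R) with hX
  set G : k → kˣ → ℂ := fun x ↦ (unitDisc (x / c) (R - W + (logAbs x - W))).indicator
        (fun _ ↦ (residueCard k : ℂ) ^ (W - logAbs (x - c))) with hG
  set J : ℤ := R + I - W with hJ
  set P : kˣ → ℂ := fun t ↦ if 0 < logAbs (t : k) ∧ logAbs (t : k) ≤ J then D.density hL R else 0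
    with hP
  have hprim : primDensity L l c R 0 0 = 0 := by
    have h1 : (0 : k) ∉ disc c R := by
      rw [mem_disc, zero_sub, neg_mem_iff, mem_ball_iff hc0]
      omega
    rw [primDensity, Set.indicator_of_notMem h1, mul_zero]
  have hGint : ∀ x ∈ X, Integrable (G x) (unitHaar k) ∧
      ∫ t, G x t ∂unitHaar k = u * (residueCard k : ℂ) ^ (W - logAbs (x - c)) := by
    intro x hx
    have hx0 := (Finset.mem_filter.mp hx).2.1
    have h1 : logAbs (x / c) = logAbs x - W := logAbs_div hx0 hc0
    have := D.integral_indicator_unitDisc (div_ne_zero hx0 hc0)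
      (n := R - W + (logAbs x - W)) (by omega) ((residueCard k : ℂ) ^ (W - logAbs (x - c)))
    rw [h1, add_sub_cancel_right] at this
    exact this
  have hPint := integral_of_eq_logAbs (h := P) (Finset.Icc 1 J)
    (fun j ↦ if 0 < j ∧ j ≤ J then D.density hL R else 0)
    (fun j hj ↦ if_neg fun h ↦ hj (Finset.mem_Icc.mpr ⟨h.1, h.2⟩)) fun _ ↦ rfl
  have hPsum : ∑ j ∈ Finset.Icc 1 J, (if 0 < j ∧ j ≤ J then D.density hL R else 0) =
      J * D.density hL R := by
    rw [Finset.sum_congr rfl (g := fun _ ↦ D.density hL R) fun j hj ↦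
      if_pos ⟨by have := (Finset.mem_Icc.mp hj).1; omega, (Finset.mem_Icc.mp hj).2⟩, Finset.sum_const,
      Int.card_Icc, nsmul_eq_mul]
    congr 1
    have : ((J + 1 - 1).toNat : ℤ) = J := by omega
    exact_mod_cast congrArg (Int.cast : ℤ → ℂ) this
  have hUint := D.integral_unitPole (k := k) d
  have hid : D.countIntegrand hL l c R = (fun t ↦ ∑ x ∈ X, G x t) - P -
      fun t ↦ (cosetFin hL l c R).card * unitPole d t := by
    funext t
    change _ = ∑ x ∈ X, G x t - P t - (cosetFin hL l c R).card * unitPole d t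
    rw [countIntegrand, hprim]
    rcases lt_or_ge J (logAbs (t : k)) with hj | hj
    · have h1 : ∑ x ∈ X, G x t = 0 := by
        refine Finset.sum_eq_zero fun x hx ↦ Set.indicator_of_notMem (fun h ↦ ?_) _
        obtain ⟨hx1, hx0, hx2⟩ := Finset.mem_filter.mp hx
        have h1 : logAbs (x / c) = logAbs x - W := logAbs_div hx0 hc0
        have h2 := (logAbs_eq_of_sub_mem (div_ne_zero hx0 hc0) (by omega) (mem_unitDisc.mp h)).2
        have h3 : x ∈ ball k (R + I) := by
          have := add_mem (mem_disc.mp (mem_cosetFin.mp hx1).2)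
            ((mem_ball_iff hc0).mpr (show logAbs c ≤ R + I by omega))
          rwa [sub_add_cancel] at this
        have h4 := (mem_ball_iff hx0).mp h3
        omega
      have h2 : unitPole d t = 0 := if_neg fun h ↦ by have := h.1; omega
      have h3 : P t = 0 := if_neg fun h ↦ by have := h.2; omega
      rw [h1, h2, h3, if_pos (by omega), hm₁ _ (by omega), density_add, sub_self]
      simp
    · have h1 := sum_indicator_unitDisc hL l hc0 hc (I := I) (by omega) hj
      rw [h1]
      have h2 : unitPole d t = if logAbs (t : k) = 0 ∧ t ∉ unitDisc (1 : k) (R - W) then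
        (absv (1 - (t : k)) : ℂ)⁻¹ else 0 := by rw [hdW]; rfl
      rw [h2]
      simp only [hP]
      rcases lt_trichotomy (logAbs (t : k)) 0 with h3 | h3 | h3
      · have h4 : t ∉ unitDisc (1 : k) (R - W) := fun h ↦ by
          have := logAbs_eq_zero_of_mem_unitDisc_one (by omega) h
          omega
        rw [if_neg (by omega), if_neg (by omega), if_neg h4, if_neg (by omega), if_neg (by omega)]
        simp
      · by_cases h4 : t ∈ unitDisc (1 : k) (R - W)
        · have h5 : cosetFin hL l (t * c) (R + logAbs (t : k)) = cosetFin hL l c R := by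
            rw [h3, add_zero]
            refine cosetFin_congr hL l ?_
            rw [show (t : k) * c - c = c * (t - 1) by ring, mem_ball_mul_iff hc0]
            exact mem_unitDisc.mp h4
          rw [if_neg (by omega), if_pos h3, if_pos h4, if_neg (by omega),
            if_neg (by tauto), h5]
          simp
        · rw [if_neg (by omega), if_pos h3, if_neg h4, if_neg (by omega), if_pos ⟨h3, h4⟩]
          ring
      · have h4 : t ∉ unitDisc (1 : k) (R - W) := fun h ↦ by
          have := logAbs_eq_zero_of_mem_unitDisc_one (by omega) h
          omega
        have h5 : (residueCard k : ℂ) ^ logAbs (t : k) ≠ 0 := zpow_ne_zero _ residueCard_ne_zero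
        rw [if_pos h3, if_neg h4, if_pos ⟨h3, hj⟩, if_neg (by omega), absv_one_sub_of_pos h3]
        push_cast
        field_simp
        ring
  have hS : Integrable (fun t ↦ ∑ x ∈ X, G x t) (unitHaar k) :=
    integrable_finsetSum _ fun x hx ↦ (hGint x hx).1
  rw [hid]
  refine ⟨(hS.sub hPint.1).sub (hUint.1.const_mul _), ?_⟩
  rw [integral_sub' (hS.sub hPint.1) (hUint.1.const_mul _), integral_sub' hS hPint.1,
    integral_finsetSum _ fun x hx ↦ (hGint x hx).1, hPint.2, hPsum, integral_const_mul, hUint.2,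
    Finset.sum_congr rfl fun x hx ↦ (hGint x hx).2, ← Finset.mul_sum,
    sum_annuli_cosetFin hL l hc0 hc (by omega)]
  have hq := residueCard_ne_zero (k := k)
  have hq1 := residueCard_sub_one_ne_zero (k := k)
  have habel := sum_abel (residueCard k : ℂ) hq hq1 (fun i ↦ (cosetFin hL l c (R + i)).card) I
  have hlast : (residueCard k : ℂ) ^ (-I : ℤ) * (cosetFin hL l c (R + I)).card = D.density hL R := by
    rw [hm₁ _ (by omega), density_add, zpow_neg, inv_mul_cancel_left₀ (zpow_ne_zero _ hq)]
  push_cast at habel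
  rw [hlast, add_zero] at habel
  have hcancel : (residueCard k : ℂ) ^ (R - W) * (residueCard k : ℂ) ^ (W - R) = 1 := by
    rw [← zpow_add₀ hq]
    simp
  have hdC : (d : ℂ) + 1 = W - R := by
    have : ((d : ℤ) + 1) = W - R := by omega
    exact_mod_cast congrArg (Int.cast : ℤ → ℂ) this
  rw [hdC, Finset.sum_sub_distrib, Finset.sum_const, Finset.card_range, nsmul_eq_mul]
  have hJC : (J : ℂ) = R + I - W := by rw [hJ]; push_cast; ring
  rw [hJC, mul_sub u, hu]
  linear_combination habel + (∑ i ∈ Finset.range I,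
        (residueCard k : ℂ) ^ (-(i + 1) : ℤ) * (((cosetFin hL l c (R + (i + 1))).card : ℂ) -
          (cosetFin hL l c (R + i)).card)) * (residueCard k / (residueCard k - 1)) * hcancel

end StirlingData

end ThetaIntegralOffCenter

/-! ### The Stirling formula for primitive rigged virtual lattices -/

section Primitive

variable {k : Type*} [Field k] [ValuativeRel k] [TopologicalSpace k] [IsNonarchimedeanLocalField k]
  [MeasurableSpace k] [BorelSpace k]

theorem indicator_integers (t : kˣ) : (𝒪[k] : Set k).indicator (fun _ ↦ (1 : ℂ)) (t : k) =
    if logAbs (t : k) ≤ 0 then 1 else 0 := by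
  rw [← coe_ball_zero]
  by_cases h : logAbs (t : k) ≤ 0
  · rw [Set.indicator_of_mem (SetLike.mem_coe.mpr ((mem_ball_iff t.ne_zero).mpr h)), if_pos h]
  · rw [Set.indicator_of_notMem (fun h' ↦ h ((mem_ball_iff t.ne_zero).mp h')), if_neg h]

theorem indicator_ball (n : ℤ) (g : k → ℂ) (t : kˣ) : (ball k n : Set k).indicator g (t : k) =
    if logAbs (t : k) ≤ n then g t else 0 := by
  by_cases h : logAbs (t : k) ≤ n
  · rw [Set.indicator_of_mem (SetLike.mem_coe.mpr ((mem_ball_iff t.ne_zero).mpr h)), if_pos h]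
  · rw [Set.indicator_of_notMem (fun h' ↦ h ((mem_ball_iff t.ne_zero).mp h')), if_neg h]

theorem integral_ball_sub_integers (n : ℤ) :
    Integrable (fun t : kˣ ↦ (if logAbs (t : k) ≤ n then (1 : ℂ) else 0) -
      if logAbs (t : k) ≤ 0 then 1 else 0) (unitHaar k) ∧
    ∫ t : kˣ, ((if logAbs (t : k) ≤ n then (1 : ℂ) else 0) -
      if logAbs (t : k) ≤ 0 then 1 else 0) ∂unitHaar k = n := by
  have h := integral_of_eq_logAbs (k := k) (h := fun t : kˣ ↦
    (if logAbs (t : k) ≤ n then (1 : ℂ) else 0) - if logAbs (t : k) ≤ 0 then 1 else 0)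
    (Finset.Icc (min n 0 + 1) (max n 0))
    (fun j ↦ (if j ≤ n then (1 : ℂ) else 0) - if j ≤ 0 then 1 else 0) (fun j hj ↦ ?_) fun _ ↦ rfl
  · refine ⟨h.1, h.2.trans ?_⟩
    rw [sum_Icc_sub (min_le_left _ _) (min_le_right _ _) (le_max_left _ _) (le_max_right _ _)]
    simp
  · rw [Finset.mem_Icc] at hj
    split_ifs <;> first | omega | simp

variable {p : ℕ} [Fact p.Prime] [CharP k p]

namespace StirlingData

theorem integral_ball_e_of_mem (D : StirlingData k p) {w : k} {n : ℤ}
    (hw : w ∈ ball k (D.cond - n)) :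
    Integrable (fun t : kˣ ↦ (ball k n : Set k).indicator (fun t ↦ D.e (-(w * t))) (t : k) -
      (𝒪[k] : Set k).indicator (fun _ ↦ 1) (t : k)) (unitHaar k) ∧
    ∫ t : kˣ, ((ball k n : Set k).indicator (fun t ↦ D.e (-(w * t))) (t : k) -
      (𝒪[k] : Set k).indicator (fun _ ↦ 1) (t : k)) ∂unitHaar k = n := by
  have h : ∀ t : kˣ, (ball k n : Set k).indicator (fun t ↦ D.e (-(w * t))) (t : k) -
      (𝒪[k] : Set k).indicator (fun _ ↦ 1) (t : k) =
      (if logAbs (t : k) ≤ n then (1 : ℂ) else 0) - if logAbs (t : k) ≤ 0 then 1 else 0 := by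
    intro t
    rw [indicator_integers, indicator_ball]
    split_ifs with h1
    all_goals first | rfl | skip
    all_goals
      rw [show -(w * (t : k)) = -w * t by ring,
        D.e_eq_one_of_mem (n := n) (neg_mem hw) ((mem_ball_iff t.ne_zero).mpr h1)]
  simp_rw [h]
  exact integral_ball_sub_integers n

/-- Up to index m = cond - log w the character is trivial and shells are merely counted. Shell m + 1
contributes -1/(q - 1), and larger shells contribute nothing. -/
theorem integral_ball_e_of_notMem (D : StirlingData k p) {w : k} {n : ℤ} (hw0 : w ≠ 0)
    (hw : D.cond - n < logAbs w) :
    Integrable (fun t : kˣ ↦ (ball k n : Set k).indicator (fun t ↦ D.e (-(w * t))) (t : k) -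
      (𝒪[k] : Set k).indicator (fun _ ↦ 1) (t : k)) (unitHaar k) ∧
    ∫ t : kˣ, ((ball k n : Set k).indicator (fun t ↦ D.e (-(w * t))) (t : k) -
      (𝒪[k] : Set k).indicator (fun _ ↦ 1) (t : k)) ∂unitHaar k =
        D.cond - logAbs w - 1 / ((residueCard k : ℂ) - 1) := by
  set m := D.cond - logAbs w with hm
  set F : kˣ → ℂ := fun t ↦ if m + 1 ≤ logAbs (t : k) ∧ logAbs (t : k) ≤ n then
    D.e (-(w * t)) else 0 with hF
  have h1 := integral_ball_sub_integers (k := k) m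
  have hFj : ∀ j ∈ Finset.Icc (m + 1) n, Set.EqOn F (fun t ↦ D.e (-(w * t))) (shell k j) :=
    fun j hj t ht ↦ by
      have hj' := Finset.mem_Icc.mp hj
      rw [← mem_shell.mp ht] at hj'
      exact if_pos hj'
  have h2 := integral_eq_sum_shell (h := F) (Finset.Icc (m + 1) n)
    (fun t ht ↦ if_neg fun h ↦ ht (Finset.mem_Icc.mpr h)) fun j hj ↦
      (D.integrableOn_shell_e w j).congr_fun (hFj j hj).symm (measurableSet_shell j)
  have h3 : (fun t : kˣ ↦ (ball k n : Set k).indicator (fun t ↦ D.e (-(w * t))) (t : k) -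
      (𝒪[k] : Set k).indicator (fun _ ↦ 1) (t : k)) =
      (fun t : kˣ ↦ (if logAbs (t : k) ≤ m then (1 : ℂ) else 0) -
      if logAbs (t : k) ≤ 0 then 1 else 0) + F := by
    funext t
    have hFt : F t = if m + 1 ≤ logAbs (t : k) ∧ logAbs (t : k) ≤ n then
      D.e (-(w * t)) else 0 := rfl
    rw [indicator_integers, indicator_ball, Pi.add_apply, hFt]
    rcases le_or_gt (logAbs (t : k)) m with h4 | h4
    · rw [if_pos (show logAbs (t : k) ≤ n by omega), if_pos h4, if_neg (show ¬(_ ∧ _) by omega),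
        add_zero, show -(w * (t : k)) = -(t : k) * w by ring,
        D.e_eq_one_of_mem (n := logAbs w) (neg_mem ((mem_ball_iff t.ne_zero).mpr h4))
          ((mem_ball_iff hw0).mpr le_rfl)]
    · rw [if_neg (show ¬ logAbs (t : k) ≤ m by omega)]
      by_cases h5 : logAbs (t : k) ≤ n
      · rw [if_pos h5,
          if_pos (show m + 1 ≤ logAbs (t : k) ∧ logAbs (t : k) ≤ n from ⟨by omega, h5⟩)]
        ring
      · rw [if_neg h5,
          if_neg (show ¬(m + 1 ≤ logAbs (t : k) ∧ logAbs (t : k) ≤ n) from fun h ↦ h5 h.2)]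
        ring
  rw [h3]
  refine ⟨h1.1.add h2.1, ?_⟩
  have h4 : ∫ t, F t ∂unitHaar k = -(1 / ((residueCard k : ℂ) - 1)) := by
    rw [h2.2, Finset.sum_congr rfl (g := fun j ↦ if j = m + 1 then
      -(1 / ((residueCard k : ℂ) - 1)) else 0) fun j hj ↦ ?_, Finset.sum_ite_eq',
      if_pos (Finset.mem_Icc.mpr ⟨le_rfl, by omega⟩)]
    have hj' := Finset.mem_Icc.mp hj
    rw [setIntegral_congr_fun (measurableSet_shell j) (hFj j hj), D.setIntegral_shell_e hw0,
      if_neg (by omega)]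
  have h5 := integral_add' h1.1 h2.1
  rw [h1.2, h4] at h5
  have h6 : ((m : ℤ) : ℂ) = D.cond - logAbs w := by rw [hm]; push_cast; ring
  rw [h6] at h5
  exact h5.trans (by ring)

theorem axisIntegrand_primLattice (D : StirlingData k p) {L : AddSubgroup k} (hL : IsLattice L)
    (l w : k) (r : kˣ) : axisIntegrand (D.primLattice hL l w r) = fun t : kˣ ↦
      {x | x - l ∈ L}.indicator (1 : k → ℂ) 0 *
        ((disc w (logAbs (r : k))).indicator (1 : k → ℂ) (t : k) -
        (disc w (logAbs (r : k))).indicator (1 : k → ℂ) 0 * (𝒪[k] : Set k).indicator (fun _ ↦ 1) (t : k)) := by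
  funext t
  rw [axisIntegrand, (D.isStar_primLattice hL l w r).lowerStar_eq, primDensity, primDensity]
  ring

theorem axisIntegrand_𝒢_primLattice (D : StirlingData k p) {L : AddSubgroup k} (hL : IsLattice L)
    (l w : k) (r : kˣ) : axisIntegrand (D.𝒢 (D.primLattice hL l w r)) = fun t : kˣ ↦
      D.density hL (logAbs (r : k)) *
        ((ball k (D.cond - logAbs (r : k)) : Set k).indicator (fun t ↦ D.e (-(w * t))) (t : k) -
          (𝒪[k] : Set k).indicator (fun _ ↦ 1) (t : k)) := by
  funext t
  have h0 : (0 : k) ∈ (D.perp L : Set k) := zero_mem _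
  have h1 : (0 : k) ∈ (ball k (D.cond - logAbs (r : k)) : Set k) := zero_mem _
  rw [axisIntegrand, (D.isStar_𝒢_primLattice hL l w r).lowerStar_eq, dualDensity, dualDensity,
    Set.indicator_of_mem h0, Set.indicator_of_mem h1, mul_zero, mul_zero, neg_zero, e_zero,
    ← density]
  ring

theorem lowerStar_𝒢_primLattice_zero (D : StirlingData k p) {L : AddSubgroup k}
    (hL : IsLattice L) (l w : k) (r : kˣ) :
    lowerStar (D.𝒢 (D.primLattice hL l w r)) 0 0 = D.density hL (logAbs (r : k)) := by
  have h0 : (0 : k) ∈ (D.perp L : Set k) := zero_mem _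
  have h1 : (0 : k) ∈ (ball k (D.cond - logAbs (r : k)) : Set k) := zero_mem _
  rw [(D.isStar_𝒢_primLattice hL l w r).lowerStar_eq, dualDensity,
    Set.indicator_of_mem h0, Set.indicator_of_mem h1, mul_zero, mul_zero, neg_zero, e_zero,
    ← density]
  ring

theorem zero_mem_disc_mul_iff {w : k} {n : ℤ} {a : kˣ} :
    (0 : k) ∈ disc (a * w) (n + logAbs (a : k)) ↔ (0 : k) ∈ disc w n := by
  rw [mem_disc, mem_disc, zero_sub, zero_sub, neg_mem_iff, neg_mem_iff, mem_ball_mul_iff a.ne_zero,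
    add_sub_cancel_right]

theorem primDensity_zero_mul (L : AddSubgroup k) (l w : k) (n : ℤ) (a : kˣ) :
    primDensity L l (a * w) (n + logAbs (a : k)) 0 0 = primDensity L l w n 0 0 := by
  classical
  simp only [primDensity, Set.indicator_apply, zero_mem_disc_mul_iff]

theorem thetaIntegrand_primLattice (D : StirlingData k p) {L : AddSubgroup k} (hL : IsLattice L)
    (l w : k) (r a : kˣ) : D.thetaIntegrand a (D.primLattice hL l w r) =
      D.countIntegrand hL l (a * w) (logAbs (r : k) + logAbs (a : k)) := by
  classical
  funext t
  have h1 : theta (a * t) (D.primLattice hL l w r) =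
      (cosetFin hL l (t * (a * w)) (logAbs (r : k) + logAbs (a : k) + logAbs (t : k))).card := by
    rw [theta_primLattice, Units.val_mul, logAbs_mul a.ne_zero t.ne_zero, add_assoc,
      show (a : k) * t * w = t * (a * w) by ring]
  rw [thetaIntegrand, countIntegrand, h1, thetaCorrection, theta_primLattice,
    lowerStar_𝒢_primLattice_zero, (D.isStar_primLattice hL l w r).lowerStar_eq,
    primDensity_zero_mul]
  simp only [one_lt_absv_iff, absv_eq_one_iff]
  have h2 : (absv ((a * t : kˣ) : k) : ℂ) * D.density hL (logAbs (r : k)) =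
      (residueCard k : ℂ) ^ logAbs (t : k) *
        D.density hL (logAbs (r : k) + logAbs (a : k)) := by
    rw [← absv_mul_density, absv_units_mul, absv_eq t.ne_zero]
    push_cast
    ring
  rw [h2]

/-- The dual sum and the theta integral contain the same truncated sum, which cancels once I is the
larger of the two thresholds. If w ∈ r𝒪, the axis integrals count shells. If not, every point
counted by Θ(a, Φ) has norm ‖aw‖, and the axis integrals are a multiplicative disc volume and a
truncated character integral, whose 1/(q - 1) terms cancel those of the theta integral. -/
theorem stirling_primLattice (D : StirlingData k p) {L : AddSubgroup k} (hL : IsLattice L)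
    (l w : k) (r a : kˣ) {Φ : GenFun k} (hΦ : Φ = D.primLattice hL l w r) :
    Integrable (D.thetaIntegrand a Φ) (unitHaar k) ∧
    Integrable (axisIntegrand Φ) (unitHaar k) ∧
    Integrable (axisIntegrand (D.𝒢 Φ)) (unitHaar k) ∧
    theta a Φ * ordDiff D.ω
        + (∑ᶠ x : kˣ, lowerStar Φ x ((a : k)⁻¹ * x) * ordv (x : k))
        + (∑ᶠ ξ : kˣ, absv (a : k) * lowerStar (D.𝒢 Φ) ξ (a * ξ) * ordv (ξ : k))
      = (∫ t, D.thetaIntegrand a Φ t ∂unitHaar k)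
        - lowerStar Φ 0 0 * ordv (a : k)
        + (∫ t, axisIntegrand Φ t ∂unitHaar k)
        + absv (a : k) * (lowerStar (D.𝒢 Φ) 0 0 * ordv (a : k)
          + (∫ t, axisIntegrand (D.𝒢 Φ) t ∂unitHaar k)) := by
  classical
  subst hΦ
  set R := logAbs (r : k) with hR
  set α := logAbs (a : k) with hα
  obtain ⟨I₁, hI₁⟩ := D.exists_dual_layer hL (R + α)
  have e1 := finsum_primDensity_ord L hL l w R a
  have e2 := D.finsum_dualDensity_ord hL l w R a
  have e3 : (absv (a : k) : ℂ) * D.density hL R = D.density hL (R + α) := D.absv_mul_density hL R a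
  rw [thetaIntegrand_primLattice, axisIntegrand_primLattice, axisIntegrand_𝒢_primLattice,
    theta_primLattice, lowerStar_𝒢_primLattice_zero, (D.isStar_primLattice hL l w r).lowerStar_eq,
    (D.isStar_𝒢_primLattice hL l w r).lowerStar_eq, e1, e2, ordDiff_eq_cond,
    ordv_eq_neg_logAbs (a : k)]
  rw [← hR, ← hα]
  set ε : ℂ := {x | x - l ∈ L}.indicator 1 0 with hε
  by_cases hw : w ∈ ball k R
  · have hc : a * w ∈ ball k (R + α) := by
      rw [mem_ball_mul_iff a.ne_zero, ← hα, add_sub_cancel_right]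
      exact hw
    obtain ⟨I₀, hI₀⟩ := D.integral_countIntegrand_of_mem hL l hc
    obtain ⟨h1, h2⟩ := hI₀ (max I₀ I₁) (le_max_left _ _)
    rw [hI₁ (max I₀ I₁) (le_max_right _ _)]
    have h0 : (0 : k) ∈ disc w R := by
      rw [mem_disc, zero_sub]
      exact neg_mem hw
    obtain ⟨h3, h4⟩ := D.integral_ball_e_of_mem (w := w) (n := D.cond - R)
      (by rwa [sub_sub_cancel])
    have h5 : ∀ t : kˣ, (disc w R).indicator (1 : k → ℂ) (t : k) -
        (disc w R).indicator 1 0 * (𝒪[k] : Set k).indicator (fun _ ↦ 1) (t : k) =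
        (if logAbs (t : k) ≤ R then 1 else 0) - if logAbs (t : k) ≤ 0 then 1 else 0 := by
      intro t
      rw [Set.indicator_of_mem h0, Pi.one_apply, one_mul, indicator_integers,
        disc_congr (w' := 0) (by rwa [sub_zero]), disc_zero, indicator_ball]
      rfl
    simp_rw [h5]
    obtain ⟨h6, h7⟩ := integral_ball_sub_integers (k := k) R
    refine ⟨h1, h6.const_mul _, h3.const_mul _, ?_⟩
    rw [integral_const_mul, integral_const_mul, h7, h4, h2, primDensity,
      Set.indicator_of_mem h0, Pi.one_apply, ← hε, mul_add, ← mul_assoc, ← mul_assoc, e3]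
    push_cast
    ring
  · obtain ⟨hw0, hwR⟩ := notMem_ball_iff.mp hw
    have hc0 : (a : k) * w ≠ 0 := mul_ne_zero a.ne_zero hw0
    have hW : logAbs ((a : k) * w) = α + logAbs w := logAbs_mul a.ne_zero hw0
    obtain ⟨I₀, hI₀⟩ := D.integral_countIntegrand_of_notMem hL l hc0
      (R := R + α) (by omega)
    obtain ⟨h1, h2⟩ := hI₀ (max I₀ I₁) (le_max_left _ _)
    rw [hI₁ (max I₀ I₁) (le_max_right _ _)]
    have h0 : (0 : k) ∉ disc w R := by
      rw [mem_disc, zero_sub, neg_mem_iff]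
      exact hw
    obtain ⟨h3, h4⟩ := D.integral_ball_e_of_notMem (n := D.cond - R) hw0 (by omega)
    have h5 : (fun t : kˣ ↦ ε * ((disc w R).indicator (1 : k → ℂ) (t : k) -
        (disc w R).indicator 1 0 * (𝒪[k] : Set k).indicator (fun _ ↦ 1) (t : k))) =
        fun t ↦ ε * (unitDisc w R).indicator (fun _ ↦ 1) t := by
      funext t
      rw [Set.indicator_of_notMem h0, zero_mul, sub_zero]
      rfl
    rw [h5]
    obtain ⟨h6, h7⟩ := D.integral_indicator_unitDisc hw0 hwR 1
    refine ⟨h1, h6.const_mul _, h3.const_mul _, ?_⟩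
    -- The disc avoids the origin, so all its points have the norm of its centre aw.
    have h8 : ∑ x ∈ cosetFin hL l (a * w) (R + α), (logAbs x : ℂ) =
        (cosetFin hL l (a * w) (R + α)).card * (α + logAbs w) := by
      rw [Finset.sum_congr rfl (g := fun _ ↦ (α : ℂ) + logAbs w) fun x hx ↦ ?_, Finset.sum_const,
        nsmul_eq_mul]
      have := (logAbs_eq_of_sub_mem hc0 (by omega) (mem_disc.mp (mem_cosetFin.mp hx).2)).2
      rw [this, hW]
      push_cast
      rfl
    rw [integral_const_mul, integral_const_mul, h7, h4, h2, primDensity, hW,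
      Set.indicator_of_notMem h0, ← hε, h8, mul_add (absv (a : k) : ℂ), ← mul_assoc (absv (a : k) : ℂ),
      ← mul_assoc (absv (a : k) : ℂ), e3, show R + α - (α + logAbs w) = R - logAbs w by ring]
    push_cast
    ring

/-- For small t the dilated disc lies in a ball where the coset has at most the point 0. -/
theorem exists_theta_eq_of_logAbs_le (D : StirlingData k p) {L : AddSubgroup k} (hL : IsLattice L)
    (l w : k) (r : kˣ) : ∃ n : ℤ, ∀ t : kˣ, logAbs (t : k) ≤ n →
      theta t (D.primLattice hL l w r) = lowerStar (D.primLattice hL l w r) 0 0 := by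
  classical
  obtain ⟨n₀, hn₀⟩ := exists_forall_mem_of_mem_ball hL l
  obtain ⟨m, hm⟩ := exists_mem_ball w
  set R := logAbs (r : k) with hR
  refine ⟨n₀ - max R m, fun t ht ↦ ?_⟩
  have h1 : ∀ x ∈ cosetFin hL l (t * w) (R + logAbs (t : k)), x = 0 := by
    intro x hx
    by_contra hx0
    obtain ⟨h2, h3⟩ := mem_cosetFin.mp hx
    have h4 : t * w ∈ ball k (max R m + logAbs (t : k)) := by
      rw [mem_ball_mul_iff t.ne_zero, add_sub_cancel_right]
      exact hm _ (le_max_right _ _)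
    have h5 := add_mem (ball_mono (by have := le_max_left R m; omega) (mem_disc.mp h3)) h4
    rw [sub_add_cancel] at h5
    have h6 := (mem_ball_iff hx0).mp h5
    have := hn₀ x h2 hx0
    omega
  have h2 := primDensity_section L hL l w R t 0
  rw [mul_zero] at h2
  rw [theta_primLattice, ← hR, (D.isStar_primLattice hL l w r).lowerStar_eq, ← hR, h2]
  by_cases h3 : (0 : k) ∈ cosetFin hL l (t * w) (R + logAbs (t : k))
  · rw [Set.indicator_of_mem (Finset.mem_coe.mpr h3),
      Finset.eq_singleton_iff_unique_mem.mpr ⟨h3, h1⟩]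
    simp
  · rw [Set.indicator_of_notMem (fun h ↦ h3 (Finset.mem_coe.mp h)),
      Finset.eq_empty_of_forall_notMem fun x hx ↦ h3 (h1 x hx ▸ hx)]
    simp

/-- For large t the count is exact, and the expected count is ‖t‖ times the dual density at the
origin. -/
theorem exists_theta_eq_of_le_logAbs (D : StirlingData k p) {L : AddSubgroup k} (hL : IsLattice L)
    (l w : k) (r : kˣ) : ∃ n : ℤ, ∀ t : kˣ, n ≤ logAbs (t : k) →
      theta t (D.primLattice hL l w r) =
        absv (t : k) * lowerStar (D.𝒢 (D.primLattice hL l w r)) 0 0 := by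
  obtain ⟨m, hm⟩ := D.exists_card_cosetFin_eq hL l
  refine ⟨m - logAbs (r : k), fun t ht ↦ ?_⟩
  rw [theta_primLattice, lowerStar_𝒢_primLattice_zero, absv_mul_density, hm _ (by omega)]

end StirlingData

end Primitive

/-! ### The Stirling formula for rigged virtual lattices -/

namespace StirlingData

variable {k : Type*} [Field k] [ValuativeRel k] [TopologicalSpace k] [IsNonarchimedeanLocalField k]
  [MeasurableSpace k] [BorelSpace k] {p : ℕ} [Fact p.Prime] [CharP k p]

/-- The Stirling formula for `Φ`, along with the finiteness and convergence statements that give it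
a meaning and with the behaviour of the theta symbol near the two ends of `kˣ`. -/
structure HasStirling (D : StirlingData k p) (Φ : GenFun k) : Prop where
  finite_support : ∀ b : kˣ, (Function.support fun x : k ↦ lowerStar Φ x ((b : k)⁻¹ * x)).Finite
  finite_support_dual : ∀ a : kˣ,
    (Function.support fun ξ : kˣ ↦ lowerStar (D.𝒢 Φ) ξ (a * ξ)).Finite
  theta_of_le : ∃ n : ℤ, ∀ t : kˣ, logAbs (t : k) ≤ n → theta t Φ = lowerStar Φ 0 0
  theta_of_ge : ∃ n : ℤ, ∀ t : kˣ, n ≤ logAbs (t : k) →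
    theta t Φ = absv (t : k) * lowerStar (D.𝒢 Φ) 0 0
  integrable_theta : ∀ a, Integrable (D.thetaIntegrand a Φ) (unitHaar k)
  integrable_axis : Integrable (axisIntegrand Φ) (unitHaar k)
  integrable_axis_dual : Integrable (axisIntegrand (D.𝒢 Φ)) (unitHaar k)
  formula : ∀ a : kˣ, theta a Φ * ordDiff D.ω
        + (∑ᶠ x : kˣ, lowerStar Φ x ((a : k)⁻¹ * x) * ordv (x : k))
        + (∑ᶠ ξ : kˣ, absv (a : k) * lowerStar (D.𝒢 Φ) ξ (a * ξ) * ordv (ξ : k))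
      = (∫ t, D.thetaIntegrand a Φ t ∂unitHaar k)
        - lowerStar Φ 0 0 * ordv (a : k)
        + (∫ t, axisIntegrand Φ t ∂unitHaar k)
        + absv (a : k) * (lowerStar (D.𝒢 Φ) 0 0 * ordv (a : k)
          + (∫ t, axisIntegrand (D.𝒢 Φ) t ∂unitHaar k))

theorem hasStirling_primLattice (D : StirlingData k p) {L : AddSubgroup k} (hL : IsLattice L)
    (l w : k) (r : kˣ) : D.HasStirling (D.primLattice hL l w r) where
  finite_support b := by
    rw [(D.isStar_primLattice hL l w r).lowerStar_eq]
    exact finite_support_section hL l w _ b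
  finite_support_dual a := by
    rw [(D.isStar_𝒢_primLattice hL l w r).lowerStar_eq]
    exact D.finite_support_dual_section hL l w _ a
  theta_of_le := D.exists_theta_eq_of_logAbs_le hL l w r
  theta_of_ge := D.exists_theta_eq_of_le_logAbs hL l w r
  integrable_theta a := (D.stirling_primLattice hL l w r a rfl).1
  integrable_axis := (D.stirling_primLattice hL l w r 1 rfl).2.1
  integrable_axis_dual := (D.stirling_primLattice hL l w r 1 rfl).2.2.1
  formula a := (D.stirling_primLattice hL l w r a rfl).2.2.2

theorem lowerStar_add (D : StirlingData k p) {Φ Ψ : GenFun k} (hΦ : Φ ∈ D.RVL) (hΨ : Ψ ∈ D.RVL) :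
    lowerStar (Φ + Ψ) = lowerStar Φ + lowerStar Ψ :=
  ((D.isStar_of_mem_RVL hΦ).add (D.isStar_of_mem_RVL hΨ)).lowerStar_eq

theorem lowerStar_smul (D : StirlingData k p) {Φ : GenFun k} (c : ℂ) (hΦ : Φ ∈ D.RVL) :
    lowerStar (c • Φ) = c • lowerStar Φ :=
  ((D.isStar_of_mem_RVL hΦ).smul c).lowerStar_eq

theorem 𝒢_add (D : StirlingData k p) (Φ Ψ : GenFun k) : D.𝒢 (Φ + Ψ) = D.𝒢 Φ + D.𝒢 Ψ :=
  LinearMap.add_comp _ _ _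

theorem 𝒢_smul (D : StirlingData k p) (c : ℂ) (Φ : GenFun k) : D.𝒢 (c • Φ) = c • D.𝒢 Φ :=
  LinearMap.smul_comp _ _ _

theorem finite_support_mul {X : Type*} {f : X → ℂ} (hf : (Function.support f).Finite) (g : X → ℂ) :
    (Function.support fun x ↦ f x * g x).Finite :=
  hf.subset fun _ h h' ↦ h (by simp only [h', zero_mul])

theorem finite_support_mul_mul {X : Type*} {f : X → ℂ} (hf : (Function.support f).Finite) (c : ℂ)
    (g : X → ℂ) : (Function.support fun x ↦ c * f x * g x).Finite :=
  hf.subset fun _ h h' ↦ h (by simp only [h', mul_zero, zero_mul])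

theorem finite_support_units {k : Type*} [Field k] {f : k → ℂ} (hf : (Function.support f).Finite) :
    (Function.support fun x : kˣ ↦ f x).Finite :=
  hf.preimage (f := fun x : kˣ ↦ (x : k)) Units.val_injective.injOn

namespace HasStirling

variable {D : StirlingData k p} {Φ Ψ : GenFun k}

/-- Membership in the span is required because lower stars are limits, additive only where the
limits exist; the finite supports make the theta symbols and the sums of orders additive. -/
theorem add (hΦ : Φ ∈ D.RVL) (hΨ : Ψ ∈ D.RVL) (h : D.HasStirling Φ) (h' : D.HasStirling Ψ) :
    D.HasStirling (Φ + Ψ) := by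
  have e1 : ∀ x y, lowerStar (Φ + Ψ) x y = lowerStar Φ x y + lowerStar Ψ x y := fun x y ↦ by
    rw [D.lowerStar_add hΦ hΨ, Pi.add_apply, Pi.add_apply]
  have e2 : ∀ x y, lowerStar (D.𝒢 (Φ + Ψ)) x y =
      lowerStar (D.𝒢 Φ) x y + lowerStar (D.𝒢 Ψ) x y := fun x y ↦ by
    rw [𝒢_add, D.lowerStar_add (D.𝒢_mem_RVL hΦ) (D.𝒢_mem_RVL hΨ), Pi.add_apply, Pi.add_apply]
  have e3 : ∀ a, theta a (Φ + Ψ) = theta a Φ + theta a Ψ := fun a ↦ by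
    simp only [theta, e1]
    exact finsum_add_distrib (h.finite_support a) (h'.finite_support a)
  have e4 : ∀ a, D.thetaIntegrand a (Φ + Ψ) = D.thetaIntegrand a Φ + D.thetaIntegrand a Ψ := by
    intro a
    funext t
    simp only [thetaIntegrand, thetaCorrection, e1, e2, e3, Pi.add_apply]
    split_ifs <;> ring
  have e5 : axisIntegrand (Φ + Ψ) = axisIntegrand Φ + axisIntegrand Ψ := by
    funext t
    simp only [axisIntegrand, e1, Pi.add_apply]
    ring
  have e6 : axisIntegrand (D.𝒢 (Φ + Ψ)) = axisIntegrand (D.𝒢 Φ) + axisIntegrand (D.𝒢 Ψ) := by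
    funext t
    simp only [axisIntegrand, e2, Pi.add_apply]
    ring
  refine ⟨fun b ↦ ?_, fun a ↦ ?_, ?_, ?_, fun a ↦ ?_, ?_, ?_, fun a ↦ ?_⟩
  · simp only [e1]
    exact ((h.finite_support b).union (h'.finite_support b)).subset (Function.support_add _ _)
  · simp only [e2]
    exact ((h.finite_support_dual a).union (h'.finite_support_dual a)).subset
      (Function.support_add _ _)
  · obtain ⟨n, hn⟩ := h.theta_of_le
    obtain ⟨n', hn'⟩ := h'.theta_of_le
    refine ⟨min n n', fun t ht ↦ ?_⟩
    rw [e3, e1, hn t (ht.trans (min_le_left _ _)), hn' t (ht.trans (min_le_right _ _))]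
  · obtain ⟨n, hn⟩ := h.theta_of_ge
    obtain ⟨n', hn'⟩ := h'.theta_of_ge
    refine ⟨max n n', fun t ht ↦ ?_⟩
    rw [e3, e2, hn t ((le_max_left _ _).trans ht), hn' t ((le_max_right _ _).trans ht), mul_add]
  · rw [e4]
    exact (h.integrable_theta a).add (h'.integrable_theta a)
  · rw [e5]
    exact h.integrable_axis.add h'.integrable_axis
  · rw [e6]
    exact h.integrable_axis_dual.add h'.integrable_axis_dual
  · rw [e4, e5, e6, integral_add' (h.integrable_theta a) (h'.integrable_theta a),
      integral_add' h.integrable_axis h'.integrable_axis,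
      integral_add' h.integrable_axis_dual h'.integrable_axis_dual]
    simp only [e1, e2, e3, add_mul, mul_add]
    rw [finsum_add_distrib (finite_support_mul (finite_support_units (h.finite_support a)) _)
        (finite_support_mul (finite_support_units (h'.finite_support a)) _),
      finsum_add_distrib (finite_support_mul_mul (h.finite_support_dual a) _ _)
        (finite_support_mul_mul (h'.finite_support_dual a) _ _)]
    linear_combination h.formula a + h'.formula a

theorem smul (c : ℂ) (hΦ : Φ ∈ D.RVL) (h : D.HasStirling Φ) : D.HasStirling (c • Φ) := by
  have e1 : ∀ x y, lowerStar (c • Φ) x y = c * lowerStar Φ x y := fun x y ↦ by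
    rw [D.lowerStar_smul c hΦ, Pi.smul_apply, Pi.smul_apply, smul_eq_mul]
  have e2 : ∀ x y, lowerStar (D.𝒢 (c • Φ)) x y = c * lowerStar (D.𝒢 Φ) x y := fun x y ↦ by
    rw [𝒢_smul, D.lowerStar_smul c (D.𝒢_mem_RVL hΦ), Pi.smul_apply, Pi.smul_apply, smul_eq_mul]
  have e3 : ∀ a, theta a (c • Φ) = c * theta a Φ := fun a ↦ by
    simp only [theta, e1]
    exact (mul_finsum' _ c (h.finite_support a)).symm
  have e4 : ∀ a, D.thetaIntegrand a (c • Φ) = fun t ↦ c * D.thetaIntegrand a Φ t := by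
    intro a
    funext t
    simp only [thetaIntegrand, thetaCorrection, e1, e2, e3]
    split_ifs <;> ring
  have e5 : axisIntegrand (c • Φ) = fun t ↦ c * axisIntegrand Φ t := by
    funext t
    simp only [axisIntegrand, e1]
    ring
  have e6 : axisIntegrand (D.𝒢 (c • Φ)) = fun t ↦ c * axisIntegrand (D.𝒢 Φ) t := by
    funext t
    simp only [axisIntegrand, e2]
    ring
  refine ⟨fun b ↦ ?_, fun a ↦ ?_, ?_, ?_, fun a ↦ ?_, ?_, ?_, fun a ↦ ?_⟩
  · simp only [e1]
    exact (h.finite_support b).subset fun _ h1 h2 ↦ h1 (by simp only [h2, mul_zero])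
  · simp only [e2]
    exact (h.finite_support_dual a).subset fun _ h1 h2 ↦ h1 (by simp only [h2, mul_zero])
  · obtain ⟨n, hn⟩ := h.theta_of_le
    refine ⟨n, fun t ht ↦ ?_⟩
    rw [e3, e1, hn t ht]
  · obtain ⟨n, hn⟩ := h.theta_of_ge
    refine ⟨n, fun t ht ↦ ?_⟩
    rw [e3, e2, hn t ht]
    ring
  · rw [e4]
    exact (h.integrable_theta a).const_mul c
  · rw [e5]
    exact h.integrable_axis.const_mul c
  · rw [e6]
    exact h.integrable_axis_dual.const_mul c
  · rw [e4, e5, e6, integral_const_mul, integral_const_mul, integral_const_mul]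
    have e7 : ∑ᶠ x : kˣ, lowerStar (c • Φ) x ((a : k)⁻¹ * x) * ordv (x : k) =
        c * ∑ᶠ x : kˣ, lowerStar Φ x ((a : k)⁻¹ * x) * ordv (x : k) := by
      rw [mul_finsum' _ c
        (finite_support_mul (finite_support_units (h.finite_support a)) _)]
      exact finsum_congr fun x ↦ by rw [e1]; ring
    have e8 : ∑ᶠ ξ : kˣ, absv (a : k) * lowerStar (D.𝒢 (c • Φ)) ξ (a * ξ) * ordv (ξ : k) =
        c * ∑ᶠ ξ : kˣ, absv (a : k) * lowerStar (D.𝒢 Φ) ξ (a * ξ) * ordv (ξ : k) := by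
      rw [mul_finsum' _ c (finite_support_mul_mul (h.finite_support_dual a) _ _)]
      exact finsum_congr fun x ↦ by rw [e2]; ring
    rw [e7, e8, e1, e2, e3]
    linear_combination c * h.formula a

end HasStirling

theorem hasStirling_zero (D : StirlingData k p) : D.HasStirling 0 := by
  have e1 : ∀ x y, lowerStar (0 : GenFun k) x y = 0 := fun x y ↦ by
    rw [IsStar.zero.lowerStar_eq]
    rfl
  have e2 : D.𝒢 (0 : GenFun k) = 0 := LinearMap.zero_comp _
  have e3 : ∀ a, theta a (0 : GenFun k) = 0 := fun a ↦ by simp only [theta, e1, finsum_zero]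
  have e4 : ∀ a, D.thetaIntegrand a (0 : GenFun k) = 0 := by
    intro a
    funext t
    simp only [thetaIntegrand, thetaCorrection, e1, e2, e3]
    split_ifs <;> simp
  have e5 : axisIntegrand (0 : GenFun k) = 0 := by
    funext t
    simp only [axisIntegrand, e1]
    simp
  refine ⟨fun b ↦ ?_, fun a ↦ ?_, ⟨0, fun t _ ↦ ?_⟩, ⟨0, fun t _ ↦ ?_⟩, fun a ↦ ?_, ?_, ?_,
    fun a ↦ ?_⟩
  · simp [e1]
  · simp [e1, e2]
  · rw [e3, e1]
  · rw [e3, e2, e1, mul_zero]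
  · rw [e4]
    exact integrable_zero _ _ _
  · rw [e5]
    exact integrable_zero _ _ _
  · rw [e2, e5]
    exact integrable_zero _ _ _
  · simp [e1, e2, e3, e4, e5]

theorem hasStirling (D : StirlingData k p) {Φ : GenFun k} (hΦ : Φ ∈ D.RVL) : D.HasStirling Φ := by
  induction hΦ using Submodule.span_induction with
  | mem Φ h =>
    obtain ⟨L, hL, l, w, r, rfl⟩ := IsPrimitive.exists_eq h
    exact D.hasStirling_primLattice hL l w r
  | zero => exact D.hasStirling_zero
  | add Φ Ψ hΦ hΨ h h' => exact h.add hΦ hΨ h'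
  | smul c Φ hΦ h => exact h.smul c hΦ

end StirlingData

/-! ### The order of products of fractional powers -/

theorem exists_eq_div_of_mem_zInv {p : ℕ} [Fact p.Prime] {ν : ℂ} (h : ν ∈ zInv p) :
    ∃ (m : ℤ) (n : ℕ), ν = (m : ℂ) / (p : ℂ) ^ n := by
  have hp : (p : ℂ) ≠ 0 := by exact_mod_cast (Fact.out : p.Prime).ne_zero
  induction h using Subring.closure_induction with
  | mem x hx => exact ⟨1, 1, by rw [Set.mem_singleton_iff.mp hx]; simp⟩
  | zero => exact ⟨0, 0, by simp⟩
  | one => exact ⟨1, 0, by simp⟩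
  | add x y _ _ hx hy =>
    obtain ⟨m, n, rfl⟩ := hx
    obtain ⟨m', n', rfl⟩ := hy
    refine ⟨m * p ^ n' + p ^ n * m', n + n', ?_⟩
    rw [div_add_div _ _ (pow_ne_zero _ hp) (pow_ne_zero _ hp), pow_add]
    push_cast
    rfl
  | neg x _ hx =>
    obtain ⟨m, n, rfl⟩ := hx
    exact ⟨-m, n, by push_cast; ring⟩
  | mul x y _ _ hx hy =>
    obtain ⟨m, n, rfl⟩ := hx
    obtain ⟨m', n', rfl⟩ := hy
    exact ⟨m * m', n + n', by rw [div_mul_div_comm, pow_add]; push_cast; rfl⟩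

section PerfectClosure

variable {k : Type*} [Field k] [ValuativeRel k] [TopologicalSpace k] [IsNonarchimedeanLocalField k]
  [MeasurableSpace k] [BorelSpace k] {p : ℕ} [Fact p.Prime] [CharP k p]

theorem ordv_mul {x y : k} (hx : x ≠ 0) (hy : y ≠ 0) : ordv (x * y) = ordv x + ordv y := by
  rw [ordv_eq_neg_logAbs, ordv_eq_neg_logAbs, ordv_eq_neg_logAbs, logAbs_mul hx hy]
  push_cast
  ring

theorem ordv_zpow (x : k) (m : ℤ) : ordv (x ^ m) = m * ordv x := by
  rcases eq_or_ne x 0 with rfl | hx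
  · rcases eq_or_ne m 0 with rfl | hm
    · simp [ordv, absv_one]
    · rw [zero_zpow _ hm]
      simp [ordv, absv_zero]
  · obtain ⟨u, rfl⟩ : ∃ u : kˣ, (u : k) = x := ⟨Units.mk0 x hx, rfl⟩
    rw [← Units.val_zpow_eq_zpow_val, ordv, ordv, absv_units_zpow, Real.log_zpow]
    ring

/-- Nonvanishing matters, since the order of 0 is 0 by convention. -/
theorem ordPerf_mul {x y : PerfectClosure k p} (hx : x ≠ 0) (hy : y ≠ 0) :
    ordPerf p (x * y) = ordPerf p x + ordPerf p y := by
  have hp : (p : ℝ) ≠ 0 := by exact_mod_cast (Fact.out : p.Prime).ne_zero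
  induction x using PerfectClosure.induction_on with | _ x => ?_
  induction y using PerfectClosure.induction_on with | _ y => ?_
  obtain ⟨m, x⟩ := x
  obtain ⟨n, y⟩ := y
  have hx0 : x ≠ 0 := by
    rintro rfl
    exact hx (PerfectClosure.mk_zero_right k p m)
  have hy0 : y ≠ 0 := by
    rintro rfl
    exact hy (PerfectClosure.mk_zero_right k p n)
  rw [PerfectClosure.mk_mul_mk, ordPerf_mk, ordPerf_mk, ordPerf_mk]
  simp only [← coe_iterateFrobenius, iterateFrobenius_def]
  rw [ordv_mul (pow_ne_zero _ hx0) (pow_ne_zero _ hy0),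
    ordv_pow x (pow_ne_zero n (Fact.out : p.Prime).ne_zero),
    ordv_pow y (pow_ne_zero m (Fact.out : p.Prime).ne_zero), pow_add]
  push_cast
  field_simp

theorem perfPow_ne_zero {k : Type*} [Field k] [CharP k p] (x : kˣ) {ν : ℂ} (h : ν ∈ zInv p) : perfPow p x ν ≠ 0 := by
  obtain ⟨m, n, rfl⟩ := exists_eq_div_of_mem_zInv h
  rw [perfPow_eq, PerfectClosure.zero_def, Ne, PerfectClosure.eq_iff]
  simp only [← coe_iterateFrobenius, iterateFrobenius_def]
  rw [zero_pow (pow_ne_zero n (Fact.out : p.Prime).ne_zero)]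
  exact pow_ne_zero _ (zpow_ne_zero _ x.ne_zero)

theorem ordPerf_perfPow (x : kˣ) {ν : ℂ} (h : ν ∈ zInv p) :
    (ordPerf p (perfPow p x ν) : ℂ) = ν * ordv (x : k) := by
  obtain ⟨m, n, rfl⟩ := exists_eq_div_of_mem_zInv h
  rw [perfPow_eq, ordPerf_mk, ordv_zpow]
  push_cast
  ring

theorem perfPow_zero {k : Type*} [Field k] [CharP k p] (x : kˣ) : perfPow p x 0 = 1 := by
  have := perfPow_eq p x 0 0
  rwa [Int.cast_zero, zero_div, zpow_zero, ← PerfectClosure.one_def] at this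

theorem ordPerf_one : ordPerf p (1 : PerfectClosure k p) = 0 := by
  rw [PerfectClosure.one_def, ordPerf_mk]
  simp [ordv, absv_one]

/-- Nonvanishing of the product is carried along because `ordPerf_mul` needs it at every step of the
induction. -/
theorem ordPerf_finprod_perfPow {f : kˣ → ℂ} (hf : ∀ x, f x ∈ zInv p)
    (hs : (Function.support f).Finite) : ∏ᶠ x : kˣ, perfPow p x (f x) ≠ 0 ∧
      (ordPerf p (∏ᶠ x : kˣ, perfPow p x (f x)) : ℂ) = ∑ᶠ x : kˣ, f x * ordv (x : k) := by
  classical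
  rw [finprod_eq_prod_of_mulSupport_subset (s := hs.toFinset), finsum_eq_sum_of_support_subset
    (s := hs.toFinset)]
  · generalize hs.toFinset = s
    induction s using Finset.induction_on with
    | empty => simp [ordPerf_one]
    | insert x s hx ih =>
      rw [Finset.prod_insert hx, Finset.sum_insert hx,
        ordPerf_mul (perfPow_ne_zero x (hf x)) ih.1, ← ih.2, ← ordPerf_perfPow x (hf x)]
      exact ⟨mul_ne_zero (perfPow_ne_zero x (hf x)) ih.1, by push_cast; rfl⟩
  · intro x hx
    rw [Set.Finite.coe_toFinset]
    exact fun h ↦ hx (by simp only [h, zero_mul])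
  · intro x hx
    rw [Set.Finite.coe_toFinset]
    exact fun h ↦ hx (by simp only [h, perfPow_zero])

theorem absv_mem_zInv (p : ℕ) [Fact p.Prime] [CharP k p] (a : kˣ) :
    (absv (a : k) : ℂ) ∈ zInv p := by
  obtain ⟨n, -, hn⟩ := residueCard_eq_pow k p
  have : (absv (a : k) : ℂ) = (p : ℂ) ^ ((n : ℤ) * logAbs (a : k)) := by
    rw [absv_eq a.ne_zero, hn, zpow_mul]
    push_cast
    rfl
  rw [this]
  exact zpow_mem_zInv p _

end PerfectClosure

/-! ### Proper rational rigged virtual lattices -/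

namespace StirlingData

variable {k : Type*} [Field k] [ValuativeRel k] [TopologicalSpace k] [IsNonarchimedeanLocalField k]
  {p : ℕ} [Fact p.Prime] [CharP k p]

/-- The inclusion of `𝔽ˣ` in `kˣ`. -/
def inclUnits (D : StirlingData k p) : D.Fˣ →* kˣ := Units.map D.incl

theorem inclUnits_val (D : StirlingData k p) (c : D.Fˣ) : (D.inclUnits c : k) = D.incl c := rfl

/-- The nontrivial character λ sums to zero over 𝔽 and the term c = 0 has weight zero, so the
weights have total mass one. -/
theorem average_const (D : StirlingData k p) [Fintype D.F] [Fintype D.Fˣ] (z : ℂ) :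
    (Fintype.card D.F : ℂ)⁻¹ * ∑ c : D.Fˣ, (1 - D.lam c) * z = z := by
  classical
  have hcard : (Fintype.card D.F : ℂ) ≠ 0 := by exact_mod_cast Fintype.card_ne_zero
  rw [sum_units_eq (fun c : D.F ↦ (1 - D.lam c) * z) (by simp), ← Finset.sum_mul,
    Finset.sum_sub_distrib, AddChar.sum_eq_zero_of_ne_one D.lam_ne_one, Finset.sum_const,
    Finset.card_univ, nsmul_eq_mul, mul_one, sub_zero, inv_mul_cancel_left₀ hcard]

variable [MeasurableSpace k] [BorelSpace k]

theorem lowerStar_𝒢₀ (D : StirlingData k p) [Fintype D.F] [Fintype D.Fˣ] {Φ : GenFun k}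
    (hΦ : Φ ∈ D.RVL) (s t : k) : lowerStar (D.𝒢₀ Φ) s t = (Fintype.card D.F : ℂ)⁻¹ * ∑ c : D.Fˣ, (1 - D.lam c) *
      lowerStar (D.𝒢 Φ) (D.inclUnits c * s) (D.inclUnits c * t) := by
  classical
  rw [(D.isStar_𝒢₀ (D.isStar_of_mem_RVL (D.𝒢_mem_RVL hΦ))).lowerStar_eq]
  exact congrArg _ (sum_units_eq (fun c : D.F ↦ (1 - D.lam c) *
    lowerStar (D.𝒢 Φ) (D.incl c * s) (D.incl c * t)) (by simp)).symm

/-- Haar measure on kˣ is invariant under the dilations by 𝔽ˣ, and the weights have total mass one.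
-/
theorem integral_lowerStar_𝒢₀ (D : StirlingData k p) {Φ : GenFun k} (hΦ : Φ ∈ D.RVL)
    (hint : Integrable (fun t : kˣ ↦ lowerStar (D.𝒢 Φ) 0 t) (unitHaar k)) :
    Integrable (fun t : kˣ ↦ lowerStar (D.𝒢₀ Φ) 0 t) (unitHaar k) ∧
    ∫ t : kˣ, lowerStar (D.𝒢₀ Φ) 0 t ∂unitHaar k =
      ∫ t : kˣ, lowerStar (D.𝒢 Φ) 0 t ∂unitHaar k := by
  classical
  have := Fintype.ofFinite D.F
  set g : kˣ → ℂ := fun t ↦ lowerStar (D.𝒢 Φ) 0 t with hg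
  have h1 : (fun t : kˣ ↦ lowerStar (D.𝒢₀ Φ) 0 t) = fun t ↦ (Fintype.card D.F : ℂ)⁻¹ *
      ∑ c : D.Fˣ, (1 - D.lam c) * g (D.inclUnits c * t) := by
    funext t
    rw [D.lowerStar_𝒢₀ hΦ]
    simp only [hg, mul_zero, Units.val_mul]
  have h2 : ∀ c : D.Fˣ, Integrable (fun t ↦ (1 - D.lam c) * g (D.inclUnits c * t)) (unitHaar k) :=
    fun c ↦ (hint.comp_mul_left (D.inclUnits c)).const_mul _
  rw [h1]
  refine ⟨(integrable_finsetSum _ fun c _ ↦ h2 c).const_mul _, ?_⟩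
  rw [integral_const_mul, integral_finsetSum _ fun c _ ↦ h2 c]
  simp_rw [integral_const_mul]
  rw [Finset.sum_congr rfl fun c _ ↦ by rw [integral_mul_left_eq_self], average_const]

/-- A dilation by 𝔽ˣ maps the line (ξ, aξ) to itself and preserves ord, so it only permutes the sum;
the weights have total mass one. -/
theorem finsum_lowerStar_𝒢₀ (D : StirlingData k p) {Φ : GenFun k} (hΦ : Φ ∈ D.RVL) (a : kˣ)
    (hs : (Function.support fun ξ : kˣ ↦ lowerStar (D.𝒢 Φ) ξ (a * ξ)).Finite) :
    (Function.support fun ξ : kˣ ↦ lowerStar (D.𝒢₀ Φ) ξ (a * ξ)).Finite ∧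
    ∑ᶠ ξ : kˣ, lowerStar (D.𝒢₀ Φ) ξ (a * ξ) * absv (a : k) * ordv (ξ : k) =
      ∑ᶠ ξ : kˣ, absv (a : k) * lowerStar (D.𝒢 Φ) ξ (a * ξ) * ordv (ξ : k) := by
  classical
  have := Fintype.ofFinite D.F
  set g : kˣ → ℂ := fun ξ ↦ lowerStar (D.𝒢 Φ) ξ (a * ξ) with hg
  have h1 : ∀ ξ : kˣ, lowerStar (D.𝒢₀ Φ) ξ (a * ξ) = (Fintype.card D.F : ℂ)⁻¹ *
      ∑ c : D.Fˣ, (1 - D.lam c) * g (D.inclUnits c * ξ) := by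
    intro ξ
    rw [D.lowerStar_𝒢₀ hΦ]
    simp only [hg, Units.val_mul, mul_left_comm]
  have h2 : ∀ c : D.Fˣ, (Function.support fun ξ ↦ g (D.inclUnits c * ξ)).Finite := fun c ↦
    hs.preimage (f := fun ξ ↦ D.inclUnits c * ξ) (mul_right_injective _).injOn
  set G : kˣ → ℂ := fun ξ ↦ absv (a : k) * g ξ * ordv (ξ : k) with hG
  have hGs : ∀ c : D.Fˣ, (Function.support fun ξ ↦ (1 - D.lam c) * G (D.inclUnits c * ξ)).Finite :=
    fun c ↦ (h2 c).subset fun ξ h h' ↦ h (by simp only [hG, h', mul_zero, zero_mul])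
  have hord : ∀ (c : D.Fˣ) (ξ : kˣ), ordv ((D.inclUnits c * ξ : kˣ) : k) = ordv (ξ : k) := by
    intro c ξ
    rw [ordv, ordv, absv_units_mul, inclUnits_val, D.absv_incl c.ne_zero, one_mul]
  constructor
  · refine (Set.finite_iUnion h2).subset fun ξ hξ ↦ ?_
    by_contra h
    rw [Set.mem_iUnion, not_exists] at h
    refine hξ ((h1 ξ).trans ?_)
    rw [Finset.sum_eq_zero fun c _ ↦ ?_, mul_zero]
    rw [Function.notMem_support.mp (h c), mul_zero]
  · have h3 : ∀ ξ : kˣ, lowerStar (D.𝒢₀ Φ) ξ (a * ξ) * absv (a : k) * ordv (ξ : k) =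
        (Fintype.card D.F : ℂ)⁻¹ * ∑ c : D.Fˣ, (1 - D.lam c) * G (D.inclUnits c * ξ) := by
      intro ξ
      rw [h1, mul_assoc, mul_assoc, Finset.sum_mul]
      refine congrArg _ (Finset.sum_congr rfl fun c _ ↦ ?_)
      simp only [hG, hord]
      ring
    simp_rw [h3]
    rw [← mul_finsum', finsum_sum_comm]
    · have h4 : ∀ c : D.Fˣ, ∑ᶠ ξ, (1 - D.lam c) * G (D.inclUnits c * ξ) =
          (1 - D.lam c) * ∑ᶠ ξ, G ξ := by
        intro c
        rw [← finsum_comp_equiv (Equiv.mulLeft (D.inclUnits c)) (f := G), mul_finsum']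
        · rfl
        · exact (h2 c).subset fun ξ h h' ↦ h (by simp only [Equiv.coe_mulLeft, hG, h', mul_zero, zero_mul])
      rw [Finset.sum_congr rfl fun c _ ↦ h4 c, average_const]
    · exact fun c _ ↦ hGs c
    · refine (Set.finite_iUnion hGs).subset fun ξ hξ ↦ ?_
      by_contra h
      rw [Set.mem_iUnion, not_exists] at h
      exact hξ (Finset.sum_eq_zero fun c _ ↦ Function.notMem_support.mp (h c))

/-- On a compact subset of kˣ both t and t⁻¹ are bounded. -/
theorem _root_.IsProper.exists_bound {Φ : GenFun k} (h : IsProper Φ) :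
    ∃ n : ℤ, ∀ t : kˣ, theta t Φ ≠ 0 → -n ≤ logAbs (t : k) ∧ logAbs (t : k) ≤ n := by
  have key : ∀ f : kˣ → kˣ, Continuous f → ∃ n : ℤ, ∀ t : kˣ, theta t Φ ≠ 0 →
      logAbs (f t : k) ≤ n := by
    intro f hf
    obtain ⟨c, hc0, hc⟩ := lf_bounded (h.isCompact.image (Units.continuous_val.comp hf))
    refine ⟨logAbs c, fun t ht ↦ ?_⟩
    have := absv_le_iff.mpr (hc (f t : k) ⟨t, subset_tsupport _ ht, rfl⟩)
    rwa [absv_eq (f t).ne_zero, absv_eq hc0, zpow_residueCard_le] at this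
  obtain ⟨n, hn⟩ := key id continuous_id
  obtain ⟨m, hm⟩ := key (fun t ↦ t⁻¹) continuous_inv
  refine ⟨max n m, fun t ht ↦ ?_⟩
  have h1 := hn t ht
  have h2 := hm t ht
  rw [id_eq] at h1
  rw [Units.val_inv_eq_inv_val, logAbs_inv t.ne_zero] at h2
  have := le_max_left n m
  have := le_max_right n m
  omega

/-- Near the two ends of kˣ the theta symbol is Φ_*(0,0), respectively ‖t‖ 𝒢[Φ]_*(0,0), and
properness makes it vanish there. -/
theorem HasStirling.lowerStar_zero_of_isProper {D : StirlingData k p} {Φ : GenFun k}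
    (h : D.HasStirling Φ) (hp : IsProper Φ) :
    lowerStar Φ 0 0 = 0 ∧ lowerStar (D.𝒢 Φ) 0 0 = 0 := by
  obtain ⟨n, hn⟩ := hp.exists_bound
  have hzero : ∀ t : kˣ, logAbs (t : k) < -n ∨ n < logAbs (t : k) → theta t Φ = 0 := by
    intro t ht
    by_contra h'
    have := hn t h'
    omega
  constructor
  · obtain ⟨m, hm⟩ := h.theta_of_le
    obtain ⟨t, ht⟩ := exists_logAbs_eq k (min m (-n - 1))
    rw [← hm t (ht.le.trans (min_le_left _ _)), hzero t (Or.inl _)]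
    rw [ht]
    exact (min_le_right _ _).trans_lt (by omega)
  · obtain ⟨m, hm⟩ := h.theta_of_ge
    obtain ⟨t, ht⟩ := exists_logAbs_eq k (max m (n + 1))
    have h1 := hm t ((le_max_left _ _).trans ht.ge)
    rw [hzero t (Or.inr (by rw [ht]; exact lt_of_lt_of_le (by omega) (le_max_right _ _)))] at h1
    refine (mul_eq_zero.mp h1.symm).resolve_left ?_
    exact_mod_cast (absv_pos t).ne'

theorem thetaIntegrand_eq_properIntegrand (D : StirlingData k p) {Φ : GenFun k}
    (h1 : lowerStar Φ 0 0 = 0) (h2 : lowerStar (D.𝒢 Φ) 0 0 = 0) (a : kˣ) :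
    D.thetaIntegrand a Φ = properIntegrand a Φ := by
  classical
  funext t
  rw [thetaIntegrand, properIntegrand, thetaCorrection, h1, h2, mul_zero, ← shell_zero]
  simp only [one_lt_absv_iff, absv_eq_one_iff]
  by_cases h : logAbs (t : k) = 0
  · rw [if_neg (by omega), if_pos h, Set.indicator_of_mem (mem_shell.mpr h), one_mul]
  · rw [if_neg h, ite_self, Set.indicator_of_notMem fun h' ↦ h (mem_shell.mp h'), zero_mul]

theorem axisIntegrand_of_lowerStar_zero {Ψ : GenFun k} (h : lowerStar Ψ 0 0 = 0) :
    axisIntegrand Ψ = fun t : kˣ ↦ lowerStar Ψ 0 t := by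
  funext t
  rw [axisIntegrand, h, zero_mul, sub_zero]

/-- With both values at the origin zero, the general formula loses its corrections. Passing from 𝒢
to 𝒢₀ leaves the dual sum and the dual axis integral unchanged, and the two sums of orders become
the order of the Catalan symbol. -/
theorem IsRational.stirling {D : StirlingData k p} {Φ : GenFun k} (hΦ : D.IsRational Φ)
    (hp : IsProper Φ) (a : kˣ) :
    (Function.support fun ξ : kˣ ↦ lowerStar (D.𝒢₀ Φ) ξ (a * ξ)).Finite ∧
    Integrable (properIntegrand a Φ) (unitHaar k) ∧
    Integrable (fun t : kˣ ↦ lowerStar Φ 0 t) (unitHaar k) ∧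
    Integrable (fun t : kˣ ↦ lowerStar (D.𝒢₀ Φ) 0 t) (unitHaar k) ∧
    theta a Φ * ordDiff D.ω + ordPerf p (D.catalan a Φ)
      = (∫ t, properIntegrand a Φ t ∂unitHaar k)
        + (∫ t : kˣ, lowerStar Φ 0 t ∂unitHaar k)
        + absv (a : k) * (∫ t : kˣ, lowerStar (D.𝒢₀ Φ) 0 t ∂unitHaar k) := by
  have hS := D.hasStirling hΦ.mem_RVL
  obtain ⟨h0, h0'⟩ := hS.lowerStar_zero_of_isProper hp
  have i1 := hS.integrable_theta a
  have i2 := hS.integrable_axis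
  have i3 := hS.integrable_axis_dual
  have hF := hS.formula a
  rw [D.thetaIntegrand_eq_properIntegrand h0 h0'] at i1 hF
  rw [axisIntegrand_of_lowerStar_zero h0] at i2 hF
  rw [axisIntegrand_of_lowerStar_zero h0'] at i3 hF
  obtain ⟨i4, e4⟩ := D.integral_lowerStar_𝒢₀ hΦ.mem_RVL i3
  obtain ⟨s5, e5⟩ := D.finsum_lowerStar_𝒢₀ hΦ.mem_RVL a (hS.finite_support_dual a)
  refine ⟨s5, i1, i2, i4, ?_⟩
  obtain ⟨n6, e6⟩ := ordPerf_finprod_perfPow (p := p)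
    (f := fun x : kˣ ↦ lowerStar Φ x ((a : k)⁻¹ * x)) (fun x ↦ hΦ.lowerStar_mem_zInv _ _)
    (finite_support_units (hS.finite_support a))
  obtain ⟨n7, e7⟩ := ordPerf_finprod_perfPow (p := p)
    (f := fun ξ : kˣ ↦ lowerStar (D.𝒢₀ Φ) ξ (a * ξ) * absv (a : k))
    (fun x ↦ mul_mem ((D.isRational_𝒢₀ hΦ).lowerStar_mem_zInv _ _) (absv_mem_zInv p a))
    (finite_support_mul s5 _)
  rw [catalan, ordPerf_mul n6 n7]
  push_cast
  rw [e6, e7, e5, e4]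
  rw [h0, h0'] at hF
  linear_combination hF

end StirlingData

theorem theorem2p1 {k : Type*} [Field k] [ValuativeRel k] [TopologicalSpace k]
    [IsNonarchimedeanLocalField k] [MeasurableSpace k] [BorelSpace k]
    {p : ℕ} [Fact p.Prime] [CharP k p] (D : StirlingData k p) :
    -- the Stirling formula for rigged virtual lattices
    (∀ (a : kˣ) (Φ : GenFun k), Φ ∈ D.RVL →
      D.𝒢 Φ ∈ D.RVL ∧ HasLowerStar Φ ∧ HasLowerStar (D.𝒢 Φ) ∧
      (∀ b : kˣ, (Function.support fun x : k ↦ lowerStar Φ x ((b : k)⁻¹ * x)).Finite) ∧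
      (Function.support fun ξ : kˣ ↦ lowerStar (D.𝒢 Φ) ξ (a * ξ)).Finite ∧
      Integrable (D.thetaIntegrand a Φ) (unitHaar k) ∧
      Integrable (StirlingData.axisIntegrand Φ) (unitHaar k) ∧
      Integrable (StirlingData.axisIntegrand (D.𝒢 Φ)) (unitHaar k) ∧
      theta a Φ * ordDiff D.ω
          + (∑ᶠ x : kˣ, lowerStar Φ x ((a : k)⁻¹ * x) * ordv (x : k))
          + (∑ᶠ ξ : kˣ, absv (a : k) * lowerStar (D.𝒢 Φ) ξ (a * ξ) * ordv (ξ : k))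
        = (∫ t, D.thetaIntegrand a Φ t ∂unitHaar k)
          - lowerStar Φ 0 0 * ordv (a : k)
          + (∫ t, StirlingData.axisIntegrand Φ t ∂unitHaar k)
          + absv (a : k) * (lowerStar (D.𝒢 Φ) 0 0 * ordv (a : k)
            + (∫ t, StirlingData.axisIntegrand (D.𝒢 Φ) t ∂unitHaar k))) ∧
    -- the simplified form, for the Catalan symbol of a proper rational rigged virtual lattice
    (∀ (a : kˣ) (Φ : GenFun k), D.IsRational Φ → IsProper Φ →
      D.IsRational (D.𝒢₀ Φ) ∧ HasLowerStar Φ ∧ HasLowerStar (D.𝒢₀ Φ) ∧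
      (∀ x y : k, lowerStar Φ x y ∈ zInv p ∧ lowerStar (D.𝒢₀ Φ) x y ∈ zInv p) ∧
      (∀ b : kˣ, (Function.support fun x : k ↦ lowerStar Φ x ((b : k)⁻¹ * x)).Finite) ∧
      (Function.support fun ξ : kˣ ↦ lowerStar (D.𝒢₀ Φ) ξ (a * ξ)).Finite ∧
      Integrable (StirlingData.properIntegrand a Φ) (unitHaar k) ∧
      Integrable (fun t : kˣ ↦ lowerStar Φ 0 t) (unitHaar k) ∧
      Integrable (fun t : kˣ ↦ lowerStar (D.𝒢₀ Φ) 0 t) (unitHaar k) ∧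
      theta a Φ * ordDiff D.ω + ordPerf p (D.catalan a Φ)
        = (∫ t, StirlingData.properIntegrand a Φ t ∂unitHaar k)
          + (∫ t : kˣ, lowerStar Φ 0 t ∂unitHaar k)
          + absv (a : k) * (∫ t : kˣ, lowerStar (D.𝒢₀ Φ) 0 t ∂unitHaar k)) := by
  refine ⟨fun a Φ hΦ ↦ ?_, fun a Φ hΦ hp ↦ ?_⟩
  · have h := D.hasStirling hΦ
    have hG := D.𝒢_mem_RVL hΦ
    exact ⟨hG, (D.isStar_of_mem_RVL hΦ).hasLowerStar, (D.isStar_of_mem_RVL hG).hasLowerStar,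
      h.finite_support, h.finite_support_dual a, h.integrable_theta a, h.integrable_axis,
      h.integrable_axis_dual, h.formula a⟩
  · have hG := D.isRational_𝒢₀ hΦ
    obtain ⟨h1, h2, h3, h4, h5⟩ := hΦ.stirling hp a
    exact ⟨hG, (D.isStar_of_mem_RVL hΦ.mem_RVL).hasLowerStar,
      (D.isStar_of_mem_RVL hG.mem_RVL).hasLowerStar,
      fun x y ↦ ⟨hΦ.lowerStar_mem_zInv x y, hG.lowerStar_mem_zInv x y⟩,
      (D.hasStirling hΦ.mem_RVL).finite_support, h1, h2, h3, h4, h5⟩
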